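/- Let $(M^{2m+1},J,\theta)$ be a compact Sasakian manifold, i.e. a compact strictly pseudoconvex pseudo-Hermitian CR manifold whose Tanaka--Webster connection $\nabla$ has vanishing pseudo-Hermitian torsion $\tau(X)=T_\nabla(T,X)=0$, where $T$ is the Reeb field, $H(M)=\ker\theta$, and $g_\theta$ is the Webster metric ($g_\theta(X,Y)=d\theta(X,JY)$ on $H(M)$, $T$ a unit vector orthogonal to $H(M)$). Let $(N,h,J')$ be a Kähler manifold with Levi-Civita connection $\nabla^h$ and curvature tensor $R$, and let $Q$ be its curvature operator, the complex-multilinear extension of $\langle Q(X\wedge Y),Z\wedge W\rangle=\langle R(X,Y)W,Z\rangle$; put $\langle\langle Q(\xi),\xi\rangle\rangle=\langle Q(\xi),\overline{\xi}\rangle$ for complex bivectors $\xi$. Assume that $N$ has strongly semi-negative curvature: $\langle\langle Q(\xi),\xi\rangle\rangle\le 0$ for every $\xi=(Z\wedge W)^{(1,1)}$ with $Z,W$ complex tangent vectors of $N$ at the same point. Let $\phi:M\to N$ be a smooth map that is harmonic (the trace with respect to $g_\theta$ of its second fundamental form $B(X,Y)=\nabla^h_Y(d\phi(X))-d\phi(\nabla^\theta_YX)$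 vanishes, $\nabla^\theta$ being the Levi-Civita connection of $g_\theta$) or pseudoharmonic ($\phi$ is a critical point, under all smooth variations, of the pseudo-energy $E_H(\phi)=\int_M \tfrac12\,\mathrm{trace}_{G_\theta}(\pi_H\phi^*h)\,\Psi$, where $\Psi$ is the Riemannian volume of $g_\theta$ and $\pi_H\phi^*h$ is the restriction of $\phi^*h$ to $H(M)$, traced with respect to $G_\theta=g_\theta|_{H(M)}$). Then $\phi$ is CR pluriharmonic, i.e. $\beta(Z,W)+\beta(JZ,JW)=0$ for all $Z,W\in H(M)$, where $\beta(X,Y)=\nabla^h_Y(d\phi(X))-d\phi(\nabla_YX)$. Moreover, at every point of $M$, for every orthonormal frame $T,e_1,\dots,e_m,Je_1,\dots,Je_m$, setting $T_\alpha=\tfrac1{\sqrt2}(e_\alpha-\sqrt{-1}\,Je_\alpha)$ and $\phi_\alpha=d\phi(T_\alpha)$, $$\langle\langle Q(\phi_\alpha\wedge\phi_\beta),\phi_\alpha\wedge\phi_\beta\rangle\rangle=0\qquad\text{for all }\alpha,\beta=1,\dots,m,$$ and hence also the sum of these terms over $\alpha,\beta$ vanishes. -/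

import Mathlib

open Bundle Set Manifold ContDiff MeasureTheory VectorField

noncomputable section

/-! ## Metrics, exterior derivative, Levi-Civita connection, curvature -/

section Riemannian

variable {E : Type*} [NormedAddCommGroup E] [NormedSpace ℝ E]
  {M : Type*} [TopologicalSpace M] [ChartedSpace E M]

/-- The exterior derivative of a one-form `θ`,
`dθ(X, Y) = X (θ Y) - Y (θ X) - θ [X, Y]`, evaluated at two tangent vectors through
local smooth extensions of them (the value does not depend on the extensions). -/
def oneFormDeriv [IsManifold 𝓘(ℝ, E) 1 M]
    (θ : ∀ x : M, TangentSpace 𝓘(ℝ, E) x →L[ℝ] ℝ) (x : M)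
    (u v : TangentSpace 𝓘(ℝ, E) x) : ℝ :=
  mvfderiv 𝓘(ℝ, E) (fun y => θ y (FiberBundle.extend E v y)) x u
    - mvfderiv 𝓘(ℝ, E) (fun y => θ y (FiberBundle.extend E u y)) x v
    - θ x (mlieBracket 𝓘(ℝ, E) (FiberBundle.extend E u) (FiberBundle.extend E v) x)

/-- `∇ g = 0`: `v (g(X, Y)) = g(∇_v X, Y) + g(X, ∇_v Y)`. -/
def IsParallelMetric [IsManifold 𝓘(ℝ, E) 1 M]
    (g : ∀ x : M, TangentSpace 𝓘(ℝ, E) x → TangentSpace 𝓘(ℝ, E) x → ℝ)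
    (D : CovariantDerivative 𝓘(ℝ, E) E (TangentSpace 𝓘(ℝ, E) : M → Type _)) : Prop :=
  ∀ (X Y : ∀ x : M, TangentSpace 𝓘(ℝ, E) x) (x : M), MDiffAt (T% X) x → MDiffAt (T% Y) x →
    ∀ v : TangentSpace 𝓘(ℝ, E) x,
      mvfderiv 𝓘(ℝ, E) (fun y => g y (X y) (Y y)) x v = g x (D X x v) (Y x) + g x (X x) (D Y x v)

/-- `∇ J = 0` for an endomorphism field `J` of the tangent bundle. -/
def IsParallelEndo [IsManifold 𝓘(ℝ, E) 1 M]
    (J : ∀ x : M, TangentSpace 𝓘(ℝ, E) x →L[ℝ] TangentSpace 𝓘(ℝ, E) x)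
    (D : CovariantDerivative 𝓘(ℝ, E) E (TangentSpace 𝓘(ℝ, E) : M → Type _)) : Prop :=
  ∀ (X : ∀ x : M, TangentSpace 𝓘(ℝ, E) x) (x : M), MDiffAt (T% X) x →
    ∀ v : TangentSpace 𝓘(ℝ, E) x, D (fun y => J y (X y)) x v = J x (D X x v)

/-- `D` is the Levi-Civita connection of the metric `g`: metric and torsion free. -/
structure IsLeviCivita [FiniteDimensional ℝ E] [CompleteSpace E] [IsManifold 𝓘(ℝ, E) ∞ M]
    (g : ∀ x : M, TangentSpace 𝓘(ℝ, E) x → TangentSpace 𝓘(ℝ, E) x → ℝ)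
    (D : CovariantDerivative 𝓘(ℝ, E) E (TangentSpace 𝓘(ℝ, E) : M → Type _)) : Prop where
  metric : IsParallelMetric g D
  torsion_free : ∀ (x : M) (u v : TangentSpace 𝓘(ℝ, E) x), D.torsion x u v = 0

/-- The curvature `R(u, v) w = ∇_u ∇_v w - ∇_v ∇_u w - ∇_[u, v] w`, evaluated at tangent vectors
through local smooth extensions. -/
def curvature [IsManifold 𝓘(ℝ, E) 1 M]
    (D : CovariantDerivative 𝓘(ℝ, E) E (TangentSpace 𝓘(ℝ, E) : M → Type _)) (x : M)
    (u v w : TangentSpace 𝓘(ℝ, E) x) : TangentSpace 𝓘(ℝ, E) x :=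
  let U : ∀ y : M, TangentSpace 𝓘(ℝ, E) y := FiberBundle.extend E u
  let V : ∀ y : M, TangentSpace 𝓘(ℝ, E) y := FiberBundle.extend E v
  let W : ∀ y : M, TangentSpace 𝓘(ℝ, E) y := FiberBundle.extend E w
  D (fun y => D W y (V y)) x u - D (fun y => D W y (U y)) x v - D W x (mlieBracket 𝓘(ℝ, E) U V x)

end Riemannian

instance {E : Type*} [NormedAddCommGroup E] [NormedSpace ℝ E] [FiniteDimensional ℝ E]
    {M : Type*} [TopologicalSpace M] [ChartedSpace E M] (x : M) :
    Module.Finite ℝ (TangentSpace 𝓘(ℝ, E) x) :=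
  inferInstanceAs (Module.Finite ℝ E)

/-- The trace of the bilinear form `C` with respect to the inner product `g` on a
finite-dimensional space: `∑ gⁱʲ C(bᵢ, bⱼ)` in a basis `b`. It equals `∑ C(eₐ, eₐ)` for every
`g`-orthonormal basis `e`. -/
def metricTrace {V : Type*} [AddCommGroup V] [Module ℝ V] [Module.Finite ℝ V]
    (g C : V → V → ℝ) : ℝ :=
  let b := Module.finBasis ℝ V
  ∑ i, ∑ j, (Matrix.of fun k l => g (b k) (b l))⁻¹ i j * C (b i) (b j)

/-- The vector-valued version of `metricTrace`. -/
def metricTraceVec {V W : Type*} [AddCommGroup V] [Module ℝ V] [Module.Finite ℝ V]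
    [AddCommGroup W] [Module ℝ W] (g : V → V → ℝ) (C : V → V → W) : W :=
  let b := Module.finBasis ℝ V
  ∑ i, ∑ j, (Matrix.of fun k l => g (b k) (b l))⁻¹ i j • C (b i) (b j)

/-! ## The Riemannian volume measure -/

section Volume

variable {d : ℕ} {M : Type*} [TopologicalSpace M] [ChartedSpace (EuclideanSpace ℝ (Fin d)) M]
  [MeasurableSpace M]

/-- The measure `√(det gᵢⱼ) dx¹ ⋯ dxᵈ` on the domain of the chart at `p`. -/
def chartVolume
    (g : ∀ x : M, TangentSpace 𝓘(ℝ, EuclideanSpace ℝ (Fin d)) x →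
      TangentSpace 𝓘(ℝ, EuclideanSpace ℝ (Fin d)) x → ℝ) (p : M) : Measure M :=
  let e := chartAt (EuclideanSpace ℝ (Fin d)) p
  let del (z : EuclideanSpace ℝ (Fin d)) (i : Fin d) :
      TangentSpace 𝓘(ℝ, EuclideanSpace ℝ (Fin d)) (e.symm z) :=
    mfderiv 𝓘(ℝ, EuclideanSpace ℝ (Fin d)) 𝓘(ℝ, EuclideanSpace ℝ (Fin d)) e.symm z
      (EuclideanSpace.basisFun (Fin d) ℝ i)
  Measure.map e.symm ((volume.restrict e.target).withDensity fun z =>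
    ENNReal.ofReal √(Matrix.det (Matrix.of fun i j => g (e.symm z) (del z i) (del z j))))

/-- The Riemannian volume measure of `g`. The measures `chartVolume g p` agree on the overlaps of
their domains, so that (on a manifold covered by countably many charts) their supremum is the
measure which restricts to each of them on the corresponding chart domain. -/
def riemannianVolume
    (g : ∀ x : M, TangentSpace 𝓘(ℝ, EuclideanSpace ℝ (Fin d)) x →
      TangentSpace 𝓘(ℝ, EuclideanSpace ℝ (Fin d)) x → ℝ) : Measure M :=
  ⨆ p : M, chartVolume g p

end Volume

/-! ## Strictly pseudoconvex CR manifolds -/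

/-- A strictly pseudoconvex CR structure with a pseudo-Hermitian structure `θ` on `M`. The Levi
distribution is `H = ker θ`; the complex structure `J` of `H` is extended to `TM` by `J T = 0`,
where `T` is the Reeb field, the (unique) vector field with `θ T = 1` and `T ⌟ dθ = 0`. -/
structure PseudohermitianStructure (E : Type*) [NormedAddCommGroup E] [NormedSpace ℝ E]
    (M : Type*) [TopologicalSpace M] [ChartedSpace E M] [IsManifold 𝓘(ℝ, E) ∞ M] where
  θ : ∀ x : M, TangentSpace 𝓘(ℝ, E) x →L[ℝ] ℝ
  J : ∀ x : M, TangentSpace 𝓘(ℝ, E) x →L[ℝ] TangentSpace 𝓘(ℝ, E) x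
  T : ∀ x : M, TangentSpace 𝓘(ℝ, E) x
  contMDiff_θ : ContMDiff 𝓘(ℝ, E) (𝓘(ℝ, E).prod 𝓘(ℝ, E →L[ℝ] ℝ)) ∞
    (fun x => TotalSpace.mk' (E →L[ℝ] ℝ)
      (E := fun x => TangentSpace 𝓘(ℝ, E) x →L[ℝ] Trivial M ℝ x) x (θ x))
  contMDiff_J : ContMDiff 𝓘(ℝ, E) (𝓘(ℝ, E).prod 𝓘(ℝ, E →L[ℝ] E)) ∞
    (fun x => TotalSpace.mk' (E →L[ℝ] E)
      (E := fun x => TangentSpace 𝓘(ℝ, E) x →L[ℝ] TangentSpace 𝓘(ℝ, E) x) x (J x))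
  contMDiff_T : CMDiff ∞ (T% T)
  θ_T : ∀ x, θ x (T x) = 1
  dθ_T : ∀ x v, oneFormDeriv θ x (T x) v = 0
  J_T : ∀ x, J x (T x) = 0
  θ_J : ∀ x v, θ x (J x v) = 0
  J_J : ∀ x v, θ x v = 0 → J x (J x v) = -v
  /-- Formal integrability `[Γ(T₁,₀), Γ(T₁,₀)] ⊆ Γ(T₁,₀)`, where `T₁,₀ = {X - i J X | X ∈ H}`:
  the bracket of `X - i J X` and `Y - i J Y` is `A - i B` with `A = [X, Y] - [J X, J Y]` and
  `B = [J X, Y] + [X, J Y]`; it is a section of `T₁,₀` if and only if `A ∈ H` and `B = J A`. -/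
  integrable : ∀ X Y : ∀ x : M, TangentSpace 𝓘(ℝ, E) x,
    CMDiff ∞ (T% X) → CMDiff ∞ (T% Y) → (∀ x, θ x (X x) = 0) → (∀ x, θ x (Y x) = 0) → ∀ x,
      let JX : ∀ y : M, TangentSpace 𝓘(ℝ, E) y := fun y => J y (X y)
      let JY : ∀ y : M, TangentSpace 𝓘(ℝ, E) y := fun y => J y (Y y)
      let A := mlieBracket 𝓘(ℝ, E) X Y x - mlieBracket 𝓘(ℝ, E) JX JY x
      let B := mlieBracket 𝓘(ℝ, E) JX Y x + mlieBracket 𝓘(ℝ, E) X JY x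
      θ x A = 0 ∧ B = J x A
  /-- Strict pseudoconvexity: the Levi form `G_θ(u, v) = dθ(u, J v)` is positive on `H`. -/
  levi_pos : ∀ x v, θ x v = 0 → v ≠ 0 → 0 < oneFormDeriv θ x v (J x v)

namespace PseudohermitianStructure

variable {E : Type*} [NormedAddCommGroup E] [NormedSpace ℝ E]
  {M : Type*} [TopologicalSpace M] [ChartedSpace E M] [IsManifold 𝓘(ℝ, E) ∞ M]
  (P : PseudohermitianStructure E M)

/-- The projection `TM → H` along the Reeb field. -/
def projH (x : M) (u : TangentSpace 𝓘(ℝ, E) x) : TangentSpace 𝓘(ℝ, E) x :=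
  u - P.θ x u • P.T x

/-- The Webster metric `g_θ(u, v) = dθ(π_H u, J π_H v) + θ(u) θ(v)`. -/
def webster (x : M) (u v : TangentSpace 𝓘(ℝ, E) x) : ℝ :=
  oneFormDeriv P.θ x (P.projH x u) (P.J x (P.projH x v)) + P.θ x u * P.θ x v

/-- The two-form `Ω(u, v) = g_θ(u, J v)`. -/
def Omega (x : M) (u v : TangentSpace 𝓘(ℝ, E) x) : ℝ :=
  P.webster x u (P.J x v)

/-- `D` is the Tanaka-Webster connection. -/
structure IsTanakaWebster [FiniteDimensional ℝ E] [CompleteSpace E]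
    (D : CovariantDerivative 𝓘(ℝ, E) E (TangentSpace 𝓘(ℝ, E) : M → Type _)) : Prop where
  /-- The Levi distribution is parallel. -/
  parallel_H : ∀ X : ∀ x : M, TangentSpace 𝓘(ℝ, E) x, (∀ x, P.θ x (X x) = 0) →
    ∀ x, MDiffAt (T% X) x → ∀ v, P.θ x (D X x v) = 0
  parallel_g : IsParallelMetric P.webster D
  parallel_J : IsParallelEndo P.J D
  parallel_θ : ∀ (X : ∀ x : M, TangentSpace 𝓘(ℝ, E) x) (x : M), MDiffAt (T% X) x →
    ∀ v, mvfderiv 𝓘(ℝ, E) (fun y => P.θ y (X y)) x v = P.θ x (D X x v)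
  torsion_H : ∀ x u v, P.θ x u = 0 → P.θ x v = 0 → D.torsion x u v = -(P.Omega x u v) • P.T x
  torsion_T : ∀ x u, P.θ x u = 0 →
    D.torsion x (P.T x) (P.J x u) = -P.J x (D.torsion x (P.T x) u)

/-- `(M, J, θ)` is Sasakian: the pseudo-Hermitian torsion `τ(u) = T_∇(T, u)` of its
Tanaka-Webster connection `D` vanishes. -/
structure IsSasakian [FiniteDimensional ℝ E] [CompleteSpace E]
    (D : CovariantDerivative 𝓘(ℝ, E) E (TangentSpace 𝓘(ℝ, E) : M → Type _)) : Prop where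
  tanakaWebster : P.IsTanakaWebster D
  torsion_eq_zero : ∀ x u, D.torsion x (P.T x) u = 0

/-- `e₁, …, e_m` are vectors at `x` such that `T, e₁, …, e_m, J e₁, …, J e_m` is orthonormal for the
Webster metric. -/
structure IsCRFrame {m : ℕ} (x : M) (e : Fin m → TangentSpace 𝓘(ℝ, E) x) : Prop where
  horizontal : ∀ a, P.θ x (e a) = 0
  orthonormal : ∀ a b, P.webster x (e a) (e b) = if a = b then 1 else 0
  orthogonal_J : ∀ a b, P.webster x (e a) (P.J x (e b)) = 0

end PseudohermitianStructure

/-! ## Second fundamental forms -/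

section Maps

variable {E : Type*} [NormedAddCommGroup E] [NormedSpace ℝ E]
  {M : Type*} [TopologicalSpace M] [ChartedSpace E M]
  {F : Type*} [NormedAddCommGroup F] [NormedSpace ℝ F]
  {N : Type*} [TopologicalSpace N] [ChartedSpace F N] [IsManifold 𝓘(ℝ, F) 1 N]

/-- The pull-back connection `φ⁻¹∇` on sections `s` of `φ⁻¹TN`. In the local trivialization of `TN`
at `φ x`, with its frame `(Eᵢ)`, write `s = ∑ sᵢ (Eᵢ ∘ φ)`; then
`∇_v s = ∑ v(sᵢ) Eᵢ + ∇_{dφ v} (∑ sᵢ(x) Eᵢ)`, the last field being `FiberBundle.extend F (s x)`. -/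
def pullbackCov (D : CovariantDerivative 𝓘(ℝ, F) F (TangentSpace 𝓘(ℝ, F) : N → Type _))
    (φ : M → N) (s : ∀ x : M, TangentSpace 𝓘(ℝ, F) (φ x)) (x : M)
    (v : TangentSpace 𝓘(ℝ, E) x) : TangentSpace 𝓘(ℝ, F) (φ x) :=
  let t := trivializationAt F (TangentSpace 𝓘(ℝ, F) : N → Type _) (φ x)
  t.symm (φ x) (mvfderiv 𝓘(ℝ, E) (fun x' => (t ⟨φ x', s x'⟩).2) x v)
    + D (FiberBundle.extend F (s x)) (φ x) (mfderiv 𝓘(ℝ, E) 𝓘(ℝ, F) φ x v)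

/-- The second fundamental form `(u, v) ↦ ∇'_v (dφ(u)) - dφ(∇_v u)` of `φ` with respect to a
connection `D = ∇` on `M` and a connection `D' = ∇'` on `N`. -/
def secondFundamentalForm [IsManifold 𝓘(ℝ, E) 1 M]
    (D : CovariantDerivative 𝓘(ℝ, E) E (TangentSpace 𝓘(ℝ, E) : M → Type _))
    (D' : CovariantDerivative 𝓘(ℝ, F) F (TangentSpace 𝓘(ℝ, F) : N → Type _))
    (φ : M → N) (x : M) (u v : TangentSpace 𝓘(ℝ, E) x) : TangentSpace 𝓘(ℝ, F) (φ x) :=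
  pullbackCov D' φ (fun y => mfderiv 𝓘(ℝ, E) 𝓘(ℝ, F) φ y (FiberBundle.extend E u y)) x v
    - mfderiv 𝓘(ℝ, E) 𝓘(ℝ, F) φ x (D (FiberBundle.extend E u) x v)

end Maps

/-! ## Harmonic, pseudoharmonic and CR pluriharmonic maps -/

section Harmonic

variable {E : Type*} [NormedAddCommGroup E] [NormedSpace ℝ E] [FiniteDimensional ℝ E]
  {M : Type*} [TopologicalSpace M] [ChartedSpace E M] [IsManifold 𝓘(ℝ, E) ∞ M]
  {F : Type*} [NormedAddCommGroup F] [NormedSpace ℝ F]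
  {N : Type*} [TopologicalSpace N] [ChartedSpace F N] [IsManifold 𝓘(ℝ, F) ∞ N]

/-- `φ` is harmonic: the trace with respect to `g_θ` of the second fundamental form `B` formed with
the Levi-Civita connection of `g_θ` and the Levi-Civita connection `D'` of `N` vanishes. -/
def IsHarmonicMap [CompleteSpace E] (P : PseudohermitianStructure E M)
    (D' : CovariantDerivative 𝓘(ℝ, F) F (TangentSpace 𝓘(ℝ, F) : N → Type _))
    (φ : M → N) : Prop :=
  ContMDiff 𝓘(ℝ, E) 𝓘(ℝ, F) ∞ φ ∧
  ∃ Dθ : CovariantDerivative 𝓘(ℝ, E) E (TangentSpace 𝓘(ℝ, E) : M → Type _),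
    IsLeviCivita P.webster Dθ ∧
    ∀ x, metricTraceVec (V := TangentSpace 𝓘(ℝ, E) x) (W := TangentSpace 𝓘(ℝ, F) (φ x))
      (P.webster x) (secondFundamentalForm Dθ D' φ x) = 0

/-- The pseudo-energy density `e_H(φ) = ½ trace_{G_θ} (π_H φ^* h)`. -/
def pseudoEnergyDensity (P : PseudohermitianStructure E M)
    (h : ContMDiffRiemannianMetric 𝓘(ℝ, F) ∞ F (TangentSpace 𝓘(ℝ, F) : N → Type _))
    (φ : M → N) (x : M) : ℝ :=
  (1 / 2) * metricTrace (V := TangentSpace 𝓘(ℝ, E) x) (P.webster x) fun u v =>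
    h.inner (φ x) (mfderiv 𝓘(ℝ, E) 𝓘(ℝ, F) φ x (P.projH x u))
      (mfderiv 𝓘(ℝ, E) 𝓘(ℝ, F) φ x (P.projH x v))

/-- `φ` is CR pluriharmonic: `β(u, v) + β(J u, J v) = 0` for `u, v ∈ H`, where `β` is formed with the
Tanaka-Webster connection `D` of `M` and the Levi-Civita connection `D'` of `N`. -/
def IsCRPluriharmonic (P : PseudohermitianStructure E M)
    (D : CovariantDerivative 𝓘(ℝ, E) E (TangentSpace 𝓘(ℝ, E) : M → Type _))
    (D' : CovariantDerivative 𝓘(ℝ, F) F (TangentSpace 𝓘(ℝ, F) : N → Type _))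
    (φ : M → N) : Prop :=
  ∀ (x : M) (u v : TangentSpace 𝓘(ℝ, E) x), P.θ x u = 0 → P.θ x v = 0 →
    secondFundamentalForm D D' φ x u v
      + secondFundamentalForm D D' φ x (P.J x u) (P.J x v) = 0

end Harmonic

section Pseudoharmonic

variable {d : ℕ} {M : Type*} [TopologicalSpace M] [ChartedSpace (EuclideanSpace ℝ (Fin d)) M]
  [IsManifold 𝓘(ℝ, EuclideanSpace ℝ (Fin d)) ∞ M] [MeasurableSpace M]
  {F : Type*} [NormedAddCommGroup F] [NormedSpace ℝ F]
  {N : Type*} [TopologicalSpace N] [ChartedSpace F N] [IsManifold 𝓘(ℝ, F) ∞ N]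

/-- The pseudo-energy `E_H(φ) = ∫_M e_H(φ) Ψ`, with `Ψ` the Riemannian volume of `g_θ`. -/
def pseudoEnergy (P : PseudohermitianStructure (EuclideanSpace ℝ (Fin d)) M)
    (h : ContMDiffRiemannianMetric 𝓘(ℝ, F) ∞ F (TangentSpace 𝓘(ℝ, F) : N → Type _))
    (φ : M → N) : ℝ :=
  ∫ x, pseudoEnergyDensity P h φ x ∂(riemannianVolume P.webster)

/-- `φ` is pseudoharmonic: a smooth map which is a critical point of the pseudo-energy, with respect
to all smooth variations `Φ_t`, `|t| < ε`, of `Φ_0 = φ` (for compact `M`). -/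
def IsPseudoharmonicMap (P : PseudohermitianStructure (EuclideanSpace ℝ (Fin d)) M)
    (h : ContMDiffRiemannianMetric 𝓘(ℝ, F) ∞ F (TangentSpace 𝓘(ℝ, F) : N → Type _))
    (φ : M → N) : Prop :=
  ContMDiff 𝓘(ℝ, EuclideanSpace ℝ (Fin d)) 𝓘(ℝ, F) ∞ φ ∧
  ∀ ε : ℝ, 0 < ε → ∀ Φ : ℝ → M → N,
    ContMDiffOn (𝓘(ℝ, ℝ).prod 𝓘(ℝ, EuclideanSpace ℝ (Fin d))) 𝓘(ℝ, F) ∞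
      (fun q : ℝ × M => Φ q.1 q.2) (Ioo (-ε) ε ×ˢ univ) →
    Φ 0 = φ → HasDerivAt (fun t => pseudoEnergy P h (Φ t)) 0 0

end Pseudoharmonic

/-! ## Complexification and Kähler manifolds

The complexification `V ⊗ ℂ` of a real vector space `V` is represented by `V × V`, the pair `(u, v)`
standing for `u + i v`. -/

section Complexification

variable {V W : Type*} [AddCommGroup V] [Module ℝ V]

/-- The complex-linear extension `f(u + i v) = f(u) + i f(v)` of a real-linear `f : V → ℂ`. -/
def complexExtend (f : V → ℂ) (z : V × V) : ℂ := f z.1 + Complex.I * f z.2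

/-- Complex conjugation on `V ⊗ ℂ`. -/
def cconj (z : V × V) : V × V := (z.1, -z.2)

/-- The (1,0)-part `½ (z - i J z)` with respect to a complex structure `J` on `V`. -/
def part10 (J : V → V) (z : V × V) : V × V :=
  ((1 / 2 : ℝ) • (z.1 + J z.2), (1 / 2 : ℝ) • (z.2 - J z.1))

/-- The (0,1)-part `½ (z + i J z)`. -/
def part01 (J : V → V) (z : V × V) : V × V :=
  ((1 / 2 : ℝ) • (z.1 - J z.2), (1 / 2 : ℝ) • (z.2 + J z.1))

/-- The complex-linear extension of a real-linear map to complexifications. -/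
def complexMap (f : V → W) (z : V × V) : W × W := (f z.1, f z.2)

end Complexification

section Kahler

variable {F : Type*} [NormedAddCommGroup F] [NormedSpace ℝ F]
  {N : Type*} [TopologicalSpace N] [ChartedSpace F N] [IsManifold 𝓘(ℝ, F) ∞ N]
  (h : ContMDiffRiemannianMetric 𝓘(ℝ, F) ∞ F (TangentSpace 𝓘(ℝ, F) : N → Type _))
  (D : CovariantDerivative 𝓘(ℝ, F) F (TangentSpace 𝓘(ℝ, F) : N → Type _))

/-- `(N, h, J)` is a Kähler manifold with Levi-Civita connection `D`: `J` is a smooth orthogonal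
almost complex structure, parallel for the Levi-Civita connection. -/
structure IsKahler [FiniteDimensional ℝ F] [CompleteSpace F]
    (J : ∀ y : N, TangentSpace 𝓘(ℝ, F) y →L[ℝ] TangentSpace 𝓘(ℝ, F) y) : Prop where
  leviCivita : IsLeviCivita (fun y u v => h.inner y u v) D
  contMDiff_J : ContMDiff 𝓘(ℝ, F) (𝓘(ℝ, F).prod 𝓘(ℝ, F →L[ℝ] F)) ∞
    (fun y => TotalSpace.mk' (F →L[ℝ] F)
      (E := fun y => TangentSpace 𝓘(ℝ, F) y →L[ℝ] TangentSpace 𝓘(ℝ, F) y) y (J y))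
  J_J : ∀ y v, J y (J y v) = -v
  hermitian : ∀ y u v, h.inner y (J y u) (J y v) = h.inner y u v
  parallel_J : IsParallelEndo J D

/-- The complex multilinear extension of `⟨Q(X ∧ Y), Z ∧ W⟩ = ⟨R(X, Y) W, Z⟩`, where `Q` is the
curvature operator. -/
def curvatureOperator (y : N)
    (X Y Z W : TangentSpace 𝓘(ℝ, F) y × TangentSpace 𝓘(ℝ, F) y) : ℂ :=
  complexExtend (fun a => complexExtend (fun b => complexExtend (fun c => complexExtend (fun d =>
    ((h.inner y (curvature D y a b d) c : ℝ) : ℂ)) W) Z) Y) X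

/-- `⟪Q(ξ), ξ⟫ = ⟨Q(ξ), conj ξ⟩` for the complex bivector `ξ = ∑ₚ Aₚ ∧ Bₚ`. -/
def curvatureHermitian {ι : Type*} [Fintype ι] (y : N)
    (A B : ι → TangentSpace 𝓘(ℝ, F) y × TangentSpace 𝓘(ℝ, F) y) : ℂ :=
  ∑ p, ∑ q, curvatureOperator h D y (A p) (B p) (cconj (A q)) (cconj (B q))

/-- Strongly semi-negative curvature: `⟪Q(ξ), ξ⟫ ≤ 0` for every
`ξ = (Z ∧ W)^(1,1) = Z^(1,0) ∧ W^(0,1) + Z^(0,1) ∧ W^(1,0)` (this number is real). -/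
def IsStronglySemiNegative
    (J : ∀ y : N, TangentSpace 𝓘(ℝ, F) y →L[ℝ] TangentSpace 𝓘(ℝ, F) y) : Prop :=
  ∀ (y : N) (Z W : TangentSpace 𝓘(ℝ, F) y × TangentSpace 𝓘(ℝ, F) y),
    (curvatureHermitian h D y ![part10 (J y) Z, part01 (J y) Z]
      ![part01 (J y) W, part10 (J y) W]).re ≤ 0

end Kahler

/-- `T_α = (e_α - i J e_α) / √2`. -/
def PseudohermitianStructure.unitaryVector {E : Type*} [NormedAddCommGroup E] [NormedSpace ℝ E]
    {M : Type*} [TopologicalSpace M] [ChartedSpace E M] [IsManifold 𝓘(ℝ, E) ∞ M]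
    (P : PseudohermitianStructure E M) (x : M) (u : TangentSpace 𝓘(ℝ, E) x) :
    TangentSpace 𝓘(ℝ, E) x × TangentSpace 𝓘(ℝ, E) x :=
  ((1 / √2 : ℝ) • u, -((1 / √2 : ℝ) • P.J x u))

end

/-! Write φ₀ = dφ(T), and let β be formed with the Tanaka-Webster connection. Three one-forms on M
have divergences of a definite sign. On a compact manifold a divergence integrates to zero, so each
of the three vanishes pointwise, and so does each nonnegative term in it.

Both hypotheses on φ become one equation, tr β = δ β(T, T). For harmonic maps δ = 0, because the
Tanaka-Webster and Levi-Civita connections of the Webster metric have the same traced Christoffel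
symbols (`IsHarmonicMap.tensionEq`). For pseudoharmonic maps δ = 1, by the first variation formula
(`IsPseudoharmonicMap.tensionEq`).

The form v ↦ ⟨∇_v φ₀, φ₀⟩ - δ θ(v) ⟨∇_T φ₀, φ₀⟩ has divergence |∇φ₀|² - δ |∇_T φ₀|² + ∑ ⟨R(dφ e_A,
φ₀) dφ e_A, φ₀⟩. The curvature of M does not enter: T is parallel, and pair symmetry, which survives
because the torsion is parallel, makes the curvature vanish whenever an argument is T. The last sum
is nonnegative because strong semi-negativity on real vectors is nonpositive sectional curvature. As
δ ≤ 1, the derivative of φ₀ vanishes along H (`secondFundamentalForm_T_eq_zero`).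

The form v ↦ ⟨dφ(J v), φ₀⟩ then has divergence -m |φ₀|², since the antisymmetric part of β is a
multiple of φ₀, coming from the torsion. Hence φ₀ = 0 when m > 0 (`mfderiv_T_eq_zero`).

Now β is symmetric and annihilates T, and Siu's argument runs as on a Kähler manifold. With σ = β +
β(J, J), the form w ↦ ∑ ⟨σ(e_A, w), dφ e_A⟩ has divergence ½ |σ|² plus a curvature term of the
target. The curvature of M cancels by J-invariance (`SasakiLocal.sum_curv`). The target term is
minus the sum of ⟪Q(ξ), ξ⟫ over ξ = φ_A ∧ φ_B (`IsKahlerForm.sum_extend_re`). So σ = 0, and each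
curvature term vanishes (`sigma_curvature_eq_zero`).

The tensor calculus is done for connections d + Γ on open subsets of vector spaces and carried to M
through charts. The divergence theorem needs only a metric connection with traceless torsion
(`IsSmoothMetric.integral_divergence_eq_zero`). -/

set_option maxSynthPendingDepth 3
set_option linter.unusedSectionVars false

/-! ## Orthonormal bases and metric traces -/

section OrthonormalFamilies

variable {V : Type*} [AddCommGroup V] [Module ℝ V]
variable {W : Type*} [AddCommGroup W] [Module ℝ W]

/-- `e` is an orthonormal basis for the form `g`. -/
structure IsOrthoBasis {ι : Type*} [Fintype ι] [DecidableEq ι] (g : V → V → ℝ) (e : ι → V) :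
    Prop where
  ortho : ∀ i j, g (e i) (e j) = if i = j then 1 else 0
  complete : ∀ v, v = ∑ i, g v (e i) • e i

theorem IsOrthoBasis.of_card [Module.Finite ℝ V] {ι : Type*} [Fintype ι] [DecidableEq ι]
    (g : V →ₗ[ℝ] V →ₗ[ℝ] ℝ) {e : ι → V}
    (h : ∀ i j, g (e i) (e j) = if i = j then 1 else 0)
    (hc : Fintype.card ι = Module.finrank ℝ V) : IsOrthoBasis (fun u v => g u v) e := by
  have key : ∀ (c : ι → ℝ) j, g (∑ i, c i • e i) (e j) = c j := by
    intro c j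
    simp [h]
  have hli : LinearIndependent ℝ e := by
    rw [Fintype.linearIndependent_iff]
    intro c hc0 j
    rw [← key c j, hc0]
    simp
  refine ⟨h, fun v => ?_⟩
  -- The basis constructor asks for a nonempty index type, so dimension zero is treated apart.
  rcases isEmpty_or_nonempty ι with hι | hι
  · have : Subsingleton V := by
      apply Module.finrank_zero_iff (R := ℝ).1
      rw [← hc, Fintype.card_eq_zero]
    exact Subsingleton.elim _ _
  · let b := basisOfLinearIndependentOfCardEqFinrank hli hc
    have hb : ∀ i, b i = e i := fun i => by simp [b]
    have hv : v = ∑ i, b.repr v i • e i := by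
      conv_lhs => rw [← b.sum_repr v]
      simp [hb]
    have : ∀ i, g v (e i) = b.repr v i := by
      intro i
      conv_lhs => rw [hv]
      exact key _ i
    simp only [this]
    exact hv

theorem exists_isOrthoBasis [Module.Finite ℝ V] (g : V →ₗ[ℝ] V →ₗ[ℝ] ℝ)
    (hs : ∀ u v, g u v = g v u) (hp : ∀ v, v ≠ 0 → 0 < g v v) :
    ∃ e : Fin (Module.finrank ℝ V) → V, IsOrthoBasis (fun u v => g u v) e := by
  obtain ⟨v, hv⟩ := LinearMap.BilinForm.exists_orthogonal_basis (B := g) ⟨fun u w => hs u w⟩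
  have hpos : ∀ i, 0 < g (v i) (v i) := fun i => hp _ (v.ne_zero i)
  refine ⟨fun i => (√(g (v i) (v i)))⁻¹ • v i, IsOrthoBasis.of_card g ?_ (by simp)⟩
  intro i j
  by_cases hij : i = j
  · subst hij
    have h1 := Real.mul_self_sqrt (hpos i).le
    have h2 : √(g (v i) (v i)) ≠ 0 := (Real.sqrt_pos.2 (hpos i)).ne'
    simp only [map_smul, LinearMap.smul_apply, smul_eq_mul, if_true]
    field_simp
    nlinarith
  · have : g (v i) (v j) = 0 := hv hij
    simp [hij, this]

variable {ι : Type*} [Fintype ι] [DecidableEq ι]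

/-- Completeness of e says that the inverse Gram matrix of any basis is the sum over A of the
coordinate vectors of e_A tensored with themselves. This gives independence of the basis. -/
theorem metricTraceVec_eq_sum [Module.Finite ℝ V] (g : V →ₗ[ℝ] V →ₗ[ℝ] ℝ) {e : ι → V}
    (he : IsOrthoBasis (fun u v => g u v) e) (C : V →ₗ[ℝ] V →ₗ[ℝ] W) :
    metricTraceVec (fun u v => g u v) (fun u v => C u v) = ∑ A, C (e A) (e A) := by
  classical
  unfold metricTraceVec
  set b := Module.finBasis ℝ V
  have hinv : (Matrix.of fun k l => g (b k) (b l))⁻¹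
      = Matrix.of fun i j => ∑ A, b.repr (e A) i * b.repr (e A) j := by
    apply Matrix.inv_eq_right_inv
    ext k l
    simp only [Matrix.mul_apply, Matrix.of_apply, Finset.mul_sum]
    rw [Finset.sum_comm]
    have h1 : ∀ A, ∑ j, g (b k) (b j) * (b.repr (e A) j * b.repr (e A) l)
        = g (b k) (e A) * b.repr (e A) l := by
      intro A
      have h0 : g (b k) (e A) = ∑ j, b.repr (e A) j * g (b k) (b j) := by
        conv_lhs => rw [← b.sum_repr (e A)]
        simp only [map_sum, map_smul, smul_eq_mul]
      rw [h0, Finset.sum_mul]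
      exact Finset.sum_congr rfl fun _ _ => by ring
    simp only [h1]
    have h2 := congrArg (fun w => b.repr w l) (he.complete (b k))
    simp only [map_sum, map_smul, Finsupp.coe_finsetSum, Finset.sum_apply, Finsupp.smul_apply,
      smul_eq_mul, Module.Basis.repr_self] at h2
    rw [← h2, Matrix.one_apply, Finsupp.single_apply]
  simp only [hinv, Matrix.of_apply]
  have h3 : ∀ A, C (e A) (e A)
      = ∑ i, ∑ j, (b.repr (e A) i * b.repr (e A) j) • C (b i) (b j) := by
    intro A
    conv_lhs => rw [← b.sum_repr (e A)]
    simp only [map_sum, map_smul, LinearMap.sum_apply, LinearMap.smul_apply, Finset.smul_sum,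
      smul_smul]
    rw [Finset.sum_comm]
    simp only [mul_comm]
  simp only [h3, Finset.sum_smul]
  rw [Finset.sum_comm (s := (Finset.univ : Finset ι))]
  exact Finset.sum_congr rfl fun i _ => Finset.sum_comm

/-- A skew endomorphism moves across a metric trace with a sign. -/
theorem IsOrthoBasis.sum_skew {g : V →ₗ[ℝ] V →ₗ[ℝ] ℝ} {e : ι → V}
    (he : IsOrthoBasis (fun u v => g u v) e) (hs : ∀ u v, g u v = g v u)
    (J : V →ₗ[ℝ] V) (hJ : ∀ u v, g (J u) v = -g u (J v)) (C : V →ₗ[ℝ] V →ₗ[ℝ] W) :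
    ∑ A, C (J (e A)) (e A) = -∑ A, C (e A) (J (e A)) := by
  -- Expanding J e_A in the basis makes both sides double sums weighted by the matrix g(J e_A, e_B),
  -- which is skew. Exchanging the two indices gives the sign.
  have h1 : ∀ A, C (J (e A)) (e A) = ∑ B, g (J (e A)) (e B) • C (e B) (e A) := by
    intro A
    conv_lhs => rw [he.complete (J (e A))]
    simp
  have h2 : ∀ A, C (e A) (J (e A)) = ∑ B, g (J (e A)) (e B) • C (e A) (e B) := by
    intro A
    conv_lhs => rw [he.complete (J (e A))]
    simp
  simp only [h1, h2]
  rw [Finset.sum_comm, ← Finset.sum_neg_distrib]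
  apply Finset.sum_congr rfl
  intro A _
  rw [← Finset.sum_neg_distrib]
  apply Finset.sum_congr rfl
  intro B _
  rw [hJ (e B) (e A), hs (e B), neg_smul]

end OrthonormalFamilies

/-! ### Traces against a cometric, in a fixed basis -/

section CometricTrace

variable {E : Type*} [NormedAddCommGroup E] [NormedSpace ℝ E] [FiniteDimensional ℝ E]
  {W : Type*} [NormedAddCommGroup W] [NormedSpace ℝ W]

/-- A fixed basis of `E`. -/
noncomputable abbrev stdB (E : Type*) [NormedAddCommGroup E] [NormedSpace ℝ E]
    [FiniteDimensional ℝ E] : Module.Basis (Fin (Module.finrank ℝ E)) ℝ E := Module.finBasis ℝ E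

/-- The coordinate functionals of `stdB`. -/
noncomputable def stdCo (E : Type*) [NormedAddCommGroup E] [NormedSpace ℝ E]
    [FiniteDimensional ℝ E] (i : Fin (Module.finrank ℝ E)) : E →L[ℝ] ℝ :=
  LinearMap.toContinuousLinearMap ((stdB E).coord i)

theorem sum_stdCo (v : E) : ∑ i, stdCo E i v • stdB E i = v := by
  simp [stdCo]

/-- The trace of a bilinear map with respect to a cometric `K`. -/
noncomputable def gtrace (K : (E →L[ℝ] ℝ) →L[ℝ] E) (C : E →L[ℝ] E →L[ℝ] W) : W :=
  ∑ i, C (stdB E i) (K (stdCo E i))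

theorem gtrace_eq_sum {ι : Type*} [Fintype ι] {e : ι → E}
    {K : (E →L[ℝ] ℝ) →L[ℝ] E}
    (hK : ∀ l, K l = ∑ A, l (e A) • e A) (C : E →L[ℝ] E →L[ℝ] W) :
    gtrace K C = ∑ A, C (e A) (e A) := by
  unfold gtrace
  simp only [hK, map_sum, map_smul]
  rw [Finset.sum_comm]
  apply Finset.sum_congr rfl
  intro A _
  conv_rhs => enter [1]; rw [← sum_stdCo (e A)]
  simp

theorem sharp_eq_sum {ι : Type*} [Fintype ι] [DecidableEq ι] {G : E →L[ℝ] E →L[ℝ] ℝ} {e : ι → E}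
    (he : IsOrthoBasis (fun u v => G u v) e) {K : (E →L[ℝ] ℝ) →L[ℝ] E}
    (hK : ∀ l v, G (K l) v = l v) (l : E →L[ℝ] ℝ) : K l = ∑ A, l (e A) • e A := by
  conv_lhs => rw [he.complete (K l)]
  simp only [hK]

end CometricTrace

/-! ## Connections on open subsets of vector spaces -/

section FlatCalculus

variable {E : Type*} [NormedAddCommGroup E] [NormedSpace ℝ E]
  {X : Type*} [NormedAddCommGroup X] [NormedSpace ℝ X]
  {Y : Type*} [NormedAddCommGroup Y] [NormedSpace ℝ Y]
  {Z : Type*} [NormedAddCommGroup Z] [NormedSpace ℝ Z]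

theorem fderiv_apply_fun {A : E → X →L[ℝ] Y} {a : E → X} {z : E} (hA : DifferentiableAt ℝ A z)
    (ha : DifferentiableAt ℝ a z) (w : E) :
    fderiv ℝ (fun y => A y (a y)) z w = fderiv ℝ A z w (a z) + A z (fderiv ℝ a z w) := by
  rw [fderiv_clm_apply hA ha]
  simp [add_comm]

theorem fderiv_apply_const {A : E → X →L[ℝ] Y} {z : E} (hA : DifferentiableAt ℝ A z) (a : X)
    (w : E) : fderiv ℝ (fun y => A y a) z w = fderiv ℝ A z w a := by
  rw [fderiv_apply_fun hA (differentiableAt_const a)]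
  simp

theorem fderiv_apply₂_fun {A : E → X →L[ℝ] Y →L[ℝ] Z} {a : E → X} {b : E → Y} {z : E}
    (hA : DifferentiableAt ℝ A z) (ha : DifferentiableAt ℝ a z) (hb : DifferentiableAt ℝ b z)
    (w : E) :
    fderiv ℝ (fun y => A y (a y) (b y)) z w
      = fderiv ℝ A z w (a z) (b z) + A z (fderiv ℝ a z w) (b z) + A z (a z) (fderiv ℝ b z w) := by
  rw [fderiv_apply_fun (A := fun y => A y (a y)) (by fun_prop) hb, fderiv_apply_fun hA ha]
  simp

theorem fderiv_fderiv_symm {f : E → X} {z : E} (hf : ContDiffAt ℝ ∞ f z) (u v : E) :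
    fderiv ℝ (fderiv ℝ f) z u v = fderiv ℝ (fderiv ℝ f) z v u :=
  (hf.isSymmSndFDerivAt (by simp [minSmoothness_of_isRCLikeNormedField]; exact WithTop.coe_le_coe.2 (le_top : (2 : ℕ∞) ≤ ⊤))).eq u v

theorem ContDiffOn.contDiffAt_of_isOpen {U : Set E} {f : E → X} (hf : ContDiffOn ℝ ∞ f U)
    (hU : IsOpen U) {z : E} (hz : z ∈ U) : ContDiffAt ℝ ∞ f z :=
  hf.contDiffAt (hU.mem_nhds hz)

theorem ContDiffAt.differentiableAt_of_smooth {f : E → X} {z : E} (hf : ContDiffAt ℝ ∞ f z) :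
    DifferentiableAt ℝ f z := hf.differentiableAt (by simp)

theorem ContDiffAt.fderiv_smooth {f : E → X} {z : E} (hf : ContDiffAt ℝ ∞ f z) :
    ContDiffAt ℝ ∞ (fderiv ℝ f) z := hf.fderiv_right (by simp)

end FlatCalculus

/-! ### Curvature of a metric connection with parallel torsion -/

section Connections

variable {E : Type*} [NormedAddCommGroup E] [NormedSpace ℝ E]

/-- The curvature of the connection `d + Γ`. -/
noncomputable def flatCurv (Γ : E → E →L[ℝ] E →L[ℝ] E) (z u v w : E) : E :=
  fderiv ℝ Γ z u v w - fderiv ℝ Γ z v u w + Γ z u (Γ z v w) - Γ z v (Γ z u w)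

/-- The connection `d + Γ` on the open set `U` preserves the metric `G`. -/
structure MetricConn (U : Set E) (G : E → E →L[ℝ] E →L[ℝ] ℝ) (Γ : E → E →L[ℝ] E →L[ℝ] E) :
    Prop where
  isOpen : IsOpen U
  smooth_G : ContDiffOn ℝ ∞ G U
  smooth_Γ : ContDiffOn ℝ ∞ Γ U
  symm : ∀ z ∈ U, ∀ u v, G z u v = G z v u
  pos : ∀ z ∈ U, ∀ v, v ≠ 0 → 0 < G z v v
  parallel : ∀ z ∈ U, ∀ w u v,
    fderiv ℝ G z w u v = G z (Γ z w u) v + G z u (Γ z w v)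

/-- The torsion `S` of `d + Γ` is parallel and satisfies `S(S(u, v), w) = 0`. -/
structure ParallelTorsion (U : Set E) (Γ : E → E →L[ℝ] E →L[ℝ] E)
    (S : E → E →L[ℝ] E →L[ℝ] E) : Prop where
  torsion : ∀ z ∈ U, ∀ u v, Γ z u v - Γ z v u = S z u v
  diff : ∀ z ∈ U, DifferentiableAt ℝ S z
  parallel : ∀ z ∈ U, ∀ w u v,
    fderiv ℝ S z w u v + Γ z w (S z u v) = S z (Γ z w u) v + S z u (Γ z w v)
  nilpotent : ∀ z ∈ U, ∀ u v w, S z (S z u v) w = 0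

theorem flatCurv_antisymm (Γ : E → E →L[ℝ] E →L[ℝ] E) (z u v w : E) :
    flatCurv Γ z u v w = -flatCurv Γ z v u w := by
  unfold flatCurv
  abel

/-- The curvature as a trilinear map in its first and last arguments. -/
noncomputable def flatCurvL (Γ : E → E →L[ℝ] E →L[ℝ] E) (z v : E) : E →ₗ[ℝ] E →ₗ[ℝ] E :=
  LinearMap.mk₂ ℝ (fun u w => flatCurv Γ z u v w)
    (by intros; simp only [flatCurv, map_add, add_apply]; abel)
    (by intros; simp only [flatCurv, map_smul, smul_apply, smul_add, smul_sub])
    (by intros; simp only [flatCurv, map_add]; abel)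
    (by intros; simp only [flatCurv, map_smul, smul_add, smul_sub])

variable {U : Set E} {G : E → E →L[ℝ] E →L[ℝ] ℝ} {Γ S : E → E →L[ℝ] E →L[ℝ] E}

theorem flatCurv_eq_L (z u v w : E) : flatCurv Γ z u v w = flatCurvL Γ z v u w := rfl

theorem flatCurv_neg_left (z u v w : E) : flatCurv Γ z (-u) v w = -flatCurv Γ z u v w := by
  simp [flatCurv_eq_L]

namespace MetricConn

variable (h : MetricConn U G Γ) {z : E} (hz : z ∈ U)
include h hz

theorem contDiffAt_G : ContDiffAt ℝ ∞ G z := h.smooth_G.contDiffAt_of_isOpen h.isOpen hz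

theorem contDiffAt_Γ : ContDiffAt ℝ ∞ Γ z := h.smooth_Γ.contDiffAt_of_isOpen h.isOpen hz

theorem diff_G : DifferentiableAt ℝ G z := (h.contDiffAt_G hz).differentiableAt_of_smooth

theorem diff_Γ : DifferentiableAt ℝ Γ z := (h.contDiffAt_Γ hz).differentiableAt_of_smooth

theorem fderiv_pair {a b : E → E} (ha : DifferentiableAt ℝ a z) (hb : DifferentiableAt ℝ b z)
    (w : E) : fderiv ℝ (fun y => G y (a y) (b y)) z w
      = G z (fderiv ℝ a z w + Γ z w (a z)) (b z) + G z (a z) (fderiv ℝ b z w + Γ z w (b z)) := by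
  rw [fderiv_apply₂_fun (h.diff_G hz) ha hb, h.parallel z hz]
  simp only [map_add, add_apply]
  ring

/-- Differentiating ∇G = 0 once more expresses the second derivative of G through Γ. Its symmetry in
the two directions says that the curvature acts on G as zero. -/
theorem curv_skew (u v a b : E) :
    G z (flatCurv Γ z u v a) b = -G z a (flatCurv Γ z u v b) := by
  have hΓ := h.diff_Γ hz
  have key : ∀ x w, fderiv ℝ (fderiv ℝ G) z x w a b
      = G z (fderiv ℝ Γ z x w a + Γ z x (Γ z w a)) b + G z (Γ z w a) (Γ z x b)
        + (G z (Γ z x a) (Γ z w b) + G z a (fderiv ℝ Γ z x w b + Γ z x (Γ z w b))) := by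
    intro x w
    have hd : DifferentiableAt ℝ (fderiv ℝ G) z :=
      (h.contDiffAt_G hz).fderiv_smooth.differentiableAt_of_smooth
    have e1 : fderiv ℝ (fderiv ℝ G) z x w a b = fderiv ℝ (fun y => fderiv ℝ G y w a b) z x := by
      rw [fderiv_apply_const (A := fun y => fderiv ℝ G y w a) (by fun_prop),
        fderiv_apply_const (A := fun y => fderiv ℝ G y w) (by fun_prop), fderiv_apply_const hd]
    have e2 : (fun y => fderiv ℝ G y w a b)
        =ᶠ[nhds z] fun y => G y (Γ y w a) b + G y a (Γ y w b) := by
      filter_upwards [h.isOpen.mem_nhds hz] with y hy using h.parallel y hy w a b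
    have hG := h.diff_G hz
    rw [e1, e2.fderiv_eq, fderiv_fun_add (by fun_prop) (by fun_prop)]
    rw [add_apply, h.fderiv_pair hz (by fun_prop) (by fun_prop),
      h.fderiv_pair hz (by fun_prop) (by fun_prop)]
    simp only [fderiv_fun_const, Pi.zero_apply, zero_apply, zero_add]
    rw [fderiv_apply_const (A := fun y => Γ y w) (by fun_prop),
      fderiv_apply_const (A := fun y => Γ y w) (by fun_prop), fderiv_apply_const hΓ]
  have hs := fderiv_fderiv_symm (h.contDiffAt_G hz) u v
  have hs' := congrArg (fun A : E →L[ℝ] E →L[ℝ] ℝ => A a b) hs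
  simp only [key] at hs'
  simp only [flatCurv, map_add, map_sub, add_apply,
    sub_apply] at hs' ⊢
  linarith

/-- With torsion S, the cyclic sum of R(u, v)w is the cyclic sum of (∇_u S)(v, w) + S(S(u, v), w).
Both terms vanish for a parallel torsion with S(S(·, ·), ·) = 0, so the torsion-free identity
persists. -/
theorem bianchi (hS : ParallelTorsion U Γ S) (u v w : E) :
    flatCurv Γ z u v w + flatCurv Γ z v w u + flatCurv Γ z w u v = 0 := by
  have hΓ := h.diff_Γ hz
  have hSz := hS.diff z hz
  have hD : ∀ x a b, fderiv ℝ Γ z x a b - fderiv ℝ Γ z x b a = fderiv ℝ S z x a b := by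
    intro x a b
    have e2 : (fun y => Γ y a b - Γ y b a) =ᶠ[nhds z] fun y => S y a b := by
      filter_upwards [h.isOpen.mem_nhds hz] with y hy using hS.torsion y hy a b
    have := congrArg (fun A : E →L[ℝ] E => A x) e2.fderiv_eq
    rw [fderiv_fun_sub (by fun_prop) (by fun_prop), sub_apply] at this
    simpa only [fderiv_apply_const (A := fun y => Γ y a) (show DifferentiableAt ℝ _ z by fun_prop),
      fderiv_apply_const (A := fun y => Γ y b) (show DifferentiableAt ℝ _ z by fun_prop),
      fderiv_apply_const (A := fun y => S y a) (show DifferentiableAt ℝ _ z by fun_prop),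
      fderiv_apply_const hΓ, fderiv_apply_const hSz] using this
  have hSa : ∀ a b, S z a b = -S z b a := by
    intro a b
    rw [← hS.torsion z hz, ← hS.torsion z hz]
    abel
  have t : ∀ a b, Γ z a b = Γ z b a + S z a b := fun a b => by
    rw [← hS.torsion z hz]; abel
  have p1 := hS.parallel z hz u v w
  have p2 := hS.parallel z hz v w u
  have p3 := hS.parallel z hz w u v
  rw [← hD, ← hS.torsion z hz v w, map_sub] at p1
  rw [← hD, ← hS.torsion z hz w u, map_sub] at p2
  rw [← hD, ← hS.torsion z hz u v, map_sub] at p3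
  have n1 : S z (Γ z u v) w - S z (Γ z v u) w = 0 := by
    rw [← hS.nilpotent z hz u v w, ← hS.torsion z hz u v, map_sub,
      sub_apply]
  have n2 : S z (Γ z v w) u - S z (Γ z w v) u = 0 := by
    rw [← hS.nilpotent z hz v w u, ← hS.torsion z hz v w, map_sub,
      sub_apply]
  have n3 : S z (Γ z w u) v - S z (Γ z u w) v = 0 := by
    rw [← hS.nilpotent z hz w u v, ← hS.torsion z hz w u, map_sub,
      sub_apply]
  rw [hSa v (Γ z u w)] at p1
  rw [hSa w (Γ z v u)] at p2
  rw [hSa u (Γ z w v)] at p3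
  -- The three parallelism equations are added cyclically. What remains on the right is the sum of
  -- the three nilpotency relations, hence zero.
  have hsum : ∀ a b c d e f a' b' c' d' e' f' : E, a = b → c = d → e = f → a' = 0 → b' = 0 →
      c' = 0 → b + d + f = a' + b' + c' → a + c + e = 0 := by
    intro a b c d e f a' b' c' d' e' f' h1 h2 h3 h4 h5 h6 h7
    rw [h1, h2, h3, h7, h4, h5, h6]; simp
  have := hsum _ _ _ _ _ _ _ _ _ 0 0 0 p1 p2 p3 n1 n2 n3 (by abel)
  rw [← this]
  unfold flatCurv
  abel

/-- The classical argument: four Bianchi identities are combined with skewness in each pair.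
Vanishing torsion is not needed, only `bianchi`. -/
theorem curv_pair_symm (hS : ParallelTorsion U Γ S) (u v a b : E) :
    G z (flatCurv Γ z u v a) b = G z (flatCurv Γ z a b u) v := by
  have B : ∀ x y w t, G z (flatCurv Γ z x y w) t + G z (flatCurv Γ z y w x) t
      + G z (flatCurv Γ z w x y) t = 0 := by
    intro x y w t
    have := congrArg (fun s => G z s t) (h.bianchi hz hS x y w)
    simpa using this
  have K : ∀ x y w t, G z (flatCurv Γ z x y w) t = -G z (flatCurv Γ z x y t) w := by
    intro x y w t
    rw [h.curv_skew hz, h.symm z hz]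
  have A : ∀ x y w t, G z (flatCurv Γ z x y w) t = -G z (flatCurv Γ z y x w) t := by
    intro x y w t
    rw [flatCurv_antisymm]
    simp
  have b1 := B u v a b
  have b2 := B v a b u
  have b3 := B a b u v
  have b4 := B b u v a
  have k1 := K u v a b
  have k2 := K v a u b
  have k3 := K a u v b
  have k4 := K a b v u
  have k5 := K b v a u
  have k6 := K b u a v
  have a1 := A v b a u
  have a2 := A u b v a
  have a3 := A a u b v
  have a4 := A u a v b
  have k7 := K a b u v
  linarith [K v a b u, K a u v b, K u v b a, A u a b v, K b v u a, A b v u a, A v b u a, K u b v a, A b u v a, K b u v a]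

end MetricConn

end Connections

/-! ### The inverse metric, and traces of covariant derivatives -/

section Sharp

variable {E : Type*} [NormedAddCommGroup E] [NormedSpace ℝ E] [FiniteDimensional ℝ E]
  {W : Type*} [NormedAddCommGroup W] [NormedSpace ℝ W]

/-- The metric `G` as an isomorphism `E ≃ E*`, for nondegenerate `G`. -/
noncomputable def flatEquiv (G : E →L[ℝ] E →L[ℝ] ℝ) (hG : ∀ v, v ≠ 0 → 0 < G v v) :
    E ≃L[ℝ] (E →L[ℝ] ℝ) :=
  (LinearEquiv.ofInjectiveOfFinrankEq (G : E →ₗ[ℝ] (E →L[ℝ] ℝ))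
    ((injective_iff_map_eq_zero _).2 fun v hv => by
      by_contra h
      have h1 := hG v h
      have h2 : G v = 0 := hv
      simp [h2] at h1)
    (by
      rw [(LinearMap.toContinuousLinearMap : (E →ₗ[ℝ] ℝ) ≃ₗ[ℝ] (E →L[ℝ] ℝ)).symm.finrank_eq]
      exact (Subspace.dual_finrank_eq (K := ℝ) (V := E)).symm)).toContinuousLinearEquiv

theorem flatEquiv_coe (G : E →L[ℝ] E →L[ℝ] ℝ) (hG : ∀ v, v ≠ 0 → 0 < G v v) :
    (flatEquiv G hG : E →L[ℝ] (E →L[ℝ] ℝ)) = G := by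
  ext v
  rfl

/-- The inverse of the metric `G`. -/
noncomputable def sharp (G : E →L[ℝ] E →L[ℝ] ℝ) : (E →L[ℝ] ℝ) →L[ℝ] E :=
  ContinuousLinearMap.inverse G

theorem sharp_spec {G : E →L[ℝ] E →L[ℝ] ℝ} (hG : ∀ v, v ≠ 0 → 0 < G v v) (l : E →L[ℝ] ℝ) :
    G (sharp G l) = l := by
  unfold sharp
  conv_lhs => rw [← flatEquiv_coe G hG]
  rw [ContinuousLinearMap.inverse_equiv]
  exact (flatEquiv G hG).apply_symm_apply l

/-- Positivity makes G z invertible, and inversion is smooth at invertible maps. -/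
theorem sharp_contDiffAt {X : Type*} [NormedAddCommGroup X] [NormedSpace ℝ X]
    {G : X → E →L[ℝ] E →L[ℝ] ℝ} {z : X} {n : ℕ∞ω}
    (h : ContDiffAt ℝ n G z) (hG : ∀ v, v ≠ 0 → 0 < G z v v) :
    ContDiffAt ℝ n (fun y => sharp (G y)) z := by
  have : ContDiffAt ℝ n (ContinuousLinearMap.inverse : (E →L[ℝ] (E →L[ℝ] ℝ)) → _) (G z) := by
    rw [← flatEquiv_coe (G z) hG]
    exact contDiffAt_map_inverse _
  exact this.comp z h

theorem exists_orthoBasis (G : E →L[ℝ] E →L[ℝ] ℝ) (hs : ∀ u v, G u v = G v u)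
    (hp : ∀ v, v ≠ 0 → 0 < G v v) :
    ∃ e : Fin (Module.finrank ℝ E) → E, IsOrthoBasis (fun u v => G u v) e :=
  exists_isOrthoBasis
    ((ContinuousLinearMap.coeLM ℝ : (E →L[ℝ] ℝ) →ₗ[ℝ] (E →ₗ[ℝ] ℝ)) ∘ₗ (G : E →ₗ[ℝ] (E →L[ℝ] ℝ)))
    hs hp

/-- A continuous bilinear map as a bilinear map. -/
noncomputable def toBilin (C : E →L[ℝ] E →L[ℝ] W) : E →ₗ[ℝ] E →ₗ[ℝ] W :=
  (ContinuousLinearMap.coeLM ℝ : (E →L[ℝ] W) →ₗ[ℝ] (E →ₗ[ℝ] W)) ∘ₗ (C : E →ₗ[ℝ] (E →L[ℝ] W))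

@[simp] theorem toBilin_apply (C : E →L[ℝ] E →L[ℝ] W) (u v : E) : toBilin C u v = C u v := rfl

namespace MetricConn

variable {U : Set E} {G : E → E →L[ℝ] E →L[ℝ] ℝ} {Γ S : E → E →L[ℝ] E →L[ℝ] E}
variable (h : MetricConn U G Γ) {z : E} (hz : z ∈ U)
include h hz

theorem gtrace_eq {ι : Type*} [Fintype ι] [DecidableEq ι] {e : ι → E}
    (he : IsOrthoBasis (fun u v => G z u v) e) (C : E →L[ℝ] E →L[ℝ] W) :
    gtrace (sharp (G z)) C = ∑ A, C (e A) (e A) :=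
  gtrace_eq_sum (sharp_eq_sum he fun l v => by rw [sharp_spec (h.pos z hz)]) C

theorem sharp_diff : DifferentiableAt ℝ (fun y => sharp (G y)) z :=
  (sharp_contDiffAt (h.contDiffAt_G hz) (h.pos z hz)).differentiableAt_of_smooth

/-- The inverse of a parallel metric is parallel: differentiate G(sharp l, v) = l(v) with l and v
constant. -/
theorem fderiv_sharp (w : E) (l : E →L[ℝ] ℝ) :
    fderiv ℝ (fun y => sharp (G y)) z w l
      = -Γ z w (sharp (G z) l) - sharp (G z) (l.comp (Γ z w)) := by
  have hp := h.pos z hz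
  have hG := h.diff_G hz
  have hK := h.sharp_diff hz
  apply (flatEquiv (G z) hp).injective
  change G z _ = G z _
  ext v
  have e : (fun y => G y (sharp (G y) l) v) =ᶠ[nhds z] fun _ => l v := by
    filter_upwards [h.isOpen.mem_nhds hz] with y hy
    rw [sharp_spec (h.pos y hy)]
  have e' := congrArg (fun A : E →L[ℝ] ℝ => A w) e.fderiv_eq
  rw [h.fderiv_pair hz (by fun_prop) (by fun_prop)] at e'
  rw [fderiv_apply_const hK] at e'
  simp only [fderiv_fun_const, Pi.zero_apply, zero_apply, zero_add] at e'
  rw [sharp_spec hp l] at e'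
  simp only [map_sub, map_neg, add_apply, sub_apply, neg_apply, map_add, sharp_spec hp,
    ContinuousLinearMap.comp_apply] at e' ⊢
  linarith

/-- Traces commute with covariant derivatives. -/
theorem fderiv_gtrace {C : E → E →L[ℝ] E →L[ℝ] W} (hC : DifferentiableAt ℝ C z) (w : E)
    {ι : Type*} [Fintype ι] [DecidableEq ι] {e : ι → E}
    (he : IsOrthoBasis (fun u v => G z u v) e) :
    fderiv ℝ (fun y => gtrace (sharp (G y)) (C y)) z w
      = ∑ A, (fderiv ℝ C z w (e A) (e A) - C z (Γ z w (e A)) (e A)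
          - C z (e A) (Γ z w (e A))) := by
  have hK := h.sharp_diff hz
  unfold gtrace
  rw [fderiv_fun_sum (fun i _ => by fun_prop)]
  rw [sum_apply]
  have h1 : ∀ i, fderiv ℝ (fun y => C y (stdB E i) (sharp (G y) (stdCo E i))) z w
      = fderiv ℝ C z w (stdB E i) (sharp (G z) (stdCo E i))
        - C z (stdB E i) (Γ z w (sharp (G z) (stdCo E i)))
        - C z (stdB E i) (sharp (G z) ((stdCo E i).comp (Γ z w))) := by
    intro i
    rw [fderiv_apply₂_fun hC (by fun_prop) (by fun_prop), fderiv_apply_const hK,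
      h.fderiv_sharp hz]
    simp only [fderiv_fun_const, Pi.zero_apply, zero_apply, map_zero, add_zero, map_sub, map_neg]
    abel
  simp only [h1, Finset.sum_sub_distrib]
  -- The connection acts on the coordinate covector here. Its matrix in the dual basis is the
  -- transpose of its matrix in the basis, so it can be moved to the coordinate vector.
  have h2 : ∑ i, C z (stdB E i) (sharp (G z) ((stdCo E i).comp (Γ z w)))
      = ∑ i, C z (Γ z w (stdB E i)) (sharp (G z) (stdCo E i)) := by
    have r1 : ∀ i, (stdCo E i).comp (Γ z w)
        = ∑ j, (stdCo E i (Γ z w (stdB E j))) • stdCo E j := by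
      intro i
      ext v
      conv_lhs => rw [ContinuousLinearMap.comp_apply, ← sum_stdCo v]
      simp [mul_comm]
    have r2 : ∀ j, Γ z w (stdB E j) = ∑ i, (stdCo E i (Γ z w (stdB E j))) • stdB E i :=
      fun j => (sum_stdCo _).symm
    simp only [r1, map_sum, map_smul]
    rw [Finset.sum_comm]
    apply Finset.sum_congr rfl
    intro j _
    conv_rhs => rw [r2 j]
    simp
  rw [h2]
  have t1 := h.gtrace_eq hz he (fderiv ℝ C z w)
  have t2 := h.gtrace_eq hz he ((C z).comp (Γ z w))
  have t3 := h.gtrace_eq hz he (((ContinuousLinearMap.compL ℝ E E W).flip (Γ z w)).comp (C z))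
  simp only [gtrace, ContinuousLinearMap.comp_apply, ContinuousLinearMap.flip_apply,
    ContinuousLinearMap.compL_apply] at t1 t2 t3
  rw [t1, t2, t3]
  abel

end MetricConn

end Sharp

/-! ### Curvature identities of a Sasakian structure in coordinates -/

section LocalSasaki

variable {E : Type*} [NormedAddCommGroup E] [NormedSpace ℝ E]

/-- The curvature commutes with a parallel endomorphism field. -/
theorem flatCurv_endo {U : Set E} {Γ : E → E →L[ℝ] E →L[ℝ] E} {J : E → E →L[ℝ] E} (hU : IsOpen U)
    (hs : ContDiffOn ℝ ∞ J U)
    (hpar : ∀ z ∈ U, ∀ w a, fderiv ℝ J z w a + Γ z w (J z a) = J z (Γ z w a)) {z : E} (hz : z ∈ U)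
    (hΓ : DifferentiableAt ℝ Γ z) (u v a : E) :
    flatCurv Γ z u v (J z a) = J z (flatCurv Γ z u v a) := by
  have hJc := hs.contDiffAt_of_isOpen hU hz
  have hJ := hJc.differentiableAt_of_smooth
  have hfd : ∀ y ∈ U, ∀ w a, fderiv ℝ J y w a = J y (Γ y w a) - Γ y w (J y a) := by
    intro y hy w a
    rw [← hpar y hy]; abel
  -- ∇J = 0 determines the second derivative of J. Its symmetry in the two directions is the
  -- commutation of the curvature with J.
  have key : ∀ x w, fderiv ℝ (fderiv ℝ J) z x w a
      = J z (Γ z x (Γ z w a)) - Γ z x (J z (Γ z w a)) + J z (fderiv ℝ Γ z x w a)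
        - (fderiv ℝ Γ z x w (J z a) + Γ z w (J z (Γ z x a) - Γ z x (J z a))) := by
    intro x w
    have hd : DifferentiableAt ℝ (fderiv ℝ J) z := hJc.fderiv_smooth.differentiableAt_of_smooth
    have e2 : (fun y => fderiv ℝ J y w a)
        =ᶠ[nhds z] fun y => J y (Γ y w a) - Γ y w (J y a) := by
      filter_upwards [hU.mem_nhds hz] with y hy using hfd y hy w a
    rw [← fderiv_apply_const hd, ← fderiv_apply_const (A := fun y => fderiv ℝ J y w) (by fun_prop),
      e2.fderiv_eq, fderiv_fun_sub (by fun_prop) (by fun_prop), sub_apply,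
      fderiv_apply_fun hJ (by fun_prop),
      fderiv_apply_fun (A := fun y => Γ y w) (a := fun y => J y a) (by fun_prop) (by fun_prop),
      fderiv_apply_const (A := fun y => Γ y w) (by fun_prop), fderiv_apply_const hΓ,
      fderiv_apply_const hJ, hfd z hz, hfd z hz]
  have hs := congrArg (fun A : E →L[ℝ] E => A a) (fderiv_fderiv_symm hJc u v)
  simp only [key, map_sub] at hs
  unfold flatCurv
  simp only [map_sub, map_add]
  rw [← sub_eq_zero] at hs ⊢
  rw [← neg_eq_zero, ← hs]
  abel

/-- The coordinate form of a Sasakian structure with its Tanaka-Webster connection. -/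
structure SasakiLocal (U : Set E) (G : E → E →L[ℝ] E →L[ℝ] ℝ) (Γ : E → E →L[ℝ] E →L[ℝ] E)
    (J : E → E →L[ℝ] E) (T : E → E) : Prop extends MetricConn U G Γ where
  smooth_J : ContDiffOn ℝ ∞ J U
  smooth_T : ContDiffOn ℝ ∞ T U
  skew_J : ∀ z ∈ U, ∀ u v, G z (J z u) v = -G z u (J z v)
  parallel_J : ∀ z ∈ U, ∀ w a, fderiv ℝ J z w a + Γ z w (J z a) = J z (Γ z w a)
  parallel_T : ∀ z ∈ U, ∀ w, fderiv ℝ T z w + Γ z w (T z) = 0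
  J_T : ∀ z ∈ U, J z (T z) = 0
  J_J : ∀ z ∈ U, ∀ v, J z (J z v) = -v + G z (T z) v • T z
  T_unit : ∀ z ∈ U, G z (T z) (T z) = 1
  torsion : ∀ z ∈ U, ∀ u v, Γ z u v - Γ z v u = -(G z u (J z v)) • T z

variable {U : Set E} {G : E → E →L[ℝ] E →L[ℝ] ℝ} {Γ : E → E →L[ℝ] E →L[ℝ] E}
  {J : E → E →L[ℝ] E} {T : E → E}

/-- The torsion `(u, v) ↦ -G(u, J v) T` of the Tanaka-Webster connection. -/
noncomputable def sasakiTorsion (G : E → E →L[ℝ] E →L[ℝ] ℝ) (J : E → E →L[ℝ] E) (T : E → E)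
    (z : E) : E →L[ℝ] E →L[ℝ] E :=
  -(((ContinuousLinearMap.smulRightL ℝ E E).flip (T z)).comp
    (((ContinuousLinearMap.compL ℝ E E ℝ).flip (J z)).comp (G z)))

theorem sasakiTorsion_apply (z u v : E) :
    sasakiTorsion G J T z u v = -(G z u (J z v)) • T z := by
  simp [sasakiTorsion]

namespace SasakiLocal

variable (h : SasakiLocal U G Γ J T) {z : E} (hz : z ∈ U)
include h hz

theorem diff_J : DifferentiableAt ℝ J z :=
  (h.smooth_J.contDiffAt_of_isOpen h.isOpen hz).differentiableAt_of_smooth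

theorem diff_T : DifferentiableAt ℝ T z :=
  (h.smooth_T.contDiffAt_of_isOpen h.isOpen hz).differentiableAt_of_smooth

theorem fderiv_J (w a : E) : fderiv ℝ J z w a = J z (Γ z w a) - Γ z w (J z a) := by
  rw [← h.parallel_J z hz]; abel

theorem fderiv_T (w : E) : fderiv ℝ T z w = -Γ z w (T z) := by
  rw [eq_neg_iff_add_eq_zero]; exact h.parallel_T z hz w

end SasakiLocal

/-- The torsion is built from the parallel tensors G, J and T, hence is parallel. It takes values in
multiples of T, and G(T, J w) = 0, so applying it twice gives zero. -/
theorem SasakiLocal.parallelTorsion (h : SasakiLocal U G Γ J T) : ParallelTorsion U Γ (sasakiTorsion G J T) where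
  torsion z hz u v := by rw [h.torsion z hz, sasakiTorsion_apply]
  diff z hz := by
    have h1 := h.diff_J hz
    have h2 := h.diff_T hz
    have h3 := h.diff_G hz
    unfold sasakiTorsion
    fun_prop
  parallel z hz w u v := by
    have h1 := h.diff_J hz
    have h2 := h.diff_T hz
    have h3 := h.diff_G hz
    have hS : DifferentiableAt ℝ (sasakiTorsion G J T) z := by
      unfold sasakiTorsion
      fun_prop
    have e : fderiv ℝ (sasakiTorsion G J T) z w u v
        = fderiv ℝ (fun y => -(G y u (J y v)) • T y) z w := by
      rw [← fderiv_apply_const hS, ← fderiv_apply_const (A := fun y => sasakiTorsion G J T y u)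
        (by fun_prop)]
      simp only [sasakiTorsion_apply]
    rw [e, fderiv_fun_smul (by fun_prop) h2, fderiv_fun_neg]
    simp only [add_apply, smul_apply, ContinuousLinearMap.smulRight_apply, neg_apply,
      sasakiTorsion_apply]
    rw [h.fderiv_pair hz (by fun_prop) (by fun_prop), fderiv_apply_const h1, h.fderiv_J hz,
      h.fderiv_T hz]
    simp only [fderiv_fun_const, Pi.zero_apply, zero_apply, zero_add, sub_add_cancel, map_smul]
    module
  nilpotent z hz u v w := by
    rw [sasakiTorsion_apply z u v, map_smul, smul_apply, sasakiTorsion_apply]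
    have : G z (T z) (J z w) = 0 := by
      have := h.skew_J z hz (T z) w
      rw [h.J_T z hz] at this
      simpa using this.symm
    simp [this]

namespace SasakiLocal

variable (h : SasakiLocal U G Γ J T) {z : E} (hz : z ∈ U)
include h hz

theorem G_T_J (w : E) : G z (T z) (J z w) = 0 := by
  have := h.skew_J z hz (T z) w
  rw [h.J_T z hz] at this
  simpa using this.symm

/-- T is parallel; the symmetry of its second derivative is the claim. -/
theorem curv_T (u v : E) : flatCurv Γ z u v (T z) = 0 := by
  have hΓ := h.diff_Γ hz
  have hT := h.diff_T hz
  have key : ∀ x w, fderiv ℝ (fderiv ℝ T) z x w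
      = -(fderiv ℝ Γ z x w (T z) - Γ z w (Γ z x (T z))) := by
    intro x w
    have hd : DifferentiableAt ℝ (fderiv ℝ T) z :=
      (h.smooth_T.contDiffAt_of_isOpen h.isOpen hz).fderiv_smooth.differentiableAt_of_smooth
    have e2 : (fun y => fderiv ℝ T y w) =ᶠ[nhds z] fun y => -(Γ y w (T y)) := by
      filter_upwards [h.isOpen.mem_nhds hz] with y hy using h.fderiv_T hy w
    rw [← fderiv_apply_const hd, e2.fderiv_eq, fderiv_fun_neg, neg_apply,
      fderiv_apply_fun (A := fun y => Γ y w) (by fun_prop) hT, fderiv_apply_const hΓ, h.fderiv_T hz]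
    simp [sub_eq_add_neg]
  have hs := fderiv_fderiv_symm (h.smooth_T.contDiffAt_of_isOpen h.isOpen hz) u v
  rw [key, key, neg_inj] at hs
  unfold flatCurv
  rw [← sub_eq_zero] at hs
  rw [← hs]
  abel

theorem curv_J (u v a : E) : flatCurv Γ z u v (J z a) = J z (flatCurv Γ z u v a) :=
  flatCurv_endo h.isOpen h.smooth_J h.parallel_J hz (h.diff_Γ hz) u v a

/-- Pair symmetry gives ⟨R(w, T)v, b⟩ = ⟨R(v, b)w, T⟩ = -⟨w, R(v, b)T⟩ = 0. Because of this, no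
curvature of M appears in the divergence of `reebForm`. -/
theorem curv_T_mid (w v : E) : flatCurv Γ z w (T z) v = 0 := by
  by_contra hne
  have h1 := h.pos z hz _ hne
  have h2 := h.toMetricConn.curv_pair_symm hz h.parallelTorsion w (T z) v
    (flatCurv Γ z w (T z) v)
  rw [h2, h.toMetricConn.curv_skew hz, h.curv_T hz] at h1
  simp at h1

theorem curv_T_left (w v : E) : flatCurv Γ z (T z) w v = 0 := by
  rw [flatCurv_antisymm, h.curv_T_mid hz, neg_zero]

theorem G_J_J (u v : E) : G z (J z u) (J z v) = G z u v - G z (T z) u * G z (T z) v := by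
  rw [h.skew_J z hz, h.J_J z hz]
  simp only [map_add, map_neg, map_smul, smul_eq_mul]
  rw [h.symm z hz u (T z)]
  ring

/-- The curvature commutes with J, and pair symmetry carries this invariance to the first pair of
arguments. The T-component in `G_J_J` is harmless because the curvature annihilates T. -/
theorem curv_J_J (u v a : E) : flatCurv Γ z (J z u) (J z v) a = flatCurv Γ z u v a := by
  have key : ∀ b, G z (flatCurv Γ z (J z u) (J z v) a - flatCurv Γ z u v a) b = 0 := by
    intro b
    rw [map_sub, sub_apply,
      h.toMetricConn.curv_pair_symm hz h.parallelTorsion,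
      h.toMetricConn.curv_pair_symm hz h.parallelTorsion u v a b,
      h.curv_J hz, h.G_J_J hz, h.symm z hz (T z) (flatCurv Γ z a b u),
      h.toMetricConn.curv_skew hz a b u (T z), h.curv_T hz]
    simp
  by_contra hne
  rw [← sub_eq_zero] at hne
  have := h.pos z hz _ hne
  rw [key] at this
  exact lt_irrefl _ this

/-- Moving one J across the trace produces -J², which is the identity up to a multiple of T in the
second slot, where C vanishes. -/
theorem sum_J_J {W : Type*} [NormedAddCommGroup W] [NormedSpace ℝ W]
    {ι : Type*} [Fintype ι] [DecidableEq ι] {e : ι → E}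
    (he : IsOrthoBasis (fun u v => G z u v) e) (C : E →ₗ[ℝ] E →ₗ[ℝ] W)
    (hC : ∀ u, C u (T z) = 0) :
    ∑ A, C (J z (e A)) (J z (e A)) = ∑ A, C (e A) (e A) := by
  have h1 := IsOrthoBasis.sum_skew (g := toBilin (G z)) he (h.symm z hz) (J z : E →ₗ[ℝ] E)
    (h.skew_J z hz) (C.compl₂ (J z : E →ₗ[ℝ] E))
  simp only [LinearMap.compl₂_apply, ContinuousLinearMap.coe_coe, h.J_J z hz, map_add, map_neg,
    map_smul, hC, smul_zero, add_zero, Finset.sum_neg_distrib, neg_neg] at h1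
  exact h1

/-- The Ricci-type trace of the Tanaka-Webster curvature that vanishes by `J`-invariance. -/
theorem sum_curv {ι : Type*} [Fintype ι] [DecidableEq ι] {e : ι → E}
    (he : IsOrthoBasis (fun u v => G z u v) e) (a : E) :
    ∑ B, (flatCurv Γ z (e B) a (e B) + flatCurv Γ z (e B) (J z a) (J z (e B))) = 0 := by
  -- R(e_B, J a) = R(J e_B, J² a) = -R(J e_B, a), the T-part of J² a contributing nothing. Summed
  -- against J e_B this is minus the first trace, by `sum_J_J`.
  have h1 : ∀ B, flatCurv Γ z (e B) (J z a) (J z (e B))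
      = -flatCurvL Γ z a (J z (e B)) (J z (e B)) := by
    intro B
    rw [← h.curv_J_J hz, h.J_J z hz a, flatCurv_antisymm, flatCurv_eq_L, map_add, map_smul,
      LinearMap.add_apply, LinearMap.smul_apply, ← flatCurv_eq_L, ← flatCurv_eq_L,
      h.curv_T_left hz, smul_zero, add_zero, flatCurv_neg_left, neg_neg, flatCurv_antisymm]
    rfl
  rw [Finset.sum_add_distrib]
  simp only [h1, Finset.sum_neg_distrib]
  rw [h.sum_J_J hz he _ fun u => h.curv_T hz u a]
  simp [flatCurv_eq_L]

end SasakiLocal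

end LocalSasaki

/-! ### Second fundamental form and Ricci identity in coordinates -/

section LocalMaps

variable {E : Type*} [NormedAddCommGroup E] [NormedSpace ℝ E]
  {F : Type*} [NormedAddCommGroup F] [NormedSpace ℝ F]

/-- The second fundamental form of `f` in coordinates; the first argument is the direction of
differentiation. -/
noncomputable def flatHess (Γ : E → E →L[ℝ] E →L[ℝ] E) (Γ' : F → F →L[ℝ] F →L[ℝ] F) (f : E → F)
    (z : E) : E →L[ℝ] E →L[ℝ] F :=
  fderiv ℝ (fderiv ℝ f) z
    + ((ContinuousLinearMap.compL ℝ E F F).flip (fderiv ℝ f z)).comp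
        ((Γ' (f z)).comp (fderiv ℝ f z))
    - (ContinuousLinearMap.compL ℝ E E F (fderiv ℝ f z)).comp (Γ z)

theorem flatHess_apply (Γ : E → E →L[ℝ] E →L[ℝ] E) (Γ' : F → F →L[ℝ] F →L[ℝ] F) (f : E → F)
    (z v u : E) : flatHess Γ Γ' f z v u
      = fderiv ℝ (fderiv ℝ f) z v u + Γ' (f z) (fderiv ℝ f z v) (fderiv ℝ f z u)
        - fderiv ℝ f z (Γ z v u) := by
  simp [flatHess]

/-- The covariant derivative of a section `s` along `f`. -/
noncomputable def alongDeriv (Γ' : F → F →L[ℝ] F →L[ℝ] F) (f : E → F) (s : E → F) (z w : E) : F :=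
  fderiv ℝ s z w + Γ' (f z) (fderiv ℝ f z w) (s z)

/-- The covariant derivative `(w, v, u) ↦ (∇_w A)(v, u)` of a two-tensor with values along `f`. -/
noncomputable def tensorDeriv (Γ : E → E →L[ℝ] E →L[ℝ] E) (Γ' : F → F →L[ℝ] F →L[ℝ] F)
    (f : E → F) (A : E → E →L[ℝ] E →L[ℝ] F) (z w v u : E) : F :=
  fderiv ℝ A z w v u + Γ' (f z) (fderiv ℝ f z w) (A z v u) - A z (Γ z w v) u - A z v (Γ z w u)

/-- The covariant derivative of a one-form; the first argument is the direction. -/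
noncomputable def formDeriv (Γ : E → E →L[ℝ] E →L[ℝ] E) (l : E → E →L[ℝ] ℝ) (z : E) :
    E →L[ℝ] E →L[ℝ] ℝ :=
  fderiv ℝ l z - (ContinuousLinearMap.compL ℝ E E ℝ (l z)).comp (Γ z)

theorem formDeriv_apply (Γ : E → E →L[ℝ] E →L[ℝ] E) (l : E → E →L[ℝ] ℝ) (z w u : E) :
    formDeriv Γ l z w u = fderiv ℝ l z w u - l z (Γ z w u) := by
  simp [formDeriv]

/-- A smooth map between coordinate domains with metric connections, the target being torsion
free. -/
structure LocalMap (U : Set E) (G : E → E →L[ℝ] E →L[ℝ] ℝ) (Γ : E → E →L[ℝ] E →L[ℝ] E)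
    (V : Set F) (H : F → F →L[ℝ] F →L[ℝ] ℝ) (Γ' : F → F →L[ℝ] F →L[ℝ] F) (f : E → F) : Prop where
  source : MetricConn U G Γ
  target : MetricConn V H Γ'
  torsion_free : ∀ y ∈ V, ∀ u v, Γ' y u v = Γ' y v u
  smooth : ContDiffOn ℝ ∞ f U
  maps : ∀ z ∈ U, f z ∈ V

variable {U : Set E} {G : E → E →L[ℝ] E →L[ℝ] ℝ} {Γ : E → E →L[ℝ] E →L[ℝ] E}
  {V : Set F} {H : F → F →L[ℝ] F →L[ℝ] ℝ} {Γ' : F → F →L[ℝ] F →L[ℝ] F} {f : E → F}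

theorem alongDeriv_tensor {z : E} {A : E → E →L[ℝ] E →L[ℝ] F} (hA : DifferentiableAt ℝ A z) {a b : E → E}
    (ha : DifferentiableAt ℝ a z) (hb : DifferentiableAt ℝ b z) (w : E) :
    alongDeriv Γ' f (fun y => A y (a y) (b y)) z w
      = tensorDeriv Γ Γ' f A z w (a z) (b z) + A z (fderiv ℝ a z w + Γ z w (a z)) (b z)
        + A z (a z) (fderiv ℝ b z w + Γ z w (b z)) := by
  rw [alongDeriv, fderiv_apply₂_fun hA ha hb, tensorDeriv]
  simp only [map_add, add_apply]
  abel

namespace LocalMap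

theorem smooth_hess (h : LocalMap U G Γ V H Γ' f) {z : E} (hz : z ∈ U) :
    ContDiffAt ℝ ∞ (flatHess Γ Γ' f) z := by
  have hf : ContDiffAt ℝ ∞ f z := h.smooth.contDiffAt_of_isOpen h.source.isOpen hz
  have h1 := hf.fderiv_smooth
  have h2 := h1.fderiv_smooth
  have h3 : ContDiffAt ℝ ∞ (fun y => Γ' (f y)) z := (h.target.contDiffAt_Γ (h.maps z hz)).comp z hf
  have h4 := h.source.contDiffAt_Γ hz
  unfold flatHess
  exact (h2.add ((contDiffAt_const.clm_apply h1).clm_comp (h3.clm_comp h1))).sub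
    ((contDiffAt_const.clm_apply h1).clm_comp h4)

variable (h : LocalMap U G Γ V H Γ' f) {z : E} (hz : z ∈ U)
include h hz

theorem smoothAt : ContDiffAt ℝ ∞ f z := h.smooth.contDiffAt_of_isOpen h.source.isOpen hz

theorem diff : DifferentiableAt ℝ f z := (h.smoothAt hz).differentiableAt_of_smooth

theorem diff' : DifferentiableAt ℝ (fderiv ℝ f) z :=
  (h.smoothAt hz).fderiv_smooth.differentiableAt_of_smooth

theorem diff'' : DifferentiableAt ℝ (fderiv ℝ (fderiv ℝ f)) z :=
  (h.smoothAt hz).fderiv_smooth.fderiv_smooth.differentiableAt_of_smooth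

theorem diff_hess : DifferentiableAt ℝ (flatHess Γ Γ' f) z :=
  (h.smooth_hess hz).differentiableAt_of_smooth

theorem diff_H : DifferentiableAt ℝ (fun y => H (f y)) z :=
  (h.target.diff_G (h.maps z hz)).comp z (h.diff hz)

theorem smooth_H : ContDiffAt ℝ ∞ (fun y => H (f y)) z :=
  (h.target.contDiffAt_G (h.maps z hz)).comp z (h.smoothAt hz)

theorem diff_Γ' : DifferentiableAt ℝ (fun y => Γ' (f y)) z :=
  (h.target.diff_Γ (h.maps z hz)).comp z (h.diff hz)

theorem fderiv_Γ' (w : E) : fderiv ℝ (fun y => Γ' (f y)) z w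
    = fderiv ℝ Γ' (f z) (fderiv ℝ f z w) := by
  have := fderiv_comp z (h.target.diff_Γ (h.maps z hz)) (h.diff hz)
  rw [show (fun y => Γ' (f y)) = Γ' ∘ f from rfl, this]
  rfl

theorem fderiv_pair {s s' : E → F} (hs : DifferentiableAt ℝ s z) (hs' : DifferentiableAt ℝ s' z)
    (w : E) : fderiv ℝ (fun y => H (f y) (s y) (s' y)) z w
      = H (f z) (alongDeriv Γ' f s z w) (s' z) + H (f z) (s z) (alongDeriv Γ' f s' z w) := by
  have e : fderiv ℝ (fun y => H (f y)) z w = fderiv ℝ H (f z) (fderiv ℝ f z w) := by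
    have := fderiv_comp z (h.target.diff_G (h.maps z hz)) (h.diff hz)
    rw [show (fun y => H (f y)) = H ∘ f from rfl, this]
    rfl
  rw [fderiv_apply₂_fun (h.diff_H hz) hs hs', e, h.target.parallel _ (h.maps z hz)]
  simp only [alongDeriv, map_add, add_apply]
  ring

/-- The second derivative of f is symmetric and the target is torsion free, so only the torsion of
the source is left. -/
theorem hess_antisymm (v u : E) : flatHess Γ Γ' f z v u - flatHess Γ Γ' f z u v
    = -fderiv ℝ f z (Γ z v u - Γ z u v) := by
  rw [flatHess_apply, flatHess_apply, fderiv_fderiv_symm (h.smoothAt hz) v u,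
    h.torsion_free _ (h.maps z hz) (fderiv ℝ f z v), map_sub]
  abel

theorem alongDeriv_fderiv {a : E → E} (ha : DifferentiableAt ℝ a z) (w : E) :
    alongDeriv Γ' f (fun y => fderiv ℝ f y (a y)) z w
      = flatHess Γ Γ' f z w (a z) + fderiv ℝ f z (fderiv ℝ a z w + Γ z w (a z)) := by
  have := h.diff' hz
  rw [alongDeriv, fderiv_apply_fun this ha, flatHess_apply, map_add]
  abel

/-- The Ricci identity. -/
theorem ricci_identity (w v u : E) :
    tensorDeriv Γ Γ' f (flatHess Γ Γ' f) z w v u - tensorDeriv Γ Γ' f (flatHess Γ Γ' f) z v w u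
      = flatCurv Γ' (f z) (fderiv ℝ f z w) (fderiv ℝ f z v) (fderiv ℝ f z u)
        - fderiv ℝ f z (flatCurv Γ z w v u) - flatHess Γ Γ' f z (Γ z w v - Γ z v w) u := by
  have hf := h.diff hz
  have hf' := h.diff' hz
  have hf'' := h.diff'' hz
  have hΓ := h.source.diff_Γ hz
  have hΓ' := h.diff_Γ' hz
  have hb := h.diff_hess hz
  -- Expand the derivative of the second fundamental form. Third derivatives of f cancel by
  -- symmetry, the derivatives and products of Γ and Γ' assemble into the two curvatures, and the
  -- torsion of the source leaves the last term.
  have key : ∀ x v u, fderiv ℝ (flatHess Γ Γ' f) z x v u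
      = fderiv ℝ (fderiv ℝ (fderiv ℝ f)) z x v u
        + (fderiv ℝ Γ' (f z) (fderiv ℝ f z x) (fderiv ℝ f z v) (fderiv ℝ f z u)
          + Γ' (f z) (fderiv ℝ (fderiv ℝ f) z x v) (fderiv ℝ f z u)
          + Γ' (f z) (fderiv ℝ f z v) (fderiv ℝ (fderiv ℝ f) z x u))
        - (fderiv ℝ (fderiv ℝ f) z x (Γ z v u) + fderiv ℝ f z (fderiv ℝ Γ z x v u)) := by
    intro x v u
    have e1 : fderiv ℝ (flatHess Γ Γ' f) z x v u
        = fderiv ℝ (fun y => flatHess Γ Γ' f y v u) z x := by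
      rw [fderiv_apply_const (A := fun y => flatHess Γ Γ' f y v) (by fun_prop),
        fderiv_apply_const hb]
    rw [e1]
    simp only [flatHess_apply]
    have d1 : DifferentiableAt ℝ (fun y => Γ' (f y) (fderiv ℝ f y v) (fderiv ℝ f y u)) z :=
      (hΓ'.clm_apply (by fun_prop)).clm_apply (by fun_prop)
    rw [fderiv_fun_sub ((by fun_prop : DifferentiableAt ℝ _ z).fun_add d1) (by fun_prop),
      fderiv_fun_add (by fun_prop) d1, sub_apply, add_apply,
      fderiv_apply₂_fun (A := fun y => Γ' (f y)) hΓ' (by fun_prop) (by fun_prop),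
      h.fderiv_Γ' hz, fderiv_apply_fun (A := fun y => fderiv ℝ f y) (a := fun y => Γ y v u)
        (by fun_prop) (by fun_prop),
      fderiv_apply_const (A := fun y => Γ y v) (by fun_prop), fderiv_apply_const hΓ,
      fderiv_apply_const hf', fderiv_apply_const hf',
      fderiv_apply_const (A := fun y => fderiv ℝ (fderiv ℝ f) y v) (by fun_prop),
      fderiv_apply_const hf'']
  have s3 : fderiv ℝ (fderiv ℝ (fderiv ℝ f)) z w v u = fderiv ℝ (fderiv ℝ (fderiv ℝ f)) z v w u := by
    rw [fderiv_fderiv_symm (h.smoothAt hz).fderiv_smooth w v]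
  have s2 := fderiv_fderiv_symm (h.smoothAt hz)
  simp only [tensorDeriv, key, s3, s2 v w]
  simp only [flatHess_apply, flatCurv, map_add, map_sub, sub_apply]
  rw [s2 v (Γ z w u), s2 w (Γ z v u)]
  abel

end LocalMap

end LocalMaps

/-! ### The three one-forms of the Bochner arguments -/

section LocalBochner

variable {E : Type*} [NormedAddCommGroup E] [NormedSpace ℝ E] [FiniteDimensional ℝ E]
  {F : Type*} [NormedAddCommGroup F] [NormedSpace ℝ F]

/-- The one-form `v ↦ ⟨∇_v φ₀, φ₀⟩ - δ θ(v) ⟨∇_T φ₀, φ₀⟩` with `φ₀ = dφ(T)`. -/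
noncomputable def reebForm (G : E → E →L[ℝ] E →L[ℝ] ℝ) (Γ : E → E →L[ℝ] E →L[ℝ] E) (T : E → E)
    (H : F → F →L[ℝ] F →L[ℝ] ℝ) (Γ' : F → F →L[ℝ] F →L[ℝ] F) (f : E → F) (δ : ℝ) (z : E) :
    E →L[ℝ] ℝ :=
  ((H (f z)).flip (fderiv ℝ f z (T z))).comp ((flatHess Γ Γ' f z).flip (T z))
    - (δ * H (f z) (flatHess Γ Γ' f z (T z) (T z)) (fderiv ℝ f z (T z))) • G z (T z)

/-- The one-form `v ↦ ⟨dφ(J v), φ₀⟩`. -/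
noncomputable def twistForm (J : E → E →L[ℝ] E) (T : E → E)
    (H : F → F →L[ℝ] F →L[ℝ] ℝ) (f : E → F) (z : E) : E →L[ℝ] ℝ :=
  ((H (f z)).flip (fderiv ℝ f z (T z))).comp ((fderiv ℝ f z).comp (J z))

/-- `σ(u, v) = β(u, v) + β(J u, J v)`. -/
noncomputable def flatSigma (Γ : E → E →L[ℝ] E →L[ℝ] E) (J : E → E →L[ℝ] E)
    (Γ' : F → F →L[ℝ] F →L[ℝ] F) (f : E → F) (z : E) : E →L[ℝ] E →L[ℝ] F :=
  flatHess Γ Γ' f z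
    + ((ContinuousLinearMap.compL ℝ E E F).flip (J z)).comp ((flatHess Γ Γ' f z).comp (J z))

theorem flatSigma_apply (Γ : E → E →L[ℝ] E →L[ℝ] E) (J : E → E →L[ℝ] E)
    (Γ' : F → F →L[ℝ] F →L[ℝ] F) (f : E → F) (z u v : E) :
    flatSigma Γ J Γ' f z u v
      = flatHess Γ Γ' f z u v + flatHess Γ Γ' f z (J z u) (J z v) := by
  simp [flatSigma]

/-- The tensor `(u, v) ↦ (w ↦ ⟨σ(u, w), dφ(v)⟩)`. -/
noncomputable def siuTensor (Γ : E → E →L[ℝ] E →L[ℝ] E) (J : E → E →L[ℝ] E)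
    (H : F → F →L[ℝ] F →L[ℝ] ℝ) (Γ' : F → F →L[ℝ] F →L[ℝ] F) (f : E → F) (z : E) :
    E →L[ℝ] E →L[ℝ] (E →L[ℝ] ℝ) :=
  ((ContinuousLinearMap.compL ℝ E (F →L[ℝ] ℝ) (E →L[ℝ] ℝ)).flip
    ((H (f z)).flip.comp (fderiv ℝ f z))).comp
      ((ContinuousLinearMap.compL ℝ E F ℝ).flip.comp (flatSigma Γ J Γ' f z))

theorem siuTensor_apply (Γ : E → E →L[ℝ] E →L[ℝ] E) (J : E → E →L[ℝ] E)
    (H : F → F →L[ℝ] F →L[ℝ] ℝ) (Γ' : F → F →L[ℝ] F →L[ℝ] F) (f : E → F) (z u v w : E) :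
    siuTensor Γ J H Γ' f z u v w = H (f z) (flatSigma Γ J Γ' f z u w) (fderiv ℝ f z v) := by
  simp [siuTensor]

/-- The one-form `w ↦ ∑ ⟨σ(e_A, w), dφ(e_A)⟩`. -/
noncomputable def siuForm (G : E → E →L[ℝ] E →L[ℝ] ℝ) (Γ : E → E →L[ℝ] E →L[ℝ] E)
    (J : E → E →L[ℝ] E) (H : F → F →L[ℝ] F →L[ℝ] ℝ) (Γ' : F → F →L[ℝ] F →L[ℝ] F) (f : E → F)
    (z : E) : E →L[ℝ] ℝ :=
  gtrace (sharp (G z)) (siuTensor Γ J H Γ' f z)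

variable {U : Set E} {G : E → E →L[ℝ] E →L[ℝ] ℝ} {Γ : E → E →L[ℝ] E →L[ℝ] E}
  {J : E → E →L[ℝ] E} {T : E → E}
  {V : Set F} {H : F → F →L[ℝ] F →L[ℝ] ℝ} {Γ' : F → F →L[ℝ] F →L[ℝ] F} {f : E → F}

theorem reebForm_apply (δ : ℝ) (z u : E) : reebForm G Γ T H Γ' f δ z u
    = H (f z) (flatHess Γ Γ' f z u (T z)) (fderiv ℝ f z (T z))
      - δ * H (f z) (flatHess Γ Γ' f z (T z) (T z)) (fderiv ℝ f z (T z)) * G z (T z) u := by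
  simp [reebForm]

theorem twistForm_apply (z u : E) : twistForm J T H f z u
    = H (f z) (fderiv ℝ f z (J z u)) (fderiv ℝ f z (T z)) := by
  simp [twistForm]

variable (h : SasakiLocal U G Γ J T) (m : LocalMap U G Γ V H Γ' f) {z : E} (hz : z ∈ U)
include h m hz

theorem smooth_reebForm (δ : ℝ) : ContDiffAt ℝ ∞ (reebForm G Γ T H Γ' f δ) z := by
  have h1 := m.smooth_hess hz
  have h2 := m.smooth_H hz
  have h3 := (m.smoothAt hz).fderiv_smooth
  have h4 : ContDiffAt ℝ ∞ T z := h.smooth_T.contDiffAt_of_isOpen h.isOpen hz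
  have h5 := h.contDiffAt_G hz
  have h6 := h3.clm_apply h4
  unfold reebForm
  exact (((((ContinuousLinearMap.flipₗᵢ ℝ F F ℝ).toContinuousLinearEquiv.contDiff.contDiffAt.comp
    z h2).clm_apply h6).clm_comp
    (((ContinuousLinearMap.flipₗᵢ ℝ E E F).toContinuousLinearEquiv.contDiff.contDiffAt.comp
    z h1).clm_apply h4))).sub
    ((contDiffAt_const.mul ((h2.clm_apply ((h1.clm_apply h4).clm_apply h4)).clm_apply h6)).smul
      (h5.clm_apply h4))

theorem smooth_twistForm : ContDiffAt ℝ ∞ (twistForm J T H f) z := by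
  have h2 := m.smooth_H hz
  have h3 := (m.smoothAt hz).fderiv_smooth
  have h4 : ContDiffAt ℝ ∞ T z := h.smooth_T.contDiffAt_of_isOpen h.isOpen hz
  have h5 : ContDiffAt ℝ ∞ J z := h.smooth_J.contDiffAt_of_isOpen h.isOpen hz
  unfold twistForm
  exact (((ContinuousLinearMap.flipₗᵢ ℝ F F ℝ).toContinuousLinearEquiv.contDiff.contDiffAt.comp
    z h2).clm_apply (h3.clm_apply h4)).clm_comp (h3.clm_comp h5)

theorem smooth_flatSigma : ContDiffAt ℝ ∞ (flatSigma Γ J Γ' f) z := by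
  have h1 := m.smooth_hess hz
  have h5 : ContDiffAt ℝ ∞ J z := h.smooth_J.contDiffAt_of_isOpen h.isOpen hz
  unfold flatSigma
  exact h1.add ((contDiffAt_const.clm_apply h5).clm_comp (h1.clm_comp h5))

theorem smooth_siuTensor : ContDiffAt ℝ ∞ (siuTensor Γ J H Γ' f) z := by
  have h2 := m.smooth_H hz
  have h3 := (m.smoothAt hz).fderiv_smooth
  have h1 := smooth_flatSigma h m hz
  unfold siuTensor
  exact (contDiffAt_const.clm_apply
    (((ContinuousLinearMap.flipₗᵢ ℝ F F ℝ).toContinuousLinearEquiv.contDiff.contDiffAt.comp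
    z h2).clm_comp h3)).clm_comp (contDiffAt_const.clm_comp h1)

theorem smooth_siuForm : ContDiffAt ℝ ∞ (siuForm G Γ J H Γ' f) z := by
  have h1 := smooth_siuTensor h m hz
  have h2 := sharp_contDiffAt (h.contDiffAt_G hz) (h.pos z hz)
  unfold siuForm gtrace
  exact ContDiffAt.sum fun i _ =>
    (h1.clm_apply contDiffAt_const).clm_apply (h2.clm_apply contDiffAt_const)

/-- The derivative of φ₀ = dφ(T) is β with T inserted, because T is parallel. -/
theorem fderiv_comp_T (w : E) : alongDeriv Γ' f (fun y => fderiv ℝ f y (T y)) z w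
    = flatHess Γ Γ' f z w (T z) := by
  rw [m.alongDeriv_fderiv hz (h.diff_T hz), h.parallel_T z hz]
  simp

/-- The torsion of the source is a multiple of T, so the antisymmetric part of β is a multiple of
φ₀. This is what makes the divergence of `twistForm` see |φ₀|². -/
theorem hess_swap (v u : E) : flatHess Γ Γ' f z v u
    = flatHess Γ Γ' f z u v + G z v (J z u) • fderiv ℝ f z (T z) := by
  have := m.hess_antisymm hz v u
  rw [h.torsion z hz] at this
  rw [← sub_eq_iff_eq_add', this]
  simp

/-- β(u, T) = β(T, u) on all of U because J T = 0. Differentiating this identity with T parallel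
keeps the symmetry. -/
theorem tensorDeriv_swap_T (w u : E) : tensorDeriv Γ Γ' f (flatHess Γ Γ' f) z w u (T z)
    = tensorDeriv Γ Γ' f (flatHess Γ Γ' f) z w (T z) u := by
  have hT := h.diff_T hz
  have hb := m.diff_hess hz
  have e1 := alongDeriv_tensor (Γ := Γ) (Γ' := Γ') (f := f) hb (differentiableAt_const u) hT w
  have e2 := alongDeriv_tensor (Γ := Γ) (Γ' := Γ') (f := f) hb hT (differentiableAt_const u) w
  have e3 : (fun y => flatHess Γ Γ' f y u (T y)) =ᶠ[nhds z] fun y => flatHess Γ Γ' f y (T y) u := by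
    filter_upwards [h.isOpen.mem_nhds hz] with y hy
    rw [hess_swap h m hy, h.J_T y hy]
    simp
  have e4 : alongDeriv Γ' f (fun y => flatHess Γ Γ' f y u (T y)) z w
      = alongDeriv Γ' f (fun y => flatHess Γ Γ' f y (T y) u) z w := by
    unfold alongDeriv
    rw [e3.fderiv_eq, e3.self_of_nhds]
  rw [e1, e2, h.parallel_T z hz] at e4
  simp only [fderiv_fun_const, Pi.zero_apply, zero_apply, zero_add, map_zero, add_zero] at e4
  have e5 := hess_swap h m hz (Γ z w u) (T z)
  rw [h.J_T z hz] at e5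
  simp only [map_zero, zero_smul, add_zero] at e5
  rw [e5] at e4
  exact add_right_cancel e4

theorem formDeriv_reebForm (δ : ℝ) (w u : E) :
    formDeriv Γ (reebForm G Γ T H Γ' f δ) z w u
      = H (f z) (tensorDeriv Γ Γ' f (flatHess Γ Γ' f) z w u (T z)) (fderiv ℝ f z (T z))
        + H (f z) (flatHess Γ Γ' f z u (T z)) (flatHess Γ Γ' f z w (T z))
        - δ * (H (f z) (tensorDeriv Γ Γ' f (flatHess Γ Γ' f) z w (T z) (T z)) (fderiv ℝ f z (T z))
          + H (f z) (flatHess Γ Γ' f z (T z) (T z)) (flatHess Γ Γ' f z w (T z))) * G z (T z) u := by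
  have hT := h.diff_T hz
  have hb := m.diff_hess hz
  have hf' := m.diff' hz
  have hG := h.diff_G hz
  have hH := m.diff_H hz
  have hr := (smooth_reebForm h m hz δ).differentiableAt_of_smooth
  have hs1 : DifferentiableAt ℝ (fun y => fderiv ℝ f y (T y)) z := by fun_prop
  have hs2 : DifferentiableAt ℝ (fun y => flatHess Γ Γ' f y (T y) (T y)) z := by fun_prop
  have hs3 : DifferentiableAt ℝ (fun y => flatHess Γ Γ' f y u (T y)) z := by fun_prop
  have d1 : DifferentiableAt ℝ (fun y => H (f y) (flatHess Γ Γ' f y u (T y))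
      (fderiv ℝ f y (T y))) z := (hH.clm_apply hs3).clm_apply hs1
  have d2 : DifferentiableAt ℝ (fun y => H (f y) (flatHess Γ Γ' f y (T y) (T y))
      (fderiv ℝ f y (T y))) z := (hH.clm_apply hs2).clm_apply hs1
  have d3 : DifferentiableAt ℝ (fun y => G y (T y) u) z := by fun_prop
  rw [formDeriv_apply, ← fderiv_apply_const hr]
  simp only [reebForm_apply]
  rw [fderiv_fun_sub d1 ((d2.const_mul δ).fun_mul d3), fderiv_fun_mul (d2.const_mul δ) d3,
    fderiv_const_mul d2, sub_apply, add_apply, smul_apply, smul_apply, smul_apply,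
    m.fderiv_pair hz hs3 hs1, m.fderiv_pair hz hs2 hs1, h.fderiv_pair hz hT (by fun_prop),
    fderiv_comp_T h m hz,
    alongDeriv_tensor (Γ := Γ) hb (differentiableAt_const u) hT,
    alongDeriv_tensor (Γ := Γ) hb hT hT, h.parallel_T z hz]
  simp only [fderiv_fun_const, Pi.zero_apply, zero_apply, zero_add, map_zero, add_zero, map_add,
    add_apply, smul_eq_mul]
  ring

theorem formDeriv_twistForm (w u : E) :
    formDeriv Γ (twistForm J T H f) z w u
      = H (f z) (flatHess Γ Γ' f z w (J z u)) (fderiv ℝ f z (T z))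
        + H (f z) (fderiv ℝ f z (J z u)) (flatHess Γ Γ' f z w (T z)) := by
  have hT := h.diff_T hz
  have hJ := h.diff_J hz
  have hf' := m.diff' hz
  have hr := (smooth_twistForm h m hz).differentiableAt_of_smooth
  rw [formDeriv_apply, ← fderiv_apply_const hr]
  simp only [twistForm_apply]
  rw [m.fderiv_pair hz (by fun_prop) (by fun_prop), fderiv_comp_T h m hz,
    m.alongDeriv_fderiv hz (a := fun y => J y u) (by fun_prop), fderiv_apply_const hJ,
    h.fderiv_J hz]
  simp only [sub_add_cancel, map_add, add_apply]
  ring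

end LocalBochner

/-! ### Divergences of the one-forms -/

section LocalDivergences

variable {E : Type*} [NormedAddCommGroup E] [NormedSpace ℝ E] [FiniteDimensional ℝ E]
  {F : Type*} [NormedAddCommGroup F] [NormedSpace ℝ F]
variable {U : Set E} {G : E → E →L[ℝ] E →L[ℝ] ℝ} {Γ : E → E →L[ℝ] E →L[ℝ] E}
  {J : E → E →L[ℝ] E} {T : E → E}
  {V : Set F} {H : F → F →L[ℝ] F →L[ℝ] ℝ} {Γ' : F → F →L[ℝ] F →L[ℝ] F} {f : E → F}

variable (h : SasakiLocal U G Γ J T) (m : LocalMap U G Γ V H Γ' f) {z : E} (hz : z ∈ U)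
variable {ι : Type*} [Fintype ι] [DecidableEq ι] {e : ι → E}
  (he : IsOrthoBasis (fun u v => G z u v) e)

include h hz he in
theorem sum_G_T (X : E →L[ℝ] ℝ) : ∑ A, X (e A) * G z (T z) (e A) = X (T z) := by
  conv_rhs => rw [he.complete (T z)]
  simp [mul_comm]

include h m hz

/-- The Ricci identity for the directions u and T. Both R(u, T) and the torsion of (u, T) vanish on
M, so only the curvature of the target remains. -/
theorem tensorDeriv_hess_T (u : E) :
    tensorDeriv Γ Γ' f (flatHess Γ Γ' f) z u u (T z)
      = tensorDeriv Γ Γ' f (flatHess Γ Γ' f) z (T z) u u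
        + flatCurv Γ' (f z) (fderiv ℝ f z u) (fderiv ℝ f z (T z)) (fderiv ℝ f z u) := by
  have := m.ricci_identity hz u (T z) u
  rw [h.curv_T_mid hz, h.torsion z hz, h.J_T z hz] at this
  rw [tensorDeriv_swap_T h m hz, ← sub_eq_iff_eq_add', this]
  simp

include he

/-- Covariant differentiation of tr β = δ β(T, T): the trace commutes with ∇, and T is parallel. -/
theorem sum_tensorDeriv_hess (δ : ℝ)
    (hτ : ∀ y ∈ U, gtrace (sharp (G y)) (flatHess Γ Γ' f y)
      = δ • flatHess Γ Γ' f y (T y) (T y)) (w : E) :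
    ∑ A, tensorDeriv Γ Γ' f (flatHess Γ Γ' f) z w (e A) (e A)
      = δ • tensorDeriv Γ Γ' f (flatHess Γ Γ' f) z w (T z) (T z) := by
  have hT := h.diff_T hz
  have hb := m.diff_hess hz
  have e1 := h.fderiv_gtrace hz hb w he
  have e2 : (fun y => gtrace (sharp (G y)) (flatHess Γ Γ' f y))
      =ᶠ[nhds z] fun y => δ • flatHess Γ Γ' f y (T y) (T y) := by
    filter_upwards [h.isOpen.mem_nhds hz] with y hy using hτ y hy
  have e3 := h.gtrace_eq hz he (flatHess Γ Γ' f z)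
  have e4 := alongDeriv_tensor (Γ := Γ) (Γ' := Γ') (f := f) hb hT hT w
  rw [h.parallel_T z hz] at e4
  simp only [map_zero, add_zero, zero_apply] at e4
  rw [e2.fderiv_eq, fderiv_fun_const_smul (by fun_prop), smul_apply] at e1
  rw [← e4, alongDeriv, smul_add, e1, ← map_smul, ← hτ z hz, e3, map_sum, ← Finset.sum_add_distrib]
  apply Finset.sum_congr rfl
  intro A _
  rw [tensorDeriv]
  abel

/-- Divergence of `reebForm`. -/
theorem div_reebForm (δ : ℝ)
    (hτ : ∀ y ∈ U, gtrace (sharp (G y)) (flatHess Γ Γ' f y)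
      = δ • flatHess Γ Γ' f y (T y) (T y)) :
    gtrace (sharp (G z)) (formDeriv Γ (reebForm G Γ T H Γ' f δ) z)
      = ∑ A, H (f z) (flatCurv Γ' (f z) (fderiv ℝ f z (e A)) (fderiv ℝ f z (T z))
          (fderiv ℝ f z (e A))) (fderiv ℝ f z (T z))
        + ∑ A, H (f z) (flatHess Γ Γ' f z (e A) (T z)) (flatHess Γ Γ' f z (e A) (T z))
        - δ * H (f z) (flatHess Γ Γ' f z (T z) (T z)) (flatHess Γ Γ' f z (T z) (T z)) := by
  rw [h.gtrace_eq hz he]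
  simp only [formDeriv_reebForm h m hz]
  rw [Finset.sum_sub_distrib, Finset.sum_add_distrib]
  -- A linear form in the direction e_A, summed against G(T, e_A), is evaluated at T by `sum_G_T`.
  -- The explicit X exhibits this linearity.
  have k1 : ∑ A, δ * (H (f z) (tensorDeriv Γ Γ' f (flatHess Γ Γ' f) z (e A) (T z) (T z))
        (fderiv ℝ f z (T z))
      + H (f z) (flatHess Γ Γ' f z (T z) (T z)) (flatHess Γ Γ' f z (e A) (T z))) * G z (T z) (e A)
      = δ * (H (f z) (tensorDeriv Γ Γ' f (flatHess Γ Γ' f) z (T z) (T z) (T z))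
        (fderiv ℝ f z (T z))
      + H (f z) (flatHess Γ Γ' f z (T z) (T z)) (flatHess Γ Γ' f z (T z) (T z))) := by
    let X : E →L[ℝ] ℝ := δ • (((H (f z)).flip (fderiv ℝ f z (T z))).comp
        (((fderiv ℝ (flatHess Γ Γ' f) z).flip (T z)).flip (T z)
          + ((Γ' (f z)).flip (flatHess Γ Γ' f z (T z) (T z))).comp (fderiv ℝ f z)
          - ((flatHess Γ Γ' f z).flip (T z)).comp ((Γ z).flip (T z))
          - (flatHess Γ Γ' f z (T z)).comp ((Γ z).flip (T z)))
        + (H (f z) (flatHess Γ Γ' f z (T z) (T z))).comp ((flatHess Γ Γ' f z).flip (T z)))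
    exact sum_G_T h hz he X
  rw [k1]
  simp only [fun A => tensorDeriv_hess_T h m hz (e A), map_add, add_apply, Finset.sum_add_distrib]
  -- After the Ricci identity, the second-order term is the trace of ∇_T β, namely δ (∇_T β)(T, T).
  -- It cancels the same term in k1; the δ-correction in `reebForm` is there for this.
  have k2 : ∑ A, H (f z) (tensorDeriv Γ Γ' f (flatHess Γ Γ' f) z (T z) (e A) (e A))
      (fderiv ℝ f z (T z)) = δ * H (f z) (tensorDeriv Γ Γ' f (flatHess Γ Γ' f) z (T z) (T z) (T z))
        (fderiv ℝ f z (T z)) := by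
    rw [← smul_eq_mul, ← smul_apply, ← map_smul,
      ← sum_tensorDeriv_hess h m hz he δ hτ (T z), map_sum, sum_apply]
  rw [k2]
  ring

/-- Divergence of `twistForm` when `∇φ₀` vanishes on the Levi distribution. -/
theorem div_twistForm
    (hν : ∀ u, G z (T z) u = 0 → flatHess Γ Γ' f z u (T z) = 0) :
    gtrace (sharp (G z)) (formDeriv Γ (twistForm J T H f) z)
      = -(1 / 2) * ((∑ A, G z (J z (e A)) (J z (e A)))
          * H (f z) (fderiv ℝ f z (T z)) (fderiv ℝ f z (T z))) := by
  rw [h.gtrace_eq hz he]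
  simp only [formDeriv_twistForm h m hz]
  rw [Finset.sum_add_distrib]
  -- Moving J across the trace puts it inside ∇φ₀, which vanishes on the horizontal vectors J e_A.
  have k1 : ∑ A, H (f z) (fderiv ℝ f z (J z (e A))) (flatHess Γ Γ' f z (e A) (T z)) = 0 := by
    have := IsOrthoBasis.sum_skew (g := toBilin (G z)) he (h.symm z hz) (J z : E →ₗ[ℝ] E)
      (h.skew_J z hz) (toBilin (((ContinuousLinearMap.compL ℝ E F ℝ).flip
        ((flatHess Γ Γ' f z).flip (T z))).comp ((H (f z)).comp (fderiv ℝ f z))))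
    simp only [toBilin_apply, ContinuousLinearMap.comp_apply, ContinuousLinearMap.flip_apply,
      ContinuousLinearMap.compL_apply, ContinuousLinearMap.coe_coe,
      hν _ (h.G_T_J hz _), map_zero, Finset.sum_const_zero, neg_zero] at this
    exact this
  -- The traces of β(J e_A, e_A) and of β(e_A, J e_A) are opposite by skewness, and by `hess_swap`
  -- they differ by ∑ |J e_A|² φ₀. Each is therefore half of that, up to sign.
  have k2 := IsOrthoBasis.sum_skew (g := toBilin (G z)) he (h.symm z hz) (J z : E →ₗ[ℝ] E)
      (h.skew_J z hz) (toBilin ((ContinuousLinearMap.compL ℝ E F ℝ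
        ((H (f z)).flip (fderiv ℝ f z (T z)))).comp (flatHess Γ Γ' f z)))
  simp only [toBilin_apply, ContinuousLinearMap.comp_apply, ContinuousLinearMap.flip_apply,
    ContinuousLinearMap.compL_apply, ContinuousLinearMap.coe_coe] at k2
  have k3 : ∀ A, flatHess Γ Γ' f z (J z (e A)) (e A) = flatHess Γ Γ' f z (e A) (J z (e A))
      + G z (J z (e A)) (J z (e A)) • fderiv ℝ f z (T z) :=
    fun A => hess_swap h m hz _ _
  simp only [k3, map_add, add_apply, map_smul, smul_apply, smul_eq_mul, Finset.sum_add_distrib,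
    ← Finset.sum_mul] at k2
  rw [k1]
  linarith

/-- G and J are parallel, so the derivative falls only on the two factors β and dφ. -/
theorem fderiv_siuForm (w x : E) :
    formDeriv Γ (siuForm G Γ J H Γ' f) z w x
      = ∑ A, (H (f z) (tensorDeriv Γ Γ' f (flatHess Γ Γ' f) z w (e A) x
            + tensorDeriv Γ Γ' f (flatHess Γ Γ' f) z w (J z (e A)) (J z x)) (fderiv ℝ f z (e A))
          + H (f z) (flatSigma Γ J Γ' f z (e A) x) (flatHess Γ Γ' f z w (e A))) := by
  have hJ := h.diff_J hz
  have hb := m.diff_hess hz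
  have hf' := m.diff' hz
  have hC := (smooth_siuTensor h m hz).differentiableAt_of_smooth
  have hσ := (smooth_flatSigma h m hz).differentiableAt_of_smooth
  have e1 := congrArg (fun l : E →L[ℝ] ℝ => l x) (h.fderiv_gtrace hz hC w he)
  have e2 := congrArg (fun l : E →L[ℝ] ℝ => l (Γ z w x)) (h.gtrace_eq hz he (siuTensor Γ J H Γ' f z))
  simp only [sum_apply, sub_apply] at e1 e2
  rw [formDeriv_apply]
  unfold siuForm
  rw [e1, e2, ← Finset.sum_sub_distrib]
  apply Finset.sum_congr rfl
  intro A _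
  have e3 : fderiv ℝ (siuTensor Γ J H Γ' f) z w (e A) (e A) x
      = fderiv ℝ (fun y => H (f y) (flatHess Γ Γ' f y (e A) x
        + flatHess Γ Γ' f y (J y (e A)) (J y x)) (fderiv ℝ f y (e A))) z w := by
    rw [← fderiv_apply_const hC, ← fderiv_apply_const (A := fun y => siuTensor Γ J H Γ' f y (e A))
      (by fun_prop), ← fderiv_apply_const (A := fun y => siuTensor Γ J H Γ' f y (e A) (e A))
      (by fun_prop)]
    simp only [siuTensor_apply, flatSigma_apply]
  have e4 : alongDeriv Γ' f (fun y => flatHess Γ Γ' f y (e A) x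
        + flatHess Γ Γ' f y (J y (e A)) (J y x)) z w
      = alongDeriv Γ' f (fun y => flatHess Γ Γ' f y (e A) x) z w
        + alongDeriv Γ' f (fun y => flatHess Γ Γ' f y (J y (e A)) (J y x)) z w := by
    unfold alongDeriv
    rw [fderiv_fun_add (by fun_prop) (by fun_prop), add_apply, map_add]
    abel
  rw [e3, m.fderiv_pair hz (by fun_prop) (by fun_prop), e4,
    alongDeriv_tensor (Γ := Γ) hb (differentiableAt_const _) (differentiableAt_const _),
    alongDeriv_tensor (Γ := Γ) hb (a := fun y => J y (e A)) (b := fun y => J y x)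
      (by fun_prop) (by fun_prop),
    m.alongDeriv_fderiv hz (differentiableAt_const _), fderiv_apply_const hJ, fderiv_apply_const hJ,
    h.fderiv_J hz, h.fderiv_J hz]
  simp only [siuTensor_apply, flatSigma_apply, fderiv_fun_const, Pi.zero_apply, zero_apply,
    zero_add, sub_add_cancel, map_add, add_apply]
  ring

end LocalDivergences

/-! ### Siu's formula for maps with dφ(T) = 0 -/

section LocalSiu

variable {E : Type*} [NormedAddCommGroup E] [NormedSpace ℝ E] [FiniteDimensional ℝ E]
  {F : Type*} [NormedAddCommGroup F] [NormedSpace ℝ F]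
variable {U : Set E} {G : E → E →L[ℝ] E →L[ℝ] ℝ} {Γ : E → E →L[ℝ] E →L[ℝ] E}
  {J : E → E →L[ℝ] E} {T : E → E}
  {V : Set F} {H : F → F →L[ℝ] F →L[ℝ] ℝ} {Γ' : F → F →L[ℝ] F →L[ℝ] F} {f : E → F}

variable (h : SasakiLocal U G Γ J T) (m : LocalMap U G Γ V H Γ' f)
  (h0 : ∀ y ∈ U, fderiv ℝ f y (T y) = 0) {z : E} (hz : z ∈ U)
variable {ι : Type*} [Fintype ι] [DecidableEq ι] {e : ι → E}
  (he : IsOrthoBasis (fun u v => G z u v) e)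

include h m h0 hz

theorem hess_right_T (u : E) : flatHess Γ Γ' f z u (T z) = 0 := by
  rw [← fderiv_comp_T h m hz]
  have e : (fun y => fderiv ℝ f y (T y)) =ᶠ[nhds z] fun _ => 0 := by
    filter_upwards [h.isOpen.mem_nhds hz] with y hy using h0 y hy
  rw [alongDeriv, e.fderiv_eq, h0 z hz]
  simp

theorem hess_symm (u v : E) : flatHess Γ Γ' f z u v = flatHess Γ Γ' f z v u := by
  rw [hess_swap h m hz u v, h0 z hz, smul_zero, add_zero]

theorem hess_left_T (u : E) : flatHess Γ Γ' f z (T z) u = 0 := by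
  rw [hess_symm h m h0 hz, hess_right_T h m h0 hz]

/-- J² is minus the identity up to multiples of T, and β now annihilates T in both slots. -/
theorem sigma_J_J (u v : E) : flatSigma Γ J Γ' f z (J z u) (J z v) = flatSigma Γ J Γ' f z u v := by
  rw [flatSigma_apply, flatSigma_apply, h.J_J z hz, h.J_J z hz]
  simp only [map_add, map_neg, map_smul, add_apply, neg_apply, smul_apply,
    hess_right_T h m h0 hz, hess_left_T h m h0 hz]
  simp [add_comm]

/-- The torsion of M takes values in multiples of T, which β annihilates, so the Ricci identity has
no torsion term left. -/
theorem hess_ricci (w v u : E) :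
    tensorDeriv Γ Γ' f (flatHess Γ Γ' f) z w v u
      = tensorDeriv Γ Γ' f (flatHess Γ Γ' f) z v w u
      + flatCurv Γ' (f z) (fderiv ℝ f z w) (fderiv ℝ f z v) (fderiv ℝ f z u)
        - fderiv ℝ f z (flatCurv Γ z w v u) := by
  have := m.ricci_identity hz w v u
  rw [h.torsion z hz, map_smul, smul_apply, hess_left_T h m h0 hz, smul_zero, sub_zero] at this
  rw [add_sub_assoc, ← this]
  abel

theorem tensorDeriv_hess_symm (w v u : E) :
    tensorDeriv Γ Γ' f (flatHess Γ Γ' f) z w v u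
      = tensorDeriv Γ Γ' f (flatHess Γ Γ' f) z w u v := by
  have hb := m.diff_hess hz
  have e1 : (fun y => flatHess Γ Γ' f y v u) =ᶠ[nhds z] fun y => flatHess Γ Γ' f y u v := by
    filter_upwards [h.isOpen.mem_nhds hz] with y hy using hess_symm h m h0 hy v u
  have e2 := congrArg (fun l : E →L[ℝ] F => l w) e1.fderiv_eq
  simp only [fderiv_apply_const (A := fun y => flatHess Γ Γ' f y v)
      (show DifferentiableAt ℝ _ z by fun_prop),
    fderiv_apply_const (A := fun y => flatHess Γ Γ' f y u)
      (show DifferentiableAt ℝ _ z by fun_prop), fderiv_apply_const hb] at e2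
  simp only [tensorDeriv, e2, hess_symm h m h0 hz v u, hess_symm h m h0 hz v (Γ z w u),
    hess_symm h m h0 hz (Γ z w v) u]
  abel

include he

omit m h0 in
theorem sum_pair_J_J {P Q : E →L[ℝ] F} {y : F} (hQ : Q (T z) = 0) :
    ∑ A, H y (P (J z (e A))) (Q (J z (e A))) = ∑ A, H y (P (e A)) (Q (e A)) := by
  have := h.sum_J_J hz he (toBilin (((ContinuousLinearMap.compL ℝ E F ℝ).flip Q).comp
    ((H y).comp P))) (by simp [hQ])
  simpa using this

/-- ∇_w β is symmetric and J is skew, so the trace is its own negative. -/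
theorem sum_tensorDeriv_hess_J (w : E) :
    ∑ B, tensorDeriv Γ Γ' f (flatHess Γ Γ' f) z w (e B) (J z (e B)) = 0 := by
  have k := IsOrthoBasis.sum_skew (g := toBilin (G z)) he (h.symm z hz) (J z : E →ₗ[ℝ] E)
    (h.skew_J z hz) (toBilin (fderiv ℝ (flatHess Γ Γ' f) z w
      + (ContinuousLinearMap.compL ℝ E F F (Γ' (f z) (fderiv ℝ f z w))).comp (flatHess Γ Γ' f z)
      - (flatHess Γ Γ' f z).comp (Γ z w)
      - ((ContinuousLinearMap.compL ℝ E E F).flip (Γ z w)).comp (flatHess Γ Γ' f z)))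
  have e1 : ∀ u v, toBilin (fderiv ℝ (flatHess Γ Γ' f) z w
      + (ContinuousLinearMap.compL ℝ E F F (Γ' (f z) (fderiv ℝ f z w))).comp (flatHess Γ Γ' f z)
      - (flatHess Γ Γ' f z).comp (Γ z w)
      - ((ContinuousLinearMap.compL ℝ E E F).flip (Γ z w)).comp (flatHess Γ Γ' f z)) u v
      = tensorDeriv Γ Γ' f (flatHess Γ Γ' f) z w u v := fun u v => by
    simp [tensorDeriv]
  simp only [e1, ContinuousLinearMap.coe_coe,
    fun u v => tensorDeriv_hess_symm h m h0 hz w (J z u) v] at k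
  have k2 : (2 : ℝ) • ∑ B, tensorDeriv Γ Γ' f (flatHess Γ Γ' f) z w (e B) (J z (e B)) = 0 := by
    rw [two_smul]
    nth_rewrite 1 [k]
    simp
  exact (smul_eq_zero.1 k2).resolve_left two_ne_zero

/-- Divergence of `siuForm` for maps with `dφ(T) = 0`. -/
theorem div_siuForm
    (hτ : ∀ y ∈ U, gtrace (sharp (G y)) (flatHess Γ Γ' f y) = 0) :
    gtrace (sharp (G z)) (formDeriv Γ (siuForm G Γ J H Γ' f) z)
      = (1 / 2) * ∑ B, ∑ A, H (f z) (flatSigma Γ J Γ' f z (e A) (e B))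
          (flatSigma Γ J Γ' f z (e A) (e B))
        + ∑ A, ∑ B, H (f z) (flatCurv Γ' (f z) (fderiv ℝ f z (e B)) (fderiv ℝ f z (e A))
            (fderiv ℝ f z (e B))
          + flatCurv Γ' (f z) (fderiv ℝ f z (e B)) (fderiv ℝ f z (J z (e A)))
            (fderiv ℝ f z (J z (e B)))) (fderiv ℝ f z (e A)) := by
  rw [h.gtrace_eq hz he]
  simp only [fderiv_siuForm h m hz he, Finset.sum_add_distrib]
  -- σ is J-invariant, so β(J, J) has the same inner product with σ as β does. Thus ⟨σ, β⟩ is half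
  -- of |σ|².
  have hsq : ∑ B, ∑ A, H (f z) (flatSigma Γ J Γ' f z (e A) (e B)) (flatHess Γ Γ' f z (e B) (e A))
      = (1 / 2) * ∑ B, ∑ A, H (f z) (flatSigma Γ J Γ' f z (e A) (e B))
          (flatSigma Γ J Γ' f z (e A) (e B)) := by
    have k1 : ∑ B, ∑ A, H (f z) (flatSigma Γ J Γ' f z (e A) (e B))
          (flatHess Γ Γ' f z (J z (e A)) (J z (e B)))
        = ∑ B, ∑ A, H (f z) (flatSigma Γ J Γ' f z (e A) (e B))
          (flatHess Γ Γ' f z (e A) (e B)) := by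
      have s1 : ∀ B, ∑ A, H (f z) (flatSigma Γ J Γ' f z (e A) (e B))
            (flatHess Γ Γ' f z (J z (e A)) (J z (e B)))
          = ∑ A, H (f z) (flatSigma Γ J Γ' f z (e A) (J z (e B)))
            (flatHess Γ Γ' f z (e A) (J z (e B))) := by
        intro B
        have := sum_pair_J_J h hz he (H := H) (y := f z)
          (P := (flatSigma Γ J Γ' f z).flip (J z (e B)))
          (Q := (flatHess Γ Γ' f z).flip (J z (e B))) (hess_left_T h m h0 hz _)
        simpa only [ContinuousLinearMap.flip_apply, sigma_J_J h m h0 hz] using this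
      simp only [s1]
      rw [Finset.sum_comm]
      conv_rhs => rw [Finset.sum_comm]
      apply Finset.sum_congr rfl
      intro A _
      exact sum_pair_J_J h hz he (P := flatSigma Γ J Γ' f z (e A))
        (Q := flatHess Γ Γ' f z (e A)) (hess_right_T h m h0 hz _)
    have k2 : ∀ A B, H (f z) (flatSigma Γ J Γ' f z (e A) (e B)) (flatSigma Γ J Γ' f z (e A) (e B))
        = H (f z) (flatSigma Γ J Γ' f z (e A) (e B)) (flatHess Γ Γ' f z (e A) (e B))
          + H (f z) (flatSigma Γ J Γ' f z (e A) (e B))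
            (flatHess Γ Γ' f z (J z (e A)) (J z (e B))) := by
      intro A B
      conv_lhs => rw [flatSigma_apply (z := z) (u := e A) (v := e B), map_add,
        ← flatSigma_apply]
    simp only [k2, Finset.sum_add_distrib, k1, fun A B => hess_symm h m h0 hz (e B) (e A)]
    ring
  rw [hsq, add_comm]
  congr 1
  rw [Finset.sum_comm]
  apply Finset.sum_congr rfl
  intro A _
  -- Commuting e_B past e_A and past J e_A leaves three traces besides the curvature of the target:
  -- the derivative of tr β = 0, the J-trace of ∇β, and the curvature trace of M. All three vanish.
  have t1 := sum_tensorDeriv_hess h m hz he 0 (by simpa using hτ) (e A)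
  have t2 := sum_tensorDeriv_hess_J h m h0 hz he (J z (e A))
  have t3 := congrArg (fderiv ℝ f z) (h.sum_curv hz he (e A))
  rw [zero_smul] at t1
  rw [map_sum, map_zero] at t3
  simp only [map_add] at t3
  have key : ∑ B, (tensorDeriv Γ Γ' f (flatHess Γ Γ' f) z (e B) (e A) (e B)
        + tensorDeriv Γ Γ' f (flatHess Γ Γ' f) z (e B) (J z (e A)) (J z (e B)))
      = ∑ B, (flatCurv Γ' (f z) (fderiv ℝ f z (e B)) (fderiv ℝ f z (e A)) (fderiv ℝ f z (e B))
          + flatCurv Γ' (f z) (fderiv ℝ f z (e B)) (fderiv ℝ f z (J z (e A)))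
            (fderiv ℝ f z (J z (e B)))) := by
    have e1 : ∀ B, tensorDeriv Γ Γ' f (flatHess Γ Γ' f) z (e B) (e A) (e B)
        + tensorDeriv Γ Γ' f (flatHess Γ Γ' f) z (e B) (J z (e A)) (J z (e B))
        = (flatCurv Γ' (f z) (fderiv ℝ f z (e B)) (fderiv ℝ f z (e A)) (fderiv ℝ f z (e B))
          + flatCurv Γ' (f z) (fderiv ℝ f z (e B)) (fderiv ℝ f z (J z (e A)))
            (fderiv ℝ f z (J z (e B))))
        + (tensorDeriv Γ Γ' f (flatHess Γ Γ' f) z (e A) (e B) (e B)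
        + tensorDeriv Γ Γ' f (flatHess Γ Γ' f) z (J z (e A)) (e B) (J z (e B))
        - (fderiv ℝ f z (flatCurv Γ z (e B) (e A) (e B))
          + fderiv ℝ f z (flatCurv Γ z (e B) (J z (e A)) (J z (e B))))) := by
      intro B
      rw [hess_ricci h m h0 hz (e B) (e A), hess_ricci h m h0 hz (e B) (J z (e A))]
      abel
    simp only [e1]
    have t12 := congrArg₂ (· + ·) t1 t2
    simp only [← Finset.sum_add_distrib, add_zero] at t12
    rw [Finset.sum_add_distrib, Finset.sum_sub_distrib, t12, t3]
    simp
  have := congrArg (fun y => H (f z) y (fderiv ℝ f z (e A))) key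
  simpa only [map_sum, sum_apply, map_add, add_apply, Finset.sum_add_distrib] using this

end LocalSiu

/-! ### Charts: tangent vectors, vector fields and brackets -/

section Coordinates

variable {E : Type*} [NormedAddCommGroup E] [NormedSpace ℝ E]
  {M : Type*} [TopologicalSpace M] [ChartedSpace E M] [IsManifold 𝓘(ℝ, E) ∞ M]

/-- The coordinates of a tangent vector at `x` in the chart at `p`. -/
noncomputable def tcoord (p x : M) : TangentSpace 𝓘(ℝ, E) x →L[ℝ] E :=
  (trivializationAt E (TangentSpace 𝓘(ℝ, E)) p).continuousLinearMapAt ℝ x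

/-- The tangent vector at `x` with given coordinates in the chart at `p`. -/
noncomputable def tvec (p x : M) : E →L[ℝ] TangentSpace 𝓘(ℝ, E) x :=
  (trivializationAt E (TangentSpace 𝓘(ℝ, E)) p).symmL ℝ x

/-- The coordinate expression of a vector field in the chart at `p`. -/
noncomputable def coordField (p : M) (X : ∀ x : M, TangentSpace 𝓘(ℝ, E) x) (z : E) : E :=
  tcoord p ((chartAt E p).symm z) (X ((chartAt E p).symm z))

theorem mem_baseSet_of_mem_source {p x : M} (hx : x ∈ (chartAt E p).source) :
    x ∈ (trivializationAt E (TangentSpace 𝓘(ℝ, E)) p).baseSet := by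
  rwa [TangentBundle.trivializationAt_baseSet]

theorem tvec_tcoord {p x : M} (hx : x ∈ (chartAt E p).source) (v : TangentSpace 𝓘(ℝ, E) x) :
    tvec p x (tcoord p x v) = v :=
  Trivialization.symmL_continuousLinearMapAt _ (mem_baseSet_of_mem_source hx) v

theorem tcoord_tvec {p x : M} (hx : x ∈ (chartAt E p).source) (v : E) :
    tcoord p x (tvec p x v) = v :=
  Trivialization.continuousLinearMapAt_symmL _ (mem_baseSet_of_mem_source hx) v

theorem tcoord_injective {p x : M} (hx : x ∈ (chartAt E p).source) :
    Function.Injective (tcoord (E := E) p x) :=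
  Function.LeftInverse.injective (tvec_tcoord hx)

theorem tcoord_apply {p x : M} (hx : x ∈ (chartAt E p).source) (v : TangentSpace 𝓘(ℝ, E) x) :
    tcoord p x v = (trivializationAt E (TangentSpace 𝓘(ℝ, E)) p ⟨x, v⟩).2 := by
  rw [tcoord, Trivialization.continuousLinearMapAt_apply, Trivialization.linearMapAt_apply,
    if_pos (mem_baseSet_of_mem_source hx)]

theorem symm_mem_source {p : M} {z : E} (hz : z ∈ (chartAt E p).target) :
    (chartAt E p).symm z ∈ (chartAt E p).source := (chartAt E p).map_target hz

theorem mfderiv_chartAt {p x : M} (hx : x ∈ (chartAt E p).source) :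
    mfderiv 𝓘(ℝ, E) 𝓘(ℝ, E) (chartAt E p) x = tcoord p x := by
  rw [mfderiv_chartAt_eq_tangentCoordChange hx, tcoord,
    TangentBundle.continuousLinearMapAt_trivializationAt_eq_core hx]

theorem mdifferentiableAt_chartAt {p x : M} (hx : x ∈ (chartAt E p).source) :
    MDifferentiableAt 𝓘(ℝ, E) 𝓘(ℝ, E) (chartAt E p) x :=
  mdifferentiableAt_atlas (chart_mem_atlas _ _) hx

theorem mdifferentiableAt_chartAt_symm {p : M} {z : E} (hz : z ∈ (chartAt E p).target) :
    MDifferentiableAt 𝓘(ℝ, E) 𝓘(ℝ, E) (chartAt E p).symm z :=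
  mdifferentiableAt_atlas_symm (chart_mem_atlas _ _) hz

theorem contMDiffAt_chartAt_symm {p : M} {z : E} (hz : z ∈ (chartAt E p).target) :
    ContMDiffAt 𝓘(ℝ, E) 𝓘(ℝ, E) ∞ (chartAt E p).symm z :=
  (contMDiffOn_chart_symm (x := p)).contMDiffAt ((chartAt E p).open_target.mem_nhds hz)

theorem contMDiffAt_chartAt {p x : M} (hx : x ∈ (chartAt E p).source) :
    ContMDiffAt 𝓘(ℝ, E) 𝓘(ℝ, E) ∞ (chartAt E p) x :=
  (contMDiffOn_chart (x := p)).contMDiffAt ((chartAt E p).open_source.mem_nhds hx)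

theorem mfderiv_chartAt_symm {p : M} {z : E} (hz : z ∈ (chartAt E p).target) :
    mfderiv 𝓘(ℝ, E) 𝓘(ℝ, E) (chartAt E p).symm z = tvec (E := E) p ((chartAt E p).symm z) := by
  have hx := symm_mem_source hz
  have h1 := mfderiv_comp z (mdifferentiableAt_chartAt hx) (mdifferentiableAt_chartAt_symm hz)
  have h2 : mfderiv 𝓘(ℝ, E) 𝓘(ℝ, E) (chartAt E p ∘ (chartAt E p).symm) z
      = mfderiv 𝓘(ℝ, E) 𝓘(ℝ, E) id z := by
    apply Filter.EventuallyEq.mfderiv_eq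
    filter_upwards [(chartAt E p).open_target.mem_nhds hz] with y hy
    exact (chartAt E p).right_inv hy
  rw [mfderiv_id] at h2
  rw [mfderiv_chartAt hx, h2] at h1
  refine ContinuousLinearMap.ext fun v => ?_
  apply tcoord_injective hx
  refine Eq.trans ?_ (tcoord_tvec hx v).symm
  exact (congrArg (fun L : E →L[ℝ] E => L v) h1).symm

section Functions

variable {G : Type*} [NormedAddCommGroup G] [NormedSpace ℝ G]

theorem symm_chart_eventuallyEq {α : Type*} (f : M → α) {p x : M}
    (hx : x ∈ (chartAt E p).source) :
    (fun y => f ((chartAt E p).symm (chartAt E p y))) =ᶠ[nhds x] f := by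
  filter_upwards [(chartAt E p).open_source.mem_nhds hx] with y hy
  rw [(chartAt E p).left_inv hy]

theorem mdifferentiableAt_iff_coord {f : M → G} {p x : M} (hx : x ∈ (chartAt E p).source) :
    MDifferentiableAt 𝓘(ℝ, E) 𝓘(ℝ, G) f x ↔
      DifferentiableAt ℝ (fun z => f ((chartAt E p).symm z)) (chartAt E p x) := by
  constructor
  · intro h
    rw [← mdifferentiableAt_iff_differentiableAt]
    refine MDifferentiableAt.comp (I' := 𝓘(ℝ, E)) _ ?_
      (mdifferentiableAt_chartAt_symm ((chartAt E p).map_source hx))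
    rwa [(chartAt E p).left_inv hx]
  · intro h
    rw [← mdifferentiableAt_iff_differentiableAt] at h
    exact (MDifferentiableAt.comp x h (mdifferentiableAt_chartAt hx)).congr_of_eventuallyEq
      (symm_chart_eventuallyEq f hx).symm

theorem contMDiffAt_iff_coord {f : M → G} {p x : M} (hx : x ∈ (chartAt E p).source) :
    ContMDiffAt 𝓘(ℝ, E) 𝓘(ℝ, G) ∞ f x ↔
      ContDiffAt ℝ ∞ (fun z => f ((chartAt E p).symm z)) (chartAt E p x) := by
  constructor
  · intro h
    rw [← contMDiffAt_iff_contDiffAt]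
    refine ContMDiffAt.comp (I' := 𝓘(ℝ, E)) _ ?_
      (contMDiffAt_chartAt_symm ((chartAt E p).map_source hx))
    rwa [(chartAt E p).left_inv hx]
  · intro h
    rw [← contMDiffAt_iff_contDiffAt] at h
    exact (ContMDiffAt.comp x h (contMDiffAt_chartAt hx)).congr_of_eventuallyEq
      (symm_chart_eventuallyEq f hx).symm

theorem mvfderiv_eq_fderiv {f : M → G} {p x : M} (hx : x ∈ (chartAt E p).source)
    (hf : MDifferentiableAt 𝓘(ℝ, E) 𝓘(ℝ, G) f x) (v : TangentSpace 𝓘(ℝ, E) x) :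
    mvfderiv 𝓘(ℝ, E) f x v =
      fderiv ℝ (fun z => f ((chartAt E p).symm z)) (chartAt E p x) (tcoord p x v) := by
  have h := (mdifferentiableAt_iff_coord hx).1 hf
  have h1 : mfderiv 𝓘(ℝ, E) 𝓘(ℝ, G) f x
      = mfderiv 𝓘(ℝ, E) 𝓘(ℝ, G) ((fun z => f ((chartAt E p).symm z)) ∘ chartAt E p) x :=
    (Filter.EventuallyEq.mfderiv_eq (symm_chart_eventuallyEq f hx)).symm
  have h2 := mfderiv_comp x (I' := 𝓘(ℝ, E)) h.mdifferentiableAt (mdifferentiableAt_chartAt hx)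
  rw [mfderiv_chartAt hx, mfderiv_eq_fderiv] at h2
  have h3 := congrArg (fun L : TangentSpace 𝓘(ℝ, E) x →L[ℝ] G => L v) (h1.trans h2)
  exact h3

end Functions

theorem mdifferentiableAt_section_iff_coord {X : ∀ x : M, TangentSpace 𝓘(ℝ, E) x} {p x : M}
    (hx : x ∈ (chartAt E p).source) :
    MDiffAt (T% X) x ↔ DifferentiableAt ℝ (coordField p X) (chartAt E p x) := by
  rw [Trivialization.mdifferentiableAt_section_iff 𝓘(ℝ, E)
    (trivializationAt E (TangentSpace 𝓘(ℝ, E)) p) X (mem_baseSet_of_mem_source hx),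
    mdifferentiableAt_iff_coord hx]
  refine Filter.EventuallyEq.differentiableAt_iff ?_
  filter_upwards [(chartAt E p).open_target.mem_nhds ((chartAt E p).map_source hx)] with z hz
  exact (tcoord_apply (symm_mem_source hz) _).symm

theorem contMDiffAt_section_iff_coord {X : ∀ x : M, TangentSpace 𝓘(ℝ, E) x} {p x : M}
    (hx : x ∈ (chartAt E p).source) :
    CMDiffAt ∞ (T% X) x ↔ ContDiffAt ℝ ∞ (coordField p X) (chartAt E p x) := by
  rw [Trivialization.contMDiffAt_section_iff
    (e := trivializationAt E (TangentSpace 𝓘(ℝ, E)) p) (mem_baseSet_of_mem_source hx),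
    contMDiffAt_iff_coord hx]
  have h : (fun z => (trivializationAt E (TangentSpace 𝓘(ℝ, E)) p
      ⟨(chartAt E p).symm z, X ((chartAt E p).symm z)⟩).2)
      =ᶠ[nhds (chartAt E p x)] coordField p X := by
    filter_upwards [(chartAt E p).open_target.mem_nhds ((chartAt E p).map_source hx)] with z hz
    exact (tcoord_apply (symm_mem_source hz) _).symm
  exact ⟨fun h1 => h1.congr_of_eventuallyEq h.symm, fun h1 => h1.congr_of_eventuallyEq h⟩

theorem coordField_chart {X : ∀ x : M, TangentSpace 𝓘(ℝ, E) x} {p x : M}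
    (hx : x ∈ (chartAt E p).source) : coordField p X (chartAt E p x) = tcoord p x (X x) := by
  rw [coordField, (chartAt E p).left_inv hx]

/-- The bracket is natural under pullback by the inverse chart, which turns it into the bracket of
coordinate fields on E. -/
theorem tcoord_mlieBracket [CompleteSpace E] {X Y : ∀ x : M, TangentSpace 𝓘(ℝ, E) x} {p x : M}
    (hx : x ∈ (chartAt E p).source) (hX : MDiffAt (T% X) x) (hY : MDiffAt (T% Y) x) :
    tcoord p x (mlieBracket 𝓘(ℝ, E) X Y x)
      = fderiv ℝ (coordField p Y) (chartAt E p x) (tcoord p x (X x))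
        - fderiv ℝ (coordField p X) (chartAt E p x) (tcoord p x (Y x)) := by
  have hz := (chartAt E p).map_source hx
  have hpull : ∀ Z : ∀ x : M, TangentSpace 𝓘(ℝ, E) x, ∀ z ∈ (chartAt E p).target,
      mpullback 𝓘(ℝ, E) 𝓘(ℝ, E) (chartAt E p).symm Z z = coordField p Z z := by
    intro Z z hz
    have hs := symm_mem_source hz
    rw [mpullback, coordField, mfderiv_chartAt_symm hz]
    -- Written as an equivalence, the derivative of the inverse chart has `tcoord` as its inverse,
    -- the map used by `mpullback`.
    have : tvec p ((chartAt E p).symm z) =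
        ((ContinuousLinearEquiv.equivOfInverse (tvec p ((chartAt E p).symm z))
          (tcoord p ((chartAt E p).symm z)) (tcoord_tvec hs) (tvec_tcoord hs)
          : E ≃L[ℝ] TangentSpace 𝓘(ℝ, E) ((chartAt E p).symm z)) :
          E →L[ℝ] TangentSpace 𝓘(ℝ, E) ((chartAt E p).symm z)) := rfl
    conv_lhs => rw [this]
    erw [ContinuousLinearMap.inverse_equiv]
    rfl
  have hxx := (chartAt E p).left_inv hx
  have hmin : minSmoothness ℝ 2 = 2 := minSmoothness_of_isRCLikeNormedField
  have : IsManifold 𝓘(ℝ, E) (minSmoothness ℝ 2) M := by rw [hmin]; infer_instance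
  have : IsManifold 𝓘(ℝ, E) (minSmoothness ℝ 2) E := by rw [hmin]; infer_instance
  have h := mpullback_mlieBracket (I := 𝓘(ℝ, E)) (I' := 𝓘(ℝ, E)) (V := X) (W := Y)
    (f := (chartAt E p).symm) (x₀ := chartAt E p x) (n := ∞)
    (by rwa [hxx]) (by rwa [hxx]) (contMDiffAt_chartAt_symm hz)
    (by rw [hmin]; exact WithTop.coe_le_coe.2 le_top)
  rw [hpull _ _ hz, coordField_chart hx] at h
  rw [h]
  have hev : ∀ Z : ∀ x : M, TangentSpace 𝓘(ℝ, E) x,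
      mpullback 𝓘(ℝ, E) 𝓘(ℝ, E) (chartAt E p).symm Z =ᶠ[nhds (chartAt E p x)] coordField p Z := by
    intro Z
    filter_upwards [(chartAt E p).open_target.mem_nhds hz] with z hz
    exact hpull Z z hz
  have h3 : mlieBracket 𝓘(ℝ, E) (mpullback 𝓘(ℝ, E) 𝓘(ℝ, E) (chartAt E p).symm X)
      (mpullback 𝓘(ℝ, E) 𝓘(ℝ, E) (chartAt E p).symm Y) (chartAt E p x)
      = lieBracket ℝ (mpullback 𝓘(ℝ, E) 𝓘(ℝ, E) (chartAt E p).symm X)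
        (mpullback 𝓘(ℝ, E) 𝓘(ℝ, E) (chartAt E p).symm Y) (chartAt E p x) := by
    rw [← mlieBracketWithin_univ, mlieBracketWithin_eq_lieBracketWithin]
    exact congrFun (lieBracketWithin_univ (𝕜 := ℝ) (E := E)) _
  have h6 : ∀ A B A' B' : E → E, A =ᶠ[nhds (chartAt E p x)] A' → B =ᶠ[nhds (chartAt E p x)] B' →
      lieBracket ℝ A B (chartAt E p x) = fderiv ℝ B' (chartAt E p x) (A' (chartAt E p x))
        - fderiv ℝ A' (chartAt E p x) (B' (chartAt E p x)) := by
    intro A B A' B' h h'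
    rw [lieBracket, h.fderiv_eq, h'.fderiv_eq, h.eq_of_nhds, h'.eq_of_nhds]
  refine h3.trans ((h6 _ _ _ _ (hev X) (hev Y)).trans ?_)
  rw [coordField_chart hx, coordField_chart hx]

theorem extend_apply_self {x : M} (v : TangentSpace 𝓘(ℝ, E) x) :
    (FiberBundle.extend E v : ∀ y : M, TangentSpace 𝓘(ℝ, E) y) x = v := by
  simp

theorem contMDiffAt_extend' {x : M} (v : TangentSpace 𝓘(ℝ, E) x) :
    CMDiffAt ∞ (T% (FiberBundle.extend E v : ∀ y : M, TangentSpace 𝓘(ℝ, E) y)) x :=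
  FiberBundle.contMDiffAt_extend 𝓘(ℝ, E) E v

/-- The field with constant coordinates `w` in the chart at `p`. -/
noncomputable def constField (p : M) (w : E) (y : M) : TangentSpace 𝓘(ℝ, E) y := tvec p y w

theorem coordField_constField {p : M} {w : E} {z : E} (hz : z ∈ (chartAt E p).target) :
    coordField p (constField p w) z = w := tcoord_tvec (symm_mem_source hz) w

theorem contMDiffAt_constField {p x : M} (hx : x ∈ (chartAt E p).source) (w : E) :
    CMDiffAt ∞ (T% (constField p w)) x := by
  rw [contMDiffAt_section_iff_coord hx]
  refine (contDiffAt_const (c := w)).congr_of_eventuallyEq ?_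
  filter_upwards [(chartAt E p).open_target.mem_nhds ((chartAt E p).map_source hx)] with z hz
  exact coordField_constField hz

end Coordinates

/-! ### Connections in charts: Christoffel symbols, torsion, curvature -/

section Connections

variable {E : Type*} [NormedAddCommGroup E] [NormedSpace ℝ E] [FiniteDimensional ℝ E]
  {M : Type*} [TopologicalSpace M] [ChartedSpace E M] [IsManifold 𝓘(ℝ, E) ∞ M]

/-- The Christoffel symbols of a connection in the chart at `p`; the first argument is the
direction. -/
noncomputable def christoffel
    (D : CovariantDerivative 𝓘(ℝ, E) E (TangentSpace 𝓘(ℝ, E) : M → Type _)) (p : M) (z : E) :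
    E →L[ℝ] E →L[ℝ] E :=
  ∑ i, (ContinuousLinearMap.smulRightL ℝ E E (stdCo E i)).comp
    ((tcoord p ((chartAt E p).symm z)).comp
      ((D (constField p (stdB E i)) ((chartAt E p).symm z)).comp (tvec p ((chartAt E p).symm z))))

theorem christoffel_apply
    (D : CovariantDerivative 𝓘(ℝ, E) E (TangentSpace 𝓘(ℝ, E) : M → Type _)) (p : M) (z v w : E) :
    christoffel D p z v w = ∑ i, stdCo E i w • tcoord p ((chartAt E p).symm z)
      (D (constField p (stdB E i)) ((chartAt E p).symm z) (tvec p ((chartAt E p).symm z) v)) := by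
  simp only [christoffel, sum_apply]
  rfl

theorem CovariantDerivative.sum_smul {ι : Type*} (s : Finset ι)
    (D : CovariantDerivative 𝓘(ℝ, E) E (TangentSpace 𝓘(ℝ, E) : M → Type _)) {x : M}
    (g : ι → M → ℝ) (B : ι → ∀ x : M, TangentSpace 𝓘(ℝ, E) x)
    (hg : ∀ i, MDifferentiableAt 𝓘(ℝ, E) 𝓘(ℝ, ℝ) (g i) x) (hB : ∀ i, MDiffAt (T% (B i)) x)
    (v : TangentSpace 𝓘(ℝ, E) x) :
    MDiffAt (T% (∑ i ∈ s, g i • B i)) x ∧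
    D (∑ i ∈ s, g i • B i) x v
      = ∑ i ∈ s, (g i x • D (B i) x v + mvfderiv 𝓘(ℝ, E) (g i) x v • B i x) := by
  classical
  induction s using Finset.induction_on with
  | empty =>
    simp only [Finset.sum_empty, CovariantDerivative.zero]
    exact ⟨mdifferentiableAt_zeroSection .., rfl⟩
  | insert a s ha ih =>
    have h1 : MDiffAt (T% (g a • B a)) x := (hg a).smul_section (hB a)
    rw [Finset.sum_insert ha, Finset.sum_insert ha]
    refine ⟨mdifferentiableAt_add_section h1 ih.1, ?_⟩
    rw [D.isCovariantDerivativeOnUniv.add h1 ih.1, add_apply, ih.2,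
      D.isCovariantDerivativeOnUniv.leibniz (hB a) (hg a)]
    rfl

theorem sum_constField {p x : M} (hx : x ∈ (chartAt E p).source) (v : TangentSpace 𝓘(ℝ, E) x) :
    ∑ i, stdCo E i (tcoord p x v) • constField p (stdB E i) x = v := by
  apply tcoord_injective hx
  simp only [constField, map_sum, map_smul, tcoord_tvec hx]
  exact sum_stdCo _

/-- Expand X in the coordinate frame and apply the Leibniz rule. The coefficients need only be
differentiable at x. -/
theorem tcoord_cov (D : CovariantDerivative 𝓘(ℝ, E) E (TangentSpace 𝓘(ℝ, E) : M → Type _))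
    {X : ∀ x : M, TangentSpace 𝓘(ℝ, E) x} {p x : M} (hx : x ∈ (chartAt E p).source)
    (hX : MDiffAt (T% X) x) (v : TangentSpace 𝓘(ℝ, E) x) :
    tcoord p x (D X x v) = fderiv ℝ (coordField p X) (chartAt E p x) (tcoord p x v)
      + christoffel D p (chartAt E p x) (tcoord p x v) (tcoord p x (X x)) := by
  have hXd := (mdifferentiableAt_section_iff_coord hx).1 hX
  let g : Fin (Module.finrank ℝ E) → M → ℝ := fun i y => stdCo E i (tcoord p y (X y))
  have hgd : ∀ i, DifferentiableAt ℝ (fun z => g i ((chartAt E p).symm z)) (chartAt E p x) :=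
    fun i => (stdCo E i).differentiableAt.comp _ hXd
  have hg : ∀ i, MDifferentiableAt 𝓘(ℝ, E) 𝓘(ℝ, ℝ) (g i) x := fun i =>
    (mdifferentiableAt_iff_coord hx).2 (hgd i)
  have hB : ∀ i, MDiffAt (T% (constField p (stdB E i))) x := fun i =>
    (contMDiffAt_constField hx _).mdifferentiableAt (by simp)
  obtain ⟨h1, h2⟩ := CovariantDerivative.sum_smul Finset.univ D g
    (fun i => constField p (stdB E i)) hg hB v
  have h3 : D X x = D (∑ i, g i • constField p (stdB E i)) x := by
    refine D.isCovariantDerivativeOnUniv.congr_of_eventuallyEq hX h1 Filter.univ_mem ?_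
    filter_upwards [(chartAt E p).open_source.mem_nhds hx] with y hy
    rw [Finset.sum_apply]
    exact (sum_constField hy (X y)).symm
  rw [h3, h2, map_sum]
  simp only [map_add, map_smul, Finset.sum_add_distrib]
  rw [add_comm]
  congr 1
  · rw [← sum_stdCo (fderiv ℝ (coordField p X) (chartAt E p x) (tcoord p x v))]
    refine Finset.sum_congr rfl fun i _ => ?_
    rw [constField, tcoord_tvec hx, mvfderiv_eq_fderiv hx (hg i)]
    congr 1
    exact congrArg (fun L : E →L[ℝ] ℝ => L (tcoord p x v))
      ((stdCo E i).hasFDerivAt.comp _ hXd.hasFDerivAt).fderiv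
  · rw [christoffel_apply, (chartAt E p).left_inv hx, tvec_tcoord hx]

theorem tcoord_torsion [CompleteSpace E]
    (D : CovariantDerivative 𝓘(ℝ, E) E (TangentSpace 𝓘(ℝ, E) : M → Type _))
    {p x : M} (hx : x ∈ (chartAt E p).source) (u v : TangentSpace 𝓘(ℝ, E) x) :
    tcoord p x (D.torsion x u v)
      = christoffel D p (chartAt E p x) (tcoord p x u) (tcoord p x v)
        - christoffel D p (chartAt E p x) (tcoord p x v) (tcoord p x u) := by
  have hd : ∀ w : TangentSpace 𝓘(ℝ, E) x,
      MDiffAt (T% (FiberBundle.extend E w : ∀ y : M, TangentSpace 𝓘(ℝ, E) y)) x := fun w =>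
    (contMDiffAt_extend' w).mdifferentiableAt (by simp)
  have h := D.torsion_apply (hd u) (hd v)
  simp only [extend_apply_self] at h
  rw [h, map_sub, map_sub, tcoord_cov D hx (hd v), tcoord_cov D hx (hd u),
    tcoord_mlieBracket hx (hd u) (hd v)]
  simp only [extend_apply_self]
  abel

/-- The derivatives of the extended fields cancel, those of first order against the bracket term and
those of second order by symmetry. What is left is algebraic in the three vectors. -/
theorem tcoord_curvature [CompleteSpace E]
    (D : CovariantDerivative 𝓘(ℝ, E) E (TangentSpace 𝓘(ℝ, E) : M → Type _))
    {p x : M} (hx : x ∈ (chartAt E p).source)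
    (hD : DifferentiableAt ℝ (christoffel D p) (chartAt E p x))
    (u v w : TangentSpace 𝓘(ℝ, E) x) :
    tcoord p x (curvature D x u v w)
      = flatCurv (christoffel D p) (chartAt E p x) (tcoord p x u) (tcoord p x v)
        (tcoord p x w) := by
  have hz := (chartAt E p).map_source hx
  have hs : ∀ w : TangentSpace 𝓘(ℝ, E) x,
      ContDiffAt ℝ ∞ (coordField p (FiberBundle.extend E w : ∀ y : M, TangentSpace 𝓘(ℝ, E) y))
        (chartAt E p x) := fun w => (contMDiffAt_section_iff_coord hx).1 (contMDiffAt_extend' w)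
  have hd : ∀ w : TangentSpace 𝓘(ℝ, E) x,
      MDiffAt (T% (FiberBundle.extend E w : ∀ y : M, TangentSpace 𝓘(ℝ, E) y)) x := fun w =>
    (contMDiffAt_extend' w).mdifferentiableAt (by simp)
  have hev : ∀ w : TangentSpace 𝓘(ℝ, E) x, ∀ᶠ z in nhds (chartAt E p x), z ∈ (chartAt E p).target ∧
      DifferentiableAt ℝ
        (coordField p (FiberBundle.extend E w : ∀ y : M, TangentSpace 𝓘(ℝ, E) y)) z := by
    intro w
    -- The inner covariant derivative is itself differentiated, so the coordinate formula is needed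
    -- on a whole neighbourhood. Smoothness of the extension at the point provides one.
    obtain ⟨s, hs1, hs2⟩ := ((hs w).of_le (m := 1) (by exact_mod_cast le_top)).eventually (by simp)
      |>.and ((chartAt E p).open_target.mem_nhds hz) |>.exists_mem
    filter_upwards [hs1] with z hz
    exact ⟨(hs2 z hz).2, (hs2 z hz).1.differentiableAt (by simp)⟩
  have key : ∀ v w : TangentSpace 𝓘(ℝ, E) x,
      coordField p (fun y => D (FiberBundle.extend E w) y
        ((FiberBundle.extend E v : ∀ y : M, TangentSpace 𝓘(ℝ, E) y) y))
      =ᶠ[nhds (chartAt E p x)] fun z =>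
        fderiv ℝ (coordField p (FiberBundle.extend E w : ∀ y : M, TangentSpace 𝓘(ℝ, E) y)) z
          (coordField p (FiberBundle.extend E v : ∀ y : M, TangentSpace 𝓘(ℝ, E) y) z)
        + christoffel D p z
          (coordField p (FiberBundle.extend E v : ∀ y : M, TangentSpace 𝓘(ℝ, E) y) z)
          (coordField p (FiberBundle.extend E w : ∀ y : M, TangentSpace 𝓘(ℝ, E) y) z) := by
    intro v w
    filter_upwards [hev w] with z hz
    have h := tcoord_cov D (symm_mem_source hz.1) (X := FiberBundle.extend E w)
      ((mdifferentiableAt_section_iff_coord (symm_mem_source hz.1)).2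
        (by rw [(chartAt E p).right_inv hz.1]; exact hz.2))
      ((FiberBundle.extend E v : ∀ y : M, TangentSpace 𝓘(ℝ, E) y) ((chartAt E p).symm z))
    rw [(chartAt E p).right_inv hz.1] at h
    exact h
  have hval : ∀ w : TangentSpace 𝓘(ℝ, E) x,
      coordField p (FiberBundle.extend E w : ∀ y : M, TangentSpace 𝓘(ℝ, E) y) (chartAt E p x)
        = tcoord p x w := by
    intro w; rw [coordField_chart hx, extend_apply_self]
  have hdf : ∀ w : TangentSpace 𝓘(ℝ, E) x, DifferentiableAt ℝ
      (coordField p (FiberBundle.extend E w : ∀ y : M, TangentSpace 𝓘(ℝ, E) y))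
        (chartAt E p x) := fun w => (hs w).differentiableAt_of_smooth
  have hdd : ∀ w : TangentSpace 𝓘(ℝ, E) x, DifferentiableAt ℝ
      (fderiv ℝ (coordField p (FiberBundle.extend E w : ∀ y : M, TangentSpace 𝓘(ℝ, E) y)))
        (chartAt E p x) := fun w => (hs w).fderiv_smooth.differentiableAt_of_smooth
  have hcf : ∀ v w : TangentSpace 𝓘(ℝ, E) x, DifferentiableAt ℝ
      (coordField p (fun y => D (FiberBundle.extend E w) y
        ((FiberBundle.extend E v : ∀ y : M, TangentSpace 𝓘(ℝ, E) y) y))) (chartAt E p x) := by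
    intro v w
    exact (((hdd w).clm_apply (hdf v)).add ((hD.clm_apply (hdf v)).clm_apply (hdf w))).congr_of_eventuallyEq
      (key v w)
  have hterm : ∀ u v w : TangentSpace 𝓘(ℝ, E) x,
      tcoord p x (D (fun y => D (FiberBundle.extend E w) y
        ((FiberBundle.extend E v : ∀ y : M, TangentSpace 𝓘(ℝ, E) y) y)) x u)
      = fderiv ℝ (fderiv ℝ (coordField p
          (FiberBundle.extend E w : ∀ y : M, TangentSpace 𝓘(ℝ, E) y))) (chartAt E p x)
          (tcoord p x u) (tcoord p x v)
        + fderiv ℝ (coordField p (FiberBundle.extend E w : ∀ y : M, TangentSpace 𝓘(ℝ, E) y))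
            (chartAt E p x) (fderiv ℝ (coordField p
              (FiberBundle.extend E v : ∀ y : M, TangentSpace 𝓘(ℝ, E) y)) (chartAt E p x)
              (tcoord p x u))
        + (fderiv ℝ (christoffel D p) (chartAt E p x) (tcoord p x u) (tcoord p x v) (tcoord p x w)
          + christoffel D p (chartAt E p x) (fderiv ℝ (coordField p
              (FiberBundle.extend E v : ∀ y : M, TangentSpace 𝓘(ℝ, E) y)) (chartAt E p x)
              (tcoord p x u)) (tcoord p x w)
          + christoffel D p (chartAt E p x) (tcoord p x v) (fderiv ℝ (coordField p
              (FiberBundle.extend E w : ∀ y : M, TangentSpace 𝓘(ℝ, E) y)) (chartAt E p x)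
              (tcoord p x u)))
        + christoffel D p (chartAt E p x) (tcoord p x u)
          (fderiv ℝ (coordField p (FiberBundle.extend E w : ∀ y : M, TangentSpace 𝓘(ℝ, E) y))
            (chartAt E p x) (tcoord p x v)
          + christoffel D p (chartAt E p x) (tcoord p x v) (tcoord p x w)) := by
    intro u v w
    rw [tcoord_cov D hx ((mdifferentiableAt_section_iff_coord hx).2 (hcf v w)),
      (key v w).fderiv_eq, fderiv_fun_add ((hdd w).clm_apply (hdf v))
        ((hD.clm_apply (hdf v)).clm_apply (hdf w)), add_apply, fderiv_apply_fun (hdd w) (hdf v),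
      fderiv_apply₂_fun hD (hdf v) (hdf w), hval, hval, tcoord_cov D hx (hd w)]
    simp only [extend_apply_self]
  unfold curvature
  dsimp only
  rw [map_sub, map_sub, hterm u v w, hterm v u w, tcoord_cov D hx (hd w),
    tcoord_mlieBracket hx (hd u) (hd v), fderiv_fderiv_symm (hs w) (tcoord p x v) (tcoord p x u)]
  simp only [extend_apply_self, flatCurv, map_add, map_sub, sub_apply]
  abel

/-- The coordinate expression of a one-form. -/
noncomputable def coordForm (p : M) (l : ∀ x : M, TangentSpace 𝓘(ℝ, E) x →L[ℝ] ℝ) (z : E) :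
    E →L[ℝ] ℝ :=
  (l ((chartAt E p).symm z)).comp (tvec p ((chartAt E p).symm z))

theorem coordForm_chart {p x : M} (hx : x ∈ (chartAt E p).source)
    (l : ∀ x : M, TangentSpace 𝓘(ℝ, E) x →L[ℝ] ℝ) (v : TangentSpace 𝓘(ℝ, E) x) :
    coordForm p l (chartAt E p x) (tcoord p x v) = l x v := by
  rw [coordForm, ContinuousLinearMap.comp_apply, (chartAt E p).left_inv hx, tvec_tcoord hx]

theorem coordForm_coordField {p : M} {z : E} (hz : z ∈ (chartAt E p).target)
    (l : ∀ x : M, TangentSpace 𝓘(ℝ, E) x →L[ℝ] ℝ) (X : ∀ x : M, TangentSpace 𝓘(ℝ, E) x) :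
    coordForm p l z (coordField p X z)
      = l ((chartAt E p).symm z) (X ((chartAt E p).symm z)) := by
  rw [coordForm, ContinuousLinearMap.comp_apply, coordField, tvec_tcoord (symm_mem_source hz)]

theorem form_field_eventuallyEq {p x : M} (hx : x ∈ (chartAt E p).source)
    (l : ∀ x : M, TangentSpace 𝓘(ℝ, E) x →L[ℝ] ℝ) (X : ∀ x : M, TangentSpace 𝓘(ℝ, E) x) :
    (fun z => l ((chartAt E p).symm z) (X ((chartAt E p).symm z)))
      =ᶠ[nhds (chartAt E p x)] fun z => coordForm p l z (coordField p X z) := by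
  filter_upwards [(chartAt E p).open_target.mem_nhds ((chartAt E p).map_source hx)] with z hz
  exact (coordForm_coordField hz l X).symm

theorem mdifferentiableAt_form_field {p x : M} (hx : x ∈ (chartAt E p).source)
    {l : ∀ x : M, TangentSpace 𝓘(ℝ, E) x →L[ℝ] ℝ}
    (hl : DifferentiableAt ℝ (coordForm p l) (chartAt E p x))
    {X : ∀ x : M, TangentSpace 𝓘(ℝ, E) x} (hX : MDiffAt (T% X) x) :
    MDifferentiableAt 𝓘(ℝ, E) 𝓘(ℝ, ℝ) (fun y => l y (X y)) x :=
  (mdifferentiableAt_iff_coord hx).2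
    ((hl.clm_apply ((mdifferentiableAt_section_iff_coord hx).1 hX)).congr_of_eventuallyEq
      (form_field_eventuallyEq hx l X))

theorem mvfderiv_form_field {p x : M} (hx : x ∈ (chartAt E p).source)
    {l : ∀ x : M, TangentSpace 𝓘(ℝ, E) x →L[ℝ] ℝ}
    (hl : DifferentiableAt ℝ (coordForm p l) (chartAt E p x))
    {X : ∀ x : M, TangentSpace 𝓘(ℝ, E) x} (hX : MDiffAt (T% X) x)
    (v : TangentSpace 𝓘(ℝ, E) x) :
    mvfderiv 𝓘(ℝ, E) (fun y => l y (X y)) x v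
      = fderiv ℝ (coordForm p l) (chartAt E p x) (tcoord p x v) (tcoord p x (X x))
        + l x (tvec p x (fderiv ℝ (coordField p X) (chartAt E p x) (tcoord p x v))) := by
  have hXd := (mdifferentiableAt_section_iff_coord hx).1 hX
  rw [mvfderiv_eq_fderiv hx (mdifferentiableAt_form_field hx hl hX),
    (form_field_eventuallyEq hx l X).fderiv_eq, fderiv_apply_fun hl hXd, coordField_chart hx]
  congr 1
  rw [coordForm, ContinuousLinearMap.comp_apply, (chartAt E p).left_inv hx]

/-- The derivatives of the extensions cancel against the bracket; only the antisymmetrized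
derivative of the form survives. -/
theorem oneFormDeriv_eq_coord [CompleteSpace E] {p x : M} (hx : x ∈ (chartAt E p).source)
    {l : ∀ x : M, TangentSpace 𝓘(ℝ, E) x →L[ℝ] ℝ}
    (hl : DifferentiableAt ℝ (coordForm p l) (chartAt E p x))
    (u v : TangentSpace 𝓘(ℝ, E) x) :
    oneFormDeriv l x u v
      = fderiv ℝ (coordForm p l) (chartAt E p x) (tcoord p x u) (tcoord p x v)
        - fderiv ℝ (coordForm p l) (chartAt E p x) (tcoord p x v) (tcoord p x u) := by
  have hd : ∀ w : TangentSpace 𝓘(ℝ, E) x,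
      MDiffAt (T% (FiberBundle.extend E w : ∀ y : M, TangentSpace 𝓘(ℝ, E) y)) x := fun w =>
    (contMDiffAt_extend' w).mdifferentiableAt (by simp)
  rw [oneFormDeriv, mvfderiv_form_field hx hl (hd v), mvfderiv_form_field hx hl (hd u),
    ← tvec_tcoord hx (mlieBracket 𝓘(ℝ, E) (FiberBundle.extend E u) (FiberBundle.extend E v) x),
    tcoord_mlieBracket hx (hd u) (hd v)]
  simp only [extend_apply_self, map_sub]
  abel

end Connections

/-! ### Maps, sections along maps and second fundamental forms in charts -/

section Maps

variable {E : Type*} [NormedAddCommGroup E] [NormedSpace ℝ E] [FiniteDimensional ℝ E]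
  {M : Type*} [TopologicalSpace M] [ChartedSpace E M] [IsManifold 𝓘(ℝ, E) ∞ M]
  {F : Type*} [NormedAddCommGroup F] [NormedSpace ℝ F] [FiniteDimensional ℝ F]
  {N : Type*} [TopologicalSpace N] [ChartedSpace F N] [IsManifold 𝓘(ℝ, F) ∞ N]

/-- The coordinate expression of a map in the charts at `p` and `q`. -/
noncomputable def coordMap (p : M) (q : N) (φ : M → N) (z : E) : F :=
  chartAt F q (φ ((chartAt E p).symm z))

/-- The coordinate expression of a section along a map. -/
noncomputable def coordAlong (p : M) (q : N) (φ : M → N)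
    (s : ∀ x : M, TangentSpace 𝓘(ℝ, F) (φ x)) (z : E) : F :=
  tcoord q (φ ((chartAt E p).symm z)) (s ((chartAt E p).symm z))

theorem coordMap_chart {p x : M} (hx : x ∈ (chartAt E p).source) (q : N) (φ : M → N) :
    coordMap p q φ (chartAt E p x) = chartAt F q (φ x) := by
  rw [coordMap, (chartAt E p).left_inv hx]

theorem coordAlong_chart {p x : M} (hx : x ∈ (chartAt E p).source) (q : N) (φ : M → N)
    (s : ∀ x : M, TangentSpace 𝓘(ℝ, F) (φ x)) :
    coordAlong p q φ s (chartAt E p x) = tcoord q (φ x) (s x) := by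
  rw [coordAlong, (chartAt E p).left_inv hx]

theorem contDiffAt_coordMap {p x : M} (hx : x ∈ (chartAt E p).source) {q : N} {φ : M → N}
    (hq : φ x ∈ (chartAt F q).source) (hφ : ContMDiffAt 𝓘(ℝ, E) 𝓘(ℝ, F) ∞ φ x) :
    ContDiffAt ℝ ∞ (coordMap (F := F) p q φ) (chartAt E p x) := by
  rw [← contMDiffAt_iff_contDiffAt]
  have h1 : ContMDiffAt 𝓘(ℝ, E) 𝓘(ℝ, E) ∞ (chartAt E p).symm (chartAt E p x) :=
    contMDiffAt_chartAt_symm ((chartAt E p).map_source hx)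
  have h2 : ContMDiffAt 𝓘(ℝ, E) 𝓘(ℝ, F) ∞ (fun z => φ ((chartAt E p).symm z)) (chartAt E p x) :=
    ContMDiffAt.comp (I' := 𝓘(ℝ, E)) _ (by rwa [(chartAt E p).left_inv hx]) h1
  exact ContMDiffAt.comp (I' := 𝓘(ℝ, F)) _
    (contMDiffAt_chartAt (by rwa [(chartAt E p).left_inv hx])) h2

theorem differentiableAt_coordMap {p x : M} (hx : x ∈ (chartAt E p).source) {q : N} {φ : M → N}
    (hq : φ x ∈ (chartAt F q).source) (hφ : MDifferentiableAt 𝓘(ℝ, E) 𝓘(ℝ, F) φ x) :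
    DifferentiableAt ℝ (coordMap (F := F) p q φ) (chartAt E p x) := by
  rw [← mdifferentiableAt_iff_differentiableAt]
  have h1 : MDifferentiableAt 𝓘(ℝ, E) 𝓘(ℝ, E) (chartAt E p).symm (chartAt E p x) :=
    mdifferentiableAt_chartAt_symm ((chartAt E p).map_source hx)
  have h2 : MDifferentiableAt 𝓘(ℝ, E) 𝓘(ℝ, F) (fun z => φ ((chartAt E p).symm z))
      (chartAt E p x) :=
    MDifferentiableAt.comp (I' := 𝓘(ℝ, E)) _ (by rwa [(chartAt E p).left_inv hx]) h1
  exact MDifferentiableAt.comp (I' := 𝓘(ℝ, F)) _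
    (mdifferentiableAt_chartAt (by rwa [(chartAt E p).left_inv hx])) h2

theorem tcoord_mfderiv {p x : M} (hx : x ∈ (chartAt E p).source) {q : N} {φ : M → N}
    (hq : φ x ∈ (chartAt F q).source) (hφ : MDifferentiableAt 𝓘(ℝ, E) 𝓘(ℝ, F) φ x)
    (v : TangentSpace 𝓘(ℝ, E) x) :
    tcoord q (φ x) (mfderiv 𝓘(ℝ, E) 𝓘(ℝ, F) φ x v)
      = fderiv ℝ (coordMap p q φ) (chartAt E p x) (tcoord p x v) := by
  have h0 : coordMap p q φ ∘ chartAt E p =ᶠ[nhds x] chartAt F q ∘ φ := by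
    filter_upwards [(chartAt E p).open_source.mem_nhds hx] with y hy
    exact coordMap_chart hy q φ
  have h1 := mfderiv_comp x (I := 𝓘(ℝ, E)) (I' := 𝓘(ℝ, F)) (I'' := 𝓘(ℝ, F))
    (mdifferentiableAt_chartAt hq) hφ
  have h2 := mfderiv_comp x (I := 𝓘(ℝ, E)) (I' := 𝓘(ℝ, E)) (I'' := 𝓘(ℝ, F))
    (differentiableAt_coordMap hx hq hφ).mdifferentiableAt (mdifferentiableAt_chartAt hx)
  have e0 : mfderiv 𝓘(ℝ, E) 𝓘(ℝ, F) (coordMap (F := F) p q φ ∘ chartAt E p) x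
      = mfderiv 𝓘(ℝ, E) 𝓘(ℝ, F) (chartAt F q ∘ φ) x := h0.mfderiv_eq
  have e1 : mfderiv 𝓘(ℝ, E) 𝓘(ℝ, F) (chartAt F q ∘ φ) x v
      = tcoord q (φ x) (mfderiv 𝓘(ℝ, E) 𝓘(ℝ, F) φ x v) := by
    rw [h1, mfderiv_chartAt hq]; rfl
  have e2 : mfderiv 𝓘(ℝ, E) 𝓘(ℝ, F) (coordMap (F := F) p q φ ∘ chartAt E p) x v
      = fderiv ℝ (coordMap (F := F) p q φ) (chartAt E p x) (tcoord p x v) := by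
    rw [h2, mfderiv_chartAt hx, mfderiv_eq_fderiv]; rfl
  exact e1.symm.trans ((congrArg (fun L : TangentSpace 𝓘(ℝ, E) x →L[ℝ] F => L v) e0).symm.trans e2)

theorem eventually_source {p x : M} (hx : x ∈ (chartAt E p).source) {q : N} {φ : M → N}
    (hq : φ x ∈ (chartAt F q).source) (hφ : ContinuousAt φ x) :
    ∀ᶠ z in nhds (chartAt E p x), z ∈ (chartAt E p).target ∧
      φ ((chartAt E p).symm z) ∈ (chartAt F q).source := by
  refine Filter.Eventually.and
    ((chartAt E p).open_target.mem_nhds ((chartAt E p).map_source hx)) ?_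
  have h1 : ContinuousAt (chartAt E p).symm (chartAt E p x) :=
    (chartAt E p).continuousAt_symm ((chartAt E p).map_source hx)
  have h2 : ContinuousAt (fun z => φ ((chartAt E p).symm z)) (chartAt E p x) :=
    ContinuousAt.comp (by rwa [(chartAt E p).left_inv hx]) h1
  exact h2.eventually ((chartAt F q).open_source.mem_nhds (by simpa [(chartAt E p).left_inv hx]))

/-- `pullbackCov` refers to the trivialization at φ x, which moves with x, whereas coordinate
computations keep one chart q of the target. This formula passes between the two. -/
theorem coordAlong_change {p x : M} (hx : x ∈ (chartAt E p).source) {q q' : N} {φ : M → N}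
    (hq : φ x ∈ (chartAt F q).source) (hq' : φ x ∈ (chartAt F q').source)
    (hφ : ContinuousAt φ x) (s : ∀ x : M, TangentSpace 𝓘(ℝ, F) (φ x)) :
    coordAlong p q' φ s =ᶠ[nhds (chartAt E p x)] fun z => ∑ i,
      stdCo F i (coordAlong p q φ s z) • coordField q' (constField q (stdB F i))
        (coordMap p q' φ z) := by
  filter_upwards [eventually_source hx hq hφ, eventually_source hx hq' hφ] with z h1 h2
  have h3 := sum_constField h1.2 (s ((chartAt E p).symm z))
  conv_lhs => rw [coordAlong, ← h3]
  rw [map_sum]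
  refine Finset.sum_congr rfl fun i _ => ?_
  rw [map_smul, coordField, coordMap, (chartAt F q').left_inv h2.2]
  rfl

theorem differentiableAt_coordAlong_change {p x : M} (hx : x ∈ (chartAt E p).source) {q q' : N}
    {φ : M → N} (hq : φ x ∈ (chartAt F q).source) (hq' : φ x ∈ (chartAt F q').source)
    (hφ : MDifferentiableAt 𝓘(ℝ, E) 𝓘(ℝ, F) φ x) {s : ∀ x : M, TangentSpace 𝓘(ℝ, F) (φ x)}
    (hs : DifferentiableAt ℝ (coordAlong p q φ s) (chartAt E p x)) :
    DifferentiableAt ℝ (coordAlong p q' φ s) (chartAt E p x) := by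
  refine DifferentiableAt.congr_of_eventuallyEq ?_
    (coordAlong_change hx hq hq' hφ.continuousAt s)
  refine DifferentiableAt.fun_sum fun i _ => ?_
  have h1 : DifferentiableAt ℝ (coordField q' (constField q (stdB F i)))
      (coordMap p q' φ (chartAt E p x)) := by
    rw [coordMap_chart hx]
    exact ((contMDiffAt_section_iff_coord hq').1
      (contMDiffAt_constField hq _)).differentiableAt_of_smooth
  exact ((stdCo F i).differentiableAt.comp _ hs).smul
    (h1.comp _ (differentiableAt_coordMap hx hq' hφ))

theorem extend_eq_constField {y : N} (v : TangentSpace 𝓘(ℝ, F) y) :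
    (FiberBundle.extend F v : ∀ y' : N, TangentSpace 𝓘(ℝ, F) y') =ᶠ[nhds y]
      constField y (tcoord y y v) := by
  filter_upwards [(chartAt F y).open_source.mem_nhds (mem_chart_source F y)] with y' hy'
  rw [constField, tvec, Trivialization.symmL_apply _ (mem_baseSet_of_mem_source hy'),
    tcoord_apply (mem_chart_source F y)]
  rfl

theorem tcoord_pullbackCov (D' : CovariantDerivative 𝓘(ℝ, F) F (TangentSpace 𝓘(ℝ, F) : N → Type _))
    {p x : M} (hx : x ∈ (chartAt E p).source) {q : N} {φ : M → N}
    (hq : φ x ∈ (chartAt F q).source) (hφ : MDifferentiableAt 𝓘(ℝ, E) 𝓘(ℝ, F) φ x)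
    {s : ∀ x : M, TangentSpace 𝓘(ℝ, F) (φ x)}
    (hs : DifferentiableAt ℝ (coordAlong p q φ s) (chartAt E p x)) (v : TangentSpace 𝓘(ℝ, E) x) :
    tcoord q (φ x) (pullbackCov D' φ s x v)
      = alongDeriv (christoffel D' q) (coordMap p q φ) (coordAlong p q φ s) (chartAt E p x)
        (tcoord p x v) := by
  have hq0 := mem_chart_source F (φ x)
  have hs0 := differentiableAt_coordAlong_change hx hq hq0 hφ hs
  have hB : ∀ i, ContDiffAt ℝ ∞ (coordField q (constField (φ x) (stdB F i)))
      (chartAt F q (φ x)) := fun i =>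
    (contMDiffAt_section_iff_coord hq).1 (contMDiffAt_constField hq0 _)
  have hBd : ∀ i, DifferentiableAt ℝ (coordField q (constField (φ x) (stdB F i)))
      (coordMap p q φ (chartAt E p x)) := by
    intro i; rw [coordMap_chart hx]; exact (hB i).differentiableAt_of_smooth
  have hf := differentiableAt_coordMap hx hq hφ
  -- The extension of s x has constant coefficients in the frame at φ x. Its derivative along df
  -- supplies one half of the product rule for ∑ sᵢ (Eᵢ ∘ φ) in the chart q; the derivatives of the
  -- sᵢ supply the other.
  have hext : coordField q (FiberBundle.extend F (s x) : ∀ y' : N, TangentSpace 𝓘(ℝ, F) y')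
      =ᶠ[nhds (chartAt F q (φ x))] fun y => ∑ i, stdCo F i (coordAlong p (φ x) φ s (chartAt E p x)) •
          coordField q (constField (φ x) (stdB F i)) y := by
    have h1 : Filter.Tendsto (chartAt F q).symm (nhds (chartAt F q (φ x))) (nhds (φ x)) := by
      have := (chartAt F q).continuousAt_symm ((chartAt F q).map_source hq)
      rwa [ContinuousAt, (chartAt F q).left_inv hq] at this
    filter_upwards [h1.eventually (extend_eq_constField (s x))] with y hy
    rw [coordField, hy, coordAlong_chart hx, constField]
    conv_lhs => rw [← sum_stdCo (tcoord (φ x) (φ x) (s x))]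
    rw [map_sum, map_sum]
    simp only [map_smul]
    rfl
  have hextd : MDiffAt (T% (FiberBundle.extend F (s x) : ∀ y' : N, TangentSpace 𝓘(ℝ, F) y'))
      (φ x) := (contMDiffAt_extend' (s x)).mdifferentiableAt (by simp)
  unfold pullbackCov
  dsimp only
  rw [map_add, tcoord_cov D' hq hextd, extend_apply_self, tcoord_mfderiv hx hq hφ,
    hext.fderiv_eq, alongDeriv, ← add_assoc, coordAlong_chart hx, coordMap_chart hx]
  congr 1
  swap
  · rw [coordAlong_chart hx]
  have hmd : MDifferentiableAt 𝓘(ℝ, E) 𝓘(ℝ, F)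
      (fun x' => (trivializationAt F (TangentSpace 𝓘(ℝ, F) : N → Type _) (φ x) ⟨φ x', s x'⟩).2) x
      ∧ (fun z => (trivializationAt F (TangentSpace 𝓘(ℝ, F) : N → Type _) (φ x)
        ⟨φ ((chartAt E p).symm z), s ((chartAt E p).symm z)⟩).2)
        =ᶠ[nhds (chartAt E p x)] coordAlong p (φ x) φ s := by
    have h2 : (fun z => (trivializationAt F (TangentSpace 𝓘(ℝ, F) : N → Type _) (φ x)
        ⟨φ ((chartAt E p).symm z), s ((chartAt E p).symm z)⟩).2)
        =ᶠ[nhds (chartAt E p x)] coordAlong p (φ x) φ s := by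
      filter_upwards [eventually_source hx hq0 hφ.continuousAt] with z hz
      rw [coordAlong, tcoord_apply hz.2]
    exact ⟨(mdifferentiableAt_iff_coord hx).2 (hs0.congr_of_eventuallyEq h2), h2⟩
  rw [mvfderiv_eq_fderiv hx hmd.1, hmd.2.fderiv_eq]
  rw [(coordAlong_change hx hq0 hq hφ.continuousAt s).fderiv_eq]
  have hsum : ∀ i ∈ Finset.univ, DifferentiableAt ℝ (fun z => stdCo F i
      (coordAlong p (φ x) φ s z) • coordField q (constField (φ x) (stdB F i)) (coordMap p q φ z))
      (chartAt E p x) := fun i _ => ((stdCo F i).differentiableAt.comp _ hs0).smul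
        ((hBd i).comp _ hf)
  have hsum' : ∀ i ∈ Finset.univ, DifferentiableAt ℝ (fun y => stdCo F i
      (tcoord (φ x) (φ x) (s x)) • coordField q (constField (φ x) (stdB F i)) y)
      (chartAt F q (φ x)) := fun i _ => ((hB i).differentiableAt_of_smooth).const_smul _
  rw [fderiv_fun_sum hsum, fderiv_fun_sum hsum',
    sum_apply, sum_apply]
  have hw : ∀ w : F, tcoord q (φ x) ((trivializationAt F (TangentSpace 𝓘(ℝ, F) : N → Type _)
      (φ x)).symm (φ x) w) = ∑ i, stdCo F i w • coordField q (constField (φ x) (stdB F i))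
        (chartAt F q (φ x)) := by
    intro w
    have : (trivializationAt F (TangentSpace 𝓘(ℝ, F) : N → Type _) (φ x)).symm (φ x) w
        = tvec (φ x) (φ x) w :=
      (Trivialization.symmL_apply _ (mem_baseSet_of_mem_source hq0) w).symm
    rw [this]
    conv_lhs => rw [← sum_stdCo w]
    simp only [map_sum, map_smul, coordField_chart hq]
    rfl
  rw [hw, ← Finset.sum_add_distrib]
  refine Finset.sum_congr rfl fun i _ => ?_
  have h4 : HasFDerivAt (fun z => stdCo F i (coordAlong p (φ x) φ s z))
      ((stdCo F i).comp (fderiv ℝ (coordAlong p (φ x) φ s) (chartAt E p x))) (chartAt E p x) :=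
    (stdCo F i).hasFDerivAt.comp _ hs0.hasFDerivAt
  have h5 := (hBd i).hasFDerivAt.comp _ hf.hasFDerivAt
  have h6 := (h4.smul h5).fderiv
  refine Eq.trans ?_ (congrArg (fun L : E →L[ℝ] F => L (tcoord p x v)) h6).symm
  have h7 : fderiv ℝ (fun y => stdCo F i (tcoord (φ x) (φ x) (s x)) •
      coordField q (constField (φ x) (stdB F i)) y) (chartAt F q (φ x))
      = stdCo F i (tcoord (φ x) (φ x) (s x)) •
        fderiv ℝ (coordField q (constField (φ x) (stdB F i))) (chartAt F q (φ x)) :=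
    fderiv_fun_const_smul ((hB i).differentiableAt_of_smooth) _
  rw [h7]
  simp only [add_apply, smul_apply, ContinuousLinearMap.comp_apply,
    ContinuousLinearMap.smulRight_apply, Function.comp_apply, coordMap_chart hx,
    coordAlong_chart hx]
  abel

theorem coordAlong_mfderiv {p x : M} (hx : x ∈ (chartAt E p).source) {q : N} {φ : M → N}
    (hq : φ x ∈ (chartAt F q).source) (hφ : ContMDiff 𝓘(ℝ, E) 𝓘(ℝ, F) ∞ φ)
    (X : ∀ x : M, TangentSpace 𝓘(ℝ, E) x) :
    coordAlong p q φ (fun y => mfderiv 𝓘(ℝ, E) 𝓘(ℝ, F) φ y (X y)) =ᶠ[nhds (chartAt E p x)]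
      fun z => fderiv ℝ (coordMap p q φ) z (coordField p X z) := by
  filter_upwards [eventually_source hx hq hφ.continuous.continuousAt] with z hz
  have h := tcoord_mfderiv (symm_mem_source hz.1) hz.2
    ((hφ.mdifferentiable (by simp)) ((chartAt E p).symm z)) (X ((chartAt E p).symm z))
  rw [(chartAt E p).right_inv hz.1] at h
  exact h

theorem tcoord_secondFundamentalForm
    (D : CovariantDerivative 𝓘(ℝ, E) E (TangentSpace 𝓘(ℝ, E) : M → Type _))
    (D' : CovariantDerivative 𝓘(ℝ, F) F (TangentSpace 𝓘(ℝ, F) : N → Type _))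
    {p x : M} (hx : x ∈ (chartAt E p).source) {q : N} {φ : M → N}
    (hq : φ x ∈ (chartAt F q).source) (hφ : ContMDiff 𝓘(ℝ, E) 𝓘(ℝ, F) ∞ φ)
    (u v : TangentSpace 𝓘(ℝ, E) x) :
    tcoord q (φ x) (secondFundamentalForm D D' φ x u v)
      = flatHess (christoffel D p) (christoffel D' q) (coordMap p q φ) (chartAt E p x)
        (tcoord p x v) (tcoord p x u) := by
  have hφd : MDifferentiableAt 𝓘(ℝ, E) 𝓘(ℝ, F) φ x := (hφ.mdifferentiable (by simp)) x
  have hfs : ContDiffAt ℝ ∞ (coordMap (F := F) p q φ) (chartAt E p x) :=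
    contDiffAt_coordMap hx hq (hφ x)
  have hXs : ContDiffAt ℝ ∞ (coordField p
      (FiberBundle.extend E u : ∀ y : M, TangentSpace 𝓘(ℝ, E) y)) (chartAt E p x) :=
    (contMDiffAt_section_iff_coord hx).1 (contMDiffAt_extend' u)
  have hev := coordAlong_mfderiv hx hq hφ
    (FiberBundle.extend E u : ∀ y : M, TangentSpace 𝓘(ℝ, E) y)
  have hd1 := hfs.fderiv_smooth.differentiableAt_of_smooth
  have hd2 := hXs.differentiableAt_of_smooth
  rw [secondFundamentalForm, map_sub, tcoord_pullbackCov D' hx hq hφd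
      ((hd1.clm_apply hd2).congr_of_eventuallyEq hev),
    tcoord_mfderiv hx hq hφd, tcoord_cov D hx
      ((contMDiffAt_extend' u).mdifferentiableAt (by simp)), alongDeriv, hev.fderiv_eq,
    hev.eq_of_nhds, fderiv_apply_fun hd1 hd2, flatHess_apply, coordField_chart hx,
    extend_apply_self, map_add]
  abel

end Maps

/-! ### Tensor fields in charts, and smoothness of Christoffel symbols -/

section Tensors

variable {E : Type*} [NormedAddCommGroup E] [NormedSpace ℝ E] [FiniteDimensional ℝ E]
  {M : Type*} [TopologicalSpace M] [ChartedSpace E M] [IsManifold 𝓘(ℝ, E) ∞ M]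

/-- The coordinate expression of an endomorphism field. -/
noncomputable def coordEndo (p : M)
    (J : ∀ x : M, TangentSpace 𝓘(ℝ, E) x →L[ℝ] TangentSpace 𝓘(ℝ, E) x) (z : E) : E →L[ℝ] E :=
  (tcoord p ((chartAt E p).symm z)).comp
    ((J ((chartAt E p).symm z)).comp (tvec p ((chartAt E p).symm z)))

theorem coordEndo_chart {p x : M} (hx : x ∈ (chartAt E p).source)
    (J : ∀ x : M, TangentSpace 𝓘(ℝ, E) x →L[ℝ] TangentSpace 𝓘(ℝ, E) x)
    (v : TangentSpace 𝓘(ℝ, E) x) :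
    coordEndo p J (chartAt E p x) (tcoord p x v) = tcoord p x (J x v) := by
  rw [coordEndo, (chartAt E p).left_inv hx, ContinuousLinearMap.comp_apply,
    ContinuousLinearMap.comp_apply, tvec_tcoord hx]

theorem coordField_endo {p : M} {z : E} (hz : z ∈ (chartAt E p).target)
    (J : ∀ x : M, TangentSpace 𝓘(ℝ, E) x →L[ℝ] TangentSpace 𝓘(ℝ, E) x)
    (X : ∀ x : M, TangentSpace 𝓘(ℝ, E) x) :
    coordField p (fun y => J y (X y)) z = coordEndo p J z (coordField p X z) := by
  rw [coordEndo, ContinuousLinearMap.comp_apply,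
    ContinuousLinearMap.comp_apply, coordField, coordField, tvec_tcoord (symm_mem_source hz)]

/-- The function `g` of two vectors is bilinear. -/
def IsBilin {V : Type*} [AddCommGroup V] [Module ℝ V] (g : V → V → ℝ) : Prop :=
  ∃ b : V →ₗ[ℝ] V →ₗ[ℝ] ℝ, ∀ u v, g u v = b u v

/-- The coordinate expression of a field of bilinear forms. -/
noncomputable def coordBilin (p : M)
    (g : ∀ x : M, TangentSpace 𝓘(ℝ, E) x → TangentSpace 𝓘(ℝ, E) x → ℝ) (z : E) :
    E →L[ℝ] E →L[ℝ] ℝ :=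
  ∑ i, ∑ j, (g ((chartAt E p).symm z) (constField p (stdB E i) ((chartAt E p).symm z))
    (constField p (stdB E j) ((chartAt E p).symm z))) • (stdCo E i).smulRight (stdCo E j)

theorem coordBilin_apply {p : M}
    {g : ∀ x : M, TangentSpace 𝓘(ℝ, E) x → TangentSpace 𝓘(ℝ, E) x → ℝ} {z : E}
    (hg : IsBilin (g ((chartAt E p).symm z))) (u v : E) :
    coordBilin p g z u v = g ((chartAt E p).symm z) (tvec p ((chartAt E p).symm z) u)
      (tvec p ((chartAt E p).symm z) v) := by
  obtain ⟨b, hb⟩ := hg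
  conv_rhs => rw [← sum_stdCo u, ← sum_stdCo v, hb]
  simp only [coordBilin, map_sum, map_smul, LinearMap.sum_apply, LinearMap.smul_apply, sum_apply,
    smul_apply, ContinuousLinearMap.smulRight_apply, smul_eq_mul, hb, constField, Finset.mul_sum]
  rw [Finset.sum_comm]
  refine Finset.sum_congr rfl fun i _ => Finset.sum_congr rfl fun j _ => ?_
  ring

theorem coordBilin_chart {p x : M} (hx : x ∈ (chartAt E p).source)
    {g : ∀ x : M, TangentSpace 𝓘(ℝ, E) x → TangentSpace 𝓘(ℝ, E) x → ℝ} (hg : IsBilin (g x))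
    (u v : TangentSpace 𝓘(ℝ, E) x) :
    coordBilin p g (chartAt E p x) (tcoord p x u) (tcoord p x v) = g x u v := by
  have h := (chartAt E p).left_inv hx
  rw [coordBilin_apply (by rwa [h]), h, tvec_tcoord hx, tvec_tcoord hx]

theorem contDiffOn_coordBilin {p : M}
    {g : ∀ x : M, TangentSpace 𝓘(ℝ, E) x → TangentSpace 𝓘(ℝ, E) x → ℝ}
    (hg : ∀ u v : E, ∀ x ∈ (chartAt E p).source, ContMDiffAt 𝓘(ℝ, E) 𝓘(ℝ, ℝ) ∞
      (fun x => g x (constField p u x) (constField p v x)) x) :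
    ContDiffOn ℝ ∞ (coordBilin p g) (chartAt E p).target := by
  refine ContDiffOn.sum fun i _ => ContDiffOn.sum fun j _ => ?_
  have h1 : ContDiffOn ℝ ∞ (fun z => g ((chartAt E p).symm z)
      (constField p (stdB E i) ((chartAt E p).symm z))
      (constField p (stdB E j) ((chartAt E p).symm z))) (chartAt E p).target := by
    intro z hz
    have h := (contMDiffAt_iff_coord (symm_mem_source hz)).1
      (hg (stdB E i) (stdB E j) _ (symm_mem_source hz))
    rw [(chartAt E p).right_inv hz] at h
    exact h.contDiffWithinAt
  exact h1.smul contDiffOn_const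

theorem contDiffOn_coordForm {l : ∀ x : M, TangentSpace 𝓘(ℝ, E) x →L[ℝ] ℝ} (p : M)
    (hl : ContMDiff 𝓘(ℝ, E) (𝓘(ℝ, E).prod 𝓘(ℝ, E →L[ℝ] ℝ)) ∞
      (fun x => TotalSpace.mk' (E →L[ℝ] ℝ)
        (E := fun x => TangentSpace 𝓘(ℝ, E) x →L[ℝ] Trivial M ℝ x) x (l x))) :
    ContDiffOn ℝ ∞ (coordForm p l) (chartAt E p).target := by
  rw [contDiffOn_clm_apply]
  intro w z hz
  have h : ContMDiffAt 𝓘(ℝ, E) (𝓘(ℝ, E).prod 𝓘(ℝ, ℝ)) ∞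
      (fun x => TotalSpace.mk' ℝ (E := Trivial M ℝ) x (l x (constField p w x)))
      ((chartAt E p).symm z) :=
    ContMDiffAt.clm_bundle_apply (hl _) (contMDiffAt_constField (symm_mem_source hz) w)
  simp only [contMDiffAt_totalSpace] at h
  have h2 := (contMDiffAt_iff_coord (symm_mem_source hz)).1 h.2
  rw [(chartAt E p).right_inv hz] at h2
  exact h2.contDiffWithinAt

theorem contMDiffAt_endo_field
    {J : ∀ x : M, TangentSpace 𝓘(ℝ, E) x →L[ℝ] TangentSpace 𝓘(ℝ, E) x}
    (hJ : ContMDiff 𝓘(ℝ, E) (𝓘(ℝ, E).prod 𝓘(ℝ, E →L[ℝ] E)) ∞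
      (fun x => TotalSpace.mk' (E →L[ℝ] E)
        (E := fun x => TangentSpace 𝓘(ℝ, E) x →L[ℝ] TangentSpace 𝓘(ℝ, E) x) x (J x)))
    {X : ∀ x : M, TangentSpace 𝓘(ℝ, E) x} {x : M} (hX : CMDiffAt ∞ (T% X) x) :
    CMDiffAt ∞ (T% (fun y => J y (X y))) x :=
  ContMDiffAt.clm_bundle_apply (hJ _) hX

theorem contDiffOn_coordEndo
    {J : ∀ x : M, TangentSpace 𝓘(ℝ, E) x →L[ℝ] TangentSpace 𝓘(ℝ, E) x} (p : M)
    (hJ : ContMDiff 𝓘(ℝ, E) (𝓘(ℝ, E).prod 𝓘(ℝ, E →L[ℝ] E)) ∞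
      (fun x => TotalSpace.mk' (E →L[ℝ] E)
        (E := fun x => TangentSpace 𝓘(ℝ, E) x →L[ℝ] TangentSpace 𝓘(ℝ, E) x) x (J x))) :
    ContDiffOn ℝ ∞ (coordEndo p J) (chartAt E p).target := by
  rw [contDiffOn_clm_apply]
  intro w z hz
  have h := (contMDiffAt_section_iff_coord (symm_mem_source hz)).1
    (contMDiffAt_endo_field hJ (contMDiffAt_constField (symm_mem_source hz) w))
  rw [(chartAt E p).right_inv hz] at h
  exact h.contDiffWithinAt

theorem contMDiffAt_bilin_field
    {g : ∀ x : M, TangentSpace 𝓘(ℝ, E) x →L[ℝ] TangentSpace 𝓘(ℝ, E) x →L[ℝ] ℝ}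
    (hg : ContMDiff 𝓘(ℝ, E) (𝓘(ℝ, E).prod 𝓘(ℝ, E →L[ℝ] E →L[ℝ] ℝ)) ∞
      (fun x => TotalSpace.mk' (E →L[ℝ] E →L[ℝ] ℝ)
        (E := fun x => TangentSpace 𝓘(ℝ, E) x →L[ℝ] TangentSpace 𝓘(ℝ, E) x →L[ℝ] ℝ) x (g x)))
    {X Y : ∀ x : M, TangentSpace 𝓘(ℝ, E) x} {x : M} (hX : CMDiffAt ∞ (T% X) x)
    (hY : CMDiffAt ∞ (T% Y) x) :
    ContMDiffAt 𝓘(ℝ, E) 𝓘(ℝ, ℝ) ∞ (fun x => g x (X x) (Y x)) x := by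
  have h : ContMDiffAt 𝓘(ℝ, E) (𝓘(ℝ, E).prod 𝓘(ℝ, ℝ)) ∞
      (fun x => TotalSpace.mk' ℝ (E := Trivial M ℝ) x (g x (X x) (Y x))) x :=
    ContMDiffAt.clm_bundle_apply₂ (F₁ := E) (F₂ := E) (hg _) hX hY
  simp only [contMDiffAt_totalSpace] at h
  exact h.2

/-- A connection with smooth torsion which preserves a smooth metric has smooth Christoffel
symbols. -/
theorem contDiffOn_of_metric_torsion {U : Set E} (hU : IsOpen U) {G : E → E →L[ℝ] E →L[ℝ] ℝ}
    {Γ S : E → E →L[ℝ] E →L[ℝ] E} (hG : ContDiffOn ℝ ∞ G U) (hS : ContDiffOn ℝ ∞ S U)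
    (hsymm : ∀ z ∈ U, ∀ u v, G z u v = G z v u) (hpos : ∀ z ∈ U, ∀ v, v ≠ 0 → 0 < G z v v)
    (hpar : ∀ z ∈ U, ∀ w u v, fderiv ℝ G z w u v = G z (Γ z w u) v + G z u (Γ z w v))
    (htor : ∀ z ∈ U, ∀ u v, Γ z u v - Γ z v u = S z u v) : ContDiffOn ℝ ∞ Γ U := by
  rw [contDiffOn_clm_apply]
  intro v
  rw [contDiffOn_clm_apply]
  intro a z hz
  have hGz := hG.contDiffAt_of_isOpen hU hz
  have hSz := hS.contDiffAt_of_isOpen hU hz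
  -- Koszul's formula with torsion: K y b equals G(Γ(v, a), b) but involves only G, its derivative
  -- and S. Thus Γ is smooth although no smoothness of the connection is assumed.
  let K : E → E → ℝ := fun y b => (1 / 2) * (fderiv ℝ G y v a b + fderiv ℝ G y a v b
    - fderiv ℝ G y b v a + G y (S y v a) b - G y (S y v b) a - G y (S y a b) v)
  let k : E → (E →L[ℝ] ℝ) := fun y => ∑ i, K y (stdB E i) • stdCo E i
  have hdG := hGz.fderiv_smooth
  have happ : ∀ u v w, ContDiffAt ℝ ∞ (fun y => fderiv ℝ G y u v w) z := fun u v w =>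
    ((hdG.clm_apply contDiffAt_const).clm_apply contDiffAt_const).clm_apply contDiffAt_const
  have hapS : ∀ u v w, ContDiffAt ℝ ∞ (fun y => G y (S y u v) w) z := fun u v w =>
    (hGz.clm_apply ((hSz.clm_apply contDiffAt_const).clm_apply contDiffAt_const)).clm_apply
      contDiffAt_const
  have hK : ∀ b, ContDiffAt ℝ ∞ (fun y => K y b) z := fun b =>
    contDiffAt_const.mul ((((((happ v a b).add (happ a v b)).sub (happ b v a)).add
      (hapS v a b)).sub (hapS v b a)).sub (hapS a b v))
  have hk : ContDiffAt ℝ ∞ k z := ContDiffAt.sum fun i _ => (hK _).smul contDiffAt_const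
  have hsh := (sharp_contDiffAt hGz (hpos z hz)).clm_apply hk
  refine (hsh.congr_of_eventuallyEq ?_).contDiffWithinAt
  filter_upwards [hU.mem_nhds hz] with y hy
  have hKy : ∀ b, K y b = G y (Γ y v a) b := by
    intro b
    simp only [K, hpar y hy, ← htor y hy, map_sub, sub_apply]
    rw [hsymm y hy v (Γ y a b), hsymm y hy v (Γ y b a), hsymm y hy a (Γ y v b)]
    ring
  have hky : k y = G y (Γ y v a) := by
    ext b
    conv_rhs => rw [← sum_stdCo b]
    simp only [k, sum_apply, smul_apply, map_sum, map_smul, smul_eq_mul, hKy]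
    exact Finset.sum_congr rfl fun i _ => mul_comm _ _
  have h1 : G y (sharp (G y) (k y)) = G y (Γ y v a) := by rw [sharp_spec (hpos y hy), hky]
  by_contra hne
  have h2 := hpos y hy _ (sub_ne_zero.2 hne)
  have h3 : G y (Γ y v a - sharp (G y) (k y)) = 0 := by rw [map_sub, h1, sub_self]
  rw [h3] at h2
  simp at h2

theorem metricConn_chart
    {D : CovariantDerivative 𝓘(ℝ, E) E (TangentSpace 𝓘(ℝ, E) : M → Type _)}
    {g : ∀ x : M, TangentSpace 𝓘(ℝ, E) x → TangentSpace 𝓘(ℝ, E) x → ℝ} (p : M)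
    (hg : ∀ x, IsBilin (g x)) (hsymm : ∀ x u v, g x u v = g x v u)
    (hpos : ∀ x v, v ≠ 0 → 0 < g x v v)
    (hsm : ContDiffOn ℝ ∞ (coordBilin p g) (chartAt E p).target)
    (hpar : IsParallelMetric g D) {S : E → E →L[ℝ] E →L[ℝ] E}
    (hS : ContDiffOn ℝ ∞ S (chartAt E p).target)
    (htor : ∀ z ∈ (chartAt E p).target, ∀ u v,
      christoffel D p z u v - christoffel D p z v u = S z u v) :
    MetricConn (chartAt E p).target (coordBilin p g) (christoffel D p) := by
  have hsy : ∀ z ∈ (chartAt E p).target, ∀ u v, coordBilin p g z u v = coordBilin p g z v u := by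
    intro z hz u v
    rw [coordBilin_apply (hg _), coordBilin_apply (hg _), hsymm]
  have hpo : ∀ z ∈ (chartAt E p).target, ∀ v, v ≠ 0 → 0 < coordBilin p g z v v := by
    intro z hz v hv
    rw [coordBilin_apply (hg _)]
    refine hpos _ _ fun h => hv ?_
    rw [← tcoord_tvec (symm_mem_source hz) v, h, map_zero]
  have hpa : ∀ z ∈ (chartAt E p).target, ∀ w u v, fderiv ℝ (coordBilin p g) z w u v
      = coordBilin p g z (christoffel D p z w u) v
        + coordBilin p g z u (christoffel D p z w v) := by
    intro z hz w u v
    have hs := symm_mem_source hz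
    have hr := (chartAt E p).right_inv hz
    have hd : ∀ c : E, MDiffAt (T% (constField p c)) ((chartAt E p).symm z) := fun c =>
      (contMDiffAt_constField hs c).mdifferentiableAt (by simp)
    have h := hpar (constField p u) (constField p v) _ (hd u) (hd v)
      (tvec p ((chartAt E p).symm z) w)
    have hGz : DifferentiableAt ℝ (coordBilin p g) z :=
      (hsm.contDiffAt_of_isOpen (chartAt E p).open_target hz).differentiableAt_of_smooth
    have hfun : (fun y => g ((chartAt E p).symm y) (constField p u ((chartAt E p).symm y))
        (constField p v ((chartAt E p).symm y))) = fun y => coordBilin p g y u v := by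
      funext y
      rw [coordBilin_apply (hg _)]
      rfl
    have hdf : DifferentiableAt ℝ (fun y => g ((chartAt E p).symm y)
        (constField p u ((chartAt E p).symm y)) (constField p v ((chartAt E p).symm y))) z := by
      rw [hfun]
      exact (hGz.clm_apply (differentiableAt_const u)).clm_apply (differentiableAt_const v)
    have hD : ∀ c : E, tcoord p ((chartAt E p).symm z) (D (constField p c) ((chartAt E p).symm z)
        (tvec p ((chartAt E p).symm z) w)) = christoffel D p z w c := by
      intro c
      rw [tcoord_cov D hs (hd c), hr, tcoord_tvec hs]
      have : coordField p (constField p c) =ᶠ[nhds z] fun _ => c := by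
        filter_upwards [(chartAt E p).open_target.mem_nhds hz] with y hy
        exact coordField_constField hy
      rw [this.fderiv_eq, constField, tcoord_tvec hs]
      simp
    rw [mvfderiv_eq_fderiv hs ((mdifferentiableAt_iff_coord hs).2 (by rw [hr]; exact hdf)), hr,
      hfun, tcoord_tvec hs, fderiv_apply₂_fun hGz (differentiableAt_const u)
      (differentiableAt_const v)] at h
    simp only [fderiv_fun_const, Pi.zero_apply, map_zero, zero_apply, add_zero] at h
    rw [h, coordBilin_apply (hg _), coordBilin_apply (hg _), ← hD u, ← hD v, tvec_tcoord hs,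
      tvec_tcoord hs]
    rfl
  exact ⟨(chartAt E p).open_target, hsm,
    contDiffOn_of_metric_torsion (chartAt E p).open_target hsm hS hsy hpo hpa htor, hsy, hpo, hpa⟩

theorem fderiv_coordEndo_of_parallel
    {D : CovariantDerivative 𝓘(ℝ, E) E (TangentSpace 𝓘(ℝ, E) : M → Type _)}
    {J : ∀ x : M, TangentSpace 𝓘(ℝ, E) x →L[ℝ] TangentSpace 𝓘(ℝ, E) x}
    (hJ : ContMDiff 𝓘(ℝ, E) (𝓘(ℝ, E).prod 𝓘(ℝ, E →L[ℝ] E)) ∞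
      (fun x => TotalSpace.mk' (E →L[ℝ] E)
        (E := fun x => TangentSpace 𝓘(ℝ, E) x →L[ℝ] TangentSpace 𝓘(ℝ, E) x) x (J x)))
    (hpar : IsParallelEndo J D) {p : M} {z : E} (hz : z ∈ (chartAt E p).target) (w a : E) :
    fderiv ℝ (coordEndo p J) z w a + christoffel D p z w (coordEndo p J z a)
      = coordEndo p J z (christoffel D p z w a) := by
  have hs := symm_mem_source hz
  have hr := (chartAt E p).right_inv hz
  have hc := contMDiffAt_constField hs a
  have h1 : MDiffAt (T% (constField p a)) ((chartAt E p).symm z) := hc.mdifferentiableAt (by simp)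
  have h2 : MDiffAt (T% (fun y => J y (constField p a y))) ((chartAt E p).symm z) :=
    (contMDiffAt_endo_field hJ hc).mdifferentiableAt (by simp)
  have h := congrArg (tcoord p ((chartAt E p).symm z))
    (hpar (constField p a) _ h1 (tvec p ((chartAt E p).symm z) w))
  have hJz : DifferentiableAt ℝ (coordEndo p J) z :=
    ((contDiffOn_coordEndo p hJ).contDiffAt_of_isOpen
      (chartAt E p).open_target hz).differentiableAt_of_smooth
  have e1 : coordField p (constField p a) =ᶠ[nhds z] fun _ => a := by
    filter_upwards [(chartAt E p).open_target.mem_nhds hz] with y hy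
    exact coordField_constField hy
  have e2 : coordField p (fun y => J y (constField p a y)) =ᶠ[nhds z]
      fun y => coordEndo p J y a := by
    filter_upwards [(chartAt E p).open_target.mem_nhds hz] with y hy
    rw [coordField_endo hy, coordField_constField hy]
  rw [← coordEndo_chart hs J, tcoord_cov D hs h1, tcoord_cov D hs h2, ← coordEndo_chart hs J, hr,
    tcoord_tvec hs, e1.fderiv_eq, e2.fderiv_eq, constField, tcoord_tvec hs,
    fderiv_apply_fun hJz (differentiableAt_const a)] at h
  simpa using h

end Tensors

/-! ### The Webster metric, and Sasakian structures in charts -/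

section Pseudohermitian

variable {E : Type*} [NormedAddCommGroup E] [NormedSpace ℝ E] [FiniteDimensional ℝ E]
  {M : Type*} [TopologicalSpace M] [ChartedSpace E M] [IsManifold 𝓘(ℝ, E) ∞ M]

/-- The integrability axiom speaks of globally defined fields, so a field with constant coordinates
is cut off by a bump function. -/
theorem exists_contMDiff_field [T2Space M] (x : M) (a : TangentSpace 𝓘(ℝ, E) x) :
    ∃ X : ∀ x : M, TangentSpace 𝓘(ℝ, E) x, CMDiff ∞ (T% X) ∧ X x = a := by
  let f : SmoothBumpFunction 𝓘(ℝ, E) x := Classical.choice inferInstance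
  refine ⟨(f : M → ℝ) • constField x (tcoord x x a), ?_, ?_⟩
  · refine ContMDiffOn.smul_section_of_tsupport (u := (chartAt E x).source)
      (f.contMDiff.contMDiffOn) (chartAt E x).open_source f.tsupport_subset_chartAt_source ?_
    intro y hy
    exact (contMDiffAt_constField hy _).contMDiffWithinAt
  · rw [Pi.smul_apply', f.eq_one, one_smul, constField, tvec_tcoord (mem_chart_source E x)]

namespace PseudohermitianStructure

variable (P : PseudohermitianStructure E M)

theorem differentiableAt_coordForm {p x : M} (hx : x ∈ (chartAt E p).source) :
    DifferentiableAt ℝ (coordForm p P.θ) (chartAt E p x) :=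
  ((contDiffOn_coordForm p P.contMDiff_θ).contDiffAt_of_isOpen (chartAt E p).open_target
    ((chartAt E p).map_source hx)).differentiableAt_of_smooth

/-- The exterior derivative of the contact form as a bilinear form. -/
noncomputable def dTheta (x : M) :
    TangentSpace 𝓘(ℝ, E) x →ₗ[ℝ] TangentSpace 𝓘(ℝ, E) x →ₗ[ℝ] ℝ :=
  LinearMap.mk₂ ℝ (fun u v =>
    fderiv ℝ (coordForm x P.θ) (chartAt E x x) (tcoord x x u) (tcoord x x v)
      - fderiv ℝ (coordForm x P.θ) (chartAt E x x) (tcoord x x v) (tcoord x x u))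
    (by intros; simp only [map_add, add_apply]; ring)
    (by intros; simp only [map_smul, smul_apply, smul_eq_mul]; ring)
    (by intros; simp only [map_add, add_apply]; ring)
    (by intros; simp only [map_smul, smul_apply, smul_eq_mul]; ring)

theorem oneFormDeriv_θ [CompleteSpace E] (x : M) (u v : TangentSpace 𝓘(ℝ, E) x) :
    oneFormDeriv P.θ x u v = P.dTheta x u v :=
  oneFormDeriv_eq_coord (mem_chart_source E x)
    (P.differentiableAt_coordForm (mem_chart_source E x)) u v

theorem dTheta_antisymm (x : M) (u v : TangentSpace 𝓘(ℝ, E) x) :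
    P.dTheta x u v = -P.dTheta x v u := by
  simp [dTheta]

theorem dTheta_T_left [CompleteSpace E] (x : M) (v : TangentSpace 𝓘(ℝ, E) x) :
    P.dTheta x (P.T x) v = 0 := by
  rw [← P.oneFormDeriv_θ, P.dθ_T]

theorem dTheta_T_right [CompleteSpace E] (x : M) (v : TangentSpace 𝓘(ℝ, E) x) :
    P.dTheta x v (P.T x) = 0 := by
  rw [dTheta_antisymm, P.dTheta_T_left, neg_zero]

theorem θ_projH (x : M) (u : TangentSpace 𝓘(ℝ, E) x) : P.θ x (P.projH x u) = 0 := by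
  simp [projH, P.θ_T]

theorem J_projH (x : M) (u : TangentSpace 𝓘(ℝ, E) x) : P.J x (P.projH x u) = P.J x u := by
  simp [projH, P.J_T]

theorem J_J_apply (x : M) (u : TangentSpace 𝓘(ℝ, E) x) :
    P.J x (P.J x u) = -u + P.θ x u • P.T x := by
  rw [← P.J_projH x u, P.J_J x _ (P.θ_projH x u), projH]
  abel

theorem webster_eq [CompleteSpace E] (x : M) (u v : TangentSpace 𝓘(ℝ, E) x) :
    P.webster x u v = P.dTheta x u (P.J x v) + P.θ x u * P.θ x v := by
  rw [webster, P.oneFormDeriv_θ, J_projH, projH]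
  simp only [map_sub, map_smul, LinearMap.sub_apply, LinearMap.smul_apply, P.dTheta_T_left,
    smul_zero, sub_zero]

theorem webster_isBilin [CompleteSpace E] (x : M) : IsBilin (P.webster x) := by
  refine ⟨LinearMap.mk₂ ℝ (P.webster x) ?_ ?_ ?_ ?_, fun u v => rfl⟩ <;> intros <;>
    simp only [P.webster_eq, map_add, map_smul, LinearMap.add_apply, LinearMap.smul_apply,
      smul_eq_mul] <;> ring

/-- The horizontal part of a smooth vector field is smooth. -/
theorem contMDiff_horizontal {X : ∀ x : M, TangentSpace 𝓘(ℝ, E) x} (hX : CMDiff ∞ (T% X)) :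
    CMDiff ∞ (T% (X - (fun x => P.θ x (X x)) • P.T)) := by
  have h1 : ContMDiff 𝓘(ℝ, E) 𝓘(ℝ, ℝ) ∞ (fun x => P.θ x (X x)) := by
    intro x
    have h : ContMDiffAt 𝓘(ℝ, E) (𝓘(ℝ, E).prod 𝓘(ℝ, ℝ)) ∞
        (fun x => TotalSpace.mk' ℝ (E := Trivial M ℝ) x (P.θ x (X x))) x :=
      ContMDiffAt.clm_bundle_apply (P.contMDiff_θ _) (hX x)
    simp only [contMDiffAt_totalSpace] at h
    exact h.2
  exact hX.sub_section (h1.smul_section P.contMDiff_T)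

theorem exists_horizontal_field [T2Space M] {x : M} {a : TangentSpace 𝓘(ℝ, E) x}
    (ha : P.θ x a = 0) : ∃ X : ∀ x : M, TangentSpace 𝓘(ℝ, E) x, CMDiff ∞ (T% X) ∧
      (∀ y, P.θ y (X y) = 0) ∧ X x = a := by
  obtain ⟨X, hX, hXa⟩ := exists_contMDiff_field x a
  refine ⟨_, P.contMDiff_horizontal hX, fun y => ?_, ?_⟩
  · simp [P.θ_T]
  · simp [hXa, ha]

/-- Differentiating θ(Z) = 0 trades each derivative of Z for a derivative of θ. -/
theorem θ_mlieBracket [CompleteSpace E] {X Y : ∀ x : M, TangentSpace 𝓘(ℝ, E) x} {x : M}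
    (hX : MDiffAt (T% X) x) (hY : MDiffAt (T% Y) x) (hX0 : ∀ y, P.θ y (X y) = 0)
    (hY0 : ∀ y, P.θ y (Y y) = 0) :
    P.θ x (mlieBracket 𝓘(ℝ, E) X Y x) = -P.dTheta x (X x) (Y x) := by
  have hx := mem_chart_source E x
  have h1 : ∀ Z : ∀ x : M, TangentSpace 𝓘(ℝ, E) x, MDiffAt (T% Z) x → (∀ y, P.θ y (Z y) = 0) →
      ∀ v, P.θ x (tvec x x (fderiv ℝ (coordField x Z) (chartAt E x x) (tcoord x x v)))
        = -fderiv ℝ (coordForm x P.θ) (chartAt E x x) (tcoord x x v) (tcoord x x (Z x)) := by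
    intro Z hZ hZ0 v
    have h := mvfderiv_form_field hx (P.differentiableAt_coordForm hx) hZ v
    have h0 : (fun y => P.θ y (Z y)) = fun _ => (0 : ℝ) := funext hZ0
    rw [h0, mvfderiv_const] at h
    have h' : (0 : ℝ) = _ := h
    linarith
  rw [← tvec_tcoord hx (mlieBracket 𝓘(ℝ, E) X Y x), tcoord_mlieBracket hx hX hY, map_sub, map_sub,
    h1 Y hY hY0, h1 X hX hX0]
  simp only [dTheta, LinearMap.mk₂_apply]
  ring

/-- The first half of formal integrability, θ([X, Y] - [J X, J Y]) = 0, is the J-invariance of dθ on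
H. The symmetry of the Webster metric rests on it. -/
theorem dTheta_J_J [T2Space M] [CompleteSpace E] {x : M} {u v : TangentSpace 𝓘(ℝ, E) x}
    (hu : P.θ x u = 0) (hv : P.θ x v = 0) :
    P.dTheta x (P.J x u) (P.J x v) = P.dTheta x u v := by
  obtain ⟨X, hX, hX0, rfl⟩ := P.exists_horizontal_field hu
  obtain ⟨Y, hY, hY0, rfl⟩ := P.exists_horizontal_field hv
  have h := (P.integrable X Y hX hY hX0 hY0 x).1
  have hd : ∀ {Z : ∀ x : M, TangentSpace 𝓘(ℝ, E) x}, CMDiff ∞ (T% Z) → MDiffAt (T% Z) x :=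
    fun hZ => (hZ x).mdifferentiableAt (by simp)
  have hdJ : ∀ {Z : ∀ x : M, TangentSpace 𝓘(ℝ, E) x}, CMDiff ∞ (T% Z) →
      MDiffAt (T% (fun y => P.J y (Z y))) x :=
    fun hZ => (contMDiffAt_endo_field P.contMDiff_J (hZ x)).mdifferentiableAt (by simp)
  rw [map_sub, P.θ_mlieBracket (hd hX) (hd hY) hX0 hY0,
    P.θ_mlieBracket (hdJ hX) (hdJ hY) (fun y => P.θ_J y _) (fun y => P.θ_J y _)] at h
  linarith

theorem dTheta_J_left [T2Space M] [CompleteSpace E] (x : M) (u v : TangentSpace 𝓘(ℝ, E) x) :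
    P.dTheta x (P.J x u) v = -P.dTheta x u (P.J x v) := by
  have h := P.dTheta_J_J (P.θ_J x u) (P.θ_projH x v)
  rw [J_projH, J_J_apply] at h
  simp only [projH, map_add, map_neg, map_sub, map_smul, LinearMap.add_apply, LinearMap.neg_apply,
    LinearMap.smul_apply, P.dTheta_T_left, P.dTheta_T_right, smul_zero, sub_zero, add_zero] at h
  exact h.symm

theorem webster_symm [T2Space M] [CompleteSpace E] (x : M) (u v : TangentSpace 𝓘(ℝ, E) x) :
    P.webster x u v = P.webster x v u := by
  rw [webster_eq, webster_eq, dTheta_antisymm, dTheta_J_left, neg_neg, mul_comm]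

theorem webster_J_left [T2Space M] [CompleteSpace E] (x : M) (u v : TangentSpace 𝓘(ℝ, E) x) :
    P.webster x (P.J x u) v = -P.webster x u (P.J x v) := by
  rw [webster_eq, webster_eq, dTheta_J_left, P.θ_J, P.θ_J]
  ring

theorem webster_T_left [CompleteSpace E] (x : M) (v : TangentSpace 𝓘(ℝ, E) x) :
    P.webster x (P.T x) v = P.θ x v := by
  rw [webster_eq, dTheta_T_left, P.θ_T]
  ring

theorem webster_pos [CompleteSpace E] (x : M) (v : TangentSpace 𝓘(ℝ, E) x) (hv : v ≠ 0) :
    0 < P.webster x v v := by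
  by_cases h : P.projH x v = 0
  · have h1 : v = P.θ x v • P.T x := by rwa [projH, sub_eq_zero] at h
    have h2 : P.θ x v ≠ 0 := by
      intro h0; rw [h0, zero_smul] at h1; exact hv h1
    rw [webster, J_projH, oneFormDeriv_θ, h, map_zero, LinearMap.zero_apply, zero_add]
    exact mul_self_pos.2 h2
  · have h1 := P.levi_pos x _ (P.θ_projH x v) h
    rw [webster]
    nlinarith [mul_self_nonneg (P.θ x v)]

theorem contDiffOn_coordBilin_webster [CompleteSpace E] (p : M) :
    ContDiffOn ℝ ∞ (coordBilin p P.webster) (chartAt E p).target := by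
  have hθ := contDiffOn_coordForm p P.contMDiff_θ
  have hJ := contDiffOn_coordEndo p P.contMDiff_J
  have h1 : ContDiffOn ℝ ∞ (fun z => ∑ i, ∑ j,
      (fderiv ℝ (coordForm p P.θ) z (stdB E i) (coordEndo p P.J z (stdB E j))
        - fderiv ℝ (coordForm p P.θ) z (coordEndo p P.J z (stdB E j)) (stdB E i)
        + coordForm p P.θ z (stdB E i) * coordForm p P.θ z (stdB E j)) •
      (stdCo E i).smulRight (stdCo E j)) (chartAt E p).target := by
    refine ContDiffOn.sum fun i _ => ContDiffOn.sum fun j _ => ?_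
    have hd : ContDiffOn ℝ ∞ (fderiv ℝ (coordForm p P.θ)) (chartAt E p).target := fun z hz =>
      (hθ.contDiffAt_of_isOpen (chartAt E p).open_target hz).fderiv_smooth.contDiffWithinAt
    have hJj := hJ.clm_apply (contDiffOn_const (c := stdB E j))
    have hc := contDiffOn_const (𝕜 := ℝ) (n := ∞) (s := (chartAt E p).target) (c := stdB E i)
    have hc' := contDiffOn_const (𝕜 := ℝ) (n := ∞) (s := (chartAt E p).target) (c := stdB E j)
    exact ((((hd.clm_apply hc).clm_apply hJj).sub ((hd.clm_apply hJj).clm_apply hc)).add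
      ((hθ.clm_apply hc).mul (hθ.clm_apply hc'))).smul contDiffOn_const
  refine h1.congr fun z hz => ?_
  have hs := symm_mem_source hz
  have hr := (chartAt E p).right_inv hz
  rw [coordBilin]
  refine Finset.sum_congr rfl fun i _ => Finset.sum_congr rfl fun j _ => ?_
  congr 1
  rw [webster_eq, ← oneFormDeriv_θ, oneFormDeriv_eq_coord hs (P.differentiableAt_coordForm hs),
    ← coordEndo_chart hs, hr, ← coordForm_chart hs, ← coordForm_chart hs, hr, constField,
    constField, tcoord_tvec hs, tcoord_tvec hs]

theorem mdifferentiableAt_T (x : M) : MDiffAt (T% P.T) x :=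
  (P.contMDiff_T x).mdifferentiableAt (by simp)

namespace IsTanakaWebster

variable {P} {D : CovariantDerivative 𝓘(ℝ, E) E (TangentSpace 𝓘(ℝ, E) : M → Type _)}

/-- Since θ(T) = 1 and J T = 0 identically, ∇T lies in the kernels of both θ and J. These meet only
in zero, as J² = -1 on H. -/
theorem cov_T [CompleteSpace E] (hD : P.IsTanakaWebster D) (x : M) (v : TangentSpace 𝓘(ℝ, E) x) :
    D P.T x v = 0 := by
  have h1 : P.θ x (D P.T x v) = 0 := by
    have h := hD.parallel_θ P.T x (P.mdifferentiableAt_T x) v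
    have h0 : (fun y => P.θ y (P.T y)) = fun _ => (1 : ℝ) := funext P.θ_T
    rw [h0, mvfderiv_const] at h
    exact h.symm
  have h2 : P.J x (D P.T x v) = 0 := by
    have h := hD.parallel_J P.T x (P.mdifferentiableAt_T x) v
    have h0 : (fun y => P.J y (P.T y)) = 0 := funext P.J_T
    rw [h0, D.zero] at h
    exact h.symm
  have h3 := P.J_J_apply x (D P.T x v)
  rw [h2, h1, map_zero, zero_smul, add_zero] at h3
  exact neg_eq_zero.1 h3.symm

end IsTanakaWebster

/-- The formula known on H extends to all vectors: with vanishing pseudo-Hermitian torsion, both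
sides are zero as soon as an argument is T. -/
theorem IsSasakian.torsion_eq [CompleteSpace E] {P : PseudohermitianStructure E M}
    {D : CovariantDerivative 𝓘(ℝ, E) E (TangentSpace 𝓘(ℝ, E) : M → Type _)}
    (hM : P.IsSasakian D) (x : M) (u v : TangentSpace 𝓘(ℝ, E) x) :
    D.torsion x u v = -(P.webster x u (P.J x v)) • P.T x := by
  have hu : u = P.projH x u + P.θ x u • P.T x := by rw [projH]; abel
  have hv : v = P.projH x v + P.θ x v • P.T x := by rw [projH]; abel
  have h0 : ∀ w, D.torsion x w (P.T x) = 0 := fun w => by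
    rw [D.torsion_antisymm, hM.torsion_eq_zero, neg_zero]
  have h1 : D.torsion x u v = D.torsion x (P.projH x u) (P.projH x v) := by
    conv_lhs => rw [hu, hv]
    simp only [map_add, map_smul, add_apply, smul_apply, h0, hM.torsion_eq_zero, smul_zero,
      add_zero]
  rw [h1, hM.tanakaWebster.torsion_H x _ _ (P.θ_projH x u) (P.θ_projH x v), Omega, J_projH,
    webster_eq, webster_eq, P.θ_J, mul_zero, mul_zero, projH]
  simp only [map_sub, map_smul, LinearMap.sub_apply, LinearMap.smul_apply, dTheta_T_left,
    smul_zero, sub_zero]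

theorem IsSasakian.sasakiLocal [T2Space M] [CompleteSpace E] {P : PseudohermitianStructure E M}
    {D : CovariantDerivative 𝓘(ℝ, E) E (TangentSpace 𝓘(ℝ, E) : M → Type _)}
    (hM : P.IsSasakian D) (p : M) :
    SasakiLocal (chartAt E p).target (coordBilin p P.webster) (christoffel D p)
      (coordEndo p P.J) (coordField p P.T) := by
  have hG := P.contDiffOn_coordBilin_webster p
  have hJ := contDiffOn_coordEndo p P.contMDiff_J
  have hT : ContDiffOn ℝ ∞ (coordField p P.T) (chartAt E p).target := by
    intro z hz
    have h := (contMDiffAt_section_iff_coord (symm_mem_source hz)).1 (P.contMDiff_T _)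
    rw [(chartAt E p).right_inv hz] at h
    exact h.contDiffWithinAt
  have hb := P.webster_isBilin
  have hGe : ∀ z ∈ (chartAt E p).target, ∀ u v : TangentSpace 𝓘(ℝ, E) ((chartAt E p).symm z),
      coordBilin p P.webster z (tcoord p _ u) (tcoord p _ v) = P.webster _ u v := by
    intro z hz u v
    have h := coordBilin_chart (symm_mem_source hz) (hb _) u v
    rwa [(chartAt E p).right_inv hz] at h
  have hJe : ∀ z ∈ (chartAt E p).target, ∀ u : TangentSpace 𝓘(ℝ, E) ((chartAt E p).symm z),
      coordEndo p P.J z (tcoord p _ u) = tcoord p _ (P.J _ u) := by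
    intro z hz u
    have h := coordEndo_chart (symm_mem_source hz) P.J u
    rwa [(chartAt E p).right_inv hz] at h
  -- Every coordinate vector is the reading of a tangent vector, so each identity can be checked on
  -- M.
  have hsur : ∀ z ∈ (chartAt E p).target, ∀ u : E,
      ∃ a : TangentSpace 𝓘(ℝ, E) ((chartAt E p).symm z), tcoord p _ a = u := fun z hz u =>
    ⟨_, tcoord_tvec (symm_mem_source hz) u⟩
  have htor : ∀ z ∈ (chartAt E p).target, ∀ u v,
      christoffel D p z u v - christoffel D p z v u
        = sasakiTorsion (coordBilin p P.webster) (coordEndo p P.J) (coordField p P.T) z u v := by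
    intro z hz u v
    obtain ⟨a, rfl⟩ := hsur z hz u
    obtain ⟨b, rfl⟩ := hsur z hz v
    have h := tcoord_torsion D (symm_mem_source hz) a b
    rw [(chartAt E p).right_inv hz, hM.torsion_eq, map_smul] at h
    rw [← h, sasakiTorsion_apply, hJe z hz, hGe z hz]
    rfl
  have hS : ContDiffOn ℝ ∞ (sasakiTorsion (coordBilin p P.webster) (coordEndo p P.J)
      (coordField p P.T)) (chartAt E p).target := by
    rw [contDiffOn_clm_apply]
    intro u
    rw [contDiffOn_clm_apply]
    intro v
    simp only [sasakiTorsion_apply]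
    exact (((hG.clm_apply contDiffOn_const).clm_apply (hJ.clm_apply contDiffOn_const)).neg).smul hT
  have hmc := metricConn_chart p hb P.webster_symm P.webster_pos hG hM.tanakaWebster.parallel_g
    hS htor
  refine ⟨hmc, hJ, hT, ?_, ?_, ?_, ?_, ?_, ?_, ?_⟩
  · intro z hz u v
    obtain ⟨a, rfl⟩ := hsur z hz u
    obtain ⟨b, rfl⟩ := hsur z hz v
    rw [hJe z hz, hJe z hz, hGe z hz, hGe z hz, webster_J_left]
  · intro z hz w a
    exact fderiv_coordEndo_of_parallel P.contMDiff_J hM.tanakaWebster.parallel_J hz w a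
  · intro z hz w
    obtain ⟨a, rfl⟩ := hsur z hz w
    have h := tcoord_cov D (symm_mem_source hz) (P.mdifferentiableAt_T _) a
    rw [hM.tanakaWebster.cov_T, map_zero, (chartAt E p).right_inv hz] at h
    exact h.symm
  · intro z hz
    rw [coordField, hJe z hz, P.J_T, map_zero]
  · intro z hz v
    obtain ⟨a, rfl⟩ := hsur z hz v
    rw [coordField, hJe z hz, hJe z hz, hGe z hz, J_J_apply, webster_T_left, map_add, map_neg,
      map_smul]
  · intro z hz
    rw [coordField, hGe z hz, webster_T_left, P.θ_T]
  · intro z hz u v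
    rw [htor z hz, sasakiTorsion_apply]

end PseudohermitianStructure

end Pseudohermitian

/-! ### Restriction to smaller open sets -/

section Restriction

variable {E : Type*} [NormedAddCommGroup E] [NormedSpace ℝ E]
  {U U' : Set E} {G : E → E →L[ℝ] E →L[ℝ] ℝ} {Γ : E → E →L[ℝ] E →L[ℝ] E}
  {J : E → E →L[ℝ] E} {T : E → E}

theorem MetricConn.mono (h : MetricConn U G Γ) (hU : IsOpen U') (hs : U' ⊆ U) :
    MetricConn U' G Γ :=
  ⟨hU, h.smooth_G.mono hs, h.smooth_Γ.mono hs, fun z hz => h.symm z (hs hz),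
    fun z hz => h.pos z (hs hz), fun z hz => h.parallel z (hs hz)⟩

theorem SasakiLocal.mono (h : SasakiLocal U G Γ J T) (hU : IsOpen U') (hs : U' ⊆ U) :
    SasakiLocal U' G Γ J T :=
  ⟨h.toMetricConn.mono hU hs, h.smooth_J.mono hs, h.smooth_T.mono hs,
    fun z hz => h.skew_J z (hs hz), fun z hz => h.parallel_J z (hs hz),
    fun z hz => h.parallel_T z (hs hz), fun z hz => h.J_T z (hs hz), fun z hz => h.J_J z (hs hz),
    fun z hz => h.T_unit z (hs hz), fun z hz => h.torsion z (hs hz)⟩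

end Restriction

/-- A four-linear form with the symmetries of the curvature tensor of a Kähler manifold. -/
structure IsKahlerForm {V : Type*} [AddCommGroup V] [Module ℝ V] (r : V → V → V → V → ℝ)
    (J : V → V) : Prop where
  add : ∀ a a' b c d, r (a + a') b c d = r a b c d + r a' b c d
  smul : ∀ (k : ℝ) a b c d, r (k • a) b c d = k * r a b c d
  skew : ∀ a b c d, r a b c d = -r b a c d
  pair : ∀ a b c d, r a b c d = r c d a b
  J_J_right : ∀ a b c d, r a b (J c) (J d) = r a b c d

/-! ### Kähler targets in charts, and the symmetries of their curvature -/

section Kahler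

variable {F : Type*} [NormedAddCommGroup F] [NormedSpace ℝ F] [FiniteDimensional ℝ F]
  {N : Type*} [TopologicalSpace N] [ChartedSpace F N] [IsManifold 𝓘(ℝ, F) ∞ N]
  {h : ContMDiffRiemannianMetric 𝓘(ℝ, F) ∞ F (TangentSpace 𝓘(ℝ, F) : N → Type _)}
  {D : CovariantDerivative 𝓘(ℝ, F) F (TangentSpace 𝓘(ℝ, F) : N → Type _)}
  {J : ∀ y : N, TangentSpace 𝓘(ℝ, F) y →L[ℝ] TangentSpace 𝓘(ℝ, F) y}

/-- The coordinate expression of a Riemannian metric. -/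
noncomputable abbrev coordMetric
    (h : ContMDiffRiemannianMetric 𝓘(ℝ, F) ∞ F (TangentSpace 𝓘(ℝ, F) : N → Type _)) (q : N) :
    F → F →L[ℝ] F →L[ℝ] ℝ :=
  coordBilin q (fun y u v => h.inner y u v)

theorem inner_isBilin (y : N) : IsBilin (fun u v : TangentSpace 𝓘(ℝ, F) y => h.inner y u v) :=
  ⟨LinearMap.mk₂ ℝ (fun u v => h.inner y u v) (by intros; simp) (by intros; simp)
    (by intros; simp) (by intros; simp), fun _ _ => rfl⟩

theorem coordMetric_chart {q y : N} (hy : y ∈ (chartAt F q).source)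
    (u v : TangentSpace 𝓘(ℝ, F) y) :
    coordMetric h q (chartAt F q y) (tcoord q y u) (tcoord q y v) = h.inner y u v :=
  coordBilin_chart hy (inner_isBilin y) u v

theorem contDiffOn_coordMetric (q : N) :
    ContDiffOn ℝ ∞ (coordMetric h q) (chartAt F q).target :=
  contDiffOn_coordBilin fun u v _ hx =>
    contMDiffAt_bilin_field h.contMDiff (contMDiffAt_constField hx u) (contMDiffAt_constField hx v)

theorem IsLeviCivita.christoffel_symm [CompleteSpace F]
    {g : ∀ x : N, TangentSpace 𝓘(ℝ, F) x → TangentSpace 𝓘(ℝ, F) x → ℝ} (hD : IsLeviCivita g D)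
    {q : N} {z : F} (hz : z ∈ (chartAt F q).target) (u v : F) :
    christoffel D q z u v = christoffel D q z v u := by
  have hs := symm_mem_source hz
  have h := tcoord_torsion D hs (tvec q _ u) (tvec q _ v)
  rw [(chartAt F q).right_inv hz, hD.torsion_free, map_zero, tcoord_tvec hs, tcoord_tvec hs] at h
  exact sub_eq_zero.1 h.symm

theorem IsLeviCivita.metricConn [CompleteSpace F]
    {g : ∀ x : N, TangentSpace 𝓘(ℝ, F) x → TangentSpace 𝓘(ℝ, F) x → ℝ} (hD : IsLeviCivita g D)
    (q : N) (hg : ∀ x, IsBilin (g x)) (hsymm : ∀ x u v, g x u v = g x v u)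
    (hpos : ∀ x v, v ≠ 0 → 0 < g x v v)
    (hsm : ContDiffOn ℝ ∞ (coordBilin q g) (chartAt F q).target) :
    MetricConn (chartAt F q).target (coordBilin q g) (christoffel D q) := by
  refine metricConn_chart q hg hsymm hpos hsm hD.metric (S := fun _ => 0) contDiffOn_const ?_
  intro z hz u v
  rw [hD.christoffel_symm hz, sub_self]
  rfl

namespace IsKahler

theorem metricConn [CompleteSpace F] (hN : IsKahler h D J) (q : N) :
    MetricConn (chartAt F q).target (coordMetric h q) (christoffel D q) :=
  hN.leviCivita.metricConn q inner_isBilin h.symm h.pos (contDiffOn_coordMetric q)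

theorem parallelTorsion [CompleteSpace F] (hN : IsKahler h D J) (q : N) :
    ParallelTorsion (chartAt F q).target (christoffel D q) (fun _ => 0) := by
  refine ⟨?_, fun z _ => differentiableAt_const _, ?_, ?_⟩
  · intro z hz u v
    rw [hN.leviCivita.christoffel_symm hz, sub_self]
    rfl
  · intro z _ w u v
    simp
  · intro z _ u v w
    simp

theorem inner_curvature_eq [CompleteSpace F] (hN : IsKahler h D J) {q y : N}
    (hy : y ∈ (chartAt F q).source) (a b c d : TangentSpace 𝓘(ℝ, F) y) :
    h.inner y (curvature D y a b c) d = coordMetric h q (chartAt F q y)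
      (flatCurv (christoffel D q) (chartAt F q y) (tcoord q y a) (tcoord q y b) (tcoord q y c))
      (tcoord q y d) := by
  rw [← coordMetric_chart hy, tcoord_curvature D hy
    ((hN.metricConn q).diff_Γ ((chartAt F q).map_source hy))]

/-- A Levi-Civita connection is the case of zero torsion in the coordinate theory, which gives
skewness and pair symmetry. Invariance under J in the last pair holds because the curvature commutes
with the parallel J and J is orthogonal. The last two arguments are exchanged to match the
convention for Q. -/
theorem isKahlerForm [CompleteSpace F] (hN : IsKahler h D J) (y : N) :
    IsKahlerForm (fun a b c d : TangentSpace 𝓘(ℝ, F) y => h.inner y (curvature D y a b d) c)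
      (J y) := by
  have hy := mem_chart_source F y
  have hz := (chartAt F y).map_source hy
  have hm := hN.metricConn y
  have hsk := hm.curv_skew hz
  have hpair := hm.curv_pair_symm hz (hN.parallelTorsion y)
  have hJ := flatCurv_endo (chartAt F y).open_target (contDiffOn_coordEndo y hN.contMDiff_J)
    (fun z hz w a => fderiv_coordEndo_of_parallel hN.contMDiff_J hN.parallel_J hz w a) hz
    (hm.diff_Γ hz)
  have hsy := hm.symm _ hz
  refine ⟨?_, ?_, ?_, ?_, ?_⟩
  · intro a a' b c d
    simp only [hN.inner_curvature_eq hy, flatCurv_eq_L, map_add, LinearMap.add_apply, add_apply]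
  · intro k a b c d
    simp only [hN.inner_curvature_eq hy, flatCurv_eq_L, map_smul, LinearMap.smul_apply, smul_apply,
      smul_eq_mul]
  · intro a b c d
    simp only [hN.inner_curvature_eq hy]
    rw [flatCurv_antisymm, map_neg, neg_apply]
  · intro a b c d
    simp only [hN.inner_curvature_eq hy]
    rw [hpair, hsk, flatCurv_antisymm, map_neg, neg_neg, hsy]
  · intro a b c d
    simp only [hN.inner_curvature_eq hy]
    rw [← coordEndo_chart hy, ← coordEndo_chart hy, hJ, coordEndo_chart hy]
    have hh : ∀ u v : F, coordMetric h y (chartAt F y y) (coordEndo y J (chartAt F y y) u)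
        (coordEndo y J (chartAt F y y) v) = coordMetric h y (chartAt F y y) u v := by
      intro u v
      have e1 := tcoord_tvec hy u
      have e2 := tcoord_tvec hy v
      rw [← e1, ← e2, coordEndo_chart hy, coordEndo_chart hy, coordMetric_chart hy,
        coordMetric_chart hy, hN.hermitian]
    rw [← coordEndo_chart hy, hh]

end IsKahler

end Kahler

/-! ### Local expression of a map in a pair of charts -/

section LocalMap

variable {E : Type*} [NormedAddCommGroup E] [NormedSpace ℝ E] [FiniteDimensional ℝ E]
  {M : Type*} [TopologicalSpace M] [ChartedSpace E M] [IsManifold 𝓘(ℝ, E) ∞ M]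
  {F : Type*} [NormedAddCommGroup F] [NormedSpace ℝ F] [FiniteDimensional ℝ F]
  {N : Type*} [TopologicalSpace N] [ChartedSpace F N] [IsManifold 𝓘(ℝ, F) ∞ N]

/-- The part of the domain of the chart at `p` which `φ` maps to the domain of the chart at `q`. -/
def coordDomain (p : M) (q : N) (φ : M → N) : Set E :=
  (chartAt E p).target ∩ (chartAt E p).symm ⁻¹' (φ ⁻¹' (chartAt F q).source)

theorem isOpen_coordDomain (p : M) (q : N) {φ : M → N} (hφ : Continuous φ) :
    IsOpen (coordDomain (E := E) (F := F) p q φ) :=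
  (chartAt E p).isOpen_inter_preimage_symm ((chartAt F q).open_source.preimage hφ)

theorem mem_coordDomain {p x : M} (hx : x ∈ (chartAt E p).source) {q : N} {φ : M → N}
    (hq : φ x ∈ (chartAt F q).source) :
    chartAt E p x ∈ coordDomain (E := E) (F := F) p q φ := by
  refine ⟨(chartAt E p).map_source hx, ?_⟩
  rwa [mem_preimage, mem_preimage, (chartAt E p).left_inv hx]

variable {P : PseudohermitianStructure E M}
  {D : CovariantDerivative 𝓘(ℝ, E) E (TangentSpace 𝓘(ℝ, E) : M → Type _)}
  {h : ContMDiffRiemannianMetric 𝓘(ℝ, F) ∞ F (TangentSpace 𝓘(ℝ, F) : N → Type _)}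
  {D' : CovariantDerivative 𝓘(ℝ, F) F (TangentSpace 𝓘(ℝ, F) : N → Type _)}
  {J' : ∀ y : N, TangentSpace 𝓘(ℝ, F) y →L[ℝ] TangentSpace 𝓘(ℝ, F) y}

theorem PseudohermitianStructure.IsSasakian.sasakiLocal_coordDomain [T2Space M] [CompleteSpace E]
    (hM : P.IsSasakian D) (p : M) (q : N) {φ : M → N} (hφ : Continuous φ) :
    SasakiLocal (coordDomain (E := E) (F := F) p q φ) (coordBilin p P.webster) (christoffel D p)
      (coordEndo p P.J) (coordField p P.T) :=
  (hM.sasakiLocal p).mono (isOpen_coordDomain p q hφ) inter_subset_left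

theorem contDiffOn_coordMap (p : M) (q : N) {φ : M → N} (hφ : ContMDiff 𝓘(ℝ, E) 𝓘(ℝ, F) ∞ φ) :
    ContDiffOn ℝ ∞ (coordMap (F := F) p q φ) (coordDomain (E := E) (F := F) p q φ) := by
  intro z hz
  have := contDiffAt_coordMap (F := F) (symm_mem_source hz.1) hz.2 (hφ _)
  rw [(chartAt E p).right_inv hz.1] at this
  exact this.contDiffWithinAt

theorem localMap_chart [CompleteSpace F] {U : Set E} {p : M} {q : N} {φ : M → N}
    (hφ : ContMDiff 𝓘(ℝ, E) 𝓘(ℝ, F) ∞ φ) {G : E → E →L[ℝ] E →L[ℝ] ℝ}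
    {Γ : E → E →L[ℝ] E →L[ℝ] E} (hm : MetricConn U G Γ)
    (hU : U ⊆ coordDomain (E := E) (F := F) p q φ) (hN : IsKahler h D' J') :
    LocalMap U G Γ (chartAt F q).target (coordMetric h q) (christoffel D' q) (coordMap p q φ) :=
  ⟨hm, hN.metricConn q, fun _ hy u v => hN.leviCivita.christoffel_symm hy u v,
    (contDiffOn_coordMap p q hφ).mono hU, fun z hz => (chartAt F q).map_source (hU hz).2⟩

end LocalMap

/-! ### Derivative of the determinant -/

section Jacobi

open Matrix

variable {ι : Type*} [Fintype ι] [DecidableEq ι]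

theorem contDiff_det : ContDiff ℝ ∞ (fun M : ι → ι → ℝ => Matrix.det (Matrix.of M)) := by
  simp only [Matrix.det_apply', Matrix.of_apply]
  exact ContDiff.sum fun σ _ => contDiff_const.mul (contDiff_prod fun i _ => by fun_prop)

theorem hasDerivAt_det_one_add (B : Matrix ι ι ℝ) :
    HasDerivAt (fun t : ℝ => Matrix.det (1 + t • B)) (Matrix.trace B) 0 := by
  have h1 := (Matrix.det (1 + (Polynomial.X : Polynomial ℝ) • B.map Polynomial.C)).hasDerivAt 0
  rw [Matrix.derivative_det_one_add_X_smul] at h1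
  refine h1.congr_of_eventuallyEq (Filter.Eventually.of_forall fun t => ?_)
  change Matrix.det (1 + t • B) = Polynomial.eval t _
  rw [← Polynomial.coe_evalRingHom, RingHom.map_det]
  congr 1
  ext i j
  simp [Matrix.one_apply, Polynomial.eval_mul, apply_ite (Polynomial.eval t), mul_comm t]

/-- **Jacobi's formula** when the derivative of `A` is `Bᵀ A + A B`. -/
theorem fderiv_det_apply (A B : Matrix ι ι ℝ) (hA : A.det ≠ 0) :
    fderiv ℝ (fun M : ι → ι → ℝ => Matrix.det (Matrix.of M)) A (Bᵀ * A + A * B : Matrix ι ι ℝ)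
      = 2 * Matrix.trace B * A.det := by
  -- C solves A C = Bᵀ A + A B, so the line A + t A C = A (1 + t C) has the required velocity and a
  -- factored determinant. Its trace is twice that of B.
  obtain ⟨C, hC⟩ : ∃ C : Matrix ι ι ℝ, C = A⁻¹ * Bᵀ * A + B := ⟨_, rfl⟩
  have hu : IsUnit A.det := isUnit_iff_ne_zero.2 hA
  have hAC : A * C = Bᵀ * A + A * B := by
    rw [hC, mul_add, ← mul_assoc, ← mul_assoc, Matrix.mul_nonsing_inv _ hu, one_mul]
  have h1 : HasDerivAt (fun t : ℝ => Matrix.det (A + t • (A * C)))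
      (A.det * Matrix.trace C) 0 := by
    refine ((hasDerivAt_det_one_add C).const_mul A.det).congr_of_eventuallyEq
      (Filter.Eventually.of_forall fun t => ?_)
    change (A + t • (A * C)).det = A.det * _
    rw [← Matrix.det_mul, mul_add, mul_one, Matrix.mul_smul]
  have h2 : HasDerivAt (fun t : ℝ => ((fun i j => A i j + t * (A * C) i j) : ι → ι → ℝ))
      ((A * C : Matrix ι ι ℝ) : ι → ι → ℝ) 0 := by
    refine hasDerivAt_pi.2 fun i => hasDerivAt_pi.2 fun j => ?_
    simpa using ((hasDerivAt_id (0 : ℝ)).mul_const ((A * C) i j)).const_add (A i j)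
  have h3 : DifferentiableAt ℝ (fun M : ι → ι → ℝ => Matrix.det (Matrix.of M))
      ((fun i j => A i j + 0 * (A * C) i j) : ι → ι → ℝ) :=
    contDiff_det.contDiffAt.differentiableAt_of_smooth
  have h4 := h3.hasFDerivAt.comp_hasDerivAt (0 : ℝ) h2
  have h5 := h4.unique h1
  have h6 : ((fun i j => A i j + 0 * (A * C) i j) : ι → ι → ℝ) = A := by
    ext i j
    simp
  rw [h6] at h5
  rw [← hAC, h5, hC, Matrix.trace_add, Matrix.mul_assoc, Matrix.trace_mul_comm, Matrix.mul_assoc,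
    Matrix.mul_nonsing_inv _ hu, mul_one, Matrix.trace_transpose]
  ring

end Jacobi

/-! ### Volume densities and the divergence theorem in coordinates -/

section Density

variable {d : ℕ}

/-- The values of a bilinear form on the standard basis. -/
noncomputable def gramFun (B : EuclideanSpace ℝ (Fin d) →L[ℝ] EuclideanSpace ℝ (Fin d) →L[ℝ] ℝ) :
    Fin d → Fin d → ℝ :=
  fun i j => B (EuclideanSpace.basisFun (Fin d) ℝ i) (EuclideanSpace.basisFun (Fin d) ℝ j)

/-- The Gram matrix of a bilinear form in the standard basis. -/
noncomputable def gramMatrix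
    (B : EuclideanSpace ℝ (Fin d) →L[ℝ] EuclideanSpace ℝ (Fin d) →L[ℝ] ℝ) :
    Matrix (Fin d) (Fin d) ℝ :=
  Matrix.of (gramFun B)

/-- The volume density of a metric. -/
noncomputable def volDensity (B : EuclideanSpace ℝ (Fin d) →L[ℝ] EuclideanSpace ℝ (Fin d) →L[ℝ] ℝ) : ℝ := √(gramMatrix B).det

theorem gramMatrix_comp (B : EuclideanSpace ℝ (Fin d) →L[ℝ] EuclideanSpace ℝ (Fin d) →L[ℝ] ℝ) (L : EuclideanSpace ℝ (Fin d) →L[ℝ] EuclideanSpace ℝ (Fin d)) :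
    (gramMatrix (ContinuousLinearMap.bilinearComp B L L)).det
      = L.det ^ 2 * (gramMatrix B).det := by
  set b := (EuclideanSpace.basisFun (Fin d) ℝ).toBasis
  set A := LinearMap.toMatrix b b (L : EuclideanSpace ℝ (Fin d) →ₗ[ℝ] EuclideanSpace ℝ (Fin d)) with hA
  have hL : ∀ i, L (b i) = ∑ k, A k i • b k := by
    intro i
    rw [← b.sum_repr (L (b i))]
    simp [hA, LinearMap.toMatrix_apply]
  have h1 : gramMatrix (ContinuousLinearMap.bilinearComp B L L) = A.transpose * gramMatrix B * A := by
    ext i j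
    have e : ∀ i, EuclideanSpace.basisFun (Fin d) ℝ i = b i := by simp [b]
    simp only [gramMatrix, gramFun, Matrix.of_apply, ContinuousLinearMap.bilinearComp_apply, e, hL,
      Matrix.mul_apply, Matrix.transpose_apply, map_sum, map_smul, sum_apply, smul_apply,
      smul_eq_mul, Finset.sum_mul]
    refine Finset.sum_congr rfl fun k _ => ?_
    rw [Finset.mul_sum]
    refine Finset.sum_congr rfl fun l _ => ?_
    ring
  rw [h1, Matrix.det_mul, Matrix.det_mul, Matrix.det_transpose, hA, LinearMap.det_toMatrix]
  change _ = LinearMap.det (L : EuclideanSpace ℝ (Fin d) →ₗ[ℝ] EuclideanSpace ℝ (Fin d)) ^ 2 * _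
  ring

theorem volDensity_comp (B : EuclideanSpace ℝ (Fin d) →L[ℝ] EuclideanSpace ℝ (Fin d) →L[ℝ] ℝ) (L : EuclideanSpace ℝ (Fin d) →L[ℝ] EuclideanSpace ℝ (Fin d)) :
    volDensity (ContinuousLinearMap.bilinearComp B L L) = |L.det| * volDensity B := by
  rw [volDensity, gramMatrix_comp, Real.sqrt_mul (sq_nonneg _), Real.sqrt_sq_eq_abs, volDensity]

theorem gramMatrix_det_pos {B : EuclideanSpace ℝ (Fin d) →L[ℝ] EuclideanSpace ℝ (Fin d) →L[ℝ] ℝ} (hs : ∀ u v, B u v = B v u)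
    (hp : ∀ v, v ≠ 0 → 0 < B v v) : 0 < (gramMatrix B).det := by
  refine Matrix.PosDef.det_pos ?_
  refine Matrix.PosDef.of_dotProduct_mulVec_pos ?_ ?_
  · ext i j
    exact hs _ _
  · intro x hx
    set b := (EuclideanSpace.basisFun (Fin d) ℝ).toBasis
    have e : ∀ i, EuclideanSpace.basisFun (Fin d) ℝ i = b i := by simp [b]
    have h1 : ∑ i, x i • b i ≠ 0 := by
      intro h
      refine hx (funext fun i => ?_)
      exact linearIndependent_iff'.1 b.linearIndependent Finset.univ x h i (Finset.mem_univ i)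
    have h2 := hp _ h1
    refine h2.trans_eq ?_
    symm
    simp only [gramMatrix, gramFun, dotProduct, Matrix.mulVec, Matrix.of_apply, star_trivial, e, map_sum,
      map_smul, sum_apply, smul_apply, smul_eq_mul, Finset.mul_sum]
    rw [Finset.sum_comm]
    refine Finset.sum_congr rfl fun k _ => Finset.sum_congr rfl fun l _ => ?_
    rw [hs]
    ring

theorem volDensity_pos {B : EuclideanSpace ℝ (Fin d) →L[ℝ] EuclideanSpace ℝ (Fin d) →L[ℝ] ℝ} (hs : ∀ u v, B u v = B v u)
    (hp : ∀ v, v ≠ 0 → 0 < B v v) : 0 < volDensity B :=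
  Real.sqrt_pos.2 (gramMatrix_det_pos hs hp)

variable {U : Set (EuclideanSpace ℝ (Fin d))} {G : EuclideanSpace ℝ (Fin d) → EuclideanSpace ℝ (Fin d) →L[ℝ] EuclideanSpace ℝ (Fin d) →L[ℝ] ℝ} {Γ : EuclideanSpace ℝ (Fin d) → EuclideanSpace ℝ (Fin d) →L[ℝ] EuclideanSpace ℝ (Fin d) →L[ℝ] EuclideanSpace ℝ (Fin d)}

theorem contDiff_gramMatrix : ContDiff ℝ ∞
    (fun B : EuclideanSpace ℝ (Fin d) →L[ℝ] EuclideanSpace ℝ (Fin d) →L[ℝ] ℝ => gramFun B) := by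
  rw [contDiff_pi]
  intro i
  rw [contDiff_pi]
  intro j
  exact (contDiff_id.clm_apply contDiff_const).clm_apply contDiff_const

namespace MetricConn

variable (h : MetricConn U G Γ) {z : EuclideanSpace ℝ (Fin d)} (hz : z ∈ U)
include h hz

theorem volDensity_pos : 0 < volDensity (G z) :=
  _root_.volDensity_pos (h.symm z hz) (h.pos z hz)

theorem contDiffAt_volDensity : ContDiffAt ℝ ∞ (fun y => volDensity (G y)) z := by
  have h1 : ContDiffAt ℝ ∞ (fun y => (gramMatrix (G y)).det) z :=
    (contDiff_det.contDiffAt.comp _ contDiff_gramMatrix.contDiffAt).comp z (h.contDiffAt_G hz)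
  exact h1.sqrt (gramMatrix_det_pos (h.symm z hz) (h.pos z hz)).ne'

/-- For a parallel metric the Gram matrix A has derivative Bᵀ A + A B, where B is the matrix of Γ_w.
Jacobi's formula then gives tr Γ_w as logarithmic derivative of the density. -/
theorem fderiv_volDensity (w : EuclideanSpace ℝ (Fin d)) : fderiv ℝ (fun y => volDensity (G y)) z w
    = volDensity (G z) * ∑ i, stdCo (EuclideanSpace ℝ (Fin d)) i (Γ z w (stdB (EuclideanSpace ℝ (Fin d)) i)) := by
  set b := (EuclideanSpace.basisFun (Fin d) ℝ).toBasis
  have e : ∀ i, EuclideanSpace.basisFun (Fin d) ℝ i = b i := by simp [b]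
  set B := LinearMap.toMatrix b b (Γ z w : EuclideanSpace ℝ (Fin d) →ₗ[ℝ] EuclideanSpace ℝ (Fin d)) with hB
  have hL : ∀ i, Γ z w (b i) = ∑ k, B k i • b k := by
    intro i
    rw [← b.sum_repr (Γ z w (b i))]
    simp [hB, LinearMap.toMatrix_apply]
  have hpos := gramMatrix_det_pos (h.symm z hz) (h.pos z hz)
  have htr : ∑ i, stdCo (EuclideanSpace ℝ (Fin d)) i (Γ z w (stdB (EuclideanSpace ℝ (Fin d)) i)) = B.trace := by
    rw [hB, ← LinearMap.trace_eq_matrix_trace, LinearMap.trace_eq_matrix_trace ℝ (stdB (EuclideanSpace ℝ (Fin d)))]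
    simp [Matrix.trace, LinearMap.toMatrix_apply, stdCo]
  have hgd : HasFDerivAt (fun y => gramFun (G y))
      (fderiv ℝ (fun y => gramFun (G y)) z) z :=
    (contDiff_gramMatrix.contDiffAt.comp z (h.contDiffAt_G hz)).differentiableAt_of_smooth.hasFDerivAt
  have hgw : fderiv ℝ (fun y => gramFun (G y)) z w
      = (B.transpose * gramMatrix (G z) + gramMatrix (G z) * B : Matrix _ _ ℝ) := by
    ext i j
    have h1 := hasFDerivAt_pi'.1 (hasFDerivAt_pi'.1 hgd i) j
    have h2 := h1.fderiv
    have h3 : fderiv ℝ (fun y => G y (b i) (b j)) z w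
        = G z (Γ z w (b i)) (b j) + G z (b i) (Γ z w (b j)) := by
      rw [← h.parallel z hz]
      have hd := h.diff_G hz
      rw [fderiv_apply_const (hd.clm_apply (differentiableAt_const _)), fderiv_apply_const hd]
    have h4 := congrArg (fun L : EuclideanSpace ℝ (Fin d) →L[ℝ] ℝ => L w) h2
    have h5 : (fun y => gramFun (G y) i j) = fun y => G y (b i) (b j) := by
      ext y
      simp [gramFun, e]
    rw [h5] at h4
    refine h4.symm.trans (h3.trans ?_)
    simp only [hL, Matrix.add_apply, Matrix.mul_apply, Matrix.transpose_apply, gramMatrix, gramFun,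
      Matrix.of_apply, e, map_sum, map_smul, sum_apply, smul_apply, smul_eq_mul]
    congr 1
    exact Finset.sum_congr rfl fun _ _ => mul_comm _ _
  have hd0 : DifferentiableAt ℝ (fun M : Fin d → Fin d → ℝ => Matrix.det (Matrix.of M))
      (gramFun (G z)) := contDiff_det.contDiffAt.differentiableAt_of_smooth
  have hdet : HasFDerivAt (fun y => (gramMatrix (G y)).det)
      ((fderiv ℝ (fun M : Fin d → Fin d → ℝ => Matrix.det (Matrix.of M)) (gramFun (G z))).comp
        (fderiv ℝ (fun y => gramFun (G y)) z)) z := hd0.hasFDerivAt.comp z hgd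
  have hs := (hdet.sqrt hpos.ne').fderiv
  rw [show (fun y => volDensity (G y)) = fun y => √(gramMatrix (G y)).det from rfl, hs, htr]
  have h7 : fderiv ℝ (fun M : Fin d → Fin d → ℝ => Matrix.det (Matrix.of M)) (gramFun (G z))
      (fderiv ℝ (fun y => gramFun (G y)) z w) = 2 * B.trace * (gramMatrix (G z)).det := by
    rw [hgw]
    exact fderiv_det_apply (gramMatrix (G z)) B hpos.ne'
  rw [smul_apply, ContinuousLinearMap.comp_apply, h7, volDensity, smul_eq_mul]
  have h9 := Real.mul_self_sqrt hpos.le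
  have h8 := Real.sqrt_pos.2 hpos
  field_simp
  rw [Real.sq_sqrt hpos.le]
  ring

/-- The divergence of a vector field with respect to a volume density, when the connection has
traceless torsion. -/
theorem div_volDensity (hS : ∀ u, ∑ i, stdCo (EuclideanSpace ℝ (Fin d)) i (Γ z u (stdB (EuclideanSpace ℝ (Fin d)) i) - Γ z (stdB (EuclideanSpace ℝ (Fin d)) i) u) = 0)
    {l : EuclideanSpace ℝ (Fin d) → EuclideanSpace ℝ (Fin d) →L[ℝ] ℝ} (hl : DifferentiableAt ℝ l z) :
    ∑ i, stdCo (EuclideanSpace ℝ (Fin d)) i (fderiv ℝ (fun y => volDensity (G y) • sharp (G y) (l y)) z (stdB (EuclideanSpace ℝ (Fin d)) i))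
      = volDensity (G z) * gtrace (sharp (G z)) (formDeriv Γ l z) := by
  set X := sharp (G z) (l z) with hX
  have hρ := (h.contDiffAt_volDensity hz).differentiableAt_of_smooth
  have hsd := h.sharp_diff hz
  have h1 : ∀ w, fderiv ℝ (fun y => volDensity (G y) • sharp (G y) (l y)) z w
      = (volDensity (G z) * ∑ i, stdCo (EuclideanSpace ℝ (Fin d)) i (Γ z w (stdB (EuclideanSpace ℝ (Fin d)) i))) • X
        + volDensity (G z) • (-Γ z w X + sharp (G z) (formDeriv Γ l z w)) := by
    intro w
    rw [fderiv_fun_smul hρ (hsd.clm_apply hl), add_apply, smul_apply,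
      ContinuousLinearMap.smulRight_apply, h.fderiv_volDensity hz, fderiv_apply_fun hsd hl,
      h.fderiv_sharp hz]
    have h2 : formDeriv Γ l z w = fderiv ℝ l z w - (l z).comp (Γ z w) := by
      ext u
      rw [formDeriv_apply]
      rfl
    rw [h2, map_sub, ← hX, add_comm]
    congr 2
    abel
  have h3 : ∀ i, stdCo (EuclideanSpace ℝ (Fin d)) i (sharp (G z) (formDeriv Γ l z (stdB (EuclideanSpace ℝ (Fin d)) i)))
      = formDeriv Γ l z (stdB (EuclideanSpace ℝ (Fin d)) i) (sharp (G z) (stdCo (EuclideanSpace ℝ (Fin d)) i)) := by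
    intro i
    conv_lhs => rw [← sharp_spec (h.pos z hz) (stdCo (EuclideanSpace ℝ (Fin d)) i)]
    rw [h.symm z hz, sharp_spec (h.pos z hz)]
  have h4 : ∑ i, (∑ j, stdCo (EuclideanSpace ℝ (Fin d)) j (Γ z (stdB (EuclideanSpace ℝ (Fin d)) i) (stdB (EuclideanSpace ℝ (Fin d)) j))) * stdCo (EuclideanSpace ℝ (Fin d)) i X
      = ∑ j, stdCo (EuclideanSpace ℝ (Fin d)) j (Γ z X (stdB (EuclideanSpace ℝ (Fin d)) j)) := by
    conv_rhs => rw [← sum_stdCo X]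
    simp only [map_sum, map_smul, sum_apply, smul_apply, smul_eq_mul, Finset.sum_mul]
    rw [Finset.sum_comm]
    exact Finset.sum_congr rfl fun _ _ => Finset.sum_congr rfl fun _ _ => mul_comm _ _
  -- The density contributes the trace of v ↦ Γ(X, v), the field contributes minus the trace of v ↦
  -- Γ(v, X). They cancel because the torsion is traceless.
  have h5 := hS X
  simp only [map_sub, Finset.sum_sub_distrib] at h5
  simp only [h1, map_add, map_smul, map_neg, smul_eq_mul, h3, gtrace, Finset.sum_add_distrib,
    mul_add, mul_assoc, ← Finset.mul_sum, Finset.sum_neg_distrib, mul_neg, h4]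
  linear_combination volDensity (G z) * h5

end MetricConn

theorem integral_fderiv_eq_zero {f : EuclideanSpace ℝ (Fin d) → ℝ} (hf : ContDiff ℝ 1 f) (hc : HasCompactSupport f)
    (v : EuclideanSpace ℝ (Fin d)) : ∫ z, fderiv ℝ f z v = 0 := by
  have hi : Integrable (fun z => fderiv ℝ f z v) :=
    ((hf.continuous_fderiv (by simp)).clm_apply continuous_const).integrable_of_hasCompactSupport
      (hc.fderiv_apply (𝕜 := ℝ) v)
  have h := integral_mul_fderiv_eq_neg_fderiv_mul_of_integrable (μ := (volume : Measure (EuclideanSpace ℝ (Fin d))))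
    (f := fun _ => (1 : ℝ)) (g := f) (v := v) (by simp) (by simpa using hi)
    (by simpa using hf.continuous.integrable_of_hasCompactSupport hc)
    (fun x _ => differentiableAt_const _) (fun x _ => (hf.differentiable (by simp)) x)
  simpa using h

/-- As V vanishes on U outside the compact set K, its extension by zero is continuously
differentiable with compact support on the whole space. -/
theorem setIntegral_div_eq_zero (hU : IsOpen U) {V : EuclideanSpace ℝ (Fin d) → EuclideanSpace ℝ (Fin d)} (hV : ContDiffOn ℝ ∞ V U)
    {K : Set (EuclideanSpace ℝ (Fin d))} (hK : IsCompact K) (hKU : K ⊆ U) (h0 : ∀ z ∈ U, z ∉ K → V z = 0) :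
    ∫ z in U, ∑ i, stdCo (EuclideanSpace ℝ (Fin d)) i (fderiv ℝ V z (stdB (EuclideanSpace ℝ (Fin d)) i)) = 0 := by
  set W : EuclideanSpace ℝ (Fin d) → EuclideanSpace ℝ (Fin d) := U.indicator V with hW
  have hWU : ∀ z ∈ U, W =ᶠ[nhds z] V := fun z hz => by
    filter_upwards [hU.mem_nhds hz] with y hy
    exact indicator_of_mem hy V
  have hW0 : ∀ z, z ∉ K → W z = 0 := by
    intro z hz
    by_cases hzU : z ∈ U
    · rw [hW, indicator_of_mem hzU, h0 z hzU hz]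
    · exact indicator_of_notMem hzU V
  have hWK : ∀ z, z ∉ K → W =ᶠ[nhds z] fun _ => 0 := fun z hz => by
    filter_upwards [hK.isClosed.isOpen_compl.mem_nhds hz] with y hy
    exact hW0 y hy
  have hWs : ContDiff ℝ 1 W := by
    rw [contDiff_iff_contDiffAt]
    intro z
    by_cases hz : z ∈ K
    · exact ((hV.contDiffAt_of_isOpen hU (hKU hz)).of_le (by simp)).congr_of_eventuallyEq
        (hWU z (hKU hz))
    · exact contDiffAt_const.congr_of_eventuallyEq (hWK z hz)
  have hWc : ∀ i, HasCompactSupport (fun z => stdCo (EuclideanSpace ℝ (Fin d)) i (W z)) := fun i =>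
    HasCompactSupport.intro hK fun z hz => by rw [hW0 z hz, map_zero]
  have hWi : ∀ i, ContDiff ℝ 1 (fun z => stdCo (EuclideanSpace ℝ (Fin d)) i (W z)) := fun i =>
    (stdCo (EuclideanSpace ℝ (Fin d)) i).contDiff.comp hWs
  have hd : ∀ z i v, fderiv ℝ (fun z => stdCo (EuclideanSpace ℝ (Fin d)) i (W z)) z v = stdCo (EuclideanSpace ℝ (Fin d)) i (fderiv ℝ W z v) := by
    intro z i v
    have := ((stdCo (EuclideanSpace ℝ (Fin d)) i).hasFDerivAt.comp z
      ((hWs.differentiable (by simp)) z).hasFDerivAt).fderiv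
    exact congrArg (fun L : EuclideanSpace ℝ (Fin d) →L[ℝ] ℝ => L v) this
  have h1 : ∫ z in U, ∑ i, stdCo (EuclideanSpace ℝ (Fin d)) i (fderiv ℝ V z (stdB (EuclideanSpace ℝ (Fin d)) i))
      = ∫ z in U, ∑ i, stdCo (EuclideanSpace ℝ (Fin d)) i (fderiv ℝ W z (stdB (EuclideanSpace ℝ (Fin d)) i)) := by
    refine setIntegral_congr_fun hU.measurableSet fun z hz => ?_
    simp only [(hWU z hz).fderiv_eq]
  rw [h1, setIntegral_eq_integral_of_forall_compl_eq_zero, integral_finsetSum]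
  · refine Finset.sum_eq_zero fun i _ => ?_
    simp only [← hd]
    exact integral_fderiv_eq_zero (hWi i) (hWc i) _
  · intro i _
    simp only [← hd]
    exact (((hWi i).continuous_fderiv (by simp)).clm_apply
      continuous_const).integrable_of_hasCompactSupport ((hWc i).fderiv_apply (𝕜 := ℝ) _)
  · intro z hz
    have h2 := (hWK z fun h => hz (hKU h)).fderiv_eq (𝕜 := ℝ)
    exact Finset.sum_eq_zero fun i _ => by rw [h2]; simp

end Density

/-! ### Gluing measures on an open cover -/

section Glue

variable {X ι : Type*} [TopologicalSpace X] [CompactSpace X] [MeasurableSpace X] [BorelSpace X]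

/-- Measures on the members of an open cover which agree on overlaps are the restrictions of their
supremum. -/
theorem restrict_iSup_measure {ν : ι → Measure X} {S : ι → Set X} (hS : ∀ i, IsOpen (S i))
    (hcov : ⋃ i, S i = univ) (hν : ∀ i, ν i (S i)ᶜ = 0)
    (hov : ∀ i j A, MeasurableSet A → A ⊆ S i → A ⊆ S j → ν i A = ν j A) (i : ι) :
    (⨆ j, ν j).restrict (S i) = ν i := by
  obtain ⟨t, ht⟩ := isCompact_univ.elim_finite_subcover S hS hcov.ge
  obtain ⟨n, ⟨e⟩⟩ := Finite.exists_equiv_fin t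
  let c : ℕ → Set X := fun k => if h : k < n then S (e.symm ⟨k, h⟩) else ∅
  let D : ℕ → Set X := disjointed c
  have hcm : ∀ k, MeasurableSet (c k) := by
    intro k
    simp only [c]
    split_ifs
    · exact (hS _).measurableSet
    · exact MeasurableSet.empty
  have hDm : ∀ k, MeasurableSet (D k) := fun k => MeasurableSet.disjointed hcm k
  have hDc : ∀ k, D k ⊆ c k := fun k => disjointed_le c k
  have hDu : ⋃ k, D k = univ := by
    rw [iUnion_disjointed]
    refine eq_univ_of_forall fun x => ?_
    obtain ⟨j, hj, hx⟩ := mem_iUnion₂.1 (ht (mem_univ x))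
    refine mem_iUnion.2 ⟨e ⟨j, hj⟩, ?_⟩
    simpa [c] using hx
  -- κ uses a single ν on each piece of a disjointed finite subcover. Agreement on overlaps makes it
  -- equal to ν j inside every S j, so it bounds all the ν j. On S i the supremum is then caught
  -- between ν i and κ, which coincide there.
  let κ : Measure X := Measure.sum fun k : ℕ =>
    if h : k < n then (ν (e.symm ⟨k, h⟩)).restrict (D k) else 0
  have hκ : ∀ (j : ι) (A : Set X), MeasurableSet A → A ⊆ S j → κ A = ν j A := by
    intro j A hA hAj
    have h1 : A = ⋃ k, A ∩ D k := by rw [← inter_iUnion, hDu, inter_univ]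
    rw [Measure.sum_apply _ hA]
    conv_rhs => rw [h1, measure_iUnion (fun a b hab => ((disjoint_disjointed c hab).mono
      inter_subset_right inter_subset_right)) (fun k => hA.inter (hDm k))]
    refine tsum_congr fun k => ?_
    split_ifs with h
    · rw [Measure.restrict_apply hA]
      refine hov _ _ _ (hA.inter (hDm k)) ?_ (inter_subset_left.trans hAj)
      refine inter_subset_right.trans ((hDc k).trans ?_)
      simp [c, h]
    · have : D k = ∅ := subset_empty_iff.1 ((hDc k).trans (by simp [c, h]))
      rw [show disjointed c k = ∅ from this]
      simp
  have hnull : ∀ j A, ν j A = ν j (A ∩ S j) := by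
    intro j A
    have h1 := measure_inter_add_sdiff (μ := ν j) A (hS j).measurableSet
    have h2 : ν j (A \ S j) = 0 := measure_mono_null (fun x hx => hx.2) (hν j)
    rw [← h1, h2, add_zero]
  have hle : ∀ j, ν j ≤ κ := by
    intro j
    refine Measure.le_iff.2 fun A hA => ?_
    have h1 : ν j A ≤ ν j (A ∩ S j) := (hnull j A).le
    rw [← hκ j _ (hA.inter (hS j).measurableSet) inter_subset_right] at h1
    exact h1.trans (measure_mono inter_subset_left)
  refine Measure.ext fun A hA => ?_
  rw [Measure.restrict_apply hA]
  have hm := hA.inter (hS i).measurableSet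
  rw [hnull i A]
  refine le_antisymm ?_ (Measure.le_iff'.1 (le_iSup ν i) _)
  exact (Measure.le_iff'.1 (iSup_le hle) _).trans (hκ i _ hm inter_subset_right).le

end Glue

/-- `g` is a smooth Riemannian metric, given by its values on vectors. -/
structure IsSmoothMetric {E : Type*} [NormedAddCommGroup E] [NormedSpace ℝ E]
    [FiniteDimensional ℝ E] {M : Type*} [TopologicalSpace M] [ChartedSpace E M]
    [IsManifold 𝓘(ℝ, E) ∞ M]
    (g : ∀ x : M, TangentSpace 𝓘(ℝ, E) x → TangentSpace 𝓘(ℝ, E) x → ℝ) : Prop where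
  bilin : ∀ x, IsBilin (g x)
  symm : ∀ x u v, g x u v = g x v u
  pos : ∀ x v, v ≠ 0 → 0 < g x v v
  smooth : ∀ p, ContDiffOn ℝ ∞ (coordBilin p g) (chartAt E p).target

/-- Needed because inverse charts are continuous only on their targets. -/
theorem MeasurableSet.inter_preimage_of_continuousOn {X Y : Type*} [TopologicalSpace X]
    [MeasurableSpace X] [BorelSpace X] [TopologicalSpace Y] [MeasurableSpace Y] [BorelSpace Y]
    {f : X → Y} {s : Set X} (hs : MeasurableSet s) (hf : ContinuousOn f s) {A : Set Y}
    (hA : MeasurableSet A) : MeasurableSet (s ∩ f ⁻¹' A) := by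
  have h := hs.subtype_image ((continuousOn_iff_continuous_domRestrict.1 hf).measurable hA)
  convert h using 1
  ext x
  simp [and_comm]

/-! ### The Riemannian volume measure -/

section Volume

variable {d : ℕ} {M : Type*} [TopologicalSpace M] [ChartedSpace (EuclideanSpace ℝ (Fin d)) M]
  [IsManifold 𝓘(ℝ, EuclideanSpace ℝ (Fin d)) ∞ M] [MeasurableSpace M] [BorelSpace M]
  {g : ∀ x : M, TangentSpace 𝓘(ℝ, EuclideanSpace ℝ (Fin d)) x →
      TangentSpace 𝓘(ℝ, EuclideanSpace ℝ (Fin d)) x → ℝ}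

theorem chartVolume_eq (hg : ∀ x, IsBilin (g x)) (p : M) :
    chartVolume g p = Measure.map (chartAt (EuclideanSpace ℝ (Fin d)) p).symm
      ((volume.restrict (chartAt (EuclideanSpace ℝ (Fin d)) p).target).withDensity
        fun z => ENNReal.ofReal (volDensity (coordBilin p g z))) := by
  unfold chartVolume
  simp only
  congr 1
  refine withDensity_congr_ae ?_
  filter_upwards [ae_restrict_mem (chartAt (EuclideanSpace ℝ (Fin d)) p).open_target.measurableSet]
    with z hz
  rw [volDensity, gramMatrix]
  congr 4
  ext i j
  rw [gramFun, coordBilin_apply (hg _), mfderiv_chartAt_symm hz]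
  rfl

theorem aemeasurable_chart_symm (p : M) (f : EuclideanSpace ℝ (Fin d) → ENNReal) :
    AEMeasurable (chartAt (EuclideanSpace ℝ (Fin d)) p).symm
      ((volume.restrict (chartAt (EuclideanSpace ℝ (Fin d)) p).target).withDensity f) :=
  ((chartAt (EuclideanSpace ℝ (Fin d)) p).continuousOn_symm.aemeasurable
    (chartAt (EuclideanSpace ℝ (Fin d)) p).open_target.measurableSet).mono_ac
      (withDensity_absolutelyContinuous _ _)

theorem chartVolume_apply (hg : ∀ x, IsBilin (g x)) (p : M) {A : Set M} (hA : MeasurableSet A) :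
    chartVolume g p A = ∫⁻ z in (chartAt (EuclideanSpace ℝ (Fin d)) p).target ∩
      (chartAt (EuclideanSpace ℝ (Fin d)) p).symm ⁻¹' A,
        ENNReal.ofReal (volDensity (coordBilin p g z)) := by
  rw [chartVolume_eq hg, Measure.map_apply_of_aemeasurable (aemeasurable_chart_symm p _) hA,
    withDensity_apply', Measure.restrict_restrict'
    (chartAt (EuclideanSpace ℝ (Fin d)) p).open_target.measurableSet, inter_comm]

theorem hasFDerivAt_transition {p q : M} {z : EuclideanSpace ℝ (Fin d)}
    (hz : z ∈ (chartAt (EuclideanSpace ℝ (Fin d)) p).target)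
    (hq : (chartAt (EuclideanSpace ℝ (Fin d)) p).symm z
      ∈ (chartAt (EuclideanSpace ℝ (Fin d)) q).source) :
    HasFDerivAt (fun y => chartAt (EuclideanSpace ℝ (Fin d)) q
        ((chartAt (EuclideanSpace ℝ (Fin d)) p).symm y))
      ((tcoord q ((chartAt (EuclideanSpace ℝ (Fin d)) p).symm z)).comp
        (tvec p ((chartAt (EuclideanSpace ℝ (Fin d)) p).symm z))) z := by
  have h1 := (mdifferentiableAt_chartAt hq).hasMFDerivAt
  have h2 := (mdifferentiableAt_chartAt_symm hz).hasMFDerivAt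
  have h3 := h1.comp z h2
  rw [mfderiv_chartAt hq, mfderiv_chartAt_symm hz] at h3
  exact h3.hasFDerivAt

/-- Change of variables along the transition map: the metrics are related by its derivative, whose
absolute determinant is the factor in `volDensity_comp`. -/
theorem chartVolume_overlap (hg : ∀ x, IsBilin (g x)) (p q : M) {A : Set M} (hA : MeasurableSet A)
    (hp : A ⊆ (chartAt (EuclideanSpace ℝ (Fin d)) p).source)
    (hq : A ⊆ (chartAt (EuclideanSpace ℝ (Fin d)) q).source) :
    chartVolume g p A = chartVolume g q A := by
  set ep := chartAt (EuclideanSpace ℝ (Fin d)) p with hep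
  set eq := chartAt (EuclideanSpace ℝ (Fin d)) q with heq
  rw [chartVolume_apply hg p hA, chartVolume_apply hg q hA]
  have him : eq.target ∩ eq.symm ⁻¹' A
      = (fun y => eq (ep.symm y)) '' (ep.target ∩ ep.symm ⁻¹' A) := by
    ext w
    constructor
    · rintro ⟨hw, hwA⟩
      refine ⟨ep (eq.symm w), ⟨ep.map_source (hp hwA), ?_⟩, ?_⟩
      · rw [mem_preimage, ep.left_inv (hp hwA)]
        exact hwA
      · simp only
        rw [ep.left_inv (hp hwA), eq.right_inv hw]
    · rintro ⟨z, ⟨hz, hzA⟩, rfl⟩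
      refine ⟨eq.map_source (hq hzA), ?_⟩
      rw [mem_preimage, eq.left_inv (hq hzA)]
      exact hzA
  have hms := ep.open_target.measurableSet.inter_preimage_of_continuousOn ep.continuousOn_symm hA
  rw [← hep, ← heq, him, lintegral_image_eq_lintegral_abs_det_fderiv_mul volume hms
    (fun z hz => (hasFDerivAt_transition hz.1 (hq hz.2)).hasFDerivWithinAt)]
  · refine setLIntegral_congr_fun hms fun z hz => ?_
    rw [← ENNReal.ofReal_mul (abs_nonneg _), ← volDensity_comp]
    congr 2
    ext u v
    have hs := hq hz.2
    rw [ContinuousLinearMap.bilinearComp_apply, coordBilin_apply (hg _)]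
    exact (coordBilin_chart hs (hg _) _ _).symm
  · intro z hz w hw hzw
    have h1 : ep.symm z = ep.symm w := eq.injOn (hq hz.2) (hq hw.2) hzw
    rw [← ep.right_inv hz.1, h1, ep.right_inv hw.1]

theorem chartVolume_compl (hg : ∀ x, IsBilin (g x)) (p : M) :
    chartVolume g p (chartAt (EuclideanSpace ℝ (Fin d)) p).sourceᶜ = 0 := by
  rw [chartVolume_apply hg p (chartAt (EuclideanSpace ℝ (Fin d)) p).open_source.measurableSet.compl]
  have : (chartAt (EuclideanSpace ℝ (Fin d)) p).target ∩
      (chartAt (EuclideanSpace ℝ (Fin d)) p).symm ⁻¹'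
        (chartAt (EuclideanSpace ℝ (Fin d)) p).sourceᶜ = ∅ := by
    ext z
    simp only [mem_inter_iff, mem_preimage, mem_compl_iff, mem_empty_iff_false, iff_false, not_and,
      not_not]
    exact fun hz => symm_mem_source hz
  rw [this, Measure.restrict_empty, lintegral_zero_measure]

variable [CompactSpace M]

theorem riemannianVolume_restrict (hg : ∀ x, IsBilin (g x)) (p : M) :
    (riemannianVolume g).restrict (chartAt (EuclideanSpace ℝ (Fin d)) p).source
      = chartVolume g p :=
  restrict_iSup_measure (fun q => (chartAt (EuclideanSpace ℝ (Fin d)) q).open_source)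
    (eq_univ_of_forall fun x => mem_iUnion.2 ⟨x, mem_chart_source _ x⟩)
    (chartVolume_compl hg) (fun i j _ hA hi hj => chartVolume_overlap hg i j hA hi hj) p

theorem riemannianVolume_apply (hg : ∀ x, IsBilin (g x)) (p : M) {A : Set M}
    (hA : MeasurableSet A) (hp : A ⊆ (chartAt (EuclideanSpace ℝ (Fin d)) p).source) :
    riemannianVolume g A = ∫⁻ z in (chartAt (EuclideanSpace ℝ (Fin d)) p).target ∩
      (chartAt (EuclideanSpace ℝ (Fin d)) p).symm ⁻¹' A,
        ENNReal.ofReal (volDensity (coordBilin p g z)) := by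
  rw [← chartVolume_apply hg p hA, ← riemannianVolume_restrict hg, Measure.restrict_apply hA,
    inter_eq_left.2 hp]

namespace IsSmoothMetric

variable (hg : IsSmoothMetric g)
include hg

theorem coord_symm (p : M) (z u v : EuclideanSpace ℝ (Fin d)) :
    coordBilin p g z u v = coordBilin p g z v u := by
  rw [coordBilin_apply (hg.bilin _), coordBilin_apply (hg.bilin _), hg.symm]

theorem coord_pos (p : M) {z : EuclideanSpace ℝ (Fin d)}
    (hz : z ∈ (chartAt (EuclideanSpace ℝ (Fin d)) p).target) (v : EuclideanSpace ℝ (Fin d))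
    (hv : v ≠ 0) : 0 < coordBilin p g z v v := by
  rw [coordBilin_apply (hg.bilin _)]
  refine hg.pos _ _ fun h => hv ?_
  rw [← tcoord_tvec (symm_mem_source hz) v, h, map_zero]

theorem contDiffOn_volDensity (p : M) : ContDiffOn ℝ ∞ (fun z => volDensity (coordBilin p g z))
    (chartAt (EuclideanSpace ℝ (Fin d)) p).target := by
  intro z hz
  have h1 : ContDiffAt ℝ ∞ (fun y => (gramMatrix (coordBilin p g y)).det) z :=
    (contDiff_det.contDiffAt.comp _ contDiff_gramMatrix.contDiffAt).comp z
      ((hg.smooth p).contDiffAt_of_isOpen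
        (chartAt (EuclideanSpace ℝ (Fin d)) p).open_target hz)
  exact (h1.sqrt (gramMatrix_det_pos (hg.coord_symm p z)
    (hg.coord_pos p hz)).ne').contDiffWithinAt

theorem isFiniteMeasure_riemannianVolume : IsFiniteMeasure (riemannianVolume g) := by
  have : IsLocallyFiniteMeasure (riemannianVolume g) := by
    refine ⟨fun x => ?_⟩
    set e := chartAt (EuclideanSpace ℝ (Fin d)) x with he
    have hx := mem_chart_source (EuclideanSpace ℝ (Fin d)) x
    obtain ⟨K, hKn, hKs, hK⟩ := local_compact_nhds (e.open_target.mem_nhds (e.map_source hx))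
    have hs : e.source ∩ e ⁻¹' (interior K) ∈ nhds x :=
      (e.isOpen_inter_preimage isOpen_interior).mem_nhds
        ⟨hx, mem_interior_iff_mem_nhds.2 hKn⟩
    refine ⟨_, hs, ?_⟩
    rw [riemannianVolume_apply hg.bilin x
      (e.isOpen_inter_preimage isOpen_interior).measurableSet inter_subset_left]
    obtain ⟨C, hC⟩ := hK.exists_bound_of_continuousOn
      ((hg.contDiffOn_volDensity x).continuousOn.mono hKs)
    have hsub : e.target ∩ e.symm ⁻¹' (e.source ∩ e ⁻¹' (interior K)) ⊆ K := by
      rintro z ⟨hz, -, hzK⟩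
      rw [mem_preimage, e.right_inv hz] at hzK
      exact interior_subset hzK
    refine (lintegral_mono_set hsub).trans_lt ?_
    refine (setLIntegral_mono (g := fun _ => ENNReal.ofReal C) measurable_const ?_).trans_lt ?_
    · intro z hz
      exact ENNReal.ofReal_le_ofReal ((Real.le_norm_self _).trans (hC z hz))
    · rw [setLIntegral_const]
      exact ENNReal.mul_lt_top ENNReal.ofReal_lt_top hK.measure_lt_top
  exact CompactSpace.isFiniteMeasure

/-- The density is positive, so nonempty open sets have positive volume. This passes from a
vanishing integral of a nonnegative continuous function to pointwise vanishing. -/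
theorem isOpenPosMeasure_riemannianVolume : (riemannianVolume g).IsOpenPosMeasure := by
  refine ⟨fun U hU ⟨x, hxU⟩ h0 => ?_⟩
  set e := chartAt (EuclideanSpace ℝ (Fin d)) x with he
  have hx := mem_chart_source (EuclideanSpace ℝ (Fin d)) x
  have h1 : riemannianVolume g (e.source ∩ U) = 0 := measure_mono_null inter_subset_right h0
  rw [riemannianVolume_apply hg.bilin x (e.open_source.inter hU).measurableSet inter_subset_left]
    at h1
  have hopen : IsOpen (e.target ∩ e.symm ⁻¹' (e.source ∩ U)) :=
    e.isOpen_inter_preimage_symm (e.open_source.inter hU)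
  have hmem : e x ∈ e.target ∩ e.symm ⁻¹' (e.source ∩ U) :=
    ⟨e.map_source hx, by rw [mem_preimage, e.left_inv hx]; exact ⟨hx, hxU⟩⟩
  have hcont : ContinuousOn (fun z => volDensity (coordBilin x g z))
      (e.target ∩ e.symm ⁻¹' (e.source ∩ U)) :=
    (hg.contDiffOn_volDensity x).continuousOn.mono inter_subset_left
  rw [setLIntegral_eq_zero_iff'] at h1
  · have h2 : volume (e.target ∩ e.symm ⁻¹' (e.source ∩ U)) = 0 := by
      refine measure_mono_null (fun z hz => ?_) h1
      intro h
      have := h hz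
      rw [ENNReal.ofReal_eq_zero] at this
      exact this.not_gt (_root_.volDensity_pos (hg.coord_symm x z) (hg.coord_pos x hz.1))
    exact (hopen.measure_pos volume ⟨_, hmem⟩).ne' h2
  · exact hopen.measurableSet
  · exact (hcont.aemeasurable hopen.measurableSet).ennreal_ofReal

/-- The integral of a function supported in a chart domain. -/
theorem integral_riemannianVolume (p : M) {f : M → ℝ} (hf : Continuous f)
    (h0 : ∀ x, x ∉ (chartAt (EuclideanSpace ℝ (Fin d)) p).source → f x = 0) :
    ∫ x, f x ∂(riemannianVolume g) = ∫ z in (chartAt (EuclideanSpace ℝ (Fin d)) p).target,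
      volDensity (coordBilin p g z) * f ((chartAt (EuclideanSpace ℝ (Fin d)) p).symm z) := by
  set e := chartAt (EuclideanSpace ℝ (Fin d)) p with he
  have hae : AEMeasurable (fun z => ENNReal.ofReal (volDensity (coordBilin p g z)))
      (volume.restrict e.target) :=
    ((hg.contDiffOn_volDensity p).continuousOn.aemeasurable
      e.open_target.measurableSet).ennreal_ofReal
  rw [← setIntegral_eq_integral_of_forall_compl_eq_zero h0, riemannianVolume_restrict hg.bilin,
    chartVolume_eq hg.bilin, integral_map (aemeasurable_chart_symm p _)
      hf.aestronglyMeasurable, integral_withDensity_eq_integral_toReal_smul₀ hae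
      (Filter.Eventually.of_forall fun _ => ENNReal.ofReal_lt_top)]
  refine setIntegral_congr_fun e.open_target.measurableSet fun z hz => ?_
  have h1 := ENNReal.toReal_ofReal (Real.sqrt_nonneg (gramMatrix (coordBilin p g z)).det)
  exact congrArg (· * f (e.symm z)) h1

end IsSmoothMetric

end Volume

/-! ### Fields dual to covector fields, and the product rule for divergences -/

theorem sharp_unique {E : Type*} [NormedAddCommGroup E] [NormedSpace ℝ E] [FiniteDimensional ℝ E]
    {G : E →L[ℝ] E →L[ℝ] ℝ} (hG : ∀ v, v ≠ 0 → 0 < G v v) {l : E →L[ℝ] ℝ} {w : E}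
    (h : ∀ v, G w v = l v) : w = sharp G l := by
  have h1 : G w = G (sharp G l) := by
    rw [sharp_spec hG]
    exact ContinuousLinearMap.ext h
  by_contra hne
  have h2 := hG _ (sub_ne_zero.2 hne)
  rw [map_sub G, h1, sub_self] at h2
  simp at h2

/-- Applied with f a cut-off function: the extra terms, df paired with the dual of l, add up to zero
over a partition of unity. -/
theorem gtrace_formDeriv_mul {E : Type*} [NormedAddCommGroup E] [NormedSpace ℝ E]
    [FiniteDimensional ℝ E] {G : E →L[ℝ] E →L[ℝ] ℝ} (hG : ∀ v, v ≠ 0 → 0 < G v v)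
    (hs : ∀ u v, G u v = G v u) {Γ : E → E →L[ℝ] E →L[ℝ] E} {f : E → ℝ} {l : E → E →L[ℝ] ℝ} {z : E}
    (hf : DifferentiableAt ℝ f z) (hl : DifferentiableAt ℝ l z) :
    gtrace (sharp G) (formDeriv Γ (fun y => f y • l y) z)
      = f z * gtrace (sharp G) (formDeriv Γ l z) + fderiv ℝ f z (sharp G (l z)) := by
  have h1 : ∀ i, l z (sharp G (stdCo E i)) = stdCo E i (sharp G (l z)) := by
    intro i
    rw [← sharp_spec hG (l z), hs, sharp_spec hG, sharp_spec hG]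
  conv_rhs => rw [← sum_stdCo (sharp G (l z))]
  simp only [gtrace, formDeriv_apply, fderiv_fun_smul hf hl, add_apply, smul_apply,
    ContinuousLinearMap.smulRight_apply, smul_eq_mul, map_sum, map_smul, Finset.mul_sum, h1]
  rw [← Finset.sum_add_distrib]
  exact Finset.sum_congr rfl fun i _ => by ring

section Sharp

variable {d : ℕ} {M : Type*} [TopologicalSpace M] [ChartedSpace (EuclideanSpace ℝ (Fin d)) M]
  [IsManifold 𝓘(ℝ, EuclideanSpace ℝ (Fin d)) ∞ M]
  {g : ∀ x : M, TangentSpace 𝓘(ℝ, EuclideanSpace ℝ (Fin d)) x →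
      TangentSpace 𝓘(ℝ, EuclideanSpace ℝ (Fin d)) x → ℝ}

/-- The vector field dual to a covector field. -/
noncomputable def sharpField
    (g : ∀ x : M, TangentSpace 𝓘(ℝ, EuclideanSpace ℝ (Fin d)) x →
      TangentSpace 𝓘(ℝ, EuclideanSpace ℝ (Fin d)) x → ℝ)
    (l : ∀ x : M, TangentSpace 𝓘(ℝ, EuclideanSpace ℝ (Fin d)) x →L[ℝ] ℝ) (x : M) :
    TangentSpace 𝓘(ℝ, EuclideanSpace ℝ (Fin d)) x :=
  tvec x x (sharp (coordBilin x g (chartAt (EuclideanSpace ℝ (Fin d)) x x))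
    (coordForm x l (chartAt (EuclideanSpace ℝ (Fin d)) x x)))

theorem IsSmoothMetric.sharpField_spec [MeasurableSpace M] [BorelSpace M] [CompactSpace M]
    (hg : IsSmoothMetric g)
    (l : ∀ x : M, TangentSpace 𝓘(ℝ, EuclideanSpace ℝ (Fin d)) x →L[ℝ] ℝ) (x : M)
    (v : TangentSpace 𝓘(ℝ, EuclideanSpace ℝ (Fin d)) x) : g x (sharpField g l x) v = l x v := by
  have hx := mem_chart_source (EuclideanSpace ℝ (Fin d)) x
  rw [← coordBilin_chart hx (hg.bilin x), sharpField, tcoord_tvec hx, sharp_spec, coordForm_chart hx]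
  exact hg.coord_pos x ((chartAt (EuclideanSpace ℝ (Fin d)) x).map_source hx)

theorem IsSmoothMetric.tcoord_sharpField [MeasurableSpace M] [BorelSpace M] [CompactSpace M]
    (hg : IsSmoothMetric g)
    (l : ∀ x : M, TangentSpace 𝓘(ℝ, EuclideanSpace ℝ (Fin d)) x →L[ℝ] ℝ) {p x : M}
    (hx : x ∈ (chartAt (EuclideanSpace ℝ (Fin d)) p).source) :
    tcoord p x (sharpField g l x)
      = sharp (coordBilin p g (chartAt (EuclideanSpace ℝ (Fin d)) p x))
        (coordForm p l (chartAt (EuclideanSpace ℝ (Fin d)) p x)) := by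
  refine sharp_unique
    (hg.coord_pos p ((chartAt (EuclideanSpace ℝ (Fin d)) p).map_source hx)) fun v => ?_
  rw [← tcoord_tvec hx v, coordBilin_chart hx (hg.bilin x), hg.sharpField_spec, coordForm_chart hx]

theorem continuous_of_coord {f : M → ℝ} (hf : ∀ p : M, ContinuousOn
    (fun z => f ((chartAt (EuclideanSpace ℝ (Fin d)) p).symm z))
    (chartAt (EuclideanSpace ℝ (Fin d)) p).target) : Continuous f := by
  rw [continuous_iff_continuousAt]
  intro x
  have hx := mem_chart_source (EuclideanSpace ℝ (Fin d)) x
  have h1 := (hf x).continuousAt ((chartAt (EuclideanSpace ℝ (Fin d)) x).open_target.mem_nhds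
    ((chartAt (EuclideanSpace ℝ (Fin d)) x).map_source hx))
  have h2 := h1.comp ((chartAt (EuclideanSpace ℝ (Fin d)) x).continuousAt hx)
  refine h2.congr ?_
  filter_upwards [(chartAt (EuclideanSpace ℝ (Fin d)) x).open_source.mem_nhds hx] with y hy
  simp only [Function.comp]
  rw [(chartAt (EuclideanSpace ℝ (Fin d)) x).left_inv hy]

theorem contDiffOn_coord_of_contMDiff {G : Type*} [NormedAddCommGroup G] [NormedSpace ℝ G]
    {f : M → G} (hf : ContMDiff 𝓘(ℝ, EuclideanSpace ℝ (Fin d)) 𝓘(ℝ, G) ∞ f) (p : M) :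
    ContDiffOn ℝ ∞ (fun z => f ((chartAt (EuclideanSpace ℝ (Fin d)) p).symm z))
      (chartAt (EuclideanSpace ℝ (Fin d)) p).target := by
  intro z hz
  have h := (contMDiffAt_iff_coord (symm_mem_source hz)).1 (hf _)
  rw [(chartAt (EuclideanSpace ℝ (Fin d)) p).right_inv hz] at h
  exact h.contDiffWithinAt

end Sharp

/-! ### The divergence theorem on a compact manifold -/

section Divergence

variable {d : ℕ} {M : Type*} [TopologicalSpace M] [T2Space M] [CompactSpace M]
  [ChartedSpace (EuclideanSpace ℝ (Fin d)) M]
  [IsManifold 𝓘(ℝ, EuclideanSpace ℝ (Fin d)) ∞ M] [MeasurableSpace M] [BorelSpace M]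
  {g : ∀ x : M, TangentSpace 𝓘(ℝ, EuclideanSpace ℝ (Fin d)) x →
      TangentSpace 𝓘(ℝ, EuclideanSpace ℝ (Fin d)) x → ℝ}
  {Γ : M → EuclideanSpace ℝ (Fin d) → EuclideanSpace ℝ (Fin d) →L[ℝ] EuclideanSpace ℝ (Fin d) →L[ℝ]
    EuclideanSpace ℝ (Fin d)}

theorem MetricConn.setIntegral_gtrace_eq_zero {U : Set (EuclideanSpace ℝ (Fin d))}
    {G : EuclideanSpace ℝ (Fin d) → EuclideanSpace ℝ (Fin d) →L[ℝ] EuclideanSpace ℝ (Fin d) →L[ℝ] ℝ}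
    {Γ : EuclideanSpace ℝ (Fin d) → EuclideanSpace ℝ (Fin d) →L[ℝ] EuclideanSpace ℝ (Fin d) →L[ℝ]
      EuclideanSpace ℝ (Fin d)} (h : MetricConn U G Γ)
    (hS : ∀ z ∈ U, ∀ u, ∑ i, stdCo _ i (Γ z u (stdB _ i) - Γ z (stdB _ i) u) = 0)
    {l : EuclideanSpace ℝ (Fin d) → EuclideanSpace ℝ (Fin d) →L[ℝ] ℝ} (hl : ContDiffOn ℝ ∞ l U)
    {K : Set (EuclideanSpace ℝ (Fin d))} (hK : IsCompact K) (hKU : K ⊆ U)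
    (h0 : ∀ z ∈ U, z ∉ K → l z = 0) :
    ∫ z in U, volDensity (G z) * gtrace (sharp (G z)) (formDeriv Γ l z) = 0 := by
  have hV : ContDiffOn ℝ ∞ (fun y => volDensity (G y) • sharp (G y) (l y)) U := fun z hz =>
    ((h.contDiffAt_volDensity hz).smul ((sharp_contDiffAt (h.contDiffAt_G hz)
      (h.pos z hz)).clm_apply (hl.contDiffAt_of_isOpen h.isOpen hz))).contDiffWithinAt
  rw [← setIntegral_div_eq_zero h.isOpen hV hK hKU fun z hz hzK => by rw [h0 z hz hzK]; simp]
  refine setIntegral_congr_fun h.isOpen.measurableSet fun z hz => ?_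
  exact (h.div_volDensity hz (hS z hz)
    (hl.contDiffAt_of_isOpen h.isOpen hz).differentiableAt_of_smooth).symm

/-- The divergence theorem on a compact manifold, for a metric connection whose torsion is
traceless. -/
theorem IsSmoothMetric.integral_divergence_eq_zero (hg : IsSmoothMetric g)
    (hm : ∀ p, MetricConn (chartAt (EuclideanSpace ℝ (Fin d)) p).target (coordBilin p g) (Γ p))
    (hS : ∀ p, ∀ z ∈ (chartAt (EuclideanSpace ℝ (Fin d)) p).target, ∀ u,
      ∑ i, stdCo _ i (Γ p z u (stdB _ i) - Γ p z (stdB _ i) u) = 0)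
    {l : ∀ x : M, TangentSpace 𝓘(ℝ, EuclideanSpace ℝ (Fin d)) x →L[ℝ] ℝ}
    (hl : ∀ p, ContDiffOn ℝ ∞ (coordForm p l) (chartAt (EuclideanSpace ℝ (Fin d)) p).target)
    {f : M → ℝ} (hfc : Continuous f)
    (hf : ∀ p, ∀ z ∈ (chartAt (EuclideanSpace ℝ (Fin d)) p).target,
      gtrace (sharp (coordBilin p g z)) (formDeriv (Γ p) (coordForm p l) z)
        = f ((chartAt (EuclideanSpace ℝ (Fin d)) p).symm z)) :
    ∫ x, f x ∂(riemannianVolume g) = 0 := by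
  have := hg.isFiniteMeasure_riemannianVolume
  obtain ⟨χ, hχ⟩ := SmoothPartitionOfUnity.exists_isSubordinate_chartAt_source
    𝓘(ℝ, EuclideanSpace ℝ (Fin d)) M
  have hχs : ∀ i, ContMDiff 𝓘(ℝ, EuclideanSpace ℝ (Fin d)) 𝓘(ℝ, ℝ) ∞ (χ i) := fun i =>
    (χ i).contMDiff
  have hfin := χ.locallyFinite.finite_nonempty_of_compact
  set t := hfin.toFinset with ht
  have hsum : ∀ x, ∑ i ∈ t, χ i x = 1 := by
    intro x
    rw [← χ.sum_eq_one (mem_univ x), finsum_eq_sum_of_support_subset]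
    intro i hi
    rw [ht, Finset.mem_coe, hfin.mem_toFinset]
    exact ⟨x, hi⟩
  -- c i is the pairing of dχ_i with the dual of l, the correction in div(χ_i l) = χ_i f + c i.
  let c : M → M → ℝ := fun i x =>
    mvfderiv 𝓘(ℝ, EuclideanSpace ℝ (Fin d)) (χ i) x (sharpField g l x)
  have hcoord : ∀ i p, ∀ z ∈ (chartAt (EuclideanSpace ℝ (Fin d)) p).target,
      c i ((chartAt (EuclideanSpace ℝ (Fin d)) p).symm z)
        = fderiv ℝ (fun z => χ i ((chartAt (EuclideanSpace ℝ (Fin d)) p).symm z)) z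
          (sharp (coordBilin p g z) (coordForm p l z)) := by
    intro i p z hz
    have hs := symm_mem_source hz
    simp only [c]
    rw [mvfderiv_eq_fderiv hs ((hχs i _).mdifferentiableAt (by simp)), hg.tcoord_sharpField l hs,
      (chartAt (EuclideanSpace ℝ (Fin d)) p).right_inv hz]
  have hcc : ∀ i, Continuous (c i) := by
    intro i
    refine continuous_of_coord (d := d) fun p => ?_
    have h1 : ContinuousOn (fun z => fderiv ℝ
        (fun z => χ i ((chartAt (EuclideanSpace ℝ (Fin d)) p).symm z)) z
          (sharp (coordBilin p g z) (coordForm p l z)))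
        (chartAt (EuclideanSpace ℝ (Fin d)) p).target := by
      intro z hz
      have hU := (chartAt (EuclideanSpace ℝ (Fin d)) p).open_target
      have h2 := ((contDiffOn_coord_of_contMDiff (hχs i) p).contDiffAt_of_isOpen hU hz).fderiv_smooth
      have h3 := (sharp_contDiffAt ((hg.smooth p).contDiffAt_of_isOpen hU hz)
        (hg.coord_pos p hz)).clm_apply ((hl p).contDiffAt_of_isOpen hU hz)
      exact (h2.clm_apply h3).continuousAt.continuousWithinAt
    exact h1.congr fun z hz => hcoord i p z hz
  -- χ_i l is supported in one chart domain, where the coordinate version of the theorem applies.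
  have hG0 : ∀ i, ∫ x, (χ i x * f x + c i x) ∂(riemannianVolume g) = 0 := by
    intro i
    set e := chartAt (EuclideanSpace ℝ (Fin d)) i with he
    have hcont : Continuous fun x => χ i x * f x + c i x :=
      ((hχs i).continuous.mul hfc).add (hcc i)
    have hzero : ∀ x, x ∉ tsupport (χ i) → χ i x = 0 := fun x hx => image_eq_zero_of_notMem_tsupport hx
    have hczero : ∀ x, x ∉ tsupport (χ i) → c i x = 0 := by
      intro x hx
      have h1 : (χ i : M → ℝ) =ᶠ[nhds x] fun _ => 0 := by
        filter_upwards [(isClosed_tsupport (χ i)).isOpen_compl.mem_nhds hx] with y hy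
        exact hzero y hy
      simp only [c]
      have hp := mem_chart_source (EuclideanSpace ℝ (Fin d)) x
      have h2 := hcoord i x _ ((chartAt (EuclideanSpace ℝ (Fin d)) x).map_source hp)
      rw [(chartAt (EuclideanSpace ℝ (Fin d)) x).left_inv hp] at h2
      refine h2.trans ?_
      have h3 : (fun z => χ i ((chartAt (EuclideanSpace ℝ (Fin d)) x).symm z))
          =ᶠ[nhds (chartAt (EuclideanSpace ℝ (Fin d)) x x)] fun _ => 0 := by
        have h4 := (chartAt (EuclideanSpace ℝ (Fin d)) x).continuousAt_symm
          ((chartAt (EuclideanSpace ℝ (Fin d)) x).map_source hp)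
        rw [ContinuousAt, (chartAt (EuclideanSpace ℝ (Fin d)) x).left_inv hp] at h4
        exact h4.eventually h1
      rw [h3.fderiv_eq]
      simp
    have hK : IsCompact (e '' tsupport (χ i)) :=
      (isClosed_tsupport (χ i)).isCompact.image_of_continuousOn (e.continuousOn.mono (hχ i))
    have hKU : e '' tsupport (χ i) ⊆ e.target := by
      rintro _ ⟨x, hx, rfl⟩
      exact e.map_source (hχ i hx)
    rw [hg.integral_riemannianVolume i hcont fun x hx => by
      rw [hzero x fun h => hx (hχ i h), hczero x fun h => hx (hχ i h)]; ring]
    have hχi := contDiffOn_coord_of_contMDiff (hχs i) i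
    rw [← (hm i).setIntegral_gtrace_eq_zero (hS i) (hχi.smul (hl i)) hK hKU]
    · refine setIntegral_congr_fun e.open_target.measurableSet fun z hz => ?_
      have h1 := gtrace_formDeriv_mul (Γ := Γ i) (hg.coord_pos i hz) (hg.coord_symm i z)
        (hχi.contDiffAt_of_isOpen e.open_target hz).differentiableAt_of_smooth
        ((hl i).contDiffAt_of_isOpen e.open_target hz).differentiableAt_of_smooth
      rw [hf i z hz, ← hcoord i i z hz] at h1
      exact congrArg (volDensity (coordBilin i g z) * ·) h1.symm
    · intro z hz hzK
      have h1 : χ i (e.symm z) = 0 := hzero _ fun h => hzK ⟨_, h, e.right_inv hz⟩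
      change χ i (e.symm z) • coordForm i l z = 0
      rw [h1, zero_smul]
  -- The functions χ_i sum to the constant 1, so their differentials sum to zero.
  have hcs : ∀ x, ∑ i ∈ t, c i x = 0 := by
    intro x
    have hp := mem_chart_source (EuclideanSpace ℝ (Fin d)) x
    have hpt := (chartAt (EuclideanSpace ℝ (Fin d)) x).map_source hp
    have h1 : ∀ i, c i x = fderiv ℝ (fun z => χ i ((chartAt (EuclideanSpace ℝ (Fin d)) x).symm z))
        (chartAt (EuclideanSpace ℝ (Fin d)) x x) (tcoord x x (sharpField g l x)) := fun i =>
      mvfderiv_eq_fderiv hp ((hχs i _).mdifferentiableAt (by simp)) _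
    simp only [h1]
    rw [← sum_apply, ← fderiv_fun_sum]
    · simp only [hsum]
      simp
    · intro i _
      exact ((contDiffOn_coord_of_contMDiff (hχs i) x).contDiffAt_of_isOpen
        (chartAt (EuclideanSpace ℝ (Fin d)) x).open_target hpt).differentiableAt_of_smooth
  have hint : ∀ {u : M → ℝ}, Continuous u → Integrable u (riemannianVolume g) := fun hu =>
    hu.integrable_of_hasCompactSupport (HasCompactSupport.of_compactSpace _)
  have h1 : ∀ x, f x = ∑ i ∈ t, (χ i x * f x + c i x) := by
    intro x
    rw [Finset.sum_add_distrib, hcs, ← Finset.sum_mul, hsum]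
    ring
  rw [integral_congr_ae (Filter.Eventually.of_forall h1), integral_finsetSum]
  · exact Finset.sum_eq_zero fun i _ => hG0 i
  · intro i _
    exact hint (((hχs i).continuous.mul hfc).add (hcc i))

/-- A nonnegative continuous function with zero integral vanishes everywhere, since the volume
charges every nonempty open set. -/
theorem IsSmoothMetric.eq_zero_of_divergence_nonneg (hg : IsSmoothMetric g)
    (hm : ∀ p, MetricConn (chartAt (EuclideanSpace ℝ (Fin d)) p).target (coordBilin p g) (Γ p))
    (hS : ∀ p, ∀ z ∈ (chartAt (EuclideanSpace ℝ (Fin d)) p).target, ∀ u,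
      ∑ i, stdCo _ i (Γ p z u (stdB _ i) - Γ p z (stdB _ i) u) = 0)
    {l : ∀ x : M, TangentSpace 𝓘(ℝ, EuclideanSpace ℝ (Fin d)) x →L[ℝ] ℝ}
    (hl : ∀ p, ContDiffOn ℝ ∞ (coordForm p l) (chartAt (EuclideanSpace ℝ (Fin d)) p).target)
    {f : M → ℝ} (hf : ∀ p, ∀ z ∈ (chartAt (EuclideanSpace ℝ (Fin d)) p).target,
      gtrace (sharp (coordBilin p g z)) (formDeriv (Γ p) (coordForm p l) z)
        = f ((chartAt (EuclideanSpace ℝ (Fin d)) p).symm z)) (h0 : ∀ x, 0 ≤ f x) (x : M) :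
    f x = 0 := by
  have := hg.isFiniteMeasure_riemannianVolume
  have := hg.isOpenPosMeasure_riemannianVolume
  have hfc : Continuous f := by
    refine continuous_of_coord (d := d) fun p => ?_
    have h1 : ContinuousOn (fun z => gtrace (sharp (coordBilin p g z))
        (formDeriv (Γ p) (coordForm p l) z))
        (chartAt (EuclideanSpace ℝ (Fin d)) p).target := by
      intro z hz
      have hU := (chartAt (EuclideanSpace ℝ (Fin d)) p).open_target
      have h2 := ((hl p).contDiffAt_of_isOpen hU hz)
      have h3 := sharp_contDiffAt ((hg.smooth p).contDiffAt_of_isOpen hU hz) (hg.coord_pos p hz)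
      have h4 := (hm p).contDiffAt_Γ hz
      simp only [gtrace, formDeriv_apply]
      have h5 : ContDiffAt ℝ ∞ (fun y => ∑ i, (fderiv ℝ (coordForm p l) y (stdB _ i)
          (sharp (coordBilin p g y) (stdCo _ i)) - coordForm p l y (Γ p y (stdB _ i)
          (sharp (coordBilin p g y) (stdCo _ i))))) z :=
        ContDiffAt.sum fun i _ =>
          ((h2.fderiv_smooth.clm_apply contDiffAt_const).clm_apply
            (h3.clm_apply contDiffAt_const)).sub (h2.clm_apply ((h4.clm_apply
              contDiffAt_const).clm_apply (h3.clm_apply contDiffAt_const)))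
      exact h5.continuousAt.continuousWithinAt
    exact h1.congr fun z hz => (hf p z hz).symm
  by_contra hx
  exact (hfc.integral_pos_of_hasCompactSupport_nonneg_nonzero (μ := riemannianVolume g)
    (HasCompactSupport.of_compactSpace f) h0 hx).ne'
    (hg.integral_divergence_eq_zero hm hS hl hfc hf)

end Divergence

/-! ### Metric traces transported to coordinates -/

section Traces

variable {E : Type*} [NormedAddCommGroup E] [NormedSpace ℝ E] [FiniteDimensional ℝ E]
  {W : Type*} [NormedAddCommGroup W] [NormedSpace ℝ W]
  {V : Type*} [AddCommGroup V] [Module ℝ V] [Module.Finite ℝ V]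

theorem gtrace_sharp_eq_sum {G : E →L[ℝ] E →L[ℝ] ℝ} (hp : ∀ v, v ≠ 0 → 0 < G v v)
    {ι : Type*} [Fintype ι] [DecidableEq ι] {e : ι → E}
    (he : IsOrthoBasis (fun u v => G u v) e) (C : E →L[ℝ] E →L[ℝ] W) :
    gtrace (sharp G) C = ∑ A, C (e A) (e A) :=
  gtrace_eq_sum (sharp_eq_sum he fun l v => by rw [sharp_spec hp]) C

theorem gtrace_sharp_flip {G : E →L[ℝ] E →L[ℝ] ℝ} (hs : ∀ u v, G u v = G v u)
    (hp : ∀ v, v ≠ 0 → 0 < G v v) (C : E →L[ℝ] E →L[ℝ] W) :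
    gtrace (sharp G) C.flip = gtrace (sharp G) C := by
  obtain ⟨e, he⟩ := exists_orthoBasis G hs hp
  rw [gtrace_sharp_eq_sum hp he, gtrace_sharp_eq_sum hp he]
  rfl

/-- The vectors of an orthonormal basis, read through a linear equivalence. -/
theorem IsOrthoBasis.map {ι : Type*} [Fintype ι] [DecidableEq ι] {g : V → V → ℝ} {e : ι → V}
    (he : IsOrthoBasis g e) {G : E →L[ℝ] E →L[ℝ] ℝ} (τ : V ≃ₗ[ℝ] E)
    (hG : ∀ u v, G (τ u) (τ v) = g u v) : IsOrthoBasis (fun u v => G u v) (fun i => τ (e i)) := by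
  refine ⟨fun i j => by simp only [hG, he.ortho], fun v => ?_⟩
  have h := congrArg τ (he.complete (τ.symm v))
  rw [τ.apply_symm_apply, map_sum] at h
  refine h.trans (Finset.sum_congr rfl fun i _ => ?_)
  rw [map_smul, ← hG, τ.apply_symm_apply]

theorem metricTraceVec_eq_gtrace (τ : V ≃ₗ[ℝ] E) {G : E →L[ℝ] E →L[ℝ] ℝ}
    (hs : ∀ u v, G u v = G v u) (hp : ∀ v, v ≠ 0 → 0 < G v v) (C : E →L[ℝ] E →L[ℝ] W) :
    metricTraceVec (fun u v => G (τ u) (τ v)) (fun u v => C (τ u) (τ v)) = gtrace (sharp G) C := by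
  let g : V →ₗ[ℝ] V →ₗ[ℝ] ℝ := (toBilin G).compl₁₂ τ.toLinearMap τ.toLinearMap
  let c : V →ₗ[ℝ] V →ₗ[ℝ] W := (toBilin C).compl₁₂ τ.toLinearMap τ.toLinearMap
  obtain ⟨e, he⟩ := exists_isOrthoBasis g (fun u v => hs _ _)
    (fun v hv => hp _ fun h => hv (τ.map_eq_zero_iff.1 h))
  exact (metricTraceVec_eq_sum g he c).trans
    (gtrace_sharp_eq_sum hp (he.map τ (G := G) fun u v => rfl) C).symm

theorem map_metricTraceVec {W' : Type*} [AddCommGroup W'] [Module ℝ W'] {W : Type*}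
    [AddCommGroup W] [Module ℝ W] (L : W →ₗ[ℝ] W') (g : V → V → ℝ) (C : V → V → W) :
    L (metricTraceVec g C) = metricTraceVec g (fun u v => L (C u v)) := by
  simp only [metricTraceVec, map_sum, map_smul]

end Traces

section Coordinates

variable {E : Type*} [NormedAddCommGroup E] [NormedSpace ℝ E] [FiniteDimensional ℝ E]
  {M : Type*} [TopologicalSpace M] [ChartedSpace E M] [IsManifold 𝓘(ℝ, E) ∞ M]

/-- The chart at `p` as a linear equivalence of a tangent space with the model space. -/
noncomputable def tcoordEquiv {p x : M} (hx : x ∈ (chartAt E p).source) :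
    TangentSpace 𝓘(ℝ, E) x ≃ₗ[ℝ] E :=
  { (tcoord (E := E) p x : TangentSpace 𝓘(ℝ, E) x →ₗ[ℝ] E) with
    invFun := tvec p x
    left_inv := tvec_tcoord hx
    right_inv := tcoord_tvec hx }

theorem tcoordEquiv_apply {p x : M} (hx : x ∈ (chartAt E p).source)
    (v : TangentSpace 𝓘(ℝ, E) x) : tcoordEquiv hx v = tcoord p x v := rfl

end Coordinates

/-! ### The tension equation of harmonic maps -/

section Tension

variable {d : ℕ} {U : Set (EuclideanSpace ℝ (Fin d))}
  {G : EuclideanSpace ℝ (Fin d) → EuclideanSpace ℝ (Fin d) →L[ℝ] EuclideanSpace ℝ (Fin d) →L[ℝ] ℝ}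
  {Γ Γ₂ : EuclideanSpace ℝ (Fin d) → EuclideanSpace ℝ (Fin d) →L[ℝ] EuclideanSpace ℝ (Fin d) →L[ℝ]
      EuclideanSpace ℝ (Fin d)}

/-- The difference A of two metric connections is skew, so G(tr A, v) is minus the trace of w ↦ A(w,
v). By the torsion hypotheses this is also minus the trace of w ↦ A(v, w). The latter vanishes, both
connections having the logarithmic derivative of the same density as trace. -/
theorem MetricConn.gtrace_eq_of_torsion (h : MetricConn U G Γ) (h₂ : MetricConn U G Γ₂)
    {z : EuclideanSpace ℝ (Fin d)} (hz : z ∈ U)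
    (hS : ∀ u, ∑ i, stdCo _ i (Γ z u (stdB _ i) - Γ z (stdB _ i) u) = 0)
    (hS₂ : ∀ u v, Γ₂ z u v = Γ₂ z v u) :
    gtrace (sharp (G z)) (Γ z) = gtrace (sharp (G z)) (Γ₂ z) := by
  have hp := h.pos z hz
  have hs := h.symm z hz
  have hskew : ∀ w u v, G z (Γ z w u) v - G z (Γ₂ z w u) v
      = -(G z u (Γ z w v) - G z u (Γ₂ z w v)) := by
    intro w u v
    have h1 := h.parallel z hz w u v
    rw [h₂.parallel z hz] at h1
    linarith
  have htr : ∀ v, ∑ i, stdCo _ i (Γ z v (stdB _ i)) = ∑ i, stdCo _ i (Γ₂ z v (stdB _ i)) := by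
    intro v
    have h1 := h.fderiv_volDensity hz v
    rw [h₂.fderiv_volDensity hz] at h1
    exact (mul_left_cancel₀ (h.volDensity_pos hz).ne' h1).symm
  have key : ∀ v, G z (gtrace (sharp (G z)) (Γ z)) v = G z (gtrace (sharp (G z)) (Γ₂ z)) v := by
    intro v
    have h2 : ∀ i, G z (Γ z (stdB _ i) (sharp (G z) (stdCo _ i))) v
        - G z (Γ₂ z (stdB _ i) (sharp (G z) (stdCo _ i))) v
        = -(stdCo _ i (Γ z (stdB _ i) v) - stdCo _ i (Γ₂ z (stdB _ i) v)) := by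
      intro i
      rw [hskew, sharp_spec hp]
    rw [← sub_eq_zero]
    simp only [gtrace, map_sum, sum_apply]
    rw [← Finset.sum_sub_distrib]
    simp only [h2]
    have h3 := hS v
    have h4 := htr v
    simp only [map_sub, Finset.sum_sub_distrib] at h3
    rw [Finset.sum_neg_distrib, Finset.sum_sub_distrib]
    simp only [hS₂ _ v]
    linarith
  by_contra hne
  have h5 := hp _ (sub_ne_zero.2 hne)
  rw [map_sub (G z), sub_apply, key, sub_self] at h5
  exact lt_irrefl _ h5

/-- The trace of v ↦ -G(u, J v) T is -G(u, J T) = 0. -/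
theorem SasakiLocal.torsion_traceless {E : Type*} [NormedAddCommGroup E] [NormedSpace ℝ E]
    [FiniteDimensional ℝ E] {U : Set E} {G : E → E →L[ℝ] E →L[ℝ] ℝ} {Γ : E → E →L[ℝ] E →L[ℝ] E}
    {J : E → E →L[ℝ] E} {T : E → E} (h : SasakiLocal U G Γ J T) {z : E} (hz : z ∈ U) (u : E) :
    ∑ i, stdCo E i (Γ z u (stdB E i) - Γ z (stdB E i) u) = 0 := by
  have h1 : ∑ i, stdCo E i (Γ z u (stdB E i) - Γ z (stdB E i) u)
      = -G z u (J z (∑ i, stdCo E i (T z) • stdB E i)) := by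
    simp only [h.torsion z hz, map_sum, map_smul, smul_eq_mul, neg_mul,
      Finset.sum_neg_distrib]
    exact congrArg _ (Finset.sum_congr rfl fun _ _ => mul_comm _ _)
  rw [h1, sum_stdCo, h.J_T z hz, map_zero, neg_zero]

variable {n : ℕ} {M : Type*} [TopologicalSpace M] [T2Space M]
  [ChartedSpace (EuclideanSpace ℝ (Fin d)) M]
  [IsManifold 𝓘(ℝ, EuclideanSpace ℝ (Fin d)) ∞ M]
  {F : Type*} [NormedAddCommGroup F] [NormedSpace ℝ F] [FiniteDimensional ℝ F]
  {N : Type*} [TopologicalSpace N] [ChartedSpace F N] [IsManifold 𝓘(ℝ, F) ∞ N]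
  {P : PseudohermitianStructure (EuclideanSpace ℝ (Fin d)) M}
  {D : CovariantDerivative 𝓘(ℝ, EuclideanSpace ℝ (Fin d)) (EuclideanSpace ℝ (Fin d))
    (TangentSpace 𝓘(ℝ, EuclideanSpace ℝ (Fin d)) : M → Type _)}
  {D' : CovariantDerivative 𝓘(ℝ, F) F (TangentSpace 𝓘(ℝ, F) : N → Type _)} {φ : M → N}

theorem PseudohermitianStructure.isSmoothMetric_webster
    (P : PseudohermitianStructure (EuclideanSpace ℝ (Fin d)) M) : IsSmoothMetric P.webster :=
  ⟨P.webster_isBilin, P.webster_symm, P.webster_pos, P.contDiffOn_coordBilin_webster⟩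

/-- In coordinates, the trace of the second fundamental form of `φ` with respect to the
Tanaka-Webster connection is `δ β(T, T)`. -/
def TensionEq (P : PseudohermitianStructure (EuclideanSpace ℝ (Fin d)) M)
    (D : CovariantDerivative 𝓘(ℝ, EuclideanSpace ℝ (Fin d)) (EuclideanSpace ℝ (Fin d))
      (TangentSpace 𝓘(ℝ, EuclideanSpace ℝ (Fin d)) : M → Type _))
    (D' : CovariantDerivative 𝓘(ℝ, F) F (TangentSpace 𝓘(ℝ, F) : N → Type _)) (φ : M → N)
    (δ : ℝ) : Prop :=
  ∀ (p : M) (q : N), ∀ z ∈ coordDomain (E := EuclideanSpace ℝ (Fin d)) (F := F) p q φ,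
    gtrace (sharp (coordBilin p P.webster z))
        (flatHess (christoffel D p) (christoffel D' q) (coordMap (F := F) p q φ) z)
      = δ • flatHess (christoffel D p) (christoffel D' q) (coordMap (F := F) p q φ) z
        (coordField p P.T z) (coordField p P.T z)

theorem IsHarmonicMap.tensionEq (hM : P.IsSasakian D) (hφ : IsHarmonicMap P D' φ) :
    TensionEq P D D' φ 0 := by
  obtain ⟨hφs, Dθ, hLC, htr⟩ := hφ
  intro p q z hz
  have hx := symm_mem_source hz.1
  set x := (chartAt (EuclideanSpace ℝ (Fin d)) p).symm z with hxd
  have hzx : chartAt (EuclideanSpace ℝ (Fin d)) p x = z :=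
    (chartAt (EuclideanSpace ℝ (Fin d)) p).right_inv hz.1
  have hs := (hM.sasakiLocal p).symm z hz.1
  have hp := (hM.sasakiLocal p).pos z hz.1
  have hg : P.webster x = fun u v => coordBilin p P.webster z (tcoordEquiv hx u)
      (tcoordEquiv hx v) := by
    ext u v
    rw [tcoordEquiv_apply, tcoordEquiv_apply, ← hzx, coordBilin_chart hx (P.webster_isBilin x)]
  have hmθ := hLC.metricConn p P.webster_isBilin P.webster_symm P.webster_pos
    (P.contDiffOn_coordBilin_webster p)
  have h1 := congrArg (tcoord (E := F) q (φ x) : TangentSpace 𝓘(ℝ, F) (φ x) →ₗ[ℝ] F) (htr x)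
  rw [map_metricTraceVec, map_zero, hg] at h1
  have h2 : (fun u v => (tcoord (E := F) q (φ x) : TangentSpace 𝓘(ℝ, F) (φ x) →ₗ[ℝ] F)
      (secondFundamentalForm Dθ D' φ x u v))
      = fun u v => (flatHess (christoffel Dθ p) (christoffel D' q) (coordMap (F := F) p q φ) z).flip
        (tcoordEquiv hx u) (tcoordEquiv hx v) := by
    ext u v
    rw [ContinuousLinearMap.flip_apply, tcoordEquiv_apply, tcoordEquiv_apply, ← hzx]
    exact tcoord_secondFundamentalForm Dθ D' hx hz.2 hφs u v
  rw [h2, metricTraceVec_eq_gtrace _ hs hp, gtrace_sharp_flip hs hp] at h1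
  rw [zero_smul, ← h1]
  have h3 := (hM.sasakiLocal p).toMetricConn.gtrace_eq_of_torsion hmθ hz.1
    ((hM.sasakiLocal p).torsion_traceless hz.1) (fun u v => hLC.christoffel_symm hz.1 u v)
  -- The trace of β depends on the connection of the source only through the traced Christoffel
  -- symbols, so the Tanaka-Webster connection may replace the Levi-Civita one.
  have h4 : ∀ Γ : EuclideanSpace ℝ (Fin d) → EuclideanSpace ℝ (Fin d) →L[ℝ]
      EuclideanSpace ℝ (Fin d) →L[ℝ] EuclideanSpace ℝ (Fin d),
      gtrace (sharp (coordBilin p P.webster z))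
        (flatHess Γ (christoffel D' q) (coordMap (F := F) p q φ) z)
      = gtrace (sharp (coordBilin p P.webster z))
        (flatHess (fun _ => 0) (christoffel D' q) (coordMap (F := F) p q φ) z)
        - fderiv ℝ (coordMap (F := F) p q φ) z
          (gtrace (sharp (coordBilin p P.webster z)) (Γ z)) := by
    intro Γ
    simp only [gtrace, map_sum]
    rw [← Finset.sum_sub_distrib]
    refine Finset.sum_congr rfl fun i _ => ?_
    rw [flatHess_apply, flatHess_apply]
    simp
  rw [h4, h3, ← h4]

end Tension

/-! ### First variation of the horizontal energy density -/

section LocalVariation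

variable {E : Type*} [NormedAddCommGroup E] [NormedSpace ℝ E] [FiniteDimensional ℝ E]
  {F : Type*} [NormedAddCommGroup F] [NormedSpace ℝ F]

/-- The horizontal energy density of a linear map `L`, for the inner products `G` and `H` and the
unit vector `T`. -/
noncomputable def horizontalEnergy (G : E →L[ℝ] E →L[ℝ] ℝ) (T : E) (H : F →L[ℝ] F →L[ℝ] ℝ)
    (L : E →L[ℝ] F) : ℝ :=
  (1 / 2) * (∑ i, H (L (stdB E i)) (L (sharp G (stdCo E i))) - H (L T) (L T))

/-- The one-form `v ↦ ⟨s, dφ(π_H v)⟩`. -/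
noncomputable def variationForm (G : E → E →L[ℝ] E →L[ℝ] ℝ) (T : E → E)
    (H : F → F →L[ℝ] F →L[ℝ] ℝ) (f s : E → F) (z : E) : E →L[ℝ] ℝ :=
  (H (f z) (s z)).comp (fderiv ℝ f z) - (H (f z) (s z) (fderiv ℝ f z (T z))) • G z (T z)

theorem variationForm_apply (G : E → E →L[ℝ] E →L[ℝ] ℝ) (T : E → E)
    (H : F → F →L[ℝ] F →L[ℝ] ℝ) (f s : E → F) (z u : E) : variationForm G T H f s z u
      = H (f z) (s z) (fderiv ℝ f z u) - H (f z) (s z) (fderiv ℝ f z (T z)) * G z (T z) u := by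
  simp [variationForm]

variable {U : Set E} {G : E → E →L[ℝ] E →L[ℝ] ℝ} {Γ : E → E →L[ℝ] E →L[ℝ] E}
  {J : E → E →L[ℝ] E} {T : E → E}
  {V : Set F} {H : F → F →L[ℝ] F →L[ℝ] ℝ} {Γ' : F → F →L[ℝ] F →L[ℝ] F} {f s : E → F}
  (h : SasakiLocal U G Γ J T) (m : LocalMap U G Γ V H Γ' f) {z : E} (hz : z ∈ U)
include h m hz

theorem smooth_variationForm (hs : ContDiffAt ℝ ∞ s z) :
    ContDiffAt ℝ ∞ (variationForm G T H f s) z := by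
  have h2 := (m.smooth_H hz).clm_apply hs
  have h3 := (m.smoothAt hz).fderiv_smooth
  have h4 : ContDiffAt ℝ ∞ T z := h.smooth_T.contDiffAt_of_isOpen h.isOpen hz
  have h5 := h.contDiffAt_G hz
  exact (h2.clm_comp h3).sub ((h2.clm_apply (h3.clm_apply h4)).smul (h5.clm_apply h4))

theorem formDeriv_variationForm (hs : ContDiffAt ℝ ∞ s z) (w u : E) :
    formDeriv Γ (variationForm G T H f s) z w u
      = H (f z) (alongDeriv Γ' f s z w) (fderiv ℝ f z u) + H (f z) (s z) (flatHess Γ Γ' f z w u)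
        - (H (f z) (alongDeriv Γ' f s z w) (fderiv ℝ f z (T z))
          + H (f z) (s z) (flatHess Γ Γ' f z w (T z))) * G z (T z) u := by
  have hT := h.diff_T hz
  have hf' := m.diff' hz
  have hG := h.diff_G hz
  have hH := m.diff_H hz
  have hsd := hs.differentiableAt_of_smooth
  have hr := (smooth_variationForm h m hz hs).differentiableAt_of_smooth
  have hs1 : DifferentiableAt ℝ (fun y => fderiv ℝ f y (T y)) z := by fun_prop
  have hs2 : DifferentiableAt ℝ (fun y => fderiv ℝ f y u) z := by fun_prop
  have d1 : DifferentiableAt ℝ (fun y => H (f y) (s y) (fderiv ℝ f y u)) z :=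
    (hH.clm_apply hsd).clm_apply hs2
  have d2 : DifferentiableAt ℝ (fun y => H (f y) (s y) (fderiv ℝ f y (T y))) z :=
    (hH.clm_apply hsd).clm_apply hs1
  have d3 : DifferentiableAt ℝ (fun y => G y (T y) u) z := by fun_prop
  rw [formDeriv_apply, ← fderiv_apply_const hr]
  simp only [variationForm_apply]
  rw [fderiv_fun_sub d1 (d2.fun_mul d3), fderiv_fun_mul d2 d3, sub_apply, add_apply, smul_apply,
    smul_apply, m.fderiv_pair hz hsd hs1, m.fderiv_pair hz hsd hs2,
    h.fderiv_pair hz hT (by fun_prop), fderiv_comp_T h m hz,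
    m.alongDeriv_fderiv hz (a := fun _ => u) (by fun_prop), h.parallel_T z hz]
  simp only [fderiv_fun_const, Pi.zero_apply, zero_apply, zero_add, map_zero, add_zero, map_add,
    add_apply, smul_eq_mul]
  ring

/-- The first variation of the horizontal energy density. -/
theorem div_variationForm (hs : ContDiffAt ℝ ∞ s z) :
    gtrace (sharp (G z)) (formDeriv Γ (variationForm G T H f s) z)
      = (∑ i, H (f z) (alongDeriv Γ' f s z (stdB E i)) (fderiv ℝ f z (sharp (G z) (stdCo E i)))
          - H (f z) (alongDeriv Γ' f s z (T z)) (fderiv ℝ f z (T z)))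
        + H (f z) (s z) (gtrace (sharp (G z)) (flatHess Γ Γ' f z)
          - flatHess Γ Γ' f z (T z) (T z)) := by
  have hp := h.pos z hz
  have h1 : ∀ i, G z (T z) (sharp (G z) (stdCo E i)) = stdCo E i (T z) := by
    intro i
    rw [h.symm z hz, sharp_spec hp]
  have h2 : T z = ∑ i, stdCo E i (T z) • stdB E i := (sum_stdCo _).symm
  have h3 : ∀ L : E →L[ℝ] F, ∑ i, stdCo E i (T z) • L (stdB E i) = L (T z) := by
    intro L
    conv_rhs => rw [h2]
    rw [map_sum]
    simp only [map_smul]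
  have h4 : ∑ i, H (f z) (alongDeriv Γ' f s z (stdB E i)) (fderiv ℝ f z (T z)) * stdCo E i (T z)
      = H (f z) (alongDeriv Γ' f s z (T z)) (fderiv ℝ f z (T z)) := by
    have h5 := h3 (fderiv ℝ s z + (Γ' (f z)).flip (s z) ∘SL (fderiv ℝ f z))
    have h6 := congrArg (fun v => H (f z) v (fderiv ℝ f z (T z))) h5
    simp only [map_sum, sum_apply, map_smul, smul_apply, smul_eq_mul] at h6
    refine Eq.trans ?_ h6
    exact Finset.sum_congr rfl fun i _ => mul_comm _ _
  have h7 : ∑ i, H (f z) (s z) (flatHess Γ Γ' f z (stdB E i) (T z)) * stdCo E i (T z)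
      = H (f z) (s z) (flatHess Γ Γ' f z (T z) (T z)) := by
    have h5 := h3 ((flatHess Γ Γ' f z).flip (T z))
    have h6 := congrArg (fun v => H (f z) (s z) v) h5
    simp only [map_sum, map_smul, smul_eq_mul] at h6
    refine Eq.trans ?_ h6
    exact Finset.sum_congr rfl fun i _ => mul_comm _ _
  simp only [gtrace, formDeriv_variationForm h m hz hs, h1, add_mul, Finset.sum_add_distrib,
    Finset.sum_sub_distrib, h4, h7, map_sub, map_sum]
  ring

/-- H is parallel and the target torsion free, so the derivative of H in the direction s combines
with the derivative of s into its covariant derivative along f. The two resulting traces agree by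
symmetry, which absorbs the factor ½. -/
theorem hasDerivAt_horizontalEnergy (hs : DifferentiableAt ℝ s z) :
    HasDerivAt (fun t : ℝ => horizontalEnergy (G z) (T z) (H (f z + t • s z))
        (fderiv ℝ f z + t • fderiv ℝ s z))
      (∑ i, H (f z) (alongDeriv Γ' f s z (stdB E i)) (fderiv ℝ f z (sharp (G z) (stdCo E i)))
          - H (f z) (alongDeriv Γ' f s z (T z)) (fderiv ℝ f z (T z))) 0 := by
  have hp := h.pos z hz
  have hsym := m.target.symm _ (m.maps z hz)
  have hH : HasDerivAt (fun t : ℝ => H (f z + t • s z)) (fderiv ℝ H (f z) (s z)) 0 := by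
    have h1 : HasDerivAt (fun t : ℝ => f z + t • s z) (s z) 0 := by
      simpa using ((hasDerivAt_id (0 : ℝ)).smul_const (s z)).const_add (f z)
    have h2 : HasFDerivAt H (fderiv ℝ H (f z)) (f z + (0 : ℝ) • s z) := by
      rw [zero_smul, add_zero]
      exact (m.target.diff_G (m.maps z hz)).hasFDerivAt
    exact h2.comp_hasDerivAt 0 h1
  have hL : ∀ a, HasDerivAt (fun t : ℝ => (fderiv ℝ f z + t • fderiv ℝ s z) a)
      (fderiv ℝ s z a) 0 := by
    intro a
    simpa using ((hasDerivAt_id (0 : ℝ)).smul_const (fderiv ℝ s z a)).const_add (fderiv ℝ f z a)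
  have key : ∀ a b, HasDerivAt (fun t : ℝ => H (f z + t • s z)
      ((fderiv ℝ f z + t • fderiv ℝ s z) a) ((fderiv ℝ f z + t • fderiv ℝ s z) b))
      (H (f z) (alongDeriv Γ' f s z a) (fderiv ℝ f z b)
        + H (f z) (alongDeriv Γ' f s z b) (fderiv ℝ f z a)) 0 := by
    intro a b
    have h1 := (hH.clm_apply (hL a)).clm_apply (hL b)
    refine h1.congr_deriv ?_
    simp only [zero_smul, add_zero, add_apply, m.target.parallel _ (m.maps z hz), alongDeriv,
      map_add]
    rw [m.torsion_free _ (m.maps z hz) (s z), m.torsion_free _ (m.maps z hz) (s z),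
      hsym (fderiv ℝ f z a), hsym (fderiv ℝ f z a)]
    ring
  have h9 := ((HasDerivAt.fun_sum fun i (_ : i ∈ Finset.univ) =>
    key (stdB E i) (sharp (G z) (stdCo E i))).fun_sub (key (T z) (T z))).const_mul (1 / 2 : ℝ)
  refine h9.congr_deriv ?_
  let C : E →L[ℝ] E →L[ℝ] ℝ := ContinuousLinearMap.bilinearComp (H (f z))
    (fderiv ℝ s z + (Γ' (f z)).flip (s z) ∘SL (fderiv ℝ f z)) (fderiv ℝ f z)
  have h10 : ∀ u v, C u v = H (f z) (alongDeriv Γ' f s z u) (fderiv ℝ f z v) := fun u v => rfl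
  have h11 := gtrace_sharp_flip (h.symm z hz) hp C
  simp only [gtrace, ContinuousLinearMap.flip_apply, h10] at h11
  rw [Finset.sum_add_distrib, h11]
  ring

end LocalVariation

/-- Differentiation under the integral sign. The tube lemma gives one time interval valid over all
of K, and compactness bounds the derivative there. -/
theorem hasDerivAt_setIntegral_of_contDiffOn {E : Type*} [NormedAddCommGroup E] [NormedSpace ℝ E]
    [MeasurableSpace E] [BorelSpace E] [FiniteDimensional ℝ E] {μ : Measure E}
    [IsFiniteMeasureOnCompacts μ] {A : ℝ × E → ℝ} {O : Set (ℝ × E)} (hO : IsOpen O)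
    (hA : ContDiffOn ℝ 1 A O) {K : Set E} (hK : IsCompact K) (hKO : ∀ z ∈ K, ((0 : ℝ), z) ∈ O) :
    HasDerivAt (fun t => ∫ z in K, A (t, z) ∂μ) (∫ z in K, fderiv ℝ A (0, z) (1, 0) ∂μ) 0 := by
  obtain ⟨u, v, hu, hv, h0u, hKv, huv⟩ := generalized_tube_lemma (isCompact_singleton (x := (0 : ℝ)))
    hK hO (by rintro ⟨t, z⟩ ⟨rfl, hz⟩; exact hKO z hz)
  obtain ⟨ε, hε, hεu⟩ := Metric.isOpen_iff.1 hu 0 (h0u rfl)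
  have hsub : Metric.closedBall (0 : ℝ) (ε / 2) ×ˢ K ⊆ O := fun q hq =>
    huv ⟨hεu (Metric.closedBall_subset_ball (half_lt_self hε) hq.1), hKv hq.2⟩
  have hcd : ContinuousOn (fderiv ℝ A) O := hA.continuousOn_fderiv_of_isOpen hO le_rfl
  have hcd' : ContinuousOn (fun q => fderiv ℝ A q (1, 0)) O := hcd.clm_apply continuousOn_const
  obtain ⟨C, hC⟩ := ((isCompact_closedBall (0 : ℝ) (ε / 2)).prod hK).exists_bound_of_continuousOn
    (hcd'.mono hsub)
  have hslice : ∀ t ∈ Metric.closedBall (0 : ℝ) (ε / 2), ∀ {B : ℝ × E → ℝ}, ContinuousOn B O →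
      ContinuousOn (fun z => B (t, z)) K := fun t ht B hB =>
    hB.comp (by fun_prop) fun z hz => hsub ⟨ht, hz⟩
  have h0 : (0 : ℝ) ∈ Metric.closedBall (0 : ℝ) (ε / 2) :=
    Metric.mem_closedBall_self (half_pos hε).le
  refine (hasDerivAt_integral_of_dominated_loc_of_deriv_le (μ := μ.restrict K)
    (F := fun t z => A (t, z)) (F' := fun t z => fderiv ℝ A (t, z) (1, 0)) (bound := fun _ => C)
    (Metric.closedBall_mem_nhds (0 : ℝ) (half_pos hε)) ?_ ?_ ?_ ?_ ?_ ?_).2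
  · filter_upwards [Metric.closedBall_mem_nhds (0 : ℝ) (half_pos hε)] with t ht
    exact (hslice t ht hA.continuousOn).aestronglyMeasurable hK.measurableSet
  · exact (hslice 0 h0 hA.continuousOn).integrableOn_compact hK
  · exact (hslice 0 h0 hcd').aestronglyMeasurable hK.measurableSet
  · exact ae_restrict_of_forall_mem hK.measurableSet fun z hz t ht => hC (t, z) ⟨ht, hz⟩
  · have : IsFiniteMeasure (μ.restrict K) := ⟨by
      rw [Measure.restrict_apply_univ]; exact hK.measure_lt_top⟩
    exact integrable_const C
  · refine ae_restrict_of_forall_mem hK.measurableSet fun z hz t ht => ?_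
    have h1 : DifferentiableAt ℝ A (t, z) :=
      (hA.contDiffAt (hO.mem_nhds (hsub ⟨ht, hz⟩))).differentiableAt (by simp)
    exact h1.hasFDerivAt.comp_hasDerivAt t ((hasDerivAt_id t).prodMk (hasDerivAt_const t z))

section Smooth

variable {X : Type*} [NormedAddCommGroup X] [NormedSpace ℝ X]
  {E : Type*} [NormedAddCommGroup E] [NormedSpace ℝ E] [FiniteDimensional ℝ E]
  {F : Type*} [NormedAddCommGroup F] [NormedSpace ℝ F]

theorem contDiffAt_horizontalEnergy {G : X → E →L[ℝ] E →L[ℝ] ℝ} {T : X → E}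
    {H : X → F →L[ℝ] F →L[ℝ] ℝ} {L : X → E →L[ℝ] F} {x : X} (hG : ContDiffAt ℝ ∞ G x)
    (hp : ∀ v, v ≠ 0 → 0 < G x v v) (hT : ContDiffAt ℝ ∞ T x) (hH : ContDiffAt ℝ ∞ H x)
    (hL : ContDiffAt ℝ ∞ L x) :
    ContDiffAt ℝ ∞ (fun y => horizontalEnergy (G y) (T y) (H y) (L y)) x := by
  have hs := sharp_contDiffAt hG hp
  exact contDiffAt_const.mul ((ContDiffAt.sum fun i _ => (hH.clm_apply
    (hL.clm_apply contDiffAt_const)).clm_apply (hL.clm_apply (hs.clm_apply contDiffAt_const))).sub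
    ((hH.clm_apply (hL.clm_apply hT)).clm_apply (hL.clm_apply hT)))

end Smooth

/-! ### The Euler-Lagrange equation in a chart -/

section Critical

variable {d : ℕ} {F : Type*} [NormedAddCommGroup F] [NormedSpace ℝ F]
  {U : Set (EuclideanSpace ℝ (Fin d))}
  {G : EuclideanSpace ℝ (Fin d) → EuclideanSpace ℝ (Fin d) →L[ℝ] EuclideanSpace ℝ (Fin d) →L[ℝ] ℝ}
  {Γ : EuclideanSpace ℝ (Fin d) → EuclideanSpace ℝ (Fin d) →L[ℝ] EuclideanSpace ℝ (Fin d) →L[ℝ]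
      EuclideanSpace ℝ (Fin d)}
  {J : EuclideanSpace ℝ (Fin d) → EuclideanSpace ℝ (Fin d) →L[ℝ] EuclideanSpace ℝ (Fin d)}
  {T : EuclideanSpace ℝ (Fin d) → EuclideanSpace ℝ (Fin d)}
  {V : Set F} {H : F → F →L[ℝ] F →L[ℝ] ℝ} {Γ' : F → F →L[ℝ] F →L[ℝ] F}
  {f s : EuclideanSpace ℝ (Fin d) → F} {K : Set (EuclideanSpace ℝ (Fin d))}

/-- The integral over `K` of the horizontal energy density of the variation `f + t s`. -/
noncomputable def variationEnergy
    (G : EuclideanSpace ℝ (Fin d) → EuclideanSpace ℝ (Fin d) →L[ℝ] EuclideanSpace ℝ (Fin d) →L[ℝ] ℝ)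
    (T : EuclideanSpace ℝ (Fin d) → EuclideanSpace ℝ (Fin d)) (H : F → F →L[ℝ] F →L[ℝ] ℝ)
    (f s : EuclideanSpace ℝ (Fin d) → F) (K : Set (EuclideanSpace ℝ (Fin d))) (t : ℝ) : ℝ :=
  ∫ z in K, volDensity (G z) * horizontalEnergy (G z) (T z) (H (f z + t • s z))
    (fderiv ℝ f z + t • fderiv ℝ s z)

/-- The derivative of the integrand is the divergence of `variationForm`, which integrates to zero
because s is supported in K, minus s paired with tr β - β(T, T). -/
theorem hasDerivAt_variationEnergy (h : SasakiLocal U G Γ J T) (m : LocalMap U G Γ V H Γ' f)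
    (hs : ContDiff ℝ ∞ s) (hK : IsCompact K) (hKU : K ⊆ U) (hs0 : ∀ z, z ∉ K → s z = 0) :
    HasDerivAt (variationEnergy G T H f s K) (-∫ z in K, volDensity (G z) * H (f z) (s z)
      (gtrace (sharp (G z)) (flatHess Γ Γ' f z) - flatHess Γ Γ' f z (T z) (T z))) 0 := by
  set O : Set (ℝ × EuclideanSpace ℝ (Fin d)) :=
    (univ ×ˢ U) ∩ (fun q => f q.2 + q.1 • s q.2) ⁻¹' V with hOd
  have hcf : ContinuousOn (fun q : ℝ × EuclideanSpace ℝ (Fin d) => f q.2 + q.1 • s q.2)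
      (univ ×ˢ U) :=
    (m.smooth.continuousOn.comp continuousOn_snd fun q hq => hq.2).add
      (continuousOn_fst.smul (hs.continuous.comp_continuousOn continuousOn_snd))
  have hO : IsOpen O := hcf.isOpen_inter_preimage (isOpen_univ.prod h.isOpen) m.target.isOpen
  have hKO : ∀ z ∈ K, ((0 : ℝ), z) ∈ O := fun z hz =>
    ⟨⟨mem_univ _, hKU hz⟩, by simpa using m.maps z (hKU hz)⟩
  have hA : ContDiffOn ℝ ∞ (fun q : ℝ × EuclideanSpace ℝ (Fin d) => volDensity (G q.2) *
      horizontalEnergy (G q.2) (T q.2) (H (f q.2 + q.1 • s q.2))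
        (fderiv ℝ f q.2 + q.1 • fderiv ℝ s q.2)) O := by
    rintro ⟨t, z⟩ ⟨⟨-, hz⟩, hV⟩
    have hsnd : ContDiffAt ℝ ∞ (Prod.snd : ℝ × EuclideanSpace ℝ (Fin d) → _) (t, z) :=
      contDiffAt_snd
    have hfst : ContDiffAt ℝ ∞ (Prod.fst : ℝ × EuclideanSpace ℝ (Fin d) → _) (t, z) :=
      contDiffAt_fst
    have h1 : ContDiffAt ℝ ∞ (fun q : ℝ × EuclideanSpace ℝ (Fin d) => volDensity (G q.2)) (t, z) :=
      (h.contDiffAt_volDensity hz).comp (t, z) hsnd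
    have h2 : ContDiffAt ℝ ∞ (fun q : ℝ × EuclideanSpace ℝ (Fin d) => G q.2) (t, z) :=
      (h.contDiffAt_G hz).comp (t, z) hsnd
    have h3 : ContDiffAt ℝ ∞ (fun q : ℝ × EuclideanSpace ℝ (Fin d) => T q.2) (t, z) :=
      (h.smooth_T.contDiffAt_of_isOpen h.isOpen hz).comp (t, z) hsnd
    have h4 : ContDiffAt ℝ ∞ (fun q : ℝ × EuclideanSpace ℝ (Fin d) => f q.2 + q.1 • s q.2)
        (t, z) := ((m.smoothAt hz).comp (t, z) hsnd).add
      (hfst.smul (hs.contDiffAt.comp (t, z) hsnd))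
    have h5 : ContDiffAt ℝ ∞ (fun q : ℝ × EuclideanSpace ℝ (Fin d) => H (f q.2 + q.1 • s q.2))
        (t, z) := (m.target.contDiffAt_G hV).comp (t, z) h4
    have h6 : ContDiffAt ℝ ∞ (fun q : ℝ × EuclideanSpace ℝ (Fin d) =>
        fderiv ℝ f q.2 + q.1 • fderiv ℝ s q.2) (t, z) :=
      ((m.smoothAt hz).fderiv_smooth.comp (t, z) hsnd).add
        (hfst.smul (hs.contDiffAt.fderiv_smooth.comp (t, z) hsnd))
    exact (h1.mul (contDiffAt_horizontalEnergy h2 (h.pos z hz) h3 h5 h6)).contDiffWithinAt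
  have hmain := hasDerivAt_setIntegral_of_contDiffOn (μ := volume) hO (hA.of_le (by simp)) hK hKO
  refine hmain.congr_deriv ?_
  have hderiv : ∀ z ∈ K, fderiv ℝ (fun q : ℝ × EuclideanSpace ℝ (Fin d) => volDensity (G q.2) *
      horizontalEnergy (G q.2) (T q.2) (H (f q.2 + q.1 • s q.2))
        (fderiv ℝ f q.2 + q.1 • fderiv ℝ s q.2)) (0, z) (1, 0)
      = volDensity (G z) * gtrace (sharp (G z)) (formDeriv Γ (variationForm G T H f s) z)
        - volDensity (G z) * H (f z) (s z)
      (gtrace (sharp (G z)) (flatHess Γ Γ' f z) - flatHess Γ Γ' f z (T z) (T z)) := by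
    intro z hz
    have h1 := ((hA.contDiffAt (hO.mem_nhds (hKO z hz))).differentiableAt
      (by simp)).hasFDerivAt.comp_hasDerivAt (0 : ℝ)
        ((hasDerivAt_id (0 : ℝ)).prodMk (hasDerivAt_const (0 : ℝ) z))
    have h2 := (hasDerivAt_horizontalEnergy h m (hKU hz) (s := s)
      (hs.differentiable (by simp) z)).const_mul (volDensity (G z))
    refine (h1.unique h2).trans ?_
    rw [div_variationForm h m (hKU hz) hs.contDiffAt]
    ring
  rw [setIntegral_congr_fun hK.measurableSet hderiv]
  have hvs : ContDiffOn ℝ ∞ (variationForm G T H f s) U := fun z hz =>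
    (smooth_variationForm h m hz hs.contDiffAt).contDiffWithinAt
  have hv0 : ∀ z ∈ U, z ∉ K → variationForm G T H f s z = 0 := by
    intro z _ hzK
    ext u
    rw [variationForm_apply, hs0 z hzK]
    simp
  have h0 := h.toMetricConn.setIntegral_gtrace_eq_zero (fun z hz => h.torsion_traceless hz) hvs
    hK hKU hv0
  have h1 : ∫ z in U, volDensity (G z) * gtrace (sharp (G z))
      (formDeriv Γ (variationForm G T H f s) z) = ∫ z in K, volDensity (G z) *
        gtrace (sharp (G z)) (formDeriv Γ (variationForm G T H f s) z) := by
    refine setIntegral_eq_of_subset_of_forall_sdiff_eq_zero h.isOpen.measurableSet hKU ?_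
    rintro z ⟨hzU, hzK⟩
    have h2 : variationForm G T H f s =ᶠ[nhds z] fun _ => 0 := by
      filter_upwards [hK.isClosed.isOpen_compl.mem_nhds hzK, h.isOpen.mem_nhds hzU] with y hy hyU
      exact hv0 y hyU hy
    have h3 : formDeriv Γ (variationForm G T H f s) z = 0 := by
      ext u v
      rw [formDeriv_apply, h2.fderiv_eq, h2.eq_of_nhds]
      simp
    rw [h3]
    simp [gtrace]
  have hc1 : ContinuousOn (fun z => volDensity (G z) * gtrace (sharp (G z))
      (formDeriv Γ (variationForm G T H f s) z)) K := by
    intro z hz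
    have h2 := smooth_variationForm h m (hKU hz) hs.contDiffAt
    have h3 := sharp_contDiffAt (h.contDiffAt_G (hKU hz)) (h.pos z (hKU hz))
    simp only [gtrace, formDeriv_apply]
    have h5 : ContDiffAt ℝ ∞ (fun y => volDensity (G y) * ∑ i,
        (fderiv ℝ (variationForm G T H f s) y (stdB _ i) (sharp (G y) (stdCo _ i))
          - variationForm G T H f s y (Γ y (stdB _ i) (sharp (G y) (stdCo _ i))))) z :=
      (h.contDiffAt_volDensity (hKU hz)).mul (ContDiffAt.sum fun i _ =>
        ((h2.fderiv_smooth.clm_apply contDiffAt_const).clm_apply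
          (h3.clm_apply contDiffAt_const)).sub (h2.clm_apply (((h.contDiffAt_Γ (hKU hz)).clm_apply
            contDiffAt_const).clm_apply (h3.clm_apply contDiffAt_const))))
    exact h5.continuousAt.continuousWithinAt
  have hc2 : ContinuousOn (fun z => volDensity (G z) * H (f z) (s z)
      (gtrace (sharp (G z)) (flatHess Γ Γ' f z) - flatHess Γ Γ' f z (T z) (T z))) K := by
    intro z hz
    have h3 := sharp_contDiffAt (h.contDiffAt_G (hKU hz)) (h.pos z (hKU hz))
    have h4 := m.smooth_hess (hKU hz)
    have h6 : ContDiffAt ℝ ∞ T z := h.smooth_T.contDiffAt_of_isOpen h.isOpen (hKU hz)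
    have h5 := (h.contDiffAt_volDensity (hKU hz)).mul (((m.smooth_H (hKU hz)).clm_apply
      hs.contDiffAt).clm_apply ((ContDiffAt.sum fun i (_ : i ∈ Finset.univ) =>
        (h4.clm_apply (contDiffAt_const (c := stdB _ i))).clm_apply
          (h3.clm_apply (contDiffAt_const (c := stdCo _ i)))).sub
        ((h4.clm_apply h6).clm_apply h6)))
    exact h5.continuousAt.continuousWithinAt
  rw [integral_sub (hc1.integrableOn_compact hK) (hc2.integrableOn_compact hK), ← h1, h0, zero_sub]

/-- The Euler-Lagrange equation of the horizontal energy. -/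
theorem tension_eq_of_critical (h : SasakiLocal U G Γ J T) (m : LocalMap U G Γ V H Γ' f)
    (hcrit : ∀ (s : EuclideanSpace ℝ (Fin d) → F) (K : Set (EuclideanSpace ℝ (Fin d))),
      ContDiff ℝ ∞ s → IsCompact K → K ⊆ U → (∀ z, z ∉ K → s z = 0) → ∀ ε : ℝ, 0 < ε →
      (∀ t ∈ Ioo (-ε) ε, ∀ z ∈ U, f z + t • s z ∈ V) →
      HasDerivAt (variationEnergy G T H f s K) 0 0) {z₀ : EuclideanSpace ℝ (Fin d)} (hz₀ : z₀ ∈ U) :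
    gtrace (sharp (G z₀)) (flatHess Γ Γ' f z₀) = flatHess Γ Γ' f z₀ (T z₀) (T z₀) := by
  set τ : EuclideanSpace ℝ (Fin d) → F := fun z =>
    gtrace (sharp (G z)) (flatHess Γ Γ' f z) - flatHess Γ Γ' f z (T z) (T z) with hτ
  by_contra hne
  have hτ0 : τ z₀ ≠ 0 := sub_ne_zero.2 hne
  have hτc : ∀ z ∈ U, ContDiffAt ℝ ∞ τ z := by
    intro z hz
    have h3 := sharp_contDiffAt (h.contDiffAt_G hz) (h.pos z hz)
    have h4 := m.smooth_hess hz
    have h6 : ContDiffAt ℝ ∞ T z := h.smooth_T.contDiffAt_of_isOpen h.isOpen hz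
    exact (ContDiffAt.sum fun i (_ : i ∈ Finset.univ) =>
        (h4.clm_apply (contDiffAt_const (c := stdB _ i))).clm_apply
          (h3.clm_apply (contDiffAt_const (c := stdCo _ i)))).sub
        ((h4.clm_apply h6).clm_apply h6)
  set w := τ z₀ with hw
  -- The test variation is a bump function times the constant vector w, the value of tr β - β(T, T)
  -- at z₀, on a ball so small that the pairing of w with this field stays positive.
  set u : EuclideanSpace ℝ (Fin d) → ℝ := fun z => volDensity (G z) * H (f z) w (τ z) with hu
  have huc : ∀ z ∈ U, ContinuousAt u z := fun z hz =>
    ((h.contDiffAt_volDensity hz).mul (((m.smooth_H hz).clm_apply contDiffAt_const).clm_apply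
      (hτc z hz))).continuousAt
  have hu0 : 0 < u z₀ := mul_pos (h.volDensity_pos hz₀) (m.target.pos _ (m.maps z₀ hz₀) _ hτ0)
  obtain ⟨r, hr, hrU⟩ := Metric.mem_nhds_iff.1
    (Filter.inter_mem (h.isOpen.mem_nhds hz₀) ((huc z₀ hz₀).eventually (lt_mem_nhds hu0)))
  let χ : ContDiffBump z₀ := ⟨r / 4, r / 2, by positivity, by linarith⟩
  have hKU : Metric.closedBall z₀ (r / 2) ⊆ U ∩ {z | 0 < u z} := fun z hz =>
    hrU (Metric.closedBall_subset_ball (half_lt_self hr) hz)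
  have hKc : IsCompact (Metric.closedBall z₀ (r / 2)) := isCompact_closedBall _ _
  have hs : ContDiff ℝ ∞ (fun z => χ z • w) := χ.contDiff.smul contDiff_const
  have hχ0 : ∀ z, z ∉ Metric.closedBall z₀ (r / 2) → χ z = 0 := by
    intro z hz
    refine χ.zero_of_le_dist ?_
    have := not_le.1 (fun hle => hz (Metric.mem_closedBall.2 hle))
    exact this.le
  have hs0 : ∀ z, z ∉ Metric.closedBall z₀ (r / 2) → χ z • w = 0 := fun z hz => by
    rw [hχ0 z hz, zero_smul]
  -- The varied map must stay in V over all of U. On the closed ball this follows from compactness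
  -- for small t, elsewhere the map is unchanged.
  have hVs : ∃ ε : ℝ, 0 < ε ∧ ∀ t ∈ Ioo (-ε) ε, ∀ z ∈ U, f z + t • χ z • w ∈ V := by
    set O : Set (ℝ × EuclideanSpace ℝ (Fin d)) :=
      (univ ×ˢ U) ∩ (fun q => f q.2 + q.1 • χ q.2 • w) ⁻¹' V with hOd
    have hcf : ContinuousOn (fun q : ℝ × EuclideanSpace ℝ (Fin d) => f q.2 + q.1 • χ q.2 • w)
        (univ ×ˢ U) :=
      (m.smooth.continuousOn.comp continuousOn_snd fun q hq => hq.2).add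
        (continuousOn_fst.smul (hs.continuous.comp_continuousOn continuousOn_snd))
    have hO : IsOpen O := hcf.isOpen_inter_preimage (isOpen_univ.prod h.isOpen) m.target.isOpen
    obtain ⟨a, b, ha, hb, h0a, hKb, hab⟩ := generalized_tube_lemma
      (isCompact_singleton (x := (0 : ℝ))) hKc hO (by
        rintro ⟨t, z⟩ ⟨rfl, hz⟩
        exact ⟨⟨mem_univ _, (hKU hz).1⟩, by simpa using m.maps z (hKU hz).1⟩)
    obtain ⟨ε, hε, hεa⟩ := Metric.isOpen_iff.1 ha 0 (h0a rfl)
    refine ⟨ε, hε, fun t ht z hz => ?_⟩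
    by_cases hzK : z ∈ Metric.closedBall z₀ (r / 2)
    · have ht' : t ∈ Metric.ball (0 : ℝ) ε := by
        rw [Metric.mem_ball, Real.dist_eq, sub_zero, abs_lt]
        exact ht
      exact (hab ⟨hεa ht', hKb hzK⟩ : (t, z) ∈ O).2
    · rw [hs0 z hzK, smul_zero, add_zero]
      exact m.maps z hz
  obtain ⟨ε, hε, hεV⟩ := hVs
  have h1 := hcrit (fun z => χ z • w) _ hs hKc (fun z hz => (hKU hz).1) hs0 ε hε hεV
  have h2 := hasDerivAt_variationEnergy h m hs hKc (fun z hz => (hKU hz).1) hs0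
  have h3 := h2.unique h1
  rw [neg_eq_zero] at h3
  have h4 : ∫ z in Metric.closedBall z₀ (r / 2), χ z * u z = 0 := by
    rw [← h3]
    refine setIntegral_congr_fun hKc.measurableSet fun z _ => ?_
    simp only [hu, hτ, map_smul, smul_apply, smul_eq_mul]
    ring
  have hcont : ContinuousOn (fun z => χ z * u z) (Metric.closedBall z₀ (r / 2)) := fun z hz =>
    (χ.contDiff (n := 0).continuous.continuousAt.mul (huc z (hKU hz).1)).continuousWithinAt
  rw [setIntegral_eq_zero_iff_of_nonneg_ae] at h4
  · have h5 : (fun z => χ z * u z) =ᵐ[volume.restrict (Metric.ball z₀ (r / 2))] fun _ => 0 :=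
      ae_restrict_of_ae_restrict_of_subset Metric.ball_subset_closedBall h4
    have h6 := Measure.eqOn_open_of_ae_eq h5 Metric.isOpen_ball
      (hcont.mono Metric.ball_subset_closedBall) continuousOn_const
      (Metric.mem_ball_self (half_pos hr))
    simp only at h6
    rw [χ.one_of_mem_closedBall (Metric.mem_closedBall_self χ.rIn_pos.le), one_mul] at h6
    exact hu0.ne' h6
  · exact ae_restrict_of_forall_mem hKc.measurableSet fun z hz =>
      mul_nonneg χ.nonneg (hKU hz).2.le
  · exact hcont.integrableOn_compact hKc

end Critical

/-! ### Horizontal traces -/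

section UnitVector

variable {V : Type*} [AddCommGroup V] [Module ℝ V] {ι : Type*} [Fintype ι] [DecidableEq ι]

/-- Computes the trace over the orthogonal complement of T from any orthonormal basis, with no need
of one that contains T. -/
theorem IsOrthoBasis.sum_sub_unit {g : V →ₗ[ℝ] V →ₗ[ℝ] ℝ} {e : ι → V}
    (he : IsOrthoBasis (fun u v => g u v) e) {T : V} (hT : g T T = 1)
    (C : V →ₗ[ℝ] V →ₗ[ℝ] ℝ) :
    ∑ A, C (e A) (e A) - C T T
      = ∑ A, C (e A - g T (e A) • T) (e A - g T (e A) • T) := by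
  have h3 : ∑ A, g T (e A) * g T (e A) = 1 := by
    have := congrArg (g T) (he.complete T)
    simp only [map_sum, map_smul, smul_eq_mul, hT] at this
    exact this.symm
  have h4 : ∑ A, g T (e A) * C (e A) T = C T T := by
    have := congrArg (fun v => C v T) (he.complete T)
    simp only [map_sum, map_smul, smul_eq_mul, LinearMap.sum_apply, LinearMap.smul_apply] at this
    exact this.symm
  have h5 : ∑ A, g T (e A) * C T (e A) = C T T := by
    have := congrArg (C T) (he.complete T)
    simp only [map_sum, map_smul, smul_eq_mul] at this
    exact this.symm
  have h6 : ∀ A, C (e A - g T (e A) • T) (e A - g T (e A) • T)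
      = C (e A) (e A) - g T (e A) * C (e A) T - g T (e A) * C T (e A)
        + g T (e A) * g T (e A) * C T T := by
    intro A
    simp only [map_sub, map_smul, LinearMap.sub_apply, LinearMap.smul_apply, smul_eq_mul]
    ring
  simp only [h6, Finset.sum_add_distrib, Finset.sum_sub_distrib, h4, h5, ← Finset.sum_mul, h3]
  ring

end UnitVector

section HorizontalTrace

variable {E : Type*} [NormedAddCommGroup E] [NormedSpace ℝ E] [FiniteDimensional ℝ E]
  {F : Type*} [NormedAddCommGroup F] [NormedSpace ℝ F]

/-- The orthogonal projection along the unit vector `T`. -/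
noncomputable def projAlong (G : E →L[ℝ] E →L[ℝ] ℝ) (T : E) : E →L[ℝ] E :=
  ContinuousLinearMap.id ℝ E - (G T).smulRight T

theorem projAlong_apply (G : E →L[ℝ] E →L[ℝ] ℝ) (T u : E) :
    projAlong G T u = u - G T u • T := by
  simp [projAlong]

theorem horizontalEnergy_eq {G : E →L[ℝ] E →L[ℝ] ℝ} (hs : ∀ u v, G u v = G v u)
    (hp : ∀ v, v ≠ 0 → 0 < G v v) {T : E} (hT : G T T = 1) (H : F →L[ℝ] F →L[ℝ] ℝ)
    (L : E →L[ℝ] F) :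
    (1 / 2) * gtrace (sharp G) (ContinuousLinearMap.bilinearComp H (L.comp (projAlong G T))
      (L.comp (projAlong G T))) = horizontalEnergy G T H L := by
  obtain ⟨e, he⟩ := exists_orthoBasis G hs hp
  have h1 := gtrace_sharp_eq_sum hp he (ContinuousLinearMap.bilinearComp H L L)
  have h1' : ∑ i, H (L (stdB E i)) (L (sharp G (stdCo E i))) = ∑ A, H (L (e A)) (L (e A)) := h1
  rw [horizontalEnergy, h1', gtrace_sharp_eq_sum hp he]
  have h2 := IsOrthoBasis.sum_sub_unit (g := toBilin G) he hT
    (toBilin (ContinuousLinearMap.bilinearComp H L L))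
  simp only [toBilin_apply, ContinuousLinearMap.bilinearComp_apply] at h2
  simp only [ContinuousLinearMap.bilinearComp_apply, ContinuousLinearMap.comp_apply,
    projAlong_apply, h2]

end HorizontalTrace

/-! ### The pseudo-energy density in charts -/

section Density

variable {d : ℕ} {M : Type*} [TopologicalSpace M] [T2Space M] [CompactSpace M]
  [MeasurableSpace M] [BorelSpace M]
  [ChartedSpace (EuclideanSpace ℝ (Fin d)) M]
  [IsManifold 𝓘(ℝ, EuclideanSpace ℝ (Fin d)) ∞ M]
  {F : Type*} [NormedAddCommGroup F] [NormedSpace ℝ F] [FiniteDimensional ℝ F]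
  {N : Type*} [TopologicalSpace N] [ChartedSpace F N] [IsManifold 𝓘(ℝ, F) ∞ N]
  (P : PseudohermitianStructure (EuclideanSpace ℝ (Fin d)) M)
  (h : ContMDiffRiemannianMetric 𝓘(ℝ, F) ∞ F (TangentSpace 𝓘(ℝ, F) : N → Type _))

theorem pseudoEnergyDensity_eq {φ : M → N} {p x : M} {q : N}
    (hx : x ∈ (chartAt (EuclideanSpace ℝ (Fin d)) p).source) (hq : φ x ∈ (chartAt F q).source)
    (hφ : MDifferentiableAt 𝓘(ℝ, EuclideanSpace ℝ (Fin d)) 𝓘(ℝ, F) φ x) :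
    pseudoEnergyDensity P h φ x
      = horizontalEnergy (coordBilin p P.webster (chartAt (EuclideanSpace ℝ (Fin d)) p x))
        (coordField p P.T (chartAt (EuclideanSpace ℝ (Fin d)) p x))
        (coordMetric h q (coordMap (F := F) p q φ (chartAt (EuclideanSpace ℝ (Fin d)) p x)))
        (fderiv ℝ (coordMap (F := F) p q φ) (chartAt (EuclideanSpace ℝ (Fin d)) p x)) := by
  have hz := (chartAt (EuclideanSpace ℝ (Fin d)) p).map_source hx
  have hg := P.isSmoothMetric_webster
  have hT : coordField p P.T (chartAt (EuclideanSpace ℝ (Fin d)) p x) = tcoord p x (P.T x) :=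
    coordField_chart hx
  have hTT : coordBilin p P.webster (chartAt (EuclideanSpace ℝ (Fin d)) p x)
      (coordField p P.T (chartAt (EuclideanSpace ℝ (Fin d)) p x))
      (coordField p P.T (chartAt (EuclideanSpace ℝ (Fin d)) p x)) = 1 := by
    rw [hT, coordBilin_chart hx (P.webster_isBilin x), P.webster_T_left, P.θ_T]
  rw [← horizontalEnergy_eq (hg.coord_symm p _) (hg.coord_pos p hz) hTT, pseudoEnergyDensity]
  congr 1
  have hW : P.webster x = fun u v => coordBilin p P.webster
      (chartAt (EuclideanSpace ℝ (Fin d)) p x) (tcoordEquiv hx u) (tcoordEquiv hx v) := by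
    ext u v
    rw [tcoordEquiv_apply, tcoordEquiv_apply, coordBilin_chart hx (P.webster_isBilin x)]
  have hproj : ∀ u, tcoord p x (P.projH x u)
      = projAlong (coordBilin p P.webster (chartAt (EuclideanSpace ℝ (Fin d)) p x))
        (coordField p P.T (chartAt (EuclideanSpace ℝ (Fin d)) p x)) (tcoord p x u) := by
    intro u
    rw [projAlong_apply, hT, coordBilin_chart hx (P.webster_isBilin x), P.webster_T_left,
      PseudohermitianStructure.projH, map_sub, map_smul]
  rw [← metricTraceVec_eq_gtrace (tcoordEquiv hx) (hg.coord_symm p _) (hg.coord_pos p hz), ← hW]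
  have hC : (fun u v => h.inner (φ x)
      (mfderiv 𝓘(ℝ, EuclideanSpace ℝ (Fin d)) 𝓘(ℝ, F) φ x (P.projH x u))
      (mfderiv 𝓘(ℝ, EuclideanSpace ℝ (Fin d)) 𝓘(ℝ, F) φ x (P.projH x v)))
      = fun u v => ContinuousLinearMap.bilinearComp
        (coordMetric h q (coordMap (F := F) p q φ (chartAt (EuclideanSpace ℝ (Fin d)) p x)))
        ((fderiv ℝ (coordMap (F := F) p q φ) (chartAt (EuclideanSpace ℝ (Fin d)) p x)).comp
          (projAlong (coordBilin p P.webster (chartAt (EuclideanSpace ℝ (Fin d)) p x))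
            (coordField p P.T (chartAt (EuclideanSpace ℝ (Fin d)) p x))))
        ((fderiv ℝ (coordMap (F := F) p q φ) (chartAt (EuclideanSpace ℝ (Fin d)) p x)).comp
          (projAlong (coordBilin p P.webster (chartAt (EuclideanSpace ℝ (Fin d)) p x))
            (coordField p P.T (chartAt (EuclideanSpace ℝ (Fin d)) p x))))
        (tcoordEquiv hx u) (tcoordEquiv hx v) := by
    ext u v
    rw [ContinuousLinearMap.bilinearComp_apply, ContinuousLinearMap.comp_apply,
      ContinuousLinearMap.comp_apply, tcoordEquiv_apply, tcoordEquiv_apply, ← hproj, ← hproj,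
      ← tcoord_mfderiv hx hq hφ, ← tcoord_mfderiv hx hq hφ, coordMap_chart hx,
      coordMetric_chart hq]
  rw [hC]
  rfl

theorem pseudoEnergyDensity_congr {φ φ' : M → N} {x : M}
    (hφ : MDifferentiableAt 𝓘(ℝ, EuclideanSpace ℝ (Fin d)) 𝓘(ℝ, F) φ x)
    (hφ' : MDifferentiableAt 𝓘(ℝ, EuclideanSpace ℝ (Fin d)) 𝓘(ℝ, F) φ' x)
    (he : φ =ᶠ[nhds x] φ') : pseudoEnergyDensity P h φ x = pseudoEnergyDensity P h φ' x := by
  have hx := mem_chart_source (EuclideanSpace ℝ (Fin d)) x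
  have hq := mem_chart_source F (φ x)
  have hq' : φ' x ∈ (chartAt F (φ x)).source := by rwa [← he.eq_of_nhds]
  rw [pseudoEnergyDensity_eq P h hx hq hφ, pseudoEnergyDensity_eq P h hx hq' hφ']
  have h1 : coordMap (F := F) x (φ x) φ =ᶠ[nhds (chartAt (EuclideanSpace ℝ (Fin d)) x x)]
      coordMap (F := F) x (φ x) φ' := by
    have h4 := (chartAt (EuclideanSpace ℝ (Fin d)) x).continuousAt_symm
      ((chartAt (EuclideanSpace ℝ (Fin d)) x).map_source hx)
    rw [ContinuousAt, (chartAt (EuclideanSpace ℝ (Fin d)) x).left_inv hx] at h4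
    filter_upwards [h4.eventually he] with z hz
    rw [coordMap, coordMap, hz]
  rw [h1.fderiv_eq, h1.eq_of_nhds]

theorem continuous_pseudoEnergyDensity {φ : M → N}
    (hφ : ContMDiff 𝓘(ℝ, EuclideanSpace ℝ (Fin d)) 𝓘(ℝ, F) ∞ φ) :
    Continuous (pseudoEnergyDensity P h φ) := by
  refine continuous_of_coord (d := d) fun p z hz => ?_
  set q := φ ((chartAt (EuclideanSpace ℝ (Fin d)) p).symm z) with hq
  have hzU : z ∈ coordDomain (E := EuclideanSpace ℝ (Fin d)) (F := F) p q φ :=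
    ⟨hz, mem_chart_source F q⟩
  have hU := isOpen_coordDomain (E := EuclideanSpace ℝ (Fin d)) (F := F) p q hφ.continuous
  have h1 : (fun z => pseudoEnergyDensity P h φ ((chartAt (EuclideanSpace ℝ (Fin d)) p).symm z))
      =ᶠ[nhds z] fun z => horizontalEnergy (coordBilin p P.webster z) (coordField p P.T z)
        (coordMetric h q (coordMap (F := F) p q φ z)) (fderiv ℝ (coordMap (F := F) p q φ) z) := by
    filter_upwards [hU.mem_nhds hzU] with y hy
    rw [pseudoEnergyDensity_eq P h (symm_mem_source hy.1) hy.2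
      ((hφ.mdifferentiable (by simp)) _), (chartAt (EuclideanSpace ℝ (Fin d)) p).right_inv hy.1]
  have hft := (chartAt (EuclideanSpace ℝ (Fin d)) p).open_target
  have hf := (contDiffOn_coordMap p q hφ).contDiffAt_of_isOpen hU hzU
  have hT : ContDiffAt ℝ ∞ (coordField p P.T) z := by
    have := (contMDiffAt_section_iff_coord (symm_mem_source hz)).1 (P.contMDiff_T _)
    rwa [(chartAt (EuclideanSpace ℝ (Fin d)) p).right_inv hz] at this
  have hH0 : ContDiffAt ℝ ∞ (coordMetric h q) (coordMap (F := F) p q φ z) := by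
    rw [coordMap]
    exact (contDiffOn_coordMetric (h := h) q).contDiffAt_of_isOpen (chartAt F q).open_target
      ((chartAt F q).map_source hzU.2)
  have hH : ContDiffAt ℝ ∞ (fun z => coordMetric h q (coordMap (F := F) p q φ z)) z :=
    ContDiffAt.comp (g := coordMetric h q) z hH0 hf
  have h2 := contDiffAt_horizontalEnergy ((P.contDiffOn_coordBilin_webster p).contDiffAt_of_isOpen
    hft hz) (P.isSmoothMetric_webster.coord_pos p hz) hT hH hf.fderiv_smooth
  exact (h2.continuousAt.congr h1.symm).continuousWithinAt

end Density

/-! ### Variations of a map supported in a chart -/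

section Variation

variable {E : Type*} [NormedAddCommGroup E] [NormedSpace ℝ E] [FiniteDimensional ℝ E]
  {M : Type*} [TopologicalSpace M] [T2Space M] [ChartedSpace E M] [IsManifold 𝓘(ℝ, E) ∞ M]
  {F : Type*} [NormedAddCommGroup F] [NormedSpace ℝ F] [FiniteDimensional ℝ F]
  {N : Type*} [TopologicalSpace N] [ChartedSpace F N] [IsManifold 𝓘(ℝ, F) ∞ N]

open Classical in
/-- The map whose coordinate expression is `φ + t s`, in the charts at `p` and `q`. -/
noncomputable def chartVariation (p : M) (q : N) (φ : M → N) (s : E → F) (t : ℝ) (x : M) : N :=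
  if x ∈ (chartAt E p).source ∩ φ ⁻¹' (chartAt F q).source then
    (chartAt F q).symm (chartAt F q (φ x) + t • s (chartAt E p x)) else φ x

variable {p : M} {q : N} {φ : M → N} {s : E → F} {K : Set E} {t : ℝ}

theorem chartVariation_zero : chartVariation p q φ s 0 = φ := by
  ext x
  rw [chartVariation]
  split_ifs with hx
  · rw [zero_smul, add_zero, (chartAt F q).left_inv hx.2]
  · rfl

theorem chartVariation_eq (hs : ∀ z, z ∉ K → s z = 0) {x : M}
    (hx : x ∉ (chartAt E p).symm '' K) : chartVariation p q φ s t x = φ x := by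
  rw [chartVariation]
  split_ifs with h
  · rw [hs _ fun hK => hx ⟨_, hK, (chartAt E p).left_inv h.1⟩, smul_zero, add_zero,
      (chartAt F q).left_inv h.2]
  · rfl

theorem chartVariation_chart {z : E} (hz : z ∈ coordDomain (E := E) (F := F) p q φ) :
    chartVariation p q φ s t ((chartAt E p).symm z)
      = (chartAt F q).symm (coordMap (F := F) p q φ z + t • s z) := by
  rw [chartVariation, if_pos ⟨symm_mem_source hz.1, hz.2⟩, (chartAt E p).right_inv hz.1, coordMap]

theorem isCompact_chart_image (hK : IsCompact K) (hKU : K ⊆ (chartAt E p).target) :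
    IsCompact ((chartAt E p).symm '' K) :=
  hK.image_of_continuousOn ((chartAt E p).continuousOn_symm.mono hKU)

/-- On the open chart domain the defining formula is smooth. Any other point lies off the image of
K, which is compact and hence closed, so near it the variation is just φ. -/
theorem contMDiffAt_chartVariation (hφ : ContMDiff 𝓘(ℝ, E) 𝓘(ℝ, F) ∞ φ) (hs : ContDiff ℝ ∞ s)
    (hK : IsCompact K) (hKU : K ⊆ coordDomain (E := E) (F := F) p q φ)
    (hs0 : ∀ z, z ∉ K → s z = 0)
    (ht : ∀ z ∈ coordDomain (E := E) (F := F) p q φ,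
      coordMap (F := F) p q φ z + t • s z ∈ (chartAt F q).target) (x : M) :
    ContMDiffAt (𝓘(ℝ, ℝ).prod 𝓘(ℝ, E)) 𝓘(ℝ, F) ∞
      (fun y : ℝ × M => chartVariation p q φ s y.1 y.2) (t, x) := by
  by_cases hx : x ∈ (chartAt E p).source ∩ φ ⁻¹' (chartAt F q).source
  · have hS : IsOpen ((chartAt E p).source ∩ φ ⁻¹' (chartAt F q).source) :=
      (chartAt E p).open_source.inter ((chartAt F q).open_source.preimage hφ.continuous)
    have h1 : (fun y : ℝ × M => chartVariation p q φ s y.1 y.2) =ᶠ[nhds (t, x)] fun y =>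
        (chartAt F q).symm (chartAt F q (φ y.2) + y.1 • s (chartAt E p y.2)) := by
      filter_upwards [continuousAt_snd.eventually (hS.mem_nhds hx)] with y hy
      exact if_pos hy
    refine ContMDiffAt.congr_of_eventuallyEq ?_ h1
    have h2 : ContMDiffAt (𝓘(ℝ, ℝ).prod 𝓘(ℝ, E)) 𝓘(ℝ, F) ∞
        (fun y : ℝ × M => chartAt F q (φ y.2)) (t, x) :=
      ContMDiffAt.comp (I' := 𝓘(ℝ, F)) (t, x) (contMDiffAt_chartAt hx.2)
        (ContMDiffAt.comp (I' := 𝓘(ℝ, E)) (t, x) (hφ x) contMDiffAt_snd)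
    have h3 : ContMDiffAt (𝓘(ℝ, ℝ).prod 𝓘(ℝ, E)) 𝓘(ℝ, F) ∞
        (fun y : ℝ × M => s (chartAt E p y.2)) (t, x) :=
      ContMDiffAt.comp (I' := 𝓘(ℝ, E)) (t, x) hs.contMDiff.contMDiffAt
        (ContMDiffAt.comp (I' := 𝓘(ℝ, E)) (t, x) (contMDiffAt_chartAt hx.1) contMDiffAt_snd)
    have h4 : ContMDiffAt (𝓘(ℝ, ℝ).prod 𝓘(ℝ, E)) 𝓘(ℝ, ℝ) ∞
        (fun y : ℝ × M => y.1) (t, x) := contMDiffAt_fst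
    have h5 := ht _ (mem_coordDomain hx.1 hx.2)
    rw [coordMap_chart hx.1] at h5
    exact ContMDiffAt.comp (I' := 𝓘(ℝ, F)) (t, x) (contMDiffAt_chartAt_symm h5) (h2.add (h4.smul h3))
  · have hx' : x ∉ (chartAt E p).symm '' K := by
      rintro ⟨z, hz, rfl⟩
      exact hx ⟨symm_mem_source (hKU hz).1, (hKU hz).2⟩
    have h1 : (fun y : ℝ × M => chartVariation p q φ s y.1 y.2) =ᶠ[nhds (t, x)] fun y => φ y.2 := by
      filter_upwards [continuousAt_snd.eventually ((isCompact_chart_image hK fun z hz =>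
        (hKU hz).1).isClosed.isOpen_compl.mem_nhds hx')] with y hy
      exact chartVariation_eq hs0 hy
    exact (ContMDiffAt.comp (I' := 𝓘(ℝ, E)) (t, x) (hφ x) contMDiffAt_snd).congr_of_eventuallyEq h1

theorem contMDiff_chartVariation (hφ : ContMDiff 𝓘(ℝ, E) 𝓘(ℝ, F) ∞ φ) (hs : ContDiff ℝ ∞ s)
    (hK : IsCompact K) (hKU : K ⊆ coordDomain (E := E) (F := F) p q φ)
    (hs0 : ∀ z, z ∉ K → s z = 0)
    (ht : ∀ z ∈ coordDomain (E := E) (F := F) p q φ,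
      coordMap (F := F) p q φ z + t • s z ∈ (chartAt F q).target) :
    ContMDiff 𝓘(ℝ, E) 𝓘(ℝ, F) ∞ (chartVariation p q φ s t) := fun x => by
  have h1 : ContMDiffAt 𝓘(ℝ, E) (𝓘(ℝ, ℝ).prod 𝓘(ℝ, E)) ∞ (fun x : M => (t, x)) x :=
    contMDiffAt_const.prodMk contMDiffAt_id
  exact ContMDiffAt.comp (I' := 𝓘(ℝ, ℝ).prod 𝓘(ℝ, E)) x
    (contMDiffAt_chartVariation hφ hs hK hKU hs0 ht x) h1

end Variation

/-! ### The Euler-Lagrange equation of pseudoharmonic maps -/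

section Critical

variable {d : ℕ} {M : Type*} [TopologicalSpace M] [T2Space M] [CompactSpace M]
  [MeasurableSpace M] [BorelSpace M]
  [ChartedSpace (EuclideanSpace ℝ (Fin d)) M]
  [IsManifold 𝓘(ℝ, EuclideanSpace ℝ (Fin d)) ∞ M]
  {F : Type*} [NormedAddCommGroup F] [NormedSpace ℝ F] [FiniteDimensional ℝ F]
  {N : Type*} [TopologicalSpace N] [ChartedSpace F N] [IsManifold 𝓘(ℝ, F) ∞ N]
  {P : PseudohermitianStructure (EuclideanSpace ℝ (Fin d)) M}
  {h : ContMDiffRiemannianMetric 𝓘(ℝ, F) ∞ F (TangentSpace 𝓘(ℝ, F) : N → Type _)}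

/-- The pseudo-energy is an integral over all of M; only the difference for two maps that agree off
the image of K can be computed in one chart. -/
theorem pseudoEnergy_sub {φ φ' : M → N} (hφ : ContMDiff 𝓘(ℝ, EuclideanSpace ℝ (Fin d)) 𝓘(ℝ, F) ∞ φ)
    (hφ' : ContMDiff 𝓘(ℝ, EuclideanSpace ℝ (Fin d)) 𝓘(ℝ, F) ∞ φ') {p : M}
    {K : Set (EuclideanSpace ℝ (Fin d))} (hK : IsCompact K)
    (hKt : K ⊆ (chartAt (EuclideanSpace ℝ (Fin d)) p).target)
    (he : ∀ x, x ∉ (chartAt (EuclideanSpace ℝ (Fin d)) p).symm '' K → φ' x = φ x) :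
    pseudoEnergy P h φ' - pseudoEnergy P h φ
      = (∫ z in K, volDensity (coordBilin p P.webster z)
          * pseudoEnergyDensity P h φ' ((chartAt (EuclideanSpace ℝ (Fin d)) p).symm z))
        - ∫ z in K, volDensity (coordBilin p P.webster z)
          * pseudoEnergyDensity P h φ ((chartAt (EuclideanSpace ℝ (Fin d)) p).symm z) := by
  have hg := P.isSmoothMetric_webster
  have hfin := hg.isFiniteMeasure_riemannianVolume
  have hc := continuous_pseudoEnergyDensity P h hφ
  have hc' := continuous_pseudoEnergyDensity P h hφ'
  have hi : ∀ {f : M → ℝ}, Continuous f → Integrable f (riemannianVolume P.webster) := fun hf =>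
    hf.integrable_of_hasCompactSupport (HasCompactSupport.of_compactSpace _)
  have h0 : ∀ x, x ∉ (chartAt (EuclideanSpace ℝ (Fin d)) p).symm '' K →
      pseudoEnergyDensity P h φ' x - pseudoEnergyDensity P h φ x = 0 := by
    intro x hx
    rw [pseudoEnergyDensity_congr P h (hφ'.mdifferentiable (by simp) x)
      (hφ.mdifferentiable (by simp) x), sub_self]
    filter_upwards [(isCompact_chart_image hK hKt).isClosed.isOpen_compl.mem_nhds hx] with y hy
    exact he y hy
  have hρ : ∀ {f : M → ℝ}, Continuous f → IntegrableOn (fun z =>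
      volDensity (coordBilin p P.webster z)
        * f ((chartAt (EuclideanSpace ℝ (Fin d)) p).symm z)) K := fun hf =>
    (((hg.contDiffOn_volDensity p).continuousOn.mul (hf.comp_continuousOn
      (chartAt (EuclideanSpace ℝ (Fin d)) p).continuousOn_symm)).mono hKt).integrableOn_compact hK
  rw [pseudoEnergy, pseudoEnergy, ← integral_sub (hi hc') (hi hc),
    hg.integral_riemannianVolume p (f := fun x => pseudoEnergyDensity P h φ' x
      - pseudoEnergyDensity P h φ x) (hc'.sub hc), ← integral_sub (hρ hc') (hρ hc)]
  · rw [← setIntegral_eq_of_subset_of_forall_sdiff_eq_zero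
      (chartAt (EuclideanSpace ℝ (Fin d)) p).open_target.measurableSet hKt]
    · exact integral_congr_ae (Filter.Eventually.of_forall fun z => mul_sub _ _ _)
    · rintro z ⟨hz, hzK⟩
      rw [← mul_sub, h0, mul_zero]
      rintro ⟨k, hk, hkz⟩
      exact hzK ((chartAt (EuclideanSpace ℝ (Fin d)) p).symm.injOn (hKt hk) hz hkz ▸ hk)
  · intro x hx
    refine h0 x ?_
    rintro ⟨k, hk, rfl⟩
    exact hx (symm_mem_source (hKt hk))

theorem pseudoEnergyDensity_chartVariation {φ : M → N} {p : M} {q : N}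
    {s : EuclideanSpace ℝ (Fin d) → F} {K : Set (EuclideanSpace ℝ (Fin d))} {t : ℝ}
    (hφ : ContMDiff 𝓘(ℝ, EuclideanSpace ℝ (Fin d)) 𝓘(ℝ, F) ∞ φ) (hs : ContDiff ℝ ∞ s)
    (hK : IsCompact K) (hKU : K ⊆ coordDomain (E := EuclideanSpace ℝ (Fin d)) (F := F) p q φ)
    (hs0 : ∀ z, z ∉ K → s z = 0)
    (ht : ∀ z ∈ coordDomain (E := EuclideanSpace ℝ (Fin d)) (F := F) p q φ,
      coordMap (F := F) p q φ z + t • s z ∈ (chartAt F q).target) {z : EuclideanSpace ℝ (Fin d)}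
    (hz : z ∈ coordDomain (E := EuclideanSpace ℝ (Fin d)) (F := F) p q φ) :
    pseudoEnergyDensity P h (chartVariation p q φ s t)
        ((chartAt (EuclideanSpace ℝ (Fin d)) p).symm z)
      = horizontalEnergy (coordBilin p P.webster z) (coordField p P.T z)
        (coordMetric h q (coordMap (F := F) p q φ z + t • s z))
        (fderiv ℝ (coordMap (F := F) p q φ) z + t • fderiv ℝ s z) := by
  have hU := isOpen_coordDomain (E := EuclideanSpace ℝ (Fin d)) (F := F) p q hφ.continuous
  have h1 : ∀ y ∈ coordDomain (E := EuclideanSpace ℝ (Fin d)) (F := F) p q φ,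
      coordMap (F := F) p q (chartVariation p q φ s t) y = coordMap (F := F) p q φ y + t • s y := by
    intro y hy
    rw [coordMap, chartVariation_chart hy, (chartAt F q).right_inv (ht y hy)]
  have h2 : coordMap (F := F) p q (chartVariation p q φ s t) =ᶠ[nhds z]
      fun y => coordMap (F := F) p q φ y + t • s y := by
    filter_upwards [hU.mem_nhds hz] with y hy using h1 y hy
  have hf := ((contDiffOn_coordMap p q hφ).contDiffAt_of_isOpen hU hz).differentiableAt_of_smooth
  have hs' : DifferentiableAt ℝ s z := hs.contDiffAt.differentiableAt_of_smooth
  rw [pseudoEnergyDensity_eq P h (symm_mem_source hz.1)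
    (by rw [chartVariation_chart hz]; exact (chartAt F q).map_target (ht z hz))
    ((contMDiff_chartVariation hφ hs hK hKU hs0 ht).mdifferentiable (by simp) _),
    (chartAt (EuclideanSpace ℝ (Fin d)) p).right_inv hz.1, h1 z hz, h2.fderiv_eq,
    fderiv_fun_add hf (hs'.fun_const_smul t), fderiv_fun_const_smul hs']

/-- The Euler-Lagrange equation of pseudoharmonic maps. -/
theorem IsPseudoharmonicMap.tensionEq
    {D : CovariantDerivative 𝓘(ℝ, EuclideanSpace ℝ (Fin d)) (EuclideanSpace ℝ (Fin d))
      (TangentSpace 𝓘(ℝ, EuclideanSpace ℝ (Fin d)) : M → Type _)}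
    {D' : CovariantDerivative 𝓘(ℝ, F) F (TangentSpace 𝓘(ℝ, F) : N → Type _)} {φ : M → N}
    {J' : ∀ y : N, TangentSpace 𝓘(ℝ, F) y →L[ℝ] TangentSpace 𝓘(ℝ, F) y}
    [CompleteSpace F] (hM : P.IsSasakian D) (hN : IsKahler h D' J')
    (hφ : IsPseudoharmonicMap P h φ) : TensionEq P D D' φ 1 := by
  intro p q z₀ hz₀
  have hS := hM.sasakiLocal_coordDomain p q (F := F) hφ.1.continuous
  rw [one_smul]
  refine tension_eq_of_critical hS (localMap_chart hφ.1 hS.toMetricConn subset_rfl hN) ?_ hz₀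
  intro s K hs hK hKU hs0 ε hε ht
  have hKt : K ⊆ (chartAt (EuclideanSpace ℝ (Fin d)) p).target := fun z hz => (hKU hz).1
  have h1 := hφ.2 ε hε (chartVariation p q φ s) (fun y hy => (contMDiffAt_chartVariation hφ.1 hs hK
    hKU hs0 (ht y.1 hy.1) y.2).contMDiffWithinAt) chartVariation_zero
  -- For small t the coordinate energy over K and the pseudo-energy of the variation differ by a
  -- constant, so criticality transfers.
  have h2 : variationEnergy (coordBilin p P.webster) (coordField p P.T) (coordMetric h q)
      (coordMap p q φ) s K =ᶠ[nhds 0] fun t => pseudoEnergy P h (chartVariation p q φ s t)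
        + ((∫ z in K, volDensity (coordBilin p P.webster z)
          * pseudoEnergyDensity P h φ ((chartAt (EuclideanSpace ℝ (Fin d)) p).symm z))
          - pseudoEnergy P h φ) := by
    filter_upwards [Ioo_mem_nhds (neg_lt_zero.2 hε) hε] with t hti
    have h3 := pseudoEnergy_sub (P := P) (h := h) hφ.1
      (contMDiff_chartVariation hφ.1 hs hK hKU hs0 (ht t hti))
      hK hKt fun x hx => chartVariation_eq hs0 hx
    have h4 : variationEnergy (coordBilin p P.webster) (coordField p P.T) (coordMetric h q)
        (coordMap p q φ) s K t = ∫ z in K, volDensity (coordBilin p P.webster z)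
          * pseudoEnergyDensity P h (chartVariation p q φ s t)
            ((chartAt (EuclideanSpace ℝ (Fin d)) p).symm z) := by
      refine setIntegral_congr_fun hK.measurableSet fun z hz => ?_
      simp only [pseudoEnergyDensity_chartVariation hφ.1 hs hK hKU hs0 (ht t hti) (hKU hz)]
    rw [h4]
    linarith
  exact (h1.add_const _).congr_of_eventuallyEq h2

end Critical

/-! ### From divergences in charts to functions on M -/

section Globalization

variable {d : ℕ} {M : Type*} [TopologicalSpace M] [T2Space M] [CompactSpace M]
  [MeasurableSpace M] [BorelSpace M]
  [ChartedSpace (EuclideanSpace ℝ (Fin d)) M]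
  [IsManifold 𝓘(ℝ, EuclideanSpace ℝ (Fin d)) ∞ M]
  {F : Type*} [NormedAddCommGroup F] [NormedSpace ℝ F] [FiniteDimensional ℝ F]
  {N : Type*} [TopologicalSpace N] [ChartedSpace F N] [IsManifold 𝓘(ℝ, F) ∞ N]
  {P : PseudohermitianStructure (EuclideanSpace ℝ (Fin d)) M}
  {D : CovariantDerivative 𝓘(ℝ, EuclideanSpace ℝ (Fin d)) (EuclideanSpace ℝ (Fin d))
    (TangentSpace 𝓘(ℝ, EuclideanSpace ℝ (Fin d)) : M → Type _)}
  {h : ContMDiffRiemannianMetric 𝓘(ℝ, F) ∞ F (TangentSpace 𝓘(ℝ, F) : N → Type _)}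
  {D' : CovariantDerivative 𝓘(ℝ, F) F (TangentSpace 𝓘(ℝ, F) : N → Type _)} {φ : M → N}
  {J' : ∀ y : N, TangentSpace 𝓘(ℝ, F) y →L[ℝ] TangentSpace 𝓘(ℝ, F) y}

/-- A one-form on a compact Sasakian manifold, given in charts of source and target of a map `φ`,
whose divergence is nonnegative has vanishing divergence. -/
theorem PseudohermitianStructure.IsSasakian.eq_zero_of_local_divergence (hM : P.IsSasakian D)
    (hφ : Continuous φ)
    (η : M → N → EuclideanSpace ℝ (Fin d) → EuclideanSpace ℝ (Fin d) →L[ℝ] ℝ)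
    (l : ∀ x : M, TangentSpace 𝓘(ℝ, EuclideanSpace ℝ (Fin d)) x → ℝ) (f : M → ℝ)
    (hη : ∀ p q x, x ∈ (chartAt (EuclideanSpace ℝ (Fin d)) p).source → φ x ∈ (chartAt F q).source →
      ContDiffAt ℝ ∞ (η p q) (chartAt (EuclideanSpace ℝ (Fin d)) p x))
    (hl : ∀ p q x, x ∈ (chartAt (EuclideanSpace ℝ (Fin d)) p).source → φ x ∈ (chartAt F q).source →
      ∀ u, η p q (chartAt (EuclideanSpace ℝ (Fin d)) p x) (tcoord p x u) = l x u)
    (hf : ∀ p q x, x ∈ (chartAt (EuclideanSpace ℝ (Fin d)) p).source → φ x ∈ (chartAt F q).source →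
      gtrace (sharp (coordBilin p P.webster (chartAt (EuclideanSpace ℝ (Fin d)) p x)))
        (formDeriv (christoffel D p) (η p q) (chartAt (EuclideanSpace ℝ (Fin d)) p x)) = f x)
    (h0 : ∀ x, 0 ≤ f x) (x : M) : f x = 0 := by
  -- The local expressions represent one covector field, whose values are given by l. It is defined
  -- from the charts at x and φ x, and hl identifies it with η p q wherever the latter is defined.
  set L : ∀ x : M, TangentSpace 𝓘(ℝ, EuclideanSpace ℝ (Fin d)) x →L[ℝ] ℝ := fun x =>
    (η x (φ x) (chartAt (EuclideanSpace ℝ (Fin d)) x x)).comp (tcoord x x) with hL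
  have hLl : ∀ x u, L x u = l x u := fun x u =>
    hl x (φ x) x (mem_chart_source _ x) (mem_chart_source _ _) u
  have hLη : ∀ p q, ∀ z ∈ coordDomain (E := EuclideanSpace ℝ (Fin d)) (F := F) p q φ,
      coordForm p L z = η p q z := by
    intro p q z hz
    have h1 := symm_mem_source hz.1
    have h2 := (chartAt (EuclideanSpace ℝ (Fin d)) p).right_inv hz.1
    ext v
    rw [← h2, ← tcoord_tvec h1 v, coordForm_chart h1, hLl, hl p q _ h1 hz.2]
  have hU : ∀ p q, IsOpen (coordDomain (E := EuclideanSpace ℝ (Fin d)) (F := F) p q φ) :=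
    fun p q => isOpen_coordDomain p q hφ
  have hmem : ∀ p, ∀ z ∈ (chartAt (EuclideanSpace ℝ (Fin d)) p).target,
      z ∈ coordDomain (E := EuclideanSpace ℝ (Fin d)) (F := F) p
        (φ ((chartAt (EuclideanSpace ℝ (Fin d)) p).symm z)) φ :=
    fun p z hz => ⟨hz, mem_chart_source F _⟩
  have hev : ∀ p, ∀ z ∈ (chartAt (EuclideanSpace ℝ (Fin d)) p).target,
      coordForm p L =ᶠ[nhds z] η p (φ ((chartAt (EuclideanSpace ℝ (Fin d)) p).symm z)) := by
    intro p z hz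
    filter_upwards [(hU p _).mem_nhds (hmem p z hz)] with y hy using hLη _ _ y hy
  refine P.isSmoothMetric_webster.eq_zero_of_divergence_nonneg (Γ := fun p => christoffel D p)
    (fun p => (hM.sasakiLocal p).toMetricConn)
    (fun p z hz u => (hM.sasakiLocal p).torsion_traceless hz u) (l := L) ?_ ?_ h0 x
  · intro p z hz
    have h1 := hη p _ _ (symm_mem_source hz) (mem_chart_source F _)
    rw [(chartAt (EuclideanSpace ℝ (Fin d)) p).right_inv hz] at h1
    exact (h1.congr_of_eventuallyEq (hev p z hz)).contDiffWithinAt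
  · intro p z hz
    have h1 := hf p _ _ (symm_mem_source hz) (mem_chart_source F _)
    rw [(chartAt (EuclideanSpace ℝ (Fin d)) p).right_inv hz] at h1
    rw [← h1]
    congr 1
    rw [formDeriv, formDeriv, (hev p z hz).fderiv_eq, (hev p z hz).eq_of_nhds]

theorem IsOrthoBasis.tcoord {ι : Type*} [Fintype ι] [DecidableEq ι] {p x : M}
    {e : ι → TangentSpace 𝓘(ℝ, EuclideanSpace ℝ (Fin d)) x} (he : IsOrthoBasis (P.webster x) e)
    (hx : x ∈ (chartAt (EuclideanSpace ℝ (Fin d)) p).source) :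
    IsOrthoBasis (fun u v => coordBilin p P.webster (chartAt (EuclideanSpace ℝ (Fin d)) p x) u v)
      (fun i => tcoord p x (e i)) :=
  he.map (tcoordEquiv hx) fun u v => by
    rw [tcoordEquiv_apply, tcoordEquiv_apply, coordBilin_chart hx (P.webster_isBilin x)]

theorem PseudohermitianStructure.exists_frame (P : PseudohermitianStructure
    (EuclideanSpace ℝ (Fin d)) M) (x : M) :
    ∃ e : Fin (Module.finrank ℝ (TangentSpace 𝓘(ℝ, EuclideanSpace ℝ (Fin d)) x)) →
      TangentSpace 𝓘(ℝ, EuclideanSpace ℝ (Fin d)) x, IsOrthoBasis (P.webster x) e := by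
  obtain ⟨B, hB⟩ := P.webster_isBilin x
  have h1 : P.webster x = fun u v => B u v := by ext u v; rw [hB]
  rw [h1]
  exact exists_isOrthoBasis B (fun u v => by rw [← hB, ← hB, P.webster_symm])
    fun v hv => by rw [← hB]; exact P.webster_pos x v hv

theorem secondFundamentalForm_eq (hφ : ContMDiff 𝓘(ℝ, EuclideanSpace ℝ (Fin d)) 𝓘(ℝ, F) ∞ φ)
    (x : M) (u v : TangentSpace 𝓘(ℝ, EuclideanSpace ℝ (Fin d)) x) :
    secondFundamentalForm D D' φ x u v = tvec (φ x) (φ x)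
      (flatHess (christoffel D x) (christoffel D' (φ x)) (coordMap (F := F) x (φ x) φ)
        (chartAt (EuclideanSpace ℝ (Fin d)) x x) (tcoord x x v) (tcoord x x u)) := by
  rw [← tcoord_secondFundamentalForm D D' (mem_chart_source _ x) (mem_chart_source F (φ x)) hφ,
    tvec_tcoord (mem_chart_source F (φ x))]

end Globalization

/-! ### Linear maps vanishing on a frame -/

section Algebra

variable {V W : Type*} [AddCommGroup V] [Module ℝ V] [AddCommGroup W] [Module ℝ W]
  {ι : Type*} [Fintype ι] [DecidableEq ι]

theorem linearMap_eq_zero_of_frame {g : V → V → ℝ} {e : ι → V} (he : IsOrthoBasis g e)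
    (ν : V →ₗ[ℝ] W) (h0 : ∀ A, ν (e A) = 0) (v : V) : ν v = 0 := by
  rw [he.complete v, map_sum]
  exact Finset.sum_eq_zero fun A _ => by rw [map_smul, h0, smul_zero]

end Algebra

/-! ### Kähler curvature forms on complex bivectors -/

section KahlerAlgebra

variable {V : Type*} [AddCommGroup V] [Module ℝ V]

/-- The complex bilinear extension of a form. -/
noncomputable def complexExtend₂ (ρ : V → V → ℂ) (X Y : V × V) : ℂ :=
  complexExtend (fun a => complexExtend (fun b => ρ a b) Y) X

/-- A J-invariant form vanishes on two vectors of type (1,0) and on two of type (0,1), so only the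
mixed parts contribute. -/
theorem complexExtend₂_parts (ρ : V →ₗ[ℝ] V →ₗ[ℝ] ℂ) (J : V →ₗ[ℝ] V) (hJ2 : ∀ v, J (J v) = -v)
    (hJ : ∀ a b, ρ (J a) (J b) = ρ a b) (Z W : V × V) :
    complexExtend₂ (fun a b => ρ a b) (part10 J Z) (part01 J W)
      + complexExtend₂ (fun a b => ρ a b) (part01 J Z) (part10 J W)
      = complexExtend₂ (fun a b => ρ a b) Z W := by
  have h1 : ∀ a b, ρ (J a) b = -ρ a (J b) := by
    intro a b
    rw [← hJ a (J b), hJ2, map_neg, neg_neg]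
  simp only [complexExtend₂, complexExtend, part10, part01, map_add, map_sub, map_smul,
    LinearMap.add_apply, LinearMap.sub_apply, LinearMap.smul_apply, hJ, h1, Complex.real_smul]
  push_cast
  ring_nf
  simp only [Complex.I_sq]
  ring

/-- The complex multilinear extension of a four-linear form. -/
noncomputable def complexExtend₄ (r : V → V → V → V → ℝ) (X Y Z W : V × V) : ℂ :=
  complexExtend₂ (fun a b => complexExtend₂ (fun c d => (r a b c d : ℂ)) Z W) X Y

namespace IsKahlerForm

variable {r : V → V → V → V → ℝ} {J : V →ₗ[ℝ] V} (hr : IsKahlerForm r J)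
include hr

theorem skew_right (a b c d : V) : r a b c d = -r a b d c := by
  rw [hr.pair, hr.skew, hr.pair]

theorem add₂ (a b b' c d : V) : r a (b + b') c d = r a b c d + r a b' c d := by
  rw [hr.skew, hr.add, hr.skew b, hr.skew b']; ring

theorem smul₂ (k : ℝ) (a b c d : V) : r a (k • b) c d = k * r a b c d := by
  rw [hr.skew, hr.smul, hr.skew b]; ring

theorem add₃ (a b c c' d : V) : r a b (c + c') d = r a b c d + r a b c' d := by
  rw [hr.pair, hr.add, hr.pair c, hr.pair c']

theorem smul₃ (k : ℝ) (a b c d : V) : r a b (k • c) d = k * r a b c d := by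
  rw [hr.pair, hr.smul, hr.pair c]

theorem smul₄ (k : ℝ) (a b c d : V) : r a b c (k • d) = k * r a b c d := by
  rw [hr.skew_right, hr.smul₃, hr.skew_right a b d]; ring

theorem neg₁ (a b c d : V) : r (-a) b c d = -r a b c d := by
  rw [← neg_one_smul ℝ, hr.smul]; ring

theorem neg₂ (a b c d : V) : r a (-b) c d = -r a b c d := by
  rw [← neg_one_smul ℝ, hr.smul₂]; ring

theorem neg₃ (a b c d : V) : r a b (-c) d = -r a b c d := by
  rw [← neg_one_smul ℝ, hr.smul₃]; ring

theorem neg₄ (a b c d : V) : r a b c (-d) = -r a b c d := by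
  rw [← neg_one_smul ℝ, hr.smul₄]; ring

theorem J_J_left (a b c d : V) : r (J a) (J b) c d = r a b c d := by
  rw [hr.pair, hr.J_J_right, hr.pair]

theorem extend_pair (X Y Z W : V × V) :
    complexExtend₄ r X Y Z W = complexExtend₄ r Z W X Y := by
  have h1 : r = fun a b c d => r c d a b := by ext; exact hr.pair _ _ _ _
  conv_rhs => rw [h1]
  simp only [complexExtend₄, complexExtend₂, complexExtend]
  ring

theorem extend_parts_left (hJ2 : ∀ v, J (J v) = -v) (X Y Z W : V × V) :
    complexExtend₄ r (part10 J X) (part01 J Y) Z W + complexExtend₄ r (part01 J X) (part10 J Y) Z W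
      = complexExtend₄ r X Y Z W := by
  let ρ : V →ₗ[ℝ] V →ₗ[ℝ] ℂ := LinearMap.mk₂ ℝ
    (fun a b => complexExtend₂ (fun c d => (r a b c d : ℂ)) Z W)
    (by intros; simp only [complexExtend₂, complexExtend, hr.add]; push_cast; ring)
    (by intros; simp only [complexExtend₂, complexExtend, hr.smul, Complex.real_smul]
        push_cast; ring)
    (by intros; simp only [complexExtend₂, complexExtend, hr.add₂]; push_cast; ring)
    (by intros; simp only [complexExtend₂, complexExtend, hr.smul₂, Complex.real_smul]
        push_cast; ring)
  refine complexExtend₂_parts ρ J hJ2 (fun a b => ?_) X Y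
  simp only [ρ, LinearMap.mk₂_apply, hr.J_J_left]

theorem extend_parts_right (hJ2 : ∀ v, J (J v) = -v) (X Y Z W : V × V) :
    complexExtend₄ r X Y (part01 J Z) (part10 J W) + complexExtend₄ r X Y (part10 J Z) (part01 J W)
      = complexExtend₄ r X Y Z W := by
  rw [hr.extend_pair X Y, hr.extend_pair X Y, hr.extend_pair X Y, add_comm]
  exact hr.extend_parts_left hJ2 Z W X Y

/-- The curvature form on the (1,1)-part of a decomposable bivector. -/
theorem extend_part11 (hJ2 : ∀ v, J (J v) = -v) (Z W : V × V) :
    ∑ p, ∑ q, complexExtend₄ r ((![part10 J Z, part01 J Z] : Fin 2 → V × V) p)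
      ((![part01 J W, part10 J W] : Fin 2 → V × V) p)
      (cconj ((![part10 J Z, part01 J Z] : Fin 2 → V × V) q))
      (cconj ((![part01 J W, part10 J W] : Fin 2 → V × V) q))
      = complexExtend₄ r Z W (cconj Z) (cconj W) := by
  have h1 : ∀ X : V × V, cconj (part10 J X) = part01 J (cconj X) := by
    intro X
    simp [cconj, part10, part01, ← smul_neg, sub_eq_add_neg, add_comm]
  have h2 : ∀ X : V × V, cconj (part01 J X) = part10 J (cconj X) := by
    intro X
    simp [cconj, part10, part01, ← smul_neg, sub_eq_add_neg, add_comm]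
  -- A Kähler curvature form sees only the (1,1)-part of a bivector in each pair. The curvature
  -- hypothesis on (1,1)-parts thus controls all decomposable bivectors.
  simp only [Fin.sum_univ_two, Matrix.cons_val_zero, Matrix.cons_val_one, h1, h2,
    hr.extend_parts_right hJ2, hr.extend_parts_left hJ2]

/-- Pair symmetry makes the value its own conjugate. The sign argument controls only the real part,
whereas the conclusion concerns the complex number. -/
theorem extend_im (Z W : V × V) :
    (complexExtend₄ r Z W (cconj Z) (cconj W)).im = 0 := by
  rw [← Complex.conj_eq_iff_im]
  conv_rhs => rw [hr.extend_pair]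
  simp only [complexExtend₄, complexExtend₂, complexExtend, cconj, hr.neg₁, hr.neg₂, hr.neg₃,
    hr.neg₄, map_add, map_mul, Complex.conj_ofReal, Complex.conj_I]
  push_cast
  ring

theorem extend_real (a b : V) :
    complexExtend₄ r (a, 0) (b, 0) (cconj (a, 0)) (cconj (b, 0)) = r a b a b := by
  -- Writing 0 as 0 • 0 lets homogeneity remove every term with a zero argument.
  have h0 : (0 : V) = (0 : ℝ) • (0 : V) := by simp
  simp only [complexExtend₄, complexExtend₂, complexExtend, cconj, neg_zero]
  rw [h0]
  simp only [hr.smul, hr.smul₂, hr.smul₃, hr.smul₄]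
  simp

/-- Of the sixteen terms, the eight with an even number of imaginary factors are real. -/
theorem extend_re (k : ℝ) (a a' b b' : V) :
    (complexExtend₄ r (k • a, -(k • a')) (k • b, -(k • b')) (cconj (k • a, -(k • a')))
      (cconj (k • b, -(k • b')))).re
      = k ^ 4 * (r a b a b - r a' b' a b + r a' b a' b + r a' b a b' + r a b' a' b + r a b' a b'
        - r a b a' b' + r a' b' a' b') := by
  simp only [complexExtend₄, complexExtend₂, complexExtend, cconj, neg_neg, hr.neg₁, hr.neg₂,
    hr.smul, hr.smul₂, hr.smul₃, hr.smul₄]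
  simp
  ring

variable {U : Type*} [AddCommGroup U] [Module ℝ U] {ι : Type*} [Fintype ι] [DecidableEq ι]
  {g : U →ₗ[ℝ] U →ₗ[ℝ] ℝ} {e : ι → U} (he : IsOrthoBasis (fun u v => g u v) e)
  (hs : ∀ u v, g u v = g v u) (K : U →ₗ[ℝ] U) (hK : ∀ u v, g (K u) v = -g u (K v))
  (L : U →ₗ[ℝ] V)
include he hs hK

theorem sum_move (b d : V) :
    ∑ A, r (L (K (e A))) b (L (e A)) d = -∑ A, r (L (e A)) b (L (K (e A))) d := by
  let C : U →ₗ[ℝ] U →ₗ[ℝ] ℝ := LinearMap.mk₂ ℝ (fun u v => r (L u) b (L v) d)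
    (by intros; simp only [map_add, hr.add]) (by intros; simp only [map_smul, hr.smul, smul_eq_mul])
    (by intros; simp only [map_add, hr.add₃])
    (by intros; simp only [map_smul, hr.smul₃, smul_eq_mul])
  exact he.sum_skew hs K hK C

variable (hL : ∀ u, L (K (K u)) = -L u)
include hL

/-- The hypothesis on L is met by dφ with K = J once dφ(T) = 0, because J² is minus the identity
modulo T. -/
theorem sum_move_both (b d : V) :
    ∑ A, r (L (K (e A))) b (L (K (e A))) d = ∑ A, r (L (e A)) b (L (e A)) d := by
  have := hr.sum_move he hs K hK L b d
  let C : U →ₗ[ℝ] U →ₗ[ℝ] ℝ := LinearMap.mk₂ ℝ (fun u v => r (L u) b (L (K v)) d)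
    (by intros; simp only [map_add, hr.add]) (by intros; simp only [map_smul, hr.smul, smul_eq_mul])
    (by intros; simp only [map_add, hr.add₃])
    (by intros; simp only [map_smul, hr.smul₃, smul_eq_mul])
  have h1 : ∑ A, r (L (K (e A))) b (L (K (e A))) d = -∑ A, r (L (e A)) b (L (K (K (e A)))) d :=
    he.sum_skew hs K hK C
  rw [h1]
  simp only [hL, hr.neg₃, Finset.sum_neg_distrib, neg_neg]

/-- The curvature term of Siu's formula as a sum of Hermitian curvatures. -/
theorem sum_extend_re {k : ℝ} (hk : k ^ 4 = 1 / 4) :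
    ∑ A, ∑ B, (r (L (e B)) (L (e A)) (L (e A)) (L (e B))
        + r (L (e B)) (L (K (e A))) (L (e A)) (L (K (e B))))
      = -∑ A, ∑ B, (complexExtend₄ r (k • L (e A), -(k • L (K (e A))))
        (k • L (e B), -(k • L (K (e B)))) (cconj (k • L (e A), -(k • L (K (e A)))))
        (cconj (k • L (e B), -(k • L (K (e B)))))).re := by
  have m1 := hr.sum_move he hs K hK L
  have m2 := hr.sum_move_both he hs K hK L hL
  have hd : ∀ a b c d, r a b c d = r b a d c := fun a b c d => by
    rw [hr.skew, hr.skew_right, neg_neg]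
  have n1 : ∀ a c, ∑ A, r a (L (K (e A))) c (L (e A)) = -∑ A, r a (L (e A)) c (L (K (e A))) := by
    intro a c
    simp only [hd a _ c _]
    exact m1 a c
  have n2 : ∀ a c, ∑ A, r a (L (K (e A))) c (L (K (e A))) = ∑ A, r a (L (e A)) c (L (e A)) := by
    intro a c
    simp only [hd a _ c _]
    exact m2 a c
  -- Moving J across the traces reduces the eight terms of `extend_re` to two sums, four
  -- contributing S₁ and four S₂. The factor k⁴ = 1/4 makes the total S₁ + S₂, the negative of the
  -- left side.
  set S₁ := ∑ A, ∑ B, r (L (e A)) (L (e B)) (L (e A)) (L (e B)) with hS₁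
  set S₂ := ∑ A, ∑ B, r (L (e A)) (L (K (e B))) (L (K (e A))) (L (e B)) with hS₂
  have t7 : ∑ A, ∑ B, r (L (e A)) (L (e B)) (L (K (e A))) (L (K (e B))) = -S₂ := by
    rw [hS₂]
    simp only [n1, Finset.sum_neg_distrib, neg_neg]
  have t2 : ∑ A, ∑ B, r (L (K (e A))) (L (K (e B))) (L (e A)) (L (e B)) = -S₂ := by
    rw [hS₂, Finset.sum_comm]
    simp only [m1, Finset.sum_neg_distrib]
    rw [Finset.sum_comm]
  have t4 : ∑ A, ∑ B, r (L (K (e A))) (L (e B)) (L (e A)) (L (K (e B))) = S₂ := by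
    rw [Finset.sum_comm]
    simp only [m1, Finset.sum_neg_distrib]
    rw [Finset.sum_comm, t7, neg_neg]
  have t3 : ∑ A, ∑ B, r (L (K (e A))) (L (e B)) (L (K (e A))) (L (e B)) = S₁ := by
    rw [Finset.sum_comm]
    simp only [m2]
    rw [Finset.sum_comm]
  have t6 : ∑ A, ∑ B, r (L (e A)) (L (K (e B))) (L (e A)) (L (K (e B))) = S₁ := by
    simp only [n2, hS₁]
  have t8 : ∑ A, ∑ B, r (L (K (e A))) (L (K (e B))) (L (K (e A))) (L (K (e B))) = S₁ := by
    simp only [n2, t3]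
  have l1 : ∑ A, ∑ B, r (L (e B)) (L (e A)) (L (e A)) (L (e B)) = -S₁ := by
    rw [hS₁, ← Finset.sum_neg_distrib]
    refine Finset.sum_congr rfl fun A _ => ?_
    rw [← Finset.sum_neg_distrib]
    exact Finset.sum_congr rfl fun B _ => hr.skew _ _ _ _
  have l2 : ∑ A, ∑ B, r (L (e B)) (L (K (e A))) (L (e A)) (L (K (e B))) = -S₂ := by
    rw [hS₂, Finset.sum_comm, ← Finset.sum_neg_distrib]
    refine Finset.sum_congr rfl fun A _ => ?_
    rw [← Finset.sum_neg_distrib]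
    exact Finset.sum_congr rfl fun B _ => hr.skew_right _ _ _ _
  simp only [hr.extend_re, hk, ← Finset.mul_sum, Finset.sum_add_distrib, Finset.sum_sub_distrib,
    t2, t3, t4, t6, t7, t8, l1, l2, ← hS₁, ← hS₂]
  ring

end IsKahlerForm

end KahlerAlgebra

/-! ### The three vanishing theorems on M -/

section Bochner

variable {d : ℕ} {M : Type*} [TopologicalSpace M] [T2Space M] [CompactSpace M]
  [MeasurableSpace M] [BorelSpace M]
  [ChartedSpace (EuclideanSpace ℝ (Fin d)) M]
  [IsManifold 𝓘(ℝ, EuclideanSpace ℝ (Fin d)) ∞ M]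
  {F : Type*} [NormedAddCommGroup F] [NormedSpace ℝ F] [FiniteDimensional ℝ F] [CompleteSpace F]
  {N : Type*} [TopologicalSpace N] [ChartedSpace F N] [IsManifold 𝓘(ℝ, F) ∞ N]
  {P : PseudohermitianStructure (EuclideanSpace ℝ (Fin d)) M}
  {D : CovariantDerivative 𝓘(ℝ, EuclideanSpace ℝ (Fin d)) (EuclideanSpace ℝ (Fin d))
    (TangentSpace 𝓘(ℝ, EuclideanSpace ℝ (Fin d)) : M → Type _)}
  {h : ContMDiffRiemannianMetric 𝓘(ℝ, F) ∞ F (TangentSpace 𝓘(ℝ, F) : N → Type _)}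
  {D' : CovariantDerivative 𝓘(ℝ, F) F (TangentSpace 𝓘(ℝ, F) : N → Type _)} {φ : M → N}
  {J' : ∀ y : N, TangentSpace 𝓘(ℝ, F) y →L[ℝ] TangentSpace 𝓘(ℝ, F) y}

section Chart

variable {p x : M} {q : N} (hx : x ∈ (chartAt (EuclideanSpace ℝ (Fin d)) p).source)
  (hq : φ x ∈ (chartAt F q).source)
include hx hq

theorem fderiv_coordMap_chart (hφ : ContMDiff 𝓘(ℝ, EuclideanSpace ℝ (Fin d)) 𝓘(ℝ, F) ∞ φ)
    (u : TangentSpace 𝓘(ℝ, EuclideanSpace ℝ (Fin d)) x) :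
    fderiv ℝ (coordMap (F := F) p q φ) (chartAt (EuclideanSpace ℝ (Fin d)) p x) (tcoord p x u)
      = tcoord q (φ x) (mfderiv 𝓘(ℝ, EuclideanSpace ℝ (Fin d)) 𝓘(ℝ, F) φ x u) :=
  (tcoord_mfderiv hx hq (hφ.mdifferentiable (by simp) x) u).symm

theorem flatHess_chart (hφ : ContMDiff 𝓘(ℝ, EuclideanSpace ℝ (Fin d)) 𝓘(ℝ, F) ∞ φ)
    (u v : TangentSpace 𝓘(ℝ, EuclideanSpace ℝ (Fin d)) x) :
    flatHess (christoffel D p) (christoffel D' q) (coordMap (F := F) p q φ)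
        (chartAt (EuclideanSpace ℝ (Fin d)) p x) (tcoord p x u) (tcoord p x v)
      = tcoord q (φ x) (secondFundamentalForm D D' φ x v u) :=
  (tcoord_secondFundamentalForm D D' hx hq hφ v u).symm

theorem flatSigma_chart (hφ : ContMDiff 𝓘(ℝ, EuclideanSpace ℝ (Fin d)) 𝓘(ℝ, F) ∞ φ)
    (u v : TangentSpace 𝓘(ℝ, EuclideanSpace ℝ (Fin d)) x) :
    flatSigma (christoffel D p) (coordEndo p P.J) (christoffel D' q) (coordMap (F := F) p q φ)
        (chartAt (EuclideanSpace ℝ (Fin d)) p x) (tcoord p x u) (tcoord p x v)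
      = tcoord q (φ x) (secondFundamentalForm D D' φ x v u
        + secondFundamentalForm D D' φ x (P.J x v) (P.J x u)) := by
  rw [flatSigma_apply, coordEndo_chart hx, coordEndo_chart hx, flatHess_chart hx hq hφ,
    flatHess_chart hx hq hφ, map_add]

theorem coordMetric_coordMap_chart (a b : TangentSpace 𝓘(ℝ, F) (φ x)) :
    coordMetric h q (coordMap (F := F) p q φ (chartAt (EuclideanSpace ℝ (Fin d)) p x))
      (tcoord q (φ x) a) (tcoord q (φ x) b) = h.inner (φ x) a b := by
  rw [coordMap_chart hx, coordMetric_chart hq]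

theorem flatCurv_coordMap_chart (hN : IsKahler h D' J') (a b c : TangentSpace 𝓘(ℝ, F) (φ x)) :
    flatCurv (christoffel D' q)
        (coordMap (F := F) p q φ (chartAt (EuclideanSpace ℝ (Fin d)) p x))
        (tcoord q (φ x) a) (tcoord q (φ x) b) (tcoord q (φ x) c)
      = tcoord q (φ x) (curvature D' (φ x) a b c) := by
  rw [coordMap_chart hx, tcoord_curvature D' hq
    ((hN.metricConn q).diff_Γ ((chartAt F q).map_source hq))]

end Chart

theorem inner_self_nonneg_of_metric (y : N) (v : TangentSpace 𝓘(ℝ, F) y) : 0 ≤ h.inner y v v := by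
  rcases eq_or_ne v 0 with rfl | hv
  · simp
  · exact (h.pos y v hv).le

theorem eq_zero_of_inner_self (y : N) (v : TangentSpace 𝓘(ℝ, F) y) (hv : h.inner y v v = 0) :
    v = 0 := by
  by_contra hne
  exact (h.pos y v hne).ne' hv

/-- The second fundamental form as a bilinear map. -/
noncomputable def sffBilin (D : CovariantDerivative 𝓘(ℝ, EuclideanSpace ℝ (Fin d))
      (EuclideanSpace ℝ (Fin d)) (TangentSpace 𝓘(ℝ, EuclideanSpace ℝ (Fin d)) : M → Type _))
    (D' : CovariantDerivative 𝓘(ℝ, F) F (TangentSpace 𝓘(ℝ, F) : N → Type _))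
    (hφ : ContMDiff 𝓘(ℝ, EuclideanSpace ℝ (Fin d)) 𝓘(ℝ, F) ∞ φ) (x : M) :
    TangentSpace 𝓘(ℝ, EuclideanSpace ℝ (Fin d)) x →ₗ[ℝ]
      TangentSpace 𝓘(ℝ, EuclideanSpace ℝ (Fin d)) x →ₗ[ℝ] TangentSpace 𝓘(ℝ, F) (φ x) :=
  LinearMap.mk₂ ℝ (fun u v => secondFundamentalForm D D' φ x u v)
    (by intros; simp only [secondFundamentalForm_eq hφ, map_add])
    (by intros; simp only [secondFundamentalForm_eq hφ, map_smul])
    (by intros; simp only [secondFundamentalForm_eq hφ, map_add, add_apply])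
    (by intros; simp only [secondFundamentalForm_eq hφ, map_smul, smul_apply])

theorem sffBilin_apply (hφ : ContMDiff 𝓘(ℝ, EuclideanSpace ℝ (Fin d)) 𝓘(ℝ, F) ∞ φ) (x : M)
    (u v : TangentSpace 𝓘(ℝ, EuclideanSpace ℝ (Fin d)) x) :
    sffBilin D D' hφ x u v = secondFundamentalForm D D' φ x u v := rfl

variable (hM : P.IsSasakian D) (hN : IsKahler h D' J')
  (hφ : ContMDiff 𝓘(ℝ, EuclideanSpace ℝ (Fin d)) 𝓘(ℝ, F) ∞ φ)
include hM hN hφ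

/-- `dφ(T)` is parallel along the Levi distribution. -/
theorem secondFundamentalForm_T_eq_zero
    (hR : ∀ y (a b : TangentSpace 𝓘(ℝ, F) y), 0 ≤ h.inner y (curvature D' y a b a) b)
    {δ : ℝ} (hδ : δ ≤ 1) (hτ : TensionEq P D D' φ δ) (x : M)
    (u : TangentSpace 𝓘(ℝ, EuclideanSpace ℝ (Fin d)) x) (hu : P.θ x u = 0) :
    secondFundamentalForm D D' φ x (P.T x) u = 0 := by
  choose e he using P.exists_frame
  set S : ∀ x, TangentSpace 𝓘(ℝ, EuclideanSpace ℝ (Fin d)) x →ₗ[ℝ]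
    TangentSpace 𝓘(ℝ, EuclideanSpace ℝ (Fin d)) x →ₗ[ℝ] TangentSpace 𝓘(ℝ, F) (φ x) :=
    sffBilin D D' hφ with hS
  set dφ : ∀ x, TangentSpace 𝓘(ℝ, EuclideanSpace ℝ (Fin d)) x →L[ℝ] TangentSpace 𝓘(ℝ, F) (φ x) :=
    fun x => mfderiv 𝓘(ℝ, EuclideanSpace ℝ (Fin d)) 𝓘(ℝ, F) φ x with hdφ
  set f : M → ℝ := fun x =>
    ∑ A, h.inner (φ x) (curvature D' (φ x) (dφ x (e x A)) (dφ x (P.T x)) (dφ x (e x A)))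
        (dφ x (P.T x))
      + ∑ A, h.inner (φ x) (S x (P.T x) (e x A)) (S x (P.T x) (e x A))
      - δ * h.inner (φ x) (S x (P.T x) (P.T x)) (S x (P.T x) (P.T x)) with hf
  -- Splitting off the Reeb direction gives |∇φ₀|² - δ |∇_T φ₀|² = |∇_H φ₀|² + (1 - δ) |∇_T φ₀|², a
  -- sum of nonnegative terms because δ ≤ 1.
  have hsq : ∀ x, f x = ∑ A, h.inner (φ x) (curvature D' (φ x) (dφ x (e x A)) (dφ x (P.T x))
        (dφ x (e x A))) (dφ x (P.T x))
      + ∑ A, h.inner (φ x) (S x (P.T x) (P.projH x (e x A))) (S x (P.T x) (P.projH x (e x A)))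
      + (1 - δ) * h.inner (φ x) (S x (P.T x) (P.T x)) (S x (P.T x) (P.T x)) := by
    intro x
    obtain ⟨B, hB⟩ := P.webster_isBilin x
    have hB' : P.webster x = fun u v => B u v := by ext u v; rw [hB]
    let C : TangentSpace 𝓘(ℝ, EuclideanSpace ℝ (Fin d)) x →ₗ[ℝ]
        TangentSpace 𝓘(ℝ, EuclideanSpace ℝ (Fin d)) x →ₗ[ℝ] ℝ :=
      LinearMap.mk₂ ℝ (fun u v => h.inner (φ x) (S x (P.T x) u) (S x (P.T x) v))
        (by intros; simp only [map_add, add_apply])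
        (by intros; simp only [map_smul, smul_apply])
        (by intros; simp only [map_add]) (by intros; simp only [map_smul])
    have h1 := IsOrthoBasis.sum_sub_unit (g := B) (by rw [← hB']; exact he x) (T := P.T x)
      (by rw [← hB, P.webster_T_left, P.θ_T]) C
    have h2 : ∀ u, u - B (P.T x) u • P.T x = P.projH x u := fun u => by
      rw [← hB, P.webster_T_left, PseudohermitianStructure.projH]
    simp only [h2] at h1
    have h3 : ∑ A, h.inner (φ x) (S x (P.T x) (e x A)) (S x (P.T x) (e x A))
        - h.inner (φ x) (S x (P.T x) (P.T x)) (S x (P.T x) (P.T x))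
        = ∑ A, h.inner (φ x) (S x (P.T x) (P.projH x (e x A)))
          (S x (P.T x) (P.projH x (e x A))) := h1
    rw [hf]
    linarith
  have hn1 : ∀ x, 0 ≤ ∑ A, h.inner (φ x) (curvature D' (φ x) (dφ x (e x A)) (dφ x (P.T x))
        (dφ x (e x A))) (dφ x (P.T x)) := fun x => Finset.sum_nonneg fun A _ => hR _ _ _
  have hn2 : ∀ x, 0 ≤ (1 - δ) * h.inner (φ x) (S x (P.T x) (P.T x)) (S x (P.T x) (P.T x)) :=
    fun x => mul_nonneg (by linarith) (inner_self_nonneg_of_metric _ _)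
  have hn3 : ∀ x, ∀ A ∈ Finset.univ, 0 ≤ h.inner (φ x) (S x (P.T x) (P.projH x (e x A)))
      (S x (P.T x) (P.projH x (e x A))) := fun x A _ => inner_self_nonneg_of_metric _ _
  have key := hM.eq_zero_of_local_divergence hφ.continuous
    (fun p q => reebForm (coordBilin p P.webster) (christoffel D p) (coordField p P.T)
      (coordMetric h q) (christoffel D' q) (coordMap p q φ) δ)
    (fun x u => h.inner (φ x) (S x (P.T x) u) (dφ x (P.T x))
      - δ * h.inner (φ x) (S x (P.T x) (P.T x)) (dφ x (P.T x)) * P.webster x (P.T x) u) f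
    (fun p q x hx hq => smooth_reebForm (hM.sasakiLocal_coordDomain p q hφ.continuous)
      (localMap_chart hφ (hM.sasakiLocal_coordDomain p q hφ.continuous).toMetricConn subset_rfl hN)
      (mem_coordDomain hx hq) δ)
    (fun p q x hx hq u => by
      rw [reebForm_apply, coordField_chart hx, flatHess_chart hx hq hφ, flatHess_chart hx hq hφ,
        fderiv_coordMap_chart hx hq hφ, coordMetric_coordMap_chart hx hq,
        coordMetric_coordMap_chart hx hq, coordBilin_chart hx (P.webster_isBilin x)]
      rfl)
    (fun p q x hx hq => by
      rw [div_reebForm (hM.sasakiLocal_coordDomain p q hφ.continuous)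
        (localMap_chart hφ (hM.sasakiLocal_coordDomain p q hφ.continuous).toMetricConn subset_rfl
          hN) (mem_coordDomain hx hq) ((he x).tcoord hx) δ (hτ p q)]
      simp only [coordField_chart hx, flatHess_chart hx hq hφ, fderiv_coordMap_chart hx hq hφ,
        flatCurv_coordMap_chart hx hq hN, coordMetric_coordMap_chart hx hq]
      rfl)
    (fun x => by
      rw [hsq]
      have := Finset.sum_nonneg (hn3 x)
      linarith [hn1 x, hn2 x]) x
  rw [hsq] at key
  have h4 : ∑ A, h.inner (φ x) (S x (P.T x) (P.projH x (e x A)))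
      (S x (P.T x) (P.projH x (e x A))) = 0 :=
    le_antisymm (by linarith [hn1 x, hn2 x]) (Finset.sum_nonneg (hn3 x))
  have h5 := (Finset.sum_eq_zero_iff_of_nonneg (hn3 x)).1 h4
  have h6 : ∀ u, S x (P.T x) (P.projH x u) = S x (P.T x) u - P.θ x u • S x (P.T x) (P.T x) := by
    intro u
    rw [PseudohermitianStructure.projH, map_sub, map_smul]
  have h7 := linearMap_eq_zero_of_frame (he x)
    (S x (P.T x) - (P.θ x : _ →ₗ[ℝ] ℝ).smulRight (S x (P.T x) (P.T x)))
    (fun A => (h6 _).symm.trans (eq_zero_of_inner_self _ _ (h5 A (Finset.mem_univ A)))) u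
  have h8 : S x (P.T x) u - P.θ x u • S x (P.T x) (P.T x) = 0 := h7
  rwa [hu, zero_smul, sub_zero] at h8

/-- `dφ(T) = 0` when `dφ(T)` is parallel along a nontrivial Levi distribution. -/
theorem mfderiv_T_eq_zero
    (hν : ∀ x u, P.θ x u = 0 → secondFundamentalForm D D' φ x (P.T x) u = 0) (x : M)
    {u : TangentSpace 𝓘(ℝ, EuclideanSpace ℝ (Fin d)) x} (hu : P.θ x u = 0) (hu0 : u ≠ 0) :
    mfderiv 𝓘(ℝ, EuclideanSpace ℝ (Fin d)) 𝓘(ℝ, F) φ x (P.T x) = 0 := by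
  choose e he using P.exists_frame
  set dφ : ∀ x, TangentSpace 𝓘(ℝ, EuclideanSpace ℝ (Fin d)) x →L[ℝ] TangentSpace 𝓘(ℝ, F) (φ x) :=
    fun x => mfderiv 𝓘(ℝ, EuclideanSpace ℝ (Fin d)) 𝓘(ℝ, F) φ x with hdφ
  have hw : ∀ x v, 0 ≤ P.webster x v v := by
    intro x v
    rcases eq_or_ne v 0 with rfl | hv
    · obtain ⟨B, hB⟩ := P.webster_isBilin x
      rw [hB, map_zero]
    · exact (P.webster_pos x v hv).le
  -- The sign of `twistForm` is reversed so that the divergence is nonnegative.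
  have key := hM.eq_zero_of_local_divergence hφ.continuous
    (fun p q z => -twistForm (coordEndo p P.J) (coordField p P.T) (coordMetric h q)
      (coordMap p q φ) z)
    (fun x u => -h.inner (φ x) (dφ x (P.J x u)) (dφ x (P.T x)))
    (fun x => (1 / 2) * ((∑ A, P.webster x (P.J x (e x A)) (P.J x (e x A)))
      * h.inner (φ x) (dφ x (P.T x)) (dφ x (P.T x))))
    (fun p q x hx hq => (smooth_twistForm (hM.sasakiLocal_coordDomain p q hφ.continuous)
      (localMap_chart hφ (hM.sasakiLocal_coordDomain p q hφ.continuous).toMetricConn subset_rfl hN)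
      (mem_coordDomain hx hq)).neg)
    (fun p q x hx hq u => by
      rw [neg_apply, twistForm_apply, coordField_chart hx, coordEndo_chart hx,
        fderiv_coordMap_chart hx hq hφ, fderiv_coordMap_chart hx hq hφ,
        coordMetric_coordMap_chart hx hq])
    (fun p q x hx hq => by
      have h1 := div_twistForm (hM.sasakiLocal_coordDomain p q hφ.continuous)
        (localMap_chart hφ (hM.sasakiLocal_coordDomain p q hφ.continuous).toMetricConn subset_rfl
          hN) (mem_coordDomain hx hq) ((he x).tcoord hx) (fun u hu => by
          rw [← tcoord_tvec hx u, coordField_chart hx,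
            coordBilin_chart hx (P.webster_isBilin x), P.webster_T_left] at hu
          rw [← tcoord_tvec hx u, coordField_chart hx, flatHess_chart hx hq hφ, hν x _ hu,
            map_zero])
      simp only [coordField_chart hx, coordEndo_chart hx, fderiv_coordMap_chart hx hq hφ,
        coordMetric_coordMap_chart hx hq, coordBilin_chart hx (P.webster_isBilin x)] at h1
      have h2 : ∀ (Γ : EuclideanSpace ℝ (Fin d) → EuclideanSpace ℝ (Fin d) →L[ℝ]
          EuclideanSpace ℝ (Fin d) →L[ℝ] EuclideanSpace ℝ (Fin d)) l z K,
          gtrace K (formDeriv Γ (fun z => -l z) z) = -gtrace K (formDeriv Γ l z) := by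
        intro Γ l z K
        simp only [gtrace, formDeriv_apply, fderiv_fun_neg, neg_apply, ← Finset.sum_neg_distrib]
        exact Finset.sum_congr rfl fun i _ => by ring
      rw [h2, h1]
      ring)
    (fun x => mul_nonneg (by norm_num) (mul_nonneg (Finset.sum_nonneg fun A _ => hw _ _)
      (inner_self_nonneg_of_metric _ _))) x
  -- If this sum were zero then J would vanish, contradicting J² u = -u for the nonzero horizontal
  -- u.
  have h3 : ∑ A, P.webster x (P.J x (e x A)) (P.J x (e x A)) ≠ 0 := by
    intro h0
    have h4 := (Finset.sum_eq_zero_iff_of_nonneg fun A _ => hw _ _).1 h0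
    have h5 : ∀ A, P.J x (e x A) = 0 := fun A => by
      by_contra hne
      exact (P.webster_pos x _ hne).ne' (h4 A (Finset.mem_univ A))
    have h6 : ∀ v, P.J x v = 0 := fun v =>
      linearMap_eq_zero_of_frame (he x) (P.J x).toLinearMap h5 v
    have h7 := P.J_J x u hu
    rw [h6] at h7
    exact hu0 (neg_eq_zero.1 h7.symm)
  have h8 : h.inner (φ x) (dφ x (P.T x)) (dφ x (P.T x)) = 0 := by
    rcases mul_eq_zero.1 key with h9 | h9
    · norm_num at h9
    · exact (mul_eq_zero.1 h9).resolve_left h3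
  exact eq_zero_of_inner_self _ _ h8

/-- Siu's formula, integrated. -/
theorem sigma_curvature_eq_zero {δ : ℝ} (hτ : TensionEq P D D' φ δ)
    (hT : ∀ x, mfderiv 𝓘(ℝ, EuclideanSpace ℝ (Fin d)) 𝓘(ℝ, F) φ x (P.T x) = 0)
    (c : ∀ x, (TangentSpace 𝓘(ℝ, EuclideanSpace ℝ (Fin d)) x →
      TangentSpace 𝓘(ℝ, EuclideanSpace ℝ (Fin d)) x → ℝ))
    (hc : ∀ x u v, c x u v = h.inner (φ x) (curvature D' (φ x)
          (mfderiv 𝓘(ℝ, EuclideanSpace ℝ (Fin d)) 𝓘(ℝ, F) φ x v)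
          (mfderiv 𝓘(ℝ, EuclideanSpace ℝ (Fin d)) 𝓘(ℝ, F) φ x u)
          (mfderiv 𝓘(ℝ, EuclideanSpace ℝ (Fin d)) 𝓘(ℝ, F) φ x v)
        + curvature D' (φ x) (mfderiv 𝓘(ℝ, EuclideanSpace ℝ (Fin d)) 𝓘(ℝ, F) φ x v)
          (mfderiv 𝓘(ℝ, EuclideanSpace ℝ (Fin d)) 𝓘(ℝ, F) φ x (P.J x u))
          (mfderiv 𝓘(ℝ, EuclideanSpace ℝ (Fin d)) 𝓘(ℝ, F) φ x (P.J x v)))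
        (mfderiv 𝓘(ℝ, EuclideanSpace ℝ (Fin d)) 𝓘(ℝ, F) φ x u))
    (hnn : ∀ x {ι : Type} [Fintype ι] [DecidableEq ι]
      (e : ι → TangentSpace 𝓘(ℝ, EuclideanSpace ℝ (Fin d)) x), IsOrthoBasis (P.webster x) e →
      0 ≤ ∑ A, ∑ B, c x (e A) (e B)) (x : M) {ι : Type} [Fintype ι] [DecidableEq ι]
    (e : ι → TangentSpace 𝓘(ℝ, EuclideanSpace ℝ (Fin d)) x) (he : IsOrthoBasis (P.webster x) e) :
    (∀ u v, secondFundamentalForm D D' φ x u v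
      + secondFundamentalForm D D' φ x (P.J x u) (P.J x v) = 0)
    ∧ ∑ A, ∑ B, c x (e A) (e B) = 0 := by
  choose b hb using P.exists_frame
  set σ : ∀ x, TangentSpace 𝓘(ℝ, EuclideanSpace ℝ (Fin d)) x →ₗ[ℝ]
    TangentSpace 𝓘(ℝ, EuclideanSpace ℝ (Fin d)) x →ₗ[ℝ] TangentSpace 𝓘(ℝ, F) (φ x) := fun x =>
    sffBilin D D' hφ x + (sffBilin D D' hφ x).compl₁₂ (P.J x : _ →ₗ[ℝ] _) (P.J x : _ →ₗ[ℝ] _)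
    with hσ
  have hσa : ∀ x u v, secondFundamentalForm D D' φ x u v
      + secondFundamentalForm D D' φ x (P.J x u) (P.J x v) = σ x u v := fun x u v => rfl
  set f : ∀ (x : M) {ι : Type} [Fintype ι]
      (e : ι → TangentSpace 𝓘(ℝ, EuclideanSpace ℝ (Fin d)) x), ℝ := fun x ι _ e =>
    (1 / 2) * ∑ B, ∑ A, h.inner (φ x) (σ x (e B) (e A)) (σ x (e B) (e A))
      + ∑ A, ∑ B, c x (e A) (e B) with hf
  have hn : ∀ x {ι : Type} [Fintype ι]
      (e : ι → TangentSpace 𝓘(ℝ, EuclideanSpace ℝ (Fin d)) x),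
      0 ≤ ∑ B, ∑ A, h.inner (φ x) (σ x (e B) (e A)) (σ x (e B) (e A)) := fun x ι _ e =>
    Finset.sum_nonneg fun B _ => Finset.sum_nonneg fun A _ => inner_self_nonneg_of_metric _ _
  -- The left side involves no frame, so the value of f is the same for all orthonormal frames.
  -- Vanishing is obtained for the chosen frames b and transferred to the given e.
  have hdiv : ∀ (p : M) (q : N) (x : M) (hx : x ∈ (chartAt (EuclideanSpace ℝ (Fin d)) p).source)
      (hq : φ x ∈ (chartAt F q).source) {ι : Type} [Fintype ι] [DecidableEq ι]
      (e : ι → TangentSpace 𝓘(ℝ, EuclideanSpace ℝ (Fin d)) x) (he : IsOrthoBasis (P.webster x) e),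
      gtrace (sharp (coordBilin p P.webster (chartAt (EuclideanSpace ℝ (Fin d)) p x)))
        (formDeriv (christoffel D p) (siuForm (coordBilin p P.webster) (christoffel D p)
          (coordEndo p P.J) (coordMetric h q) (christoffel D' q) (coordMap p q φ))
          (chartAt (EuclideanSpace ℝ (Fin d)) p x)) = f x e := by
    intro p q x hx hq ι _ _ e he
    have hS := hM.sasakiLocal_coordDomain p q (F := F) hφ.continuous
    have hL := localMap_chart hφ hS.toMetricConn subset_rfl hN
    have h0 : ∀ y ∈ coordDomain (E := EuclideanSpace ℝ (Fin d)) (F := F) p q φ,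
        fderiv ℝ (coordMap (F := F) p q φ) y (coordField p P.T y) = 0 := by
      intro y hy
      rw [← (chartAt (EuclideanSpace ℝ (Fin d)) p).right_inv hy.1,
        coordField_chart (symm_mem_source hy.1),
        fderiv_coordMap_chart (symm_mem_source hy.1) hy.2 hφ, hT, map_zero]
    rw [div_siuForm hS hL h0 (mem_coordDomain hx hq) (he.tcoord hx) fun y hy => by
      rw [hτ p q y hy, hess_right_T hS hL h0 hy, smul_zero]]
    simp only [coordEndo_chart hx, flatSigma_chart hx hq hφ, fderiv_coordMap_chart hx hq hφ,
        flatCurv_coordMap_chart hx hq hN, ← map_add, coordMetric_coordMap_chart hx hq, hσa, hf, hc]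
  have key := hM.eq_zero_of_local_divergence hφ.continuous
    (fun p q => siuForm (coordBilin p P.webster) (christoffel D p)
          (coordEndo p P.J) (coordMetric h q) (christoffel D' q) (coordMap p q φ))
    (fun x u => ∑ A, h.inner (φ x) (σ x u (b x A))
      (mfderiv 𝓘(ℝ, EuclideanSpace ℝ (Fin d)) 𝓘(ℝ, F) φ x (b x A))) (fun x => f x (b x))
    (fun p q x hx hq => smooth_siuForm (hM.sasakiLocal_coordDomain p q hφ.continuous)
      (localMap_chart hφ (hM.sasakiLocal_coordDomain p q hφ.continuous).toMetricConn subset_rfl hN)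
      (mem_coordDomain hx hq))
    (fun p q x hx hq u => by
      rw [siuForm, gtrace_sharp_eq_sum (P.isSmoothMetric_webster.coord_pos p
        ((chartAt (EuclideanSpace ℝ (Fin d)) p).map_source hx)) ((hb x).tcoord hx), sum_apply]
      refine Finset.sum_congr rfl fun A _ => ?_
      rw [siuTensor_apply, flatSigma_chart hx hq hφ, fderiv_coordMap_chart hx hq hφ,
        coordMetric_coordMap_chart hx hq, hσa])
    (fun p q x hx hq => hdiv p q x hx hq (b x) (hb x))
    (fun x => add_nonneg (mul_nonneg (by norm_num) (hn x (b x))) (hnn x (b x) (hb x))) x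
  have h1 : f x e = 0 := by
    rw [← hdiv x (φ x) x (mem_chart_source _ x) (mem_chart_source F _) e he,
      hdiv x (φ x) x (mem_chart_source _ x) (mem_chart_source F _) (b x) (hb x), key]
  have h2 : (1 / 2) * ∑ B, ∑ A, h.inner (φ x) (σ x (e B) (e A)) (σ x (e B) (e A))
      + ∑ A, ∑ B, c x (e A) (e B) = 0 := h1
  have h3 := hn x e
  have h4 := hnn x e he
  refine ⟨fun u v => ?_, by linarith⟩
  have h5 : ∑ B, ∑ A, h.inner (φ x) (σ x (e B) (e A)) (σ x (e B) (e A)) = 0 := by linarith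
  have h6 : ∀ B A, σ x (e B) (e A) = 0 := fun B A =>
    eq_zero_of_inner_self _ _ ((Finset.sum_eq_zero_iff_of_nonneg fun A _ =>
      inner_self_nonneg_of_metric _ _).1 ((Finset.sum_eq_zero_iff_of_nonneg fun B _ =>
        Finset.sum_nonneg fun A _ => inner_self_nonneg_of_metric _ _).1 h5 B (Finset.mem_univ B)) A
        (Finset.mem_univ A))
  have h7 : ∀ B, σ x (e B) = 0 := fun B => LinearMap.ext fun v =>
    linearMap_eq_zero_of_frame he (σ x (e B)) (h6 B) v
  rw [hσa, linearMap_eq_zero_of_frame he (σ x) h7 u, LinearMap.zero_apply]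

end Bochner

/-! ### Consequences of strong semi-negativity -/

section SemiNegative

variable {F : Type*} [NormedAddCommGroup F] [NormedSpace ℝ F] [FiniteDimensional ℝ F]
  [CompleteSpace F] {N : Type*} [TopologicalSpace N] [ChartedSpace F N] [IsManifold 𝓘(ℝ, F) ∞ N]
  {h : ContMDiffRiemannianMetric 𝓘(ℝ, F) ∞ F (TangentSpace 𝓘(ℝ, F) : N → Type _)}
  {D : CovariantDerivative 𝓘(ℝ, F) F (TangentSpace 𝓘(ℝ, F) : N → Type _)}
  {J : ∀ y : N, TangentSpace 𝓘(ℝ, F) y →L[ℝ] TangentSpace 𝓘(ℝ, F) y}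

/-- The curvature form `⟨R(a, b) d, c⟩`. -/
noncomputable def curvatureForm (h : ContMDiffRiemannianMetric 𝓘(ℝ, F) ∞ F (TangentSpace 𝓘(ℝ, F) : N → Type _))
    (D : CovariantDerivative 𝓘(ℝ, F) F (TangentSpace 𝓘(ℝ, F) : N → Type _)) (y : N)
    (a b c d : TangentSpace 𝓘(ℝ, F) y) : ℝ :=
  h.inner y (curvature D y a b d) c

theorem IsKahler.isKahlerForm_curvatureForm (hN : IsKahler h D J) (y : N) :
    IsKahlerForm (curvatureForm h D y) (J y).toLinearMap :=
  hN.isKahlerForm y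

/-- The curvature only sees (1,1)-parts, so the hypothesis bounds ⟪Q(Z ∧ W), Z ∧ W⟫ for arbitrary
complex Z and W. -/
theorem IsStronglySemiNegative.extend_re_nonpos (hN : IsKahler h D J)
    (hc : IsStronglySemiNegative h D J) (y : N)
    (Z W : TangentSpace 𝓘(ℝ, F) y × TangentSpace 𝓘(ℝ, F) y) :
    (complexExtend₄ (curvatureForm h D y) Z W (cconj Z) (cconj W)).re ≤ 0 := by
  rw [← (hN.isKahlerForm_curvatureForm y).extend_part11 (hN.J_J y)]
  exact hc y Z W

/-- The case of real vectors, that is, nonpositive sectional curvature. The sign is reversed because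
the arguments a, b are paired in the opposite order. -/
theorem IsStronglySemiNegative.inner_curvature_nonneg (hN : IsKahler h D J)
    (hc : IsStronglySemiNegative h D J) (y : N) (a b : TangentSpace 𝓘(ℝ, F) y) :
    0 ≤ h.inner y (curvature D y a b a) b := by
  have h1 := hc.extend_re_nonpos hN y (a, 0) (b, 0)
  have hr := hN.isKahlerForm_curvatureForm y
  rw [hr.extend_real, Complex.ofReal_re, hr.skew_right] at h1
  exact neg_nonpos.1 h1

end SemiNegative

/-! ### CR frames and the dimension of the Levi distribution -/

section Frames

variable {E : Type*} [NormedAddCommGroup E] [NormedSpace ℝ E] [FiniteDimensional ℝ E]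
  [CompleteSpace E] {M : Type*} [TopologicalSpace M] [T2Space M] [ChartedSpace E M]
  [IsManifold 𝓘(ℝ, E) ∞ M] {P : PseudohermitianStructure E M} {m : ℕ}

theorem PseudohermitianStructure.IsCRFrame.isOrthoBasis (hE : Module.finrank ℝ E = 2 * m + 1)
    {x : M} {e : Fin m → TangentSpace 𝓘(ℝ, E) x} (he : P.IsCRFrame x e) :
    IsOrthoBasis (P.webster x) (Sum.elim (fun _ : Unit => P.T x)
      (Sum.elim e fun a => P.J x (e a))) := by
  obtain ⟨B, hB⟩ := P.webster_isBilin x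
  have hB' : P.webster x = fun u v => B u v := by ext u v; rw [hB]
  have h1 : ∀ u, P.θ x u = 0 → P.webster x (P.T x) u = 0 := fun u hu => by
    rw [P.webster_T_left, hu]
  have h2 : ∀ u, P.θ x u = 0 → P.webster x u (P.T x) = 0 := fun u hu => by
    rw [P.webster_symm, h1 u hu]
  have h3 : ∀ a b, P.webster x (P.J x (e a)) (P.J x (e b)) = if a = b then 1 else 0 := by
    intro a b
    rw [P.webster_J_left, P.J_J x _ (he.horizontal b), hB, map_neg, neg_neg, ← hB,
      he.orthonormal]
  have h4 : ∀ a b, P.webster x (P.J x (e a)) (e b) = 0 := fun a b => by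
    rw [P.webster_symm, he.orthogonal_J]
  have h5 : P.webster x (P.T x) (P.T x) = 1 := by rw [P.webster_T_left, P.θ_T]
  rw [hB']
  refine IsOrthoBasis.of_card B ?_ ?_
  · rintro (i | i | i) (j | j | j) <;>
      simp [← hB, h1, h2, h3, h4, h5, he.horizontal, he.orthonormal, he.orthogonal_J, P.θ_J]
  · have h6 : Module.finrank ℝ (TangentSpace 𝓘(ℝ, E) x) = 2 * m + 1 := hE
    rw [h6]
    simp
    ring

theorem PseudohermitianStructure.exists_horizontal_ne_zero (P : PseudohermitianStructure E M)
    (hE : 1 < Module.finrank ℝ E) (x : M) : ∃ u, P.θ x u = 0 ∧ u ≠ 0 := by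
  by_contra! hne
  have h1 : Function.Injective (P.θ x).toLinearMap :=
    (injective_iff_map_eq_zero _).2 hne
  have h2 := LinearMap.finrank_le_finrank_of_injective h1
  have h3 : Module.finrank ℝ (TangentSpace 𝓘(ℝ, E) x) = Module.finrank ℝ E := rfl
  rw [h3, Module.finrank_self] at h2
  omega

/-- Serves the degenerate case m = 0, where T spans the tangent space. -/
theorem PseudohermitianStructure.eq_zero_of_horizontal (P : PseudohermitianStructure E M)
    (hE : Module.finrank ℝ E = 1) {x : M} {u : TangentSpace 𝓘(ℝ, E) x} (hu : P.θ x u = 0) :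
    u = 0 := by
  have hT : P.T x ≠ 0 := fun h0 => by
    have := P.θ_T x
    rw [h0, map_zero] at this
    exact zero_ne_one this
  obtain ⟨c, hc⟩ := exists_smul_eq_of_finrank_eq_one (V := TangentSpace 𝓘(ℝ, E) x) hE hT u
  have hc' : u = c • P.T x := hc.symm
  rw [hc', map_smul, P.θ_T, smul_eq_mul, mul_one] at hu
  rw [hc', hu, zero_smul]

end Frames

theorem siuTerm_eq {F : Type*} [NormedAddCommGroup F] [NormedSpace ℝ F] [FiniteDimensional ℝ F]
    {N : Type*} [TopologicalSpace N] [ChartedSpace F N] [IsManifold 𝓘(ℝ, F) ∞ N]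
    (h : ContMDiffRiemannianMetric 𝓘(ℝ, F) ∞ F (TangentSpace 𝓘(ℝ, F) : N → Type _))
    (D : CovariantDerivative 𝓘(ℝ, F) F (TangentSpace 𝓘(ℝ, F) : N → Type _)) (y : N)
    (a a' b b' : TangentSpace 𝓘(ℝ, F) y) :
    h.inner y (curvature D y b a b + curvature D y b a' b') a
      = curvatureForm h D y b a a b + curvatureForm h D y b a' a b' := by
  rw [map_add, add_apply]
  rfl

theorem theorem6p2 {m n : ℕ}
    {M : Type*} [TopologicalSpace M] [T2Space M] [CompactSpace M]
    [ChartedSpace (EuclideanSpace ℝ (Fin (2 * m + 1))) M]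
    [IsManifold 𝓘(ℝ, EuclideanSpace ℝ (Fin (2 * m + 1))) ∞ M]
    [MeasurableSpace M] [BorelSpace M]
    {N : Type*} [TopologicalSpace N] [T2Space N] [SecondCountableTopology N]
    [ChartedSpace (EuclideanSpace ℝ (Fin n)) N]
    [IsManifold 𝓘(ℝ, EuclideanSpace ℝ (Fin n)) ∞ N]
    (P : PseudohermitianStructure (EuclideanSpace ℝ (Fin (2 * m + 1))) M)
    (D : CovariantDerivative 𝓘(ℝ, EuclideanSpace ℝ (Fin (2 * m + 1)))
      (EuclideanSpace ℝ (Fin (2 * m + 1)))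
      (TangentSpace 𝓘(ℝ, EuclideanSpace ℝ (Fin (2 * m + 1))) : M → Type _))
    (hM : P.IsSasakian D)
    (h : Bundle.ContMDiffRiemannianMetric 𝓘(ℝ, EuclideanSpace ℝ (Fin n)) ∞
      (EuclideanSpace ℝ (Fin n)) (TangentSpace 𝓘(ℝ, EuclideanSpace ℝ (Fin n)) : N → Type _))
    (D' : CovariantDerivative 𝓘(ℝ, EuclideanSpace ℝ (Fin n)) (EuclideanSpace ℝ (Fin n))
      (TangentSpace 𝓘(ℝ, EuclideanSpace ℝ (Fin n)) : N → Type _))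
    (J' : ∀ y : N, TangentSpace 𝓘(ℝ, EuclideanSpace ℝ (Fin n)) y →L[ℝ]
      TangentSpace 𝓘(ℝ, EuclideanSpace ℝ (Fin n)) y)
    (hN : IsKahler h D' J')
    (hcurv : IsStronglySemiNegative h D' J')
    (φ : M → N)
    (hφ : IsHarmonicMap P D' φ ∨ IsPseudoharmonicMap P h φ) :
    IsCRPluriharmonic P D D' φ ∧
    ∀ (x : M) (e : Fin m → TangentSpace 𝓘(ℝ, EuclideanSpace ℝ (Fin (2 * m + 1))) x),
      P.IsCRFrame x e → ∀ α β : Fin m,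
        let dφ := complexMap (mfderiv 𝓘(ℝ, EuclideanSpace ℝ (Fin (2 * m + 1)))
          𝓘(ℝ, EuclideanSpace ℝ (Fin n)) φ x)
        curvatureHermitian h D' (φ x)
          (fun _ : Unit => dφ (P.unitaryVector x (e α)))
          (fun _ : Unit => dφ (P.unitaryVector x (e β))) = 0 := by
  have hfr : Module.finrank ℝ (EuclideanSpace ℝ (Fin (2 * m + 1))) = 2 * m + 1 := by simp
  obtain ⟨hsm, δ, hδ, hτ⟩ : ContMDiff 𝓘(ℝ, EuclideanSpace ℝ (Fin (2 * m + 1)))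
      𝓘(ℝ, EuclideanSpace ℝ (Fin n)) ∞ φ ∧ ∃ δ : ℝ, δ ≤ 1 ∧ TensionEq P D D' φ δ := by
    rcases hφ with hφ | hφ
    · exact ⟨hφ.1, 0, zero_le_one, hφ.tensionEq hM⟩
    · exact ⟨hφ.1, 1, le_rfl, hφ.tensionEq hM hN⟩
  -- For m = 0 the Levi distribution is zero and there are no indices α, β. For m > 0 a nonzero
  -- horizontal vector exists, as the proof of dφ(T) = 0 requires.
  rcases Nat.eq_zero_or_pos m with rfl | hm
  · refine ⟨fun x u v hu _ => ?_, fun x e _ α => α.elim0⟩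
    rw [P.eq_zero_of_horizontal hfr hu, map_zero, ← sffBilin_apply hsm, ← sffBilin_apply hsm,
      map_zero, LinearMap.zero_apply, LinearMap.zero_apply, add_zero]
  have hT : ∀ x, mfderiv 𝓘(ℝ, EuclideanSpace ℝ (Fin (2 * m + 1)))
      𝓘(ℝ, EuclideanSpace ℝ (Fin n)) φ x (P.T x) = 0 := by
    intro x
    obtain ⟨u, hu, hu0⟩ := P.exists_horizontal_ne_zero (by omega) x
    exact mfderiv_T_eq_zero hM hN hsm (fun x u hu => secondFundamentalForm_T_eq_zero hM hN hsm
      (hcurv.inner_curvature_nonneg hN) hδ hτ x u hu) x hu hu0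
  -- The normalization of T_α; the four slots of the curvature produce k⁴.
  set k : ℝ := 1 / √2 with hk
  have hk4 : k ^ 4 = 1 / 4 := by
    have h2 : √2 ^ 2 = (2 : ℝ) := Real.sq_sqrt (by norm_num)
    rw [hk, div_pow, one_pow, show √2 ^ 4 = (√2 ^ 2) ^ 2 by ring, h2]
    norm_num
  -- Siu's curvature term in any orthonormal frame, as minus a sum of Hermitian curvatures. For e_A
  -- = T the bivectors vanish, because dφ(T) = 0 and J T = 0.
  have hsum : ∀ x {ι : Type} [Fintype ι] [DecidableEq ι]
      (e : ι → TangentSpace 𝓘(ℝ, EuclideanSpace ℝ (Fin (2 * m + 1))) x),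
      IsOrthoBasis (P.webster x) e → _ := fun x ι _ _ e he =>
    (hN.isKahlerForm_curvatureForm (φ x)).sum_extend_re
      (g := (P.webster_isBilin x).choose) (e := e)
      (by rwa [← show P.webster x = fun u v => (P.webster_isBilin x).choose u v from
        funext₂ (P.webster_isBilin x).choose_spec])
      (fun u v => by
        rw [← (P.webster_isBilin x).choose_spec, ← (P.webster_isBilin x).choose_spec,
          P.webster_symm]) (P.J x).toLinearMap
      (fun u v => by
        rw [← (P.webster_isBilin x).choose_spec, ← (P.webster_isBilin x).choose_spec]
        exact P.webster_J_left x u v)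
      (mfderiv 𝓘(ℝ, EuclideanSpace ℝ (Fin (2 * m + 1)))
        𝓘(ℝ, EuclideanSpace ℝ (Fin n)) φ x).toLinearMap
      (fun u => by
        simp only [ContinuousLinearMap.coe_coe]
        rw [P.J_J_apply, map_add, map_smul, hT, smul_zero, add_zero, map_neg]) hk4
  have hnn := fun x => hcurv.extend_re_nonpos hN (φ x)
  set L : ∀ x, TangentSpace 𝓘(ℝ, EuclideanSpace ℝ (Fin (2 * m + 1))) x →L[ℝ]
      TangentSpace 𝓘(ℝ, EuclideanSpace ℝ (Fin n)) (φ x) := fun x =>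
    mfderiv 𝓘(ℝ, EuclideanSpace ℝ (Fin (2 * m + 1))) 𝓘(ℝ, EuclideanSpace ℝ (Fin n)) φ x with hL
  have key := fun x (ι : Type) [Fintype ι] [DecidableEq ι]
      (e : ι → TangentSpace 𝓘(ℝ, EuclideanSpace ℝ (Fin (2 * m + 1))) x) he =>
    sigma_curvature_eq_zero hM hN hsm hτ hT
    (fun x u v => curvatureForm h D' (φ x) (L x v) (L x u) (L x u) (L x v)
      + curvatureForm h D' (φ x) (L x v) (L x (P.J x u)) (L x u) (L x (P.J x v)))
    (fun x u v => (siuTerm_eq h D' (φ x) _ _ _ _).symm)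
    (fun x ι _ _ e he => by
      refine le_of_le_of_eq ?_ (hsum x e he).symm
      rw [neg_nonneg]
      exact Finset.sum_nonpos fun A _ => Finset.sum_nonpos fun B _ => hnn x _ _) x (ι := ι) e he
  refine ⟨fun x u v _ _ => ?_, fun x e he α β => ?_⟩
  · obtain ⟨b, hb⟩ := P.exists_frame x
    exact (key x _ b hb).1 u v
  · have he' := he.isOrthoBasis hfr
    have h1 := (hsum x _ he').symm.trans (key x _ _ he').2
    -- A vanishing sum of nonpositive terms vanishes termwise. The indices α and β are then read in
    -- the block of e in the frame T, e, J e.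
    rw [neg_eq_zero, Finset.sum_eq_zero_iff_of_nonpos fun A _ =>
      Finset.sum_nonpos fun B _ => hnn x _ _] at h1
    have h2 := (Finset.sum_eq_zero_iff_of_nonpos fun B _ => hnn x _ _).1
      (h1 (Sum.inr (Sum.inl α)) (Finset.mem_univ _)) (Sum.inr (Sum.inl β)) (Finset.mem_univ _)
    have h3 := (hN.isKahlerForm_curvatureForm (φ x)).extend_im
      (k • L x (e α), -(k • L x (P.J x (e α)))) (k • L x (e β), -(k • L x (P.J x (e β))))
    have h4 : ∀ u, complexMap (L x) (P.unitaryVector x u) = (k • L x u, -(k • L x (P.J x u))) := by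
      intro u
      rw [complexMap, PseudohermitianStructure.unitaryVector, map_neg, map_smul, map_smul]
    intro dφ
    have h5 : ∀ u, dφ (P.unitaryVector x u) = (k • L x u, -(k • L x (P.J x u))) := h4
    simp only [h5, curvatureHermitian, Finset.univ_unique, Finset.sum_singleton]
    exact Complex.ext h2 h3
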